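/- Let $\Omega\subset\mathbb R^3$ be a bounded domain with smooth boundary, $Y=(0,1)^3$, and let the reference hole $\mathcal H$ be an open set with smooth boundary such that $\overline{\mathcal H}\subset Y$ and $Y\setminus\overline{\mathcal H}$ is connected. For $\epsilon>0$ put $$\overline{\mathcal H}^{\epsilon}=\bigcup_{k\in\mathbb Z^3,\ \epsilon(k+Y)\subset\Omega}\epsilon(k+\overline{\mathcal H}),\qquad \Omega^\epsilon=\Omega\setminus\overline{\mathcal H}^\epsilon .$$ Let $\mathbf A,\mathbf K\in L^\infty(\Omega;C_\sharp(Y))$ and $\boldsymbol\mu\in L^\infty(\mathbb R^3;C_\sharp(Y))$ be symmetric, uniformly coercive fields of $3\times 3$ matrices ($C_\sharp(Y)$: continuous $Y$-periodic functions), and set $\mathbf A^\epsilon(x)=\mathbf A(x,x/\epsilon)$, and similarly $\mathbf K^\epsilon,\boldsymbol\mu^\epsilon$. Let $\gamma,\theta_c,c_1,c_2,k_0,k_1,T>0$ and $F(s)=c_1\ln s+c_2 s$ for $s>0$. For $\mathbf m_0^\epsilon\in H^1(\Omega^\epsilon)^3$ and $\theta^\epsilon_0\in L^2(\Omega^\epsilon)$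 with $\theta_0^\epsilon>0$ a.e. and $F(\theta_0^\epsilon)\in L^2(\Omega^\epsilon)$, let $(\mathbf m^\epsilon,\theta^\epsilon,\varphi^\epsilon)$, $\theta^\epsilon>0$ a.e., be a weak solution on $(0,T)$ of $$\gamma\,\partial_t\mathbf m^\epsilon=\mathrm{div}(\mathbf A^\epsilon\nabla\mathbf m^\epsilon)-\theta_c(|\mathbf m^\epsilon|^2-1)\mathbf m^\epsilon-\theta^\epsilon\mathbf m^\epsilon+\nabla\varphi^\epsilon\quad\text{in }(0,T)\times\Omega^\epsilon,$$ $$c_1\partial_t\ln\theta^\epsilon+c_2\partial_t\theta^\epsilon-\mathbf m^\epsilon\cdot\partial_t\mathbf m^\epsilon=\mathrm{div}\big(\mathbf K^\epsilon\nabla(k_0\ln\theta^\epsilon+k_1\theta^\epsilon)\big)\quad\text{in }(0,T)\times\Omega^\epsilon,$$ with zero fluxes $\mathbf A^\epsilon\nabla\mathbf m^\epsilon\cdot\nu^\epsilon=0$ and $\mathbf K^\epsilon\nabla(k_0\ln\theta^\epsilon+k_1\theta^\epsilon)\cdot\nu^\epsilon=0$ on $\partial\Omega^\epsilon$, with $\mathbf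 m^\epsilon(0)=\mathbf m_0^\epsilon$ and $\theta^\epsilon(0)=\theta^\epsilon_0$ (in the sense that $F(\theta^\epsilon)$ takes the initial value $F(\theta_0^\epsilon)$), and with, for a.e. $t$, $\varphi^\epsilon(t)\in W:=\{\omega:\ \nabla\omega\in L^2,\ \omega/\sqrt{1+|x|^2}\in L^2 \text{ on }\mathbb R^3\setminus\overline{\mathcal H}^\epsilon\}$ and $$\int_{\mathbb R^3\setminus\overline{\mathcal H}^\epsilon}\boldsymbol\mu^\epsilon\nabla\varphi^\epsilon\cdot\nabla\omega\,dx+\int_{\Omega^\epsilon}\mathbf m^\epsilon\cdot\nabla\omega\,dx=0\qquad\text{for all }\omega\in W,$$ in the regularity class $\mathbf m^\epsilon\in L^2(0,T;H^2(\Omega^\epsilon))\cap L^\infty(0,T;L^4(\Omega^\epsilon))\cap H^1(0,T;L^2(\Omega^\epsilon))$, $\theta^\epsilon,\ln\theta^\epsilon\in L^2(0,T;H^1(\Omega^\epsilon))$, $c_1\ln\theta^\epsilon+c_2\theta^\epsilon\in H^1(0,T;(H^1(\Omega^\epsilon))')$, $\nabla\varphi^\epsilon\in L^\infty(0,T;L^2(\mathbb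 R^3\setminus\overline{\mathcal H}^\epsilon))$. Then for every $C_0$ there is a constant $C>0$, depending on $C_0$, $T$ and the data above but not on $\epsilon$ or on the solution, such that for every $\epsilon>0$ and every such solution whose initial data satisfy $\|\mathbf m_{0,i}^\epsilon\|_{H^1(\Omega^\epsilon)}\le C_0$ for $i=1,2,3$, $\|\theta_0^\epsilon\|_{L^2(\Omega^\epsilon)}\le C_0$ and $\|F(\theta_0^\epsilon)\|_{L^2(\Omega^\epsilon)}\le C_0$, the function $v^\epsilon=F(\theta^\epsilon)$ satisfies $$\|v^\epsilon\|_{L^2(0,T;H^1(\Omega^\epsilon))}\le C,\qquad \|\partial_t v^\epsilon\|_{L^2(0,T;H^{-1}(\Omega^\epsilon))}\le C,$$ where $H^{-1}(\Omega^\epsilon)$ is the dual of $H^1_0(\Omega^\epsilon)$. -/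

import Mathlib

open MeasureTheory Filter Topology Set
open scoped ENNReal NNReal ContDiff BoundedContinuousFunction

noncomputable section

namespace Ferro

/-! ### Function spaces -/

/-- Euclidean three-space. -/
abbrev E3 : Type := EuclideanSpace ℝ (Fin 3)

/-- The `i`-th vector of the canonical basis. -/
def basisVec (i : Fin 3) : E3 := EuclideanSpace.single i 1

/-- `L²(U)`. -/
abbrev L2 (U : Set E3) : Type := Lp ℝ 2 (volume.restrict U)

/-- `L²(U)³`. -/
abbrev L2Vec (U : Set E3) : Type := Lp E3 2 (volume.restrict U)

/-- Test functions `ψ ∈ C_c^∞(U)`. -/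
structure IsTest (U : Set E3) (ψ : E3 → ℝ) : Prop where
  smooth : ContDiff ℝ ∞ ψ
  compact : HasCompactSupport ψ
  support : tsupport ψ ⊆ U

/-- `p` is the weak (distributional) gradient of `u` in `U`. -/
def HasWeakGradient (U : Set E3) (u : E3 → ℝ) (p : E3 → E3) : Prop :=
  ∀ ψ : E3 → ℝ, IsTest U ψ → ∀ i : Fin 3,
    ∫ x in U, u x * fderiv ℝ ψ x (basisVec i) = - ∫ x in U, p x i * ψ x

theorem IsTest.memLp {U : Set E3} {ψ : E3 → ℝ} (h : IsTest U ψ) :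
    MemLp ψ 2 (volume.restrict U) :=
  h.smooth.continuous.memLp_of_hasCompactSupport h.compact

theorem IsTest.memLp_fderiv {U : Set E3} {ψ : E3 → ℝ} (h : IsTest U ψ) (i : Fin 3) :
    MemLp (fun x => fderiv ℝ ψ x (basisVec i)) 2 (volume.restrict U) :=
  ((h.smooth.continuous_fderiv (by simp)).clm_apply
    continuous_const).memLp_of_hasCompactSupport (h.compact.fderiv_apply ℝ _)

theorem integrable_left {U : Set E3} {ψ : E3 → ℝ} (h : IsTest U ψ) (i : Fin 3) (u : L2 U) :
    Integrable (fun x => u x * fderiv ℝ ψ x (basisVec i)) (volume.restrict U) :=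
  (Lp.memLp u).integrable_mul (h.memLp_fderiv i)

theorem memLp_coord {U : Set E3} (i : Fin 3) (p : L2Vec U) :
    MemLp (fun x => p x i) 2 (volume.restrict U) :=
  (Lp.memLp p).continuousLinearMap_comp (EuclideanSpace.proj (𝕜 := ℝ) i)

theorem integrable_right {U : Set E3} {ψ : E3 → ℝ} (h : IsTest U ψ) (i : Fin 3) (p : L2Vec U) :
    Integrable (fun x => p x i * ψ x) (volume.restrict U) :=
  (memLp_coord i p).integrable_mul h.memLp

/-- The Sobolev space `H¹(U)`: pairs `(u, ∇u) ∈ L²(U) × L²(U)³` with `∇u` the weak gradient of `u`,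
with norm `(‖u‖² + ‖∇u‖²)^{1/2}`. -/
def H1 (U : Set E3) : Submodule ℝ (WithLp 2 (L2 U × L2Vec U)) where
  carrier := {w | HasWeakGradient U w.fst w.snd}
  zero_mem' := by
    intro ψ hψ i
    have h1 : (⇑(0 : L2 U)) =ᵐ[volume.restrict U] 0 := Lp.coeFn_zero _ _ _
    have h2 : (⇑(0 : L2Vec U)) =ᵐ[volume.restrict U] 0 := Lp.coeFn_zero _ _ _
    have e1 : ∫ x in U, (0 : L2 U) x * fderiv ℝ ψ x (basisVec i) = 0 := by
      rw [integral_congr_ae (g := fun _ => (0 : ℝ)) (h1.mono fun x hx => by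
        simp only [hx, Pi.zero_apply, zero_mul])]
      simp
    have e2 : ∫ x in U, (0 : L2Vec U) x i * ψ x = 0 := by
      rw [integral_congr_ae (g := fun _ => (0 : ℝ)) (h2.mono fun x hx => by
        simp only [hx, Pi.zero_apply, PiLp.zero_apply, zero_mul])]
      simp
    exact e1.trans (by rw [← neg_zero, ← e2]; rfl)
  add_mem' := by
    intro v w hv hw ψ hψ i
    have e1 : ∫ x in U, (v + w).fst x * fderiv ℝ ψ x (basisVec i)
        = (∫ x in U, v.fst x * fderiv ℝ ψ x (basisVec i))
          + ∫ x in U, w.fst x * fderiv ℝ ψ x (basisVec i) := by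
      rw [← integral_add (integrable_left hψ i _) (integrable_left hψ i _)]
      refine integral_congr_ae ((Lp.coeFn_add v.fst w.fst).mono fun x hx => ?_)
      simp only [WithLp.add_fst, hx, Pi.add_apply]
      ring
    have e2 : ∫ x in U, (v + w).snd x i * ψ x
        = (∫ x in U, v.snd x i * ψ x) + ∫ x in U, w.snd x i * ψ x := by
      rw [← integral_add (integrable_right hψ i _) (integrable_right hψ i _)]
      refine integral_congr_ae ((Lp.coeFn_add v.snd w.snd).mono fun x hx => ?_)
      simp only [WithLp.add_snd, hx, Pi.add_apply, PiLp.add_apply]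
      ring
    rw [e1, e2, hv ψ hψ i, hw ψ hψ i]
    ring
  smul_mem' := by
    intro c w hw ψ hψ i
    have e1 : ∫ x in U, (c • w).fst x * fderiv ℝ ψ x (basisVec i)
        = c * ∫ x in U, w.fst x * fderiv ℝ ψ x (basisVec i) := by
      rw [← integral_const_mul]
      refine integral_congr_ae ((Lp.coeFn_smul c w.fst).mono fun x hx => ?_)
      simp only [WithLp.smul_fst, hx, Pi.smul_apply, smul_eq_mul]
      ring
    have e2 : ∫ x in U, (c • w).snd x i * ψ x = c * ∫ x in U, w.snd x i * ψ x := by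
      rw [← integral_const_mul]
      refine integral_congr_ae ((Lp.coeFn_smul c w.snd).mono fun x hx => ?_)
      simp only [WithLp.smul_snd, hx, Pi.smul_apply, PiLp.smul_apply, smul_eq_mul]
      ring
    rw [e1, e2, hw ψ hψ i]
    ring

/-- The function underlying an element of `H¹(U)`, as an element of `L²(U)`. -/
def fn {U : Set E3} (w : H1 U) : L2 U := w.1.fst

/-- The weak gradient of an element of `H¹(U)`. -/
def wgrad {U : Set E3} (w : H1 U) : L2Vec U := w.1.snd

/-- `H¹₀(U)`: the closure of `C_c^∞(U)` in `H¹(U)`, with the norm of `H¹(U)`. -/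
def H10 (U : Set E3) : Submodule ℝ (H1 U) :=
  (Submodule.span ℝ
    {w : H1 U | ∃ ψ : E3 → ℝ, IsTest U ψ ∧ fn w =ᵐ[volume.restrict U] ψ}).topologicalClosure

/-- The map `L²(U) → (H¹(U))'`, `u ↦ (w ↦ ∫_U u w)`. -/
def toH1Dual {U : Set E3} (u : L2 U) : StrongDual ℝ (H1 U) :=
  ((innerSL ℝ u).comp (WithLp.fstL 2 ℝ (L2 U) (L2Vec U))).comp (H1 U).subtypeL

/-- `H⁻¹(U)`, the dual of `H¹₀(U)`. -/
abbrev Hm1 (U : Set E3) : Type := StrongDual ℝ (H10 U)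

/-- The map `L²(U) → H⁻¹(U)`, `u ↦ (w ↦ ∫_U u w)`. -/
def toHm1 {U : Set E3} (u : L2 U) : Hm1 U := (toH1Dual u).comp (H10 U).subtypeL

/-- `u` belongs to the Beppo-Levi space on `O`: `u / √(1 + |x|²) ∈ L²(O)` and `∇u = p ∈ L²(O)³`. -/
structure IsBeppoLevi (O : Set E3) (u : E3 → ℝ) (p : L2Vec O) : Prop where
  weighted : MemLp (fun x => u x / Real.sqrt (1 + ‖x‖ ^ 2)) 2 (volume.restrict O)
  grad : HasWeakGradient O u p

/-! ### Functions of time with values in a Banach space -/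

/-- Lebesgue measure on `(0, T)`. -/
abbrev timeMeasure (T : ℝ) : Measure ℝ := volume.restrict (Ioo 0 T)

/-- `f'` is the weak derivative of `f` on `(0, T)`. -/
def HasWeakTimeDeriv {X : Type*} [NormedAddCommGroup X] [NormedSpace ℝ X] (T : ℝ)
    (f f' : ℝ → X) : Prop :=
  ∀ ψ : ℝ → ℝ, ContDiff ℝ ∞ ψ → HasCompactSupport ψ → tsupport ψ ⊆ Ioo 0 T →
    ∫ t, deriv ψ t • f t ∂(timeMeasure T) = - ∫ t, ψ t • f' t ∂(timeMeasure T)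

/-- The function `f` on `(0, T)` has a representative that is continuous on `[0, T]`, with the
value `x₀` at time `0`. -/
def HasInitialValue {X : Type*} [NormedAddCommGroup X] (T : ℝ) (f : ℝ → X) (x₀ : X) : Prop :=
  ∃ c : ℝ → X, ContinuousOn c (Icc 0 T) ∧ (∀ᵐ t ∂(timeMeasure T), c t = f t) ∧ c 0 = x₀

/-! ### Geometry and coefficients -/

/-- The boundary of `S` is smooth, with `S` locally on one side of it: near each boundary point,
`S` is the sublevel set of a smooth function with nonvanishing differential. -/
def HasSmoothBoundary (S : Set E3) : Prop :=
  ∀ x ∈ frontier S, ∃ ρ : E3 → ℝ, ContDiff ℝ ∞ ρ ∧ fderiv ℝ ρ x ≠ 0 ∧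
    ∀ᶠ y in 𝓝 x, (y ∈ S ↔ ρ y < 0)

/-- The unit cell `Y = (0, 1)³`. -/
def unitCell : Set E3 := {y | ∀ i, y i ∈ Ioo (0 : ℝ) 1}

/-- The lattice point `k ∈ ℤ³`. -/
def latticePt (k : Fin 3 → ℤ) : E3 := WithLp.toLp 2 fun i => (k i : ℝ)

/-- The set `ε (k + S)`. -/
def scaledCopy (ε : ℝ) (k : Fin 3 → ℤ) (S : Set E3) : Set E3 :=
  (fun y => ε • (latticePt k + y)) '' S

/-- `a` is a symmetric coercive matrix field of class `L^∞(D; C_♯(Y))`. A field `a(x, y)` is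
encoded by the maps `x ↦ a i j x` with values in the bounded continuous functions of `y`. -/
structure IsCoefficient (D : Set E3) (a : Fin 3 → Fin 3 → E3 → (E3 →ᵇ ℝ)) : Prop where
  memLp : ∀ i j, MemLp (a i j) ∞ (volume.restrict D)
  periodic : ∀ i j, ∀ᵐ x ∂(volume.restrict D), ∀ y l, a i j x (y + basisVec l) = a i j x y
  symm : ∀ i j, ∀ᵐ x ∂(volume.restrict D), ∀ y, a i j x y = a j i x y
  coercive : ∃ α : ℝ, 0 < α ∧ ∀ᵐ x ∂(volume.restrict D), ∀ y ξ : E3,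
    α * ‖ξ‖ ^ 2 ≤ ∑ i, ∑ j, a i j x y * ξ j * ξ i

/-- `a(x, x/ε) p · q`. -/
def oscForm (a : Fin 3 → Fin 3 → E3 → (E3 →ᵇ ℝ)) (ε : ℝ) (x p q : E3) : ℝ :=
  ∑ i, ∑ j, a i j x (ε⁻¹ • x) * p j * q i

/-- The data of the model that do not depend on `ε`. -/
structure Model where
  /-- the macroscopic domain -/
  Ω : Set E3
  /-- the reference hole -/
  hole : Set E3
  A : Fin 3 → Fin 3 → E3 → (E3 →ᵇ ℝ)
  K : Fin 3 → Fin 3 → E3 → (E3 →ᵇ ℝ)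
  μ : Fin 3 → Fin 3 → E3 → (E3 →ᵇ ℝ)
  γ : ℝ
  θc : ℝ
  c₁ : ℝ
  c₂ : ℝ
  k₀ : ℝ
  k₁ : ℝ

namespace Model

/-- The standing assumptions on the data. -/
structure Admissible (P : Model) : Prop where
  Ω_open : IsOpen P.Ω
  Ω_connected : IsConnected P.Ω
  Ω_bounded : Bornology.IsBounded P.Ω
  Ω_smooth : HasSmoothBoundary P.Ω
  hole_open : IsOpen P.hole
  hole_isolated : closure P.hole ⊆ unitCell
  hole_smooth : HasSmoothBoundary P.hole
  cell_connected : IsConnected (unitCell \ closure P.hole)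
  A_coef : IsCoefficient P.Ω P.A
  K_coef : IsCoefficient P.Ω P.K
  μ_coef : IsCoefficient univ P.μ
  γ_pos : 0 < P.γ
  θc_pos : 0 < P.θc
  c₁_pos : 0 < P.c₁
  c₂_pos : 0 < P.c₂
  k₀_pos : 0 < P.k₀
  k₁_pos : 0 < P.k₁

/-- The union of the closed holes `ε (k + closure hole)` over the cells `ε (k + Y)` that are
contained in `Ω`. -/
def holes (P : Model) (ε : ℝ) : Set E3 :=
  ⋃ k ∈ {k : Fin 3 → ℤ | scaledCopy ε k unitCell ⊆ P.Ω}, scaledCopy ε k (closure P.hole)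

/-- The perforated domain `Ω^ε`. -/
def perforated (P : Model) (ε : ℝ) : Set E3 := P.Ω \ P.holes ε

/-- The complement of the holes in the whole space. -/
def exterior (P : Model) (ε : ℝ) : Set E3 := (P.holes ε)ᶜ

/-- `F(s) = c₁ ln s + c₂ s` for `s > 0`. -/
def F (P : Model) (s : ℝ) : ℝ := P.c₁ * Real.log s + P.c₂ * s

/-- The unknowns: the magnetization `m` with its time derivative `dm`, the temperature `θ` with its
logarithm `logθ`, the time derivative `dv` of `c₁ ln θ + c₂ θ`, and the magnetic potential `φ` with
its gradient `gradφ`. -/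
structure Unknowns (P : Model) (ε : ℝ) where
  m : Fin 3 → ℝ → H1 (P.perforated ε)
  dm : Fin 3 → ℝ → L2 (P.perforated ε)
  θ : ℝ → H1 (P.perforated ε)
  logθ : ℝ → H1 (P.perforated ε)
  dv : ℝ → StrongDual ℝ (H1 (P.perforated ε))
  φ : ℝ → E3 → ℝ
  gradφ : ℝ → L2Vec (P.exterior ε)

/-- Weak solutions on `(0, T)` of the microscopic problem with initial values `m₀` and `v₀`
for `m` and `v = c₁ ln θ + c₂ θ`; for `v₀ = F(θ₀)` the latter means that `θ` starts from `θ₀`. -/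
structure IsWeakSolution (P : Model) (ε T : ℝ) (m₀ : Fin 3 → H1 (P.perforated ε))
    (v₀ : L2 (P.perforated ε)) (s : P.Unknowns ε) : Prop where
  /-- `m ∈ L²(0,T;H¹)` -/
  m_memLp : ∀ i, MemLp (s.m i) 2 (timeMeasure T)
  /-- `∂_j m ∈ L²(0,T;H¹)`, so that `m ∈ L²(0,T;H²)` -/
  m_H2 : ∀ i j, ∃ d : ℝ → H1 (P.perforated ε), MemLp d 2 (timeMeasure T) ∧
    ∀ᵐ t ∂(timeMeasure T), fn (d t) =ᵐ[volume.restrict (P.perforated ε)]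
      fun x => wgrad (s.m i t) x j
  /-- `m ∈ L^∞(0,T;L⁴)` -/
  m_L4 : ∃ R : ℝ≥0, ∀ i, ∀ᵐ t ∂(timeMeasure T),
    eLpNorm (fn (s.m i t)) 4 (volume.restrict (P.perforated ε)) ≤ R
  /-- `∂_t m ∈ L²(0,T;L²)` -/
  dm_memLp : ∀ i, MemLp (s.dm i) 2 (timeMeasure T)
  dm_deriv : ∀ i, HasWeakTimeDeriv T (fun t => fn (s.m i t)) (s.dm i)
  m_init : ∀ i, HasInitialValue T (fun t => fn (s.m i t)) (fn (m₀ i))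
  /-- `θ ∈ L²(0,T;H¹)` and `ln θ ∈ L²(0,T;H¹)` -/
  θ_memLp : MemLp s.θ 2 (timeMeasure T)
  θ_pos : ∀ᵐ t ∂(timeMeasure T), ∀ᵐ x ∂(volume.restrict (P.perforated ε)), 0 < fn (s.θ t) x
  logθ_memLp : MemLp s.logθ 2 (timeMeasure T)
  logθ_eq : ∀ᵐ t ∂(timeMeasure T), fn (s.logθ t) =ᵐ[volume.restrict (P.perforated ε)]
    fun x => Real.log (fn (s.θ t) x)
  /-- `c₁ ln θ + c₂ θ ∈ H¹(0,T;(H¹)')` -/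
  dv_memLp : MemLp s.dv 2 (timeMeasure T)
  dv_deriv : HasWeakTimeDeriv T
    (fun t => toH1Dual (P.c₁ • fn (s.logθ t) + P.c₂ • fn (s.θ t))) s.dv
  v_init : HasInitialValue T
    (fun t => toH1Dual (P.c₁ • fn (s.logθ t) + P.c₂ • fn (s.θ t))) (toH1Dual v₀)
  /-- `∇φ ∈ L^∞(0,T;L²)` -/
  gradφ_memLp : MemLp s.gradφ ∞ (timeMeasure T)
  φ_beppoLevi : ∀ᵐ t ∂(timeMeasure T), IsBeppoLevi (P.exterior ε) (s.φ t) (s.gradφ t)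
  /-- `γ ∂_t m = div(A^ε ∇m) - θc (|m|² - 1) m - θ m + ∇φ` with `A^ε ∇m · ν = 0` -/
  eq_m : ∀ᵐ t ∂(timeMeasure T), ∀ (w : H1 (P.perforated ε)) (i : Fin 3),
    P.γ * (∫ x in P.perforated ε, s.dm i t x * fn w x)
      = - (∫ x in P.perforated ε, oscForm P.A ε x (wgrad (s.m i t) x) (wgrad w x))
        - P.θc * (∫ x in P.perforated ε,
            ((∑ j, fn (s.m j t) x ^ 2) - 1) * fn (s.m i t) x * fn w x)
        - (∫ x in P.perforated ε, fn (s.θ t) x * fn (s.m i t) x * fn w x)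
        + ∫ x in P.perforated ε, s.gradφ t x i * fn w x
  /-- `∂_t (c₁ ln θ + c₂ θ) - m · ∂_t m = div(K^ε ∇(k₀ ln θ + k₁ θ))` with
  `K^ε ∇(k₀ ln θ + k₁ θ) · ν = 0` -/
  eq_θ : ∀ᵐ t ∂(timeMeasure T), ∀ w : H1 (P.perforated ε),
    s.dv t w - (∫ x in P.perforated ε, (∑ j, fn (s.m j t) x * s.dm j t x) * fn w x)
      = - ∫ x in P.perforated ε, oscForm P.K ε x
          (P.k₀ • wgrad (s.logθ t) x + P.k₁ • wgrad (s.θ t) x) (wgrad w x)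
  /-- `div(μ^ε ∇φ + χ m) = 0` outside the holes, with zero normal flux through their boundary -/
  eq_φ : ∀ᵐ t ∂(timeMeasure T), ∀ (u : E3 → ℝ) (p : L2Vec (P.exterior ε)),
    IsBeppoLevi (P.exterior ε) u p →
      (∫ x in P.exterior ε, oscForm P.μ ε x (s.gradφ t x) (p x))
        + ∫ x in P.perforated ε, ∑ j, fn (s.m j t) x * p x j = 0

end Model

end Ferro

end

/-! Formally the estimate comes from testing the system three times. Testing the magnetization
equation with $\mathbf m$ bounds $\mathbf m$ in $L^\infty(0,T;L^2)$: the term $\theta|\mathbf m|^2$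
has a good sign, the quartic term absorbs the quadratic ones, and $\nabla\varphi$ is controlled by
$\mathbf m$ through the magnetostatic equation (`exists_bound_norm_m`). Next the magnetization
equation is tested with $\partial_t\mathbf m$ and the heat equation with $\theta$. The coupling
terms $\theta\,\mathbf m\cdot\partial_t\mathbf m$ cancel, which bounds $\mathbf m$ in
$L^\infty(0,T;L^4)$ and $\partial_t\mathbf m$, $\nabla\theta$ in $L^2$ (`exists_bound_energy`).
Finally the heat equation is tested with $v=F(\theta)$. The diffusion term controls
$\nabla\ln\theta$ and $\nabla\theta$ separately, since $\nabla\theta=\theta\nabla\ln\theta$ makes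
the mixed terms nonnegative (`weakGradient_log`), and the source $\mathbf m\cdot\partial_t\mathbf m$
is a functional on $H^1$ of norm at most a multiple of $\|\mathbf m\|_{L^4}\|\partial_t\mathbf
m\|_{L^2}$. The bound of $\partial_t v$ is then read off the equation (`exists_bound_entropy`).

None of these tests can be performed by a chain rule in time: $\partial_t\mathbf m$ is only in
$L^2$, and $\partial_t v$ only in a dual space. Each energy is however a convex function of the
quantity whose time derivative appears, with the test function as subgradient. `energy_inequality`
turns such subgradient inequalities, valid between almost all pairs of times, into the integrated
energy inequality by backward difference quotients.

The constants stay independent of $\epsilon$ because the embedding $H^1\subset L^4$ of the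
perforated domain has a constant independent of $\epsilon$ (`Model.exists_uniform_sobolev`). It
follows from the embedding on $\Omega$ and a Poincaré–Sobolev inequality on the perforated unit
cell, scaled to each cell: near each hole the function is blended into its cell average by a cutoff,
and the factor $\epsilon^{-1}$ from the cutoff is cancelled by the factor $\epsilon$ of the scaled
Poincaré inequality. Both inequalities on fixed domains come from `exists_cone_sobolev`, where a
function is compared with its averages over balls shrinking to the vertex of an interior cone. -/

namespace Ferro

/-! ### Energy inequalities and weak derivatives in time -/

section Time

variable {X Y : Type*} [NormedAddCommGroup X] [NormedSpace ℝ X]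
  [NormedAddCommGroup Y] [NormedSpace ℝ Y]

/-- Translation acts continuously on $L^2(\mathbb R;X)$, and pairing with the fixed `g` is a
continuous functional of the translate. -/
theorem continuous_pairing_translate (B : X →L[ℝ] Y →L[ℝ] ℝ) {f : ℝ → X} {g : ℝ → Y}
    (hf : MemLp f 2) (hg : MemLp g 2) :
    Continuous fun s : ℝ => ∫ t, B (f (t - s)) (g t) := by
  let σ : ℝ → C(ℝ, ℝ) := fun s => ⟨fun t => t - s, by fun_prop⟩
  have hσ : Continuous σ := by
    apply ContinuousMap.continuous_of_continuous_uncurry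
    exact (continuous_snd.sub continuous_fst)
  have hmp : ∀ s, MeasurePreserving (σ s) (volume : Measure ℝ) volume := fun s =>
    measurePreserving_sub_right volume s
  have hc : Continuous fun s => Lp.compMeasurePreserving (σ s) (hmp s) (hf.toLp f) :=
    Continuous.compMeasurePreservingLp continuous_const hσ hmp (by simp)
  have h2 : Continuous fun s => B.lpPairing volume 2 2
      (Lp.compMeasurePreserving (σ s) (hmp s) (hf.toLp f)) (hg.toLp g) :=
    ((B.lpPairing volume 2 2).continuous.comp hc).clm_apply continuous_const
  refine h2.congr fun s => ?_
  rw [ContinuousLinearMap.lpPairing_eq_integral]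
  refine integral_congr_ae ?_
  filter_upwards [Lp.coeFn_compMeasurePreserving (hf.toLp f) (hmp s), hg.coeFn_toLp,
    (hmp s).quasiMeasurePreserving.ae_eq_comp hf.coeFn_toLp] with t h1 h2 h3
  rw [h1, h2, h3]
  rfl

variable [CompleteSpace X]

/-- By Fubini the left side is the mean over $s\in(0,h)$ of the function `q`, which is continuous by
`continuous_pairing_translate`, so it tends to `q 0`. This identifies the limit of the right-hand
side when difference quotients are taken in `energy_inequality`. -/
theorem tendsto_pairing_average (B : X →L[ℝ] Y →L[ℝ] ℝ) {f : ℝ → X} {g : ℝ → Y}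
    (hf : MemLp f 2) (hg : MemLp g 2) (hf1 : Integrable f) (hg1 : Integrable g) :
    Tendsto (fun h : ℝ => h⁻¹ * ∫ t, B (∫ s in (t - h)..t, f s) (g t)) (𝓝[>] 0)
      (𝓝 (∫ t, B (f t) (g t))) := by
  set q : ℝ → ℝ := fun s => ∫ t, B (f (t - s)) (g t) with hq
  have hqc : Continuous q := continuous_pairing_translate B hf hg
  -- The shear $(t,s)\mapsto(t,t-s)$ preserves the product measure, which reduces the claim to the
  -- integrable tensor product of `f` and `g`.
  have hint : Integrable (fun z : ℝ × ℝ => B (f (z.1 - z.2)) (g z.1)) (volume.prod volume) := by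
    have h1 : Integrable (fun z : ℝ × ℝ => B (f z.2) (g z.1)) (volume.prod volume) := by
      have hn : Integrable (fun z : ℝ × ℝ => ‖B‖ * (‖g z.1‖ * ‖f z.2‖)) (volume.prod volume) :=
        (hg1.norm.mul_prod hf1.norm).const_mul _
      refine hn.mono' (B.aestronglyMeasurable_comp₂ hf1.1.comp_snd hg1.1.comp_fst) ?_
      refine Eventually.of_forall fun z => (B.le_opNorm₂ _ _).trans (le_of_eq (by ring))
    have h2 := measurePreserving_prod_sub (volume : Measure ℝ) (volume : Measure ℝ)
    have h3 : MeasurePreserving (fun z : ℝ × ℝ => (z.1, z.1 - z.2))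
        (volume.prod volume) (volume.prod volume) := by
      have h4 : MeasurePreserving (fun z : ℝ × ℝ => (z.1, -z.2))
          (volume.prod volume) (volume.prod volume) :=
        (MeasurePreserving.id _).prod (Measure.measurePreserving_neg _)
      have h5 := (measurePreserving_prod_add (volume : Measure ℝ) (volume : Measure ℝ)).comp h4
      convert h5 using 2
      exact Prod.ext rfl (sub_eq_add_neg _ _)
    exact h3.integrable_comp_of_integrable h1
  have key : ∀ h : ℝ, 0 < h → ∫ t, B (∫ s in (t - h)..t, f s) (g t) = ∫ s in (0 : ℝ)..h, q s := by
    intro h hh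
    have e1 : ∀ t, B (∫ s in (t - h)..t, f s) (g t) = ∫ s in Ioc 0 h, B (f (t - s)) (g t) := by
      intro t
      have : ∫ s in (t - h)..t, f s = ∫ s in (0 : ℝ)..h, f (t - s) := by
        rw [intervalIntegral.integral_comp_sub_left (fun s => f s) t]; simp
      rw [this, ← ContinuousLinearMap.flip_apply, ← ContinuousLinearMap.intervalIntegral_comp_comm,
        intervalIntegral.integral_of_le hh.le]
      · rfl
      · exact (hf1.comp_sub_left t).intervalIntegrable
    simp_rw [e1]
    rw [intervalIntegral.integral_of_le hh.le, integral_integral_swap]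
    refine hint.mono_measure ?_
    exact Measure.prod_mono le_rfl Measure.restrict_le_self
  have hd : HasDerivAt (fun h => ∫ s in (0 : ℝ)..h, q s) (q 0) 0 :=
    intervalIntegral.integral_hasDerivAt_right (by simp) (hqc.stronglyMeasurableAtFilter _ _)
      hqc.continuousAt
  have h0 : q 0 = ∫ t, B (f t) (g t) := by simp [hq]
  rw [← h0]
  have := (hasDerivAt_iff_tendsto_slope.1 hd).mono_left
    (nhdsWithin_mono 0 (show Ioi (0 : ℝ) ⊆ {0}ᶜ from fun x hx => ne_of_gt hx))
  refine this.congr' ?_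
  filter_upwards [self_mem_nhdsWithin] with h hh
  rw [key h hh, slope_def_field]
  simp [div_eq_inv_mul]

theorem memLp_two_indicator_of_timeMeasure {Z : Type*} [NormedAddCommGroup Z] {T : ℝ} {f : ℝ → Z}
    (hf : MemLp f 2 (timeMeasure T)) : MemLp ((Ioo 0 T).indicator f) 2 :=
  (memLp_indicator_iff_restrict measurableSet_Ioo).2 hf

theorem integrable_of_memLp_timeMeasure {Z : Type*} [NormedAddCommGroup Z] {T : ℝ} {f : ℝ → Z}
    (hf : MemLp f 2 (timeMeasure T)) : Integrable f (timeMeasure T) :=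
  hf.integrable (by norm_num)

/-- If `Φ` satisfies the subgradient inequality `Φ t ≤ Φ s + ∑ ⟨u t - u s, w t⟩` for almost all
times, where `u' = D`, then `Φ τ ≤ Φ 0 + ∫₀^τ ∑ ⟨D, w⟩` for almost all `τ`. -/
theorem energy_inequality {ι : Type*} [Fintype ι] {T : ℝ} (B : X →L[ℝ] Y →L[ℝ] ℝ)
    {D : ι → ℝ → X} (hD : ∀ i, MemLp (D i) 2 (timeMeasure T))
    {w : ι → ℝ → Y} (hw : ∀ i, MemLp (w i) 2 (timeMeasure T))
    {Φ : ℝ → ℝ} {Φ₀ : ℝ} (hΦ : ∀ t, 0 ≤ Φ t) {G : Set ℝ} (hG : ∀ᵐ t ∂(timeMeasure T), t ∈ G)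
    (h0 : ∀ t ∈ G, Φ t ≤ Φ₀ + ∑ i, B (∫ s in (0 : ℝ)..t, D i s) (w i t))
    (h1 : ∀ s ∈ G, ∀ t ∈ G, Φ t ≤ Φ s + ∑ i, B (∫ r in s..t, D i r) (w i t)) :
    ∀ᵐ τ ∂(timeMeasure T),
      Φ τ ≤ Φ₀ + ∫ t in (0 : ℝ)..τ, ∑ i, B (D i t) (w i t) := by
  set Dt : ι → ℝ → X := fun i => (Ioo 0 T).indicator (D i) with hDt
  have hDtL2 : ∀ i, MemLp (Dt i) 2 := fun i => memLp_two_indicator_of_timeMeasure (hD i)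
  have hDt1 : ∀ i, Integrable (Dt i) := fun i =>
    (integrable_indicator_iff measurableSet_Ioo).2 (integrable_of_memLp_timeMeasure (hD i))
  have hDtint : ∀ i, ∀ a ∈ Icc 0 T, ∀ b ∈ Icc 0 T, ∫ r in a..b, Dt i r = ∫ r in a..b, D i r := by
    intro i a ha b hb
    refine intervalIntegral.integral_congr_ae ?_
    have h3 : ∀ᵐ x : ℝ, x ≠ T := by simp [ae_iff, measure_singleton]
    filter_upwards [h3] with x h3 hx
    have hx' : x ∈ Ioo 0 T := by
      rcases uIoc_subset_uIcc hx with ⟨hx1, hx2⟩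
      rw [mem_uIoc] at hx
      refine ⟨?_, lt_of_le_of_ne ?_ h3⟩
      · rcases hx with hx | hx
        · exact ha.1.trans_lt hx.1
        · exact hb.1.trans_lt hx.1
      · rcases hx with hx | hx
        · exact hx.2.trans hb.2
        · exact hx.2.trans ha.2
    exact indicator_of_mem hx' _
  set G' : Set ℝ := G ∩ Ioo 0 T with hG'
  have hGae : ∀ᵐ t, t ∈ Ioo 0 T → t ∈ G' := by
    filter_upwards [(ae_restrict_iff' measurableSet_Ioo).1 hG] with t ht h
    exact ⟨ht h, h⟩
  -- measurability of `Φ`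
  have hΦm : AEMeasurable Φ (timeMeasure T) := by
    -- By `h1` the supremum is attained at `t = s` when `s` is a good time, so `Φ` agrees there with
    -- `Ψ`. As a supremum of functions continuous in `s`, `Ψ` is lower semicontinuous, hence
    -- measurable whatever the size of the index set. Extended values are needed because `Ψ` may be
    -- infinite at other times.
    let Ψ : ℝ → EReal := fun s => ⨆ t : G', ((Φ t - ∑ i, B (∫ r in s..t, Dt i r) (w i t) : ℝ) : EReal)
    have hΨ : LowerSemicontinuous Ψ := by
      refine lowerSemicontinuous_iSup fun t => Continuous.lowerSemicontinuous ?_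
      refine continuous_coe_real_ereal.comp (continuous_const.sub ?_)
      refine continuous_finsetSum _ fun i _ => ?_
      have hc : Continuous fun s : ℝ => ∫ r in s..(t : ℝ), Dt i r := by
        have : (fun s : ℝ => ∫ r in s..(t : ℝ), Dt i r) = fun s => - ∫ r in (t : ℝ)..s, Dt i r := by
          ext s; exact intervalIntegral.integral_symm _ _
        rw [this]
        exact (intervalIntegral.continuous_primitive
          (fun a b => (hDt1 i).intervalIntegrable) _).neg
      exact (B.continuous.comp hc).clm_apply continuous_const
    refine ⟨fun s => (Ψ s).toReal, hΨ.measurable.ereal_toReal, ?_⟩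
    refine (ae_restrict_iff' measurableSet_Ioo).2 ?_
    filter_upwards [hGae] with s hs hsT
    have hsG := hs hsT
    have : Ψ s = (Φ s : EReal) := by
      apply le_antisymm
      · refine iSup_le fun t => ?_
        rw [EReal.coe_le_coe_iff]
        have := h1 s hsG.1 t t.2.1
        have e : ∀ i, ∫ r in s..(t : ℝ), Dt i r = ∫ r in s..(t : ℝ), D i r := fun i =>
          hDtint i s (Ioo_subset_Icc_self hsT) t (Ioo_subset_Icc_self t.2.2)
        simp only [e]
        linarith
      · refine le_iSup_of_le ⟨s, hsG⟩ ?_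
        simp
    simp [this]
  have hwI : ∀ i, Integrable (w i) (timeMeasure T) := fun i =>
    integrable_of_memLp_timeMeasure (hw i)
  have hΦi : Integrable Φ (timeMeasure T) := by
    have hb : Integrable (fun t => |Φ₀| + ∑ i, ‖B‖ * (∫ r, ‖Dt i r‖) * ‖w i t‖) (timeMeasure T) :=
      (integrable_const _).add (integrable_finsetSum _ fun i _ => (hwI i).norm.const_mul _)
    refine hb.mono' hΦm.aestronglyMeasurable ?_
    refine (ae_restrict_iff' measurableSet_Ioo).2 ?_
    filter_upwards [hGae] with t ht htT
    rw [Real.norm_of_nonneg (hΦ t)]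
    refine (h0 t (ht htT).1).trans (add_le_add (le_abs_self _) (Finset.sum_le_sum fun i _ => ?_))
    refine (le_abs_self _).trans ((B.le_opNorm₂ _ _).trans ?_)
    gcongr
    rw [← hDtint i 0 ⟨le_rfl, (htT.1.trans htT.2).le⟩ t (Ioo_subset_Icc_self htT)]
    exact (intervalIntegral.norm_integral_le_integral_norm_uIoc).trans
      (setIntegral_le_integral (hDt1 i).norm (Eventually.of_forall fun _ => norm_nonneg _))
  -- Before time zero `Φ` is continued by `Φ₀`, so that backward differences with step below one
  -- make sense up to the initial time and are governed there by `h0`.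
  set Φt : ℝ → ℝ := fun t => (Ioo 0 T).indicator Φ t + (Ioc (-1) 0).indicator (fun _ => Φ₀) t
    with hΦt
  have hΦti : Integrable Φt :=
    ((integrable_indicator_iff measurableSet_Ioo).2 hΦi).add
      ((integrable_indicator_iff measurableSet_Ioc).2 (by simp))
  -- The conclusion is proved at each `τ` where the primitive of `Φt` has derivative `Φt τ`. At such
  -- points backward averages converge.
  have hleb := _root_.LocallyIntegrable.ae_hasDerivAt_integral hΦti.locallyIntegrable
  refine (ae_restrict_iff' measurableSet_Ioo).2 ?_
  filter_upwards [hleb] with τ hτd hτ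
  have hΦτ : Φt τ = Φ τ := by
    simp only [hΦt]
    rw [indicator_of_mem hτ, indicator_of_notMem (fun h => absurd h.2 (not_le.2 hτ.1)), add_zero]
  -- the average of `Φ` on `(τ - h, τ)`
  have hlim1 : Tendsto (fun h : ℝ => h⁻¹ * ∫ t in (τ - h)..τ, Φt t) (𝓝[>] 0) (𝓝 (Φ τ)) := by
    have h2 := (hasDerivAt_iff_tendsto_slope.1 (hτd τ))
    have h3 : Tendsto (fun h : ℝ => τ - h) (𝓝[>] 0) (𝓝[≠] τ) := by
      refine tendsto_nhdsWithin_iff.2 ⟨?_, ?_⟩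
      · have : Tendsto (fun h : ℝ => τ - h) (𝓝 0) (𝓝 (τ - 0)) := by
          exact (continuous_const.sub continuous_id).tendsto 0
        rw [sub_zero] at this
        exact this.mono_left nhdsWithin_le_nhds
      · filter_upwards [self_mem_nhdsWithin] with h hh
        simp only [mem_compl_iff, mem_singleton_iff, sub_eq_self]
        exact ne_of_gt hh
    rw [← hΦτ]
    refine (h2.comp h3).congr' ?_
    filter_upwards [self_mem_nhdsWithin] with h hh
    have hh' : h ≠ 0 := ne_of_gt hh
    simp only [Function.comp, slope_def_field, intervalIntegral.integral_same]
    rw [intervalIntegral.integral_symm, sub_zero, sub_sub_cancel_left, neg_div_neg_eq,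
      div_eq_inv_mul]
  set wt : ι → ℝ → Y := fun i => (Ioo 0 τ).indicator (w i) with hwt
  have hwtL2 : ∀ i, MemLp (wt i) 2 := fun i => by
    have := (memLp_two_indicator_of_timeMeasure (hw i)).indicator (measurableSet_Ioo (a := 0) (b := τ))
    rw [indicator_indicator, inter_eq_left.2 (Ioo_subset_Ioo_right hτ.2.le)] at this
    exact this
  have hwt1 : ∀ i, Integrable (wt i) := fun i => by
    have := ((integrable_indicator_iff measurableSet_Ioo).2 (hwI i)).indicator
      (measurableSet_Ioo (a := 0) (b := τ))
    rw [indicator_indicator, inter_eq_left.2 (Ioo_subset_Ioo_right hτ.2.le)] at this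
    exact this
  have hlim2 : Tendsto (fun h : ℝ => Φ₀ + ∑ i, h⁻¹ * ∫ t, B (∫ s in (t - h)..t, Dt i s) (wt i t))
      (𝓝[>] 0) (𝓝 (Φ₀ + ∑ i, ∫ t, B (Dt i t) (wt i t))) :=
    tendsto_const_nhds.add (tendsto_finsetSum _ fun i _ =>
      tendsto_pairing_average B (hDtL2 i) (hwtL2 i) (hDt1 i) (hwt1 i))
  have hfin : Φ₀ + ∑ i, ∫ t, B (Dt i t) (wt i t)
      = Φ₀ + ∫ t in (0 : ℝ)..τ, ∑ i, B (D i t) (w i t) := by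
    congr 1
    have e : ∀ i, ∫ t, B (Dt i t) (wt i t) = ∫ t in Ioo 0 τ, B (D i t) (w i t) := by
      intro i
      rw [← integral_indicator measurableSet_Ioo]
      refine integral_congr_ae (Eventually.of_forall fun t => ?_)
      by_cases ht : t ∈ Ioo 0 τ
      · have ht' : t ∈ Ioo 0 T := ⟨ht.1, ht.2.trans hτ.2⟩
        simp [hDt, hwt, ht, ht']
      · simp only [hwt, indicator_of_notMem ht, map_zero]
    simp_rw [e]
    rw [intervalIntegral.integral_of_le hτ.1.le, integral_Ioc_eq_integral_Ioo,
      ← integral_finsetSum]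
    · intro i _
      have : MemLp (fun t => B (D i t) (w i t)) 1 (timeMeasure T) :=
        B.memLp_of_bilin 1 (hD i) (hw i)
      have h2 : IntegrableOn (fun t => B (D i t) (w i t)) (Ioo 0 T) :=
        memLp_one_iff_integrable.1 this
      exact h2.mono_set (Ioo_subset_Ioo_right hτ.2.le)
  rw [← hfin]
  refine le_of_tendsto_of_tendsto hlim1 hlim2 ?_
  have hsmall : ∀ᶠ h : ℝ in 𝓝[>] 0, h < 1 ∧ h < τ :=
    (eventually_lt_nhds one_pos |>.filter_mono nhdsWithin_le_nhds).and
      (eventually_lt_nhds hτ.1 |>.filter_mono nhdsWithin_le_nhds)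
  filter_upwards [self_mem_nhdsWithin, hsmall] with h hh hs
  have hh : 0 < h := hh
  have hII : ∀ a b : ℝ, IntervalIntegrable Φt volume a b := fun a b => hΦti.intervalIntegrable
  -- After a shift the two integrals cancel on the common interval. What remains lies in the last
  -- `h` units before `τ` and in $(-h,0)$, where `Φt` equals `Φ₀`.
  have e1 : ∫ t in (0 : ℝ)..τ, (Φt t - Φt (t - h)) = (∫ t in (τ - h)..τ, Φt t) - h * Φ₀ := by
    rw [intervalIntegral.integral_sub (hII _ _) (hΦti.comp_sub_right h).intervalIntegrable,
      intervalIntegral.integral_comp_sub_right (fun t => Φt t) h,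
      intervalIntegral.integral_interval_sub_interval_comm (hII _ _) (hII _ _) (hII _ _)]
    have e2 : ∫ t in (0 : ℝ)..(0 - h), Φt t = - (h * Φ₀) := by
      rw [intervalIntegral.integral_symm, neg_inj]
      have : ∫ t in (0 - h)..0, Φt t = ∫ t in (0 - h)..(0 : ℝ), Φ₀ := by
        refine intervalIntegral.integral_congr_ae (Eventually.of_forall fun t ht => ?_)
        rw [uIoc_of_le (by linarith)] at ht
        simp only [hΦt]
        rw [indicator_of_notMem (fun h' => absurd h'.1 (not_lt.2 ht.2)),
          indicator_of_mem (show t ∈ Ioc (-1) 0 from ⟨by linarith [ht.1], ht.2⟩), zero_add]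
      rw [this]; simp
    rw [e2, intervalIntegral.integral_symm τ (τ - h)]
    ring
  have hGshift : ∀ᵐ t, t - h ∈ Ioo 0 T → t - h ∈ G' :=
    (measurePreserving_sub_right volume h).quasiMeasurePreserving.ae hGae
  have hne : ∀ᵐ t : ℝ, t ≠ h := by simp [ae_iff, measure_singleton]
  have hBint : ∀ i, Integrable fun t => B (∫ s in (t - h)..t, Dt i s) (wt i t) := by
    intro i
    have hcont : Continuous fun t => ∫ s in (t - h)..t, Dt i s := by
      have hp := intervalIntegral.continuous_primitive
          (fun a b => (hDt1 i).intervalIntegrable (a := a) (b := b)) 0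
      have : (fun t => ∫ s in (t - h)..t, Dt i s)
          = fun t => (∫ s in (0 : ℝ)..t, Dt i s) - ∫ s in (0 : ℝ)..(t - h), Dt i s := by
        ext t
        rw [intervalIntegral.integral_interval_sub_left] <;>
          exact (hDt1 i).intervalIntegrable
      rw [this]
      exact hp.sub (hp.comp (continuous_id.sub continuous_const))
    refine B.integrable_of_bilin_of_bdd_left (∫ r, ‖Dt i r‖) hcont.aestronglyMeasurable
      (Eventually.of_forall fun t => ?_) (hwt1 i)
    exact (intervalIntegral.norm_integral_le_integral_norm_uIoc).trans
      (setIntegral_le_integral (hDt1 i).norm (Eventually.of_forall fun _ => norm_nonneg _))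
  -- For `t > h` the subgradient inequality `h1` is used between the times `t - h` and `t`. For `t <
  -- h` it is `h0`, because `Dt` vanishes before zero and the integral from `t - h` is the integral
  -- from `0`.
  have hmain : ∫ t in (0 : ℝ)..τ, (Φt t - Φt (t - h))
      ≤ ∑ i, ∫ t, B (∫ s in (t - h)..t, Dt i s) (wt i t) := by
    have e3 : ∑ i, ∫ t, B (∫ s in (t - h)..t, Dt i s) (wt i t)
        = ∫ t in (0 : ℝ)..τ, ∑ i, B (∫ s in (t - h)..t, Dt i s) (wt i t) := by
      rw [← integral_finsetSum _ fun i _ => hBint i, intervalIntegral.integral_of_le hτ.1.le,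
        integral_Ioc_eq_integral_Ioo, setIntegral_eq_integral_of_forall_compl_eq_zero]
      intro t ht
      simp [hwt, indicator_of_notMem ht]
    rw [e3, intervalIntegral.integral_of_le hτ.1.le, intervalIntegral.integral_of_le hτ.1.le,
      integral_Ioc_eq_integral_Ioo, integral_Ioc_eq_integral_Ioo]
    refine setIntegral_mono_ae_restrict (hΦti.sub (hΦti.comp_sub_right h)).integrableOn
      (integrable_finsetSum _ fun i _ => hBint i).integrableOn ?_
    refine (ae_restrict_iff' measurableSet_Ioo).2 ?_
    filter_upwards [hGae, hGshift, hne] with t hgt hgs hne ht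
    have htT : t ∈ Ioo 0 T := ⟨ht.1, ht.2.trans hτ.2⟩
    have htG := hgt htT
    have hΦ1 : Φt t = Φ t := by
      simp only [hΦt]
      rw [indicator_of_mem htT, indicator_of_notMem (fun h => absurd h.2 (not_le.2 ht.1)), add_zero]
    have hw1 : ∀ i, wt i t = w i t := fun i => indicator_of_mem ht _
    rcases lt_or_gt_of_ne hne with hth | hth
    · have hΦ2 : Φt (t - h) = Φ₀ := by
        simp only [hΦt]
        rw [indicator_of_notMem (fun h' => absurd h'.1 (not_lt.2 (by linarith))),
          indicator_of_mem (show t - h ∈ Ioc (-1) 0 from ⟨by linarith [ht.1], by linarith⟩),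
          zero_add]
      have e4 : ∀ i, ∫ s in (t - h)..t, Dt i s = ∫ s in (0 : ℝ)..t, D i s := by
        intro i
        rw [← hDtint i 0 ⟨le_rfl, (hτ.1.trans hτ.2).le⟩ t (Ioo_subset_Icc_self htT),
          ← intervalIntegral.integral_add_adjacent_intervals
            ((hDt1 i).intervalIntegrable (a := t - h) (b := 0)) (hDt1 i).intervalIntegrable]
        have : ∫ s in (t - h)..0, Dt i s = ∫ s in (t - h)..(0 : ℝ), (0 : X) := by
          refine intervalIntegral.integral_congr_ae (Eventually.of_forall fun s hs => ?_)
          rw [uIoc_of_le (by linarith)] at hs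
          exact indicator_of_notMem (fun h' => absurd h'.1 (not_lt.2 hs.2)) _
        rw [this]; simp
      simp only [hΦ1, hΦ2, e4, hw1]
      linarith [h0 t htG.1]
    · have hsT : t - h ∈ Ioo 0 T := ⟨by linarith, by linarith [htT.2]⟩
      have hΦ2 : Φt (t - h) = Φ (t - h) := by
        simp only [hΦt]
        rw [indicator_of_mem hsT, indicator_of_notMem (fun h => absurd h.2 (not_le.2 hsT.1)),
          add_zero]
      simp only [hΦ1, hΦ2, hw1, hDtint _ (t - h) (Ioo_subset_Icc_self hsT) t
        (Ioo_subset_Icc_self htT)]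
      linarith [h1 (t - h) (hgs hsT).1 t htG.1]
  rw [e1] at hmain
  have : h⁻¹ * ((∫ t in (τ - h)..τ, Φt t) - h * Φ₀)
      ≤ h⁻¹ * ∑ i, ∫ t, B (∫ s in (t - h)..t, Dt i s) (wt i t) :=
    mul_le_mul_of_nonneg_left hmain (by positivity)
  rw [Finset.mul_sum, mul_sub, inv_mul_cancel_left₀ hh.ne'] at this
  linarith

/-- Fubini: for fixed `s` the integral of $\psi'$ over $t>s$ is $-\psi(s)$. -/
theorem integral_deriv_smul_primitive {D : ℝ → X} (hD : Integrable D) {ψ : ℝ → ℝ}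
    (hψ : ContDiff ℝ ∞ ψ) (hc : HasCompactSupport ψ) :
    ∫ t, deriv ψ t • ∫ s in Iio t, D s = - ∫ t, ψ t • D t := by
  have hψ' : Integrable (deriv ψ) :=
    (hψ.continuous_deriv (by simp)).integrable_of_hasCompactSupport hc.deriv
  have hint : Integrable (fun z : ℝ × ℝ => deriv ψ z.1 • (Iio z.1).indicator D z.2)
      (volume.prod volume) := by
    have h1 := hψ'.smul_prod hD
    have hm : MeasurableSet {z : ℝ × ℝ | z.2 < z.1} := measurableSet_lt measurable_snd measurable_fst
    refine (h1.indicator hm).congr (Eventually.of_forall fun z => ?_)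
    by_cases hz : z.2 < z.1
    · simp [indicator, hz]
    · simp [indicator, hz]
  calc ∫ t, deriv ψ t • ∫ s in Iio t, D s
      = ∫ t, ∫ s, deriv ψ t • (Iio t).indicator D s := by
        refine integral_congr_ae (Eventually.of_forall fun t => ?_)
        simp only
        rw [integral_smul, integral_indicator measurableSet_Iio]
    _ = ∫ s, ∫ t, deriv ψ t • (Iio t).indicator D s := integral_integral_swap hint
    _ = ∫ s, - (ψ s • D s) := by
        refine integral_congr_ae (Eventually.of_forall fun s => ?_)
        simp only
        have : (fun t => deriv ψ t • (Iio t).indicator D s)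
            = fun t => (Ioi s).indicator (deriv ψ) t • D s := by
          ext t
          by_cases h : s < t <;> simp [indicator, h]
        rw [this, integral_smul_const, integral_indicator measurableSet_Ioi,
          hc.integral_Ioi_deriv_eq (hψ.of_le (by simp)), neg_smul]
    _ = _ := integral_neg _

/-- The du Bois-Reymond lemma. Subtracting from a test function its integral times a fixed bump of
mass one leaves the derivative of a test function, so `g` integrates against every test function
like a constant. Continuity carries the equality to the endpoints, which is needed to compare with
the value at time zero. -/
theorem exists_const_of_integral_deriv_smul_eq_zero {T : ℝ} (hT : 0 < T) {g : ℝ → X}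
    (hg : ContinuousOn g (Icc 0 T))
    (h : ∀ ψ : ℝ → ℝ, ContDiff ℝ ∞ ψ → HasCompactSupport ψ → tsupport ψ ⊆ Ioo 0 T →
      ∫ t, deriv ψ t • g t ∂(timeMeasure T) = 0) :
    ∀ t ∈ Icc 0 T, g t = g 0 := by
  let b : ContDiffBump (T / 2) := ⟨T / 8, T / 4, by positivity, by linarith⟩
  set φ₀ : ℝ → ℝ := b.normed volume with hφ₀
  have hφ₀s : ContDiff ℝ ∞ φ₀ := b.contDiff_normed
  have hφ₀c : HasCompactSupport φ₀ := b.hasCompactSupport_normed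
  have hφ₀t : tsupport φ₀ ⊆ Ioo 0 T := by
    rw [hφ₀, b.tsupport_normed_eq, Real.closedBall_eq_Icc]
    intro x hx
    have h1 : T / 2 - T / 4 ≤ x := hx.1
    have h2 : x ≤ T / 2 + T / 4 := hx.2
    exact ⟨by linarith, by linarith⟩
  have hφ₀i : ∫ t, φ₀ t = 1 := b.integral_normed
  have hgI : IntegrableOn g (Ioo 0 T) :=
    (hg.integrableOn_compact isCompact_Icc).mono_set Ioo_subset_Icc_self
  set k : X := ∫ t in Ioo 0 T, φ₀ t • g t with hk
  have hsm : ∀ φ : ℝ → ℝ, Continuous φ → HasCompactSupport φ →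
      IntegrableOn (fun t => φ t • g t) (Ioo 0 T) := by
    intro φ hφ hc
    obtain ⟨C, hC⟩ := hc.exists_bound_of_continuous hφ
    exact hgI.bdd_smul C hφ.aestronglyMeasurable (Eventually.of_forall hC)
  have key : ∀ᵐ t, t ∈ Ioo 0 T → g t - k = 0 := by
    refine isOpen_Ioo.ae_eq_zero_of_integral_contDiff_smul_eq_zero ?_ ?_
    · exact ((hg.mono Ioo_subset_Icc_self).sub continuousOn_const).locallyIntegrableOn
        measurableSet_Ioo
    intro φ hφ hφc hφt
    set r : ℝ := ∫ t, φ t with hr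
    set χ : ℝ → ℝ := fun t => φ t - r * φ₀ t with hχ
    have hχs : ContDiff ℝ ∞ χ := hφ.sub (contDiff_const.mul hφ₀s)
    have hχi : Integrable χ := (hφ.continuous.integrable_of_hasCompactSupport hφc).sub
      ((hφ₀s.continuous.integrable_of_hasCompactSupport hφ₀c).const_mul _)
    have hχ0 : ∫ t, χ t = 0 := by
      rw [hχ, integral_sub (hφ.continuous.integrable_of_hasCompactSupport hφc)
        ((hφ₀s.continuous.integrable_of_hasCompactSupport hφ₀c).const_mul _),
        integral_const_mul, hφ₀i]
      ring
    -- The primitive `ψ` of `χ` vanishes to the left of the least point of `K` because `χ` does, and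
    -- to the right of the greatest point because `χ` has integral zero.
    set K : Set ℝ := tsupport φ ∪ tsupport φ₀ with hK
    have hKc : IsCompact K := hφc.isCompact.union hφ₀c.isCompact
    have hKs : K ⊆ Ioo 0 T := union_subset hφt hφ₀t
    have hχK : ∀ t, t ∉ K → χ t = 0 := by
      intro t ht
      have h1 : φ t = 0 := image_eq_zero_of_notMem_tsupport fun h => ht (Or.inl h)
      have h2 : φ₀ t = 0 := image_eq_zero_of_notMem_tsupport fun h => ht (Or.inr h)
      simp [hχ, h1, h2]
    have hKne : K.Nonempty := ⟨T / 2, Or.inr (by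
      rw [hφ₀, b.tsupport_normed_eq]; exact Metric.mem_closedBall_self b.rOut_pos.le)⟩
    obtain ⟨a, ha⟩ := hKc.exists_isLeast hKne
    obtain ⟨c, hc⟩ := hKc.exists_isGreatest hKne
    set ψ : ℝ → ℝ := fun t => ∫ s in (0 : ℝ)..t, χ s with hψ
    have hψd : ∀ t, HasDerivAt ψ (χ t) t := fun t =>
      intervalIntegral.integral_hasDerivAt_right hχi.intervalIntegrable
        (hχs.continuous.stronglyMeasurableAtFilter _ _) hχs.continuous.continuousAt
    have hψd' : deriv ψ = χ := funext fun t => (hψd t).deriv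
    have hψs : ContDiff ℝ ∞ ψ := by
      rw [contDiff_infty_iff_deriv, hψd']
      exact ⟨fun t => (hψd t).differentiableAt, hχs⟩
    have hψz : ∀ t, t ∉ Icc a c → ψ t = 0 := by
      intro t ht
      rw [mem_Icc, not_and_or, not_le, not_le] at ht
      rcases ht with ht | ht
      · have : ∫ s in (0 : ℝ)..t, χ s = ∫ s in (0 : ℝ)..t, (0 : ℝ) := by
          refine intervalIntegral.integral_congr_ae (Eventually.of_forall fun s hs => ?_)
          refine hχK s fun hsK => ?_
          have h1 := ha.2 hsK
          have h2 := (hKs ha.1).1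
          rw [mem_uIoc] at hs
          rcases hs with hs | hs <;> linarith [hs.1, hs.2]
        simp only [hψ, this, intervalIntegral.integral_zero]
      · have h1 : ∫ s in (0 : ℝ)..t, χ s = ∫ s, χ s := by
          have h2 := (hKs ha.1).1
          have h3 := (hKs hc.1).1
          rw [intervalIntegral.integral_of_le (by linarith),
            setIntegral_eq_integral_of_forall_compl_eq_zero]
          intro s hs
          refine hχK s fun hsK => hs ⟨h2.trans_le (ha.2 hsK), (hc.2 hsK).trans ht.le⟩
        simp only [hψ, h1, hχ0]
    have hψt : tsupport ψ ⊆ Icc a c :=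
      closure_minimal (fun t ht => by_contra fun h' => ht (hψz t h')) isClosed_Icc
    have hψc : HasCompactSupport ψ := isCompact_Icc.of_isClosed_subset (isClosed_tsupport _) hψt
    have hψT : tsupport ψ ⊆ Ioo 0 T := fun t ht =>
      ⟨(hKs ha.1).1.trans_le (hψt ht).1, (hψt ht).2.trans_lt (hKs hc.1).2⟩
    have h3 := h ψ hψs hψc hψT
    rw [hψd'] at h3
    have h4 : ∫ t in Ioo 0 T, χ t • g t = (∫ t in Ioo 0 T, φ t • g t) - r • k := by
      rw [hk, ← integral_smul]
      refine Eq.trans ?_ (integral_sub (hsm φ hφ.continuous hφc)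
        ((hsm φ₀ hφ₀s.continuous hφ₀c).smul r))
      refine integral_congr_ae (Eventually.of_forall fun t => ?_)
      simp only [hχ, sub_smul, mul_smul]
    have h5 : ∫ t in Ioo 0 T, φ t • k = r • k := by
      rw [integral_smul_const, hr, setIntegral_eq_integral_of_forall_compl_eq_zero]
      exact fun t ht => image_eq_zero_of_notMem_tsupport fun h => ht (hφt h)
    have h6 : ∫ t, φ t • (g t - k) = ∫ t in Ioo 0 T, φ t • (g t - k) := by
      rw [setIntegral_eq_integral_of_forall_compl_eq_zero]
      intro t ht
      rw [image_eq_zero_of_notMem_tsupport fun h => ht (hφt h), zero_smul]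
    rw [h6]
    simp_rw [smul_sub]
    rw [integral_sub (hsm φ hφ.continuous hφc), h5, ← h4]
    · exact h3
    · exact ((hφ.continuous.integrable_of_hasCompactSupport hφc).smul_const k).integrableOn
  have hall : ∀ t ∈ Icc 0 T, g t = k := by
    have hae : g =ᵐ[volume.restrict (Ioo 0 T)] fun _ => k :=
      (ae_restrict_iff' measurableSet_Ioo).2 (key.mono fun t ht h => sub_eq_zero.1 (ht h))
    have h7 : EqOn g (fun _ => k) (Ioo 0 T) :=
      Measure.eqOn_open_of_ae_eq hae isOpen_Ioo (hg.mono Ioo_subset_Icc_self) continuousOn_const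
    have h8 : EqOn g (fun _ => k) (closure (Ioo 0 T)) := by
      refine h7.of_subset_closure ?_ continuousOn_const subset_closure le_rfl
      rwa [closure_Ioo hT.ne]
    rw [closure_Ioo hT.ne] at h8
    exact h8
  intro t ht
  rw [hall t ht, hall 0 ⟨le_rfl, hT.le⟩]

/-- A function with a weak derivative `D` and an initial value is a primitive of `D`. -/
theorem eq_primitive_of_hasWeakTimeDeriv {T : ℝ} (hT : 0 < T) {f D : ℝ → X} {x₀ : X}
    (hD : MemLp D 2 (timeMeasure T)) (h : HasWeakTimeDeriv T f D) (h0 : HasInitialValue T f x₀) :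
    ∀ᵐ t ∂(timeMeasure T), f t = x₀ + ∫ s in (0 : ℝ)..t, D s := by
  obtain ⟨c, hc, hcf, hc0⟩ := h0
  set Dt : ℝ → X := (Ioo 0 T).indicator D with hDt
  have hDt1 : Integrable Dt :=
    (integrable_indicator_iff measurableSet_Ioo).2 (integrable_of_memLp_timeMeasure hD)
  have hprim : ∀ t ∈ Icc 0 T, ∫ s in (0 : ℝ)..t, Dt s = ∫ s in Iio t, Dt s := by
    intro t ht
    rw [intervalIntegral.integral_of_le ht.1, integral_Ioc_eq_integral_Ioo]
    symm
    refine setIntegral_eq_of_subset_of_forall_sdiff_eq_zero measurableSet_Iio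
      (fun x hx => hx.2) fun x hx => indicator_of_notMem (fun h' => hx.2 ⟨h'.1, hx.1⟩) _
  have hprim' : ∀ t ∈ Icc 0 T, ∫ s in (0 : ℝ)..t, Dt s = ∫ s in (0 : ℝ)..t, D s := by
    intro t ht
    rw [intervalIntegral.integral_of_le ht.1, intervalIntegral.integral_of_le ht.1,
      integral_Ioc_eq_integral_Ioo, integral_Ioc_eq_integral_Ioo]
    exact setIntegral_congr_fun measurableSet_Ioo fun x hx =>
      indicator_of_mem (show x ∈ Ioo 0 T from ⟨hx.1, hx.2.trans_le ht.2⟩) _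
  have hpc : Continuous fun t => ∫ s in (0 : ℝ)..t, Dt s :=
    intervalIntegral.continuous_primitive (fun a b => hDt1.intervalIntegrable) 0
  have hcI : IntegrableOn c (Ioo 0 T) :=
    (hc.integrableOn_compact isCompact_Icc).mono_set Ioo_subset_Icc_self
  -- The continuous representative and the primitive of `D` have the same weak derivative, so their
  -- difference is constant on the closed interval and equal to its value at zero.
  have hconst := exists_const_of_integral_deriv_smul_eq_zero hT
    (g := fun t => c t - ∫ s in (0 : ℝ)..t, Dt s) (hc.sub hpc.continuousOn) (by
      intro ψ hψ hψc hψT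
      have hdc : Continuous (deriv ψ) := hψ.continuous_deriv (by simp)
      obtain ⟨C, hC⟩ := hψc.deriv.exists_bound_of_continuous hdc
      simp_rw [smul_sub]
      have e1 : ∫ t in Ioo 0 T, deriv ψ t • c t = - ∫ t in Ioo 0 T, ψ t • D t := by
        rw [← h ψ hψ hψc hψT]
        exact integral_congr_ae (hcf.mono fun t ht => by simp only [ht])
      have e2 : ∫ t in Ioo 0 T, deriv ψ t • ∫ s in (0 : ℝ)..t, Dt s
          = - ∫ t in Ioo 0 T, ψ t • D t := by
        have e3 := integral_deriv_smul_primitive hDt1 hψ hψc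
        have e4 : ∫ t, ψ t • Dt t = ∫ t in Ioo 0 T, ψ t • D t := by
          rw [← integral_indicator measurableSet_Ioo]
          refine integral_congr_ae (Eventually.of_forall fun t => ?_)
          by_cases ht : t ∈ Ioo 0 T <;> simp [hDt, indicator, ht]
        rw [← e4, ← e3, ← setIntegral_eq_integral_of_forall_compl_eq_zero (s := Ioo 0 T)
          (f := fun t => deriv ψ t • ∫ s in Iio t, Dt s)]
        · exact setIntegral_congr_fun measurableSet_Ioo fun t ht => by
            simp only [hprim t (Ioo_subset_Icc_self ht)]
        · intro t ht
          rw [image_eq_zero_of_notMem_tsupport fun h' => ht (hψT (tsupport_deriv_subset h')),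
            zero_smul]
      exact (integral_sub (hcI.bdd_smul C hdc.aestronglyMeasurable (Eventually.of_forall hC))
        ((hdc.smul hpc).integrable_of_hasCompactSupport hψc.deriv.smul_right).integrableOn).trans
        ((congrArg₂ (· - ·) e1 e2).trans (sub_self _)))
  filter_upwards [hcf, ae_restrict_mem measurableSet_Ioo] with t ht htT
  have h9 := hconst t (Ioo_subset_Icc_self htT)
  simp only [intervalIntegral.integral_same, sub_zero, hc0] at h9
  rw [← ht, ← hprim' t (Ioo_subset_Icc_self htT), ← h9]
  abel

end Time

end Ferro

namespace Ferro

/-! ### Local averages -/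

/-- A smooth bump function supported in the unit ball. -/
noncomputable def unitBump : ContDiffBump (0 : E3) := ⟨1 / 2, 1, by norm_num, by norm_num⟩

/-- A smooth probability density supported in the unit ball. -/
noncomputable def mollifier : E3 → ℝ := unitBump.normed volume

theorem contDiff_mollifier : ContDiff ℝ ∞ mollifier := unitBump.contDiff_normed

theorem hasCompactSupport_mollifier : HasCompactSupport mollifier :=
  unitBump.hasCompactSupport_normed

theorem mollifier_nonneg (z : E3) : 0 ≤ mollifier z := unitBump.nonneg_normed z

theorem integral_mollifier : ∫ z, mollifier z = 1 := unitBump.integral_normed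

theorem support_mollifier : Function.support mollifier = Metric.ball 0 1 :=
  unitBump.support_normed_eq

theorem mollifier_eq_zero {z : E3} (hz : 1 ≤ ‖z‖) : mollifier z = 0 := by
  by_contra h
  have : z ∈ Function.support mollifier := h
  rw [support_mollifier, mem_ball_zero_iff] at this
  linarith

theorem fderiv_mollifier_eq_zero {z : E3} (hz : 1 < ‖z‖) : fderiv ℝ mollifier z = 0 := by
  refine Function.notMem_support.1 fun h => ?_
  have h2 := support_fderiv_subset ℝ h
  rw [tsupport, support_mollifier, closure_ball _ one_ne_zero, mem_closedBall_zero_iff] at h2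
  linarith

theorem exists_mollifier_bound : ∃ C : ℝ, 0 < C ∧ (∀ z, mollifier z ≤ C) ∧
    ∀ z, ‖fderiv ℝ mollifier z‖ ≤ C := by
  obtain ⟨C₁, h₁⟩ := hasCompactSupport_mollifier.exists_bound_of_continuous
    contDiff_mollifier.continuous
  obtain ⟨C₂, h₂⟩ := (hasCompactSupport_mollifier.fderiv (𝕜 := ℝ)).exists_bound_of_continuous
    (contDiff_mollifier.continuous_fderiv (by simp))
  refine ⟨max (max C₁ C₂) 1, by positivity, fun z => ?_, fun z => ?_⟩
  · exact (le_abs_self _).trans ((h₁ z).trans ((le_max_left _ _).trans (le_max_left _ _)))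
  · exact (h₂ z).trans ((le_max_right _ _).trans (le_max_left _ _))

/-- A bound for the mollifier and its differential. -/
noncomputable def mollifierBound : ℝ := exists_mollifier_bound.choose

theorem mollifierBound_pos : 0 < mollifierBound := exists_mollifier_bound.choose_spec.1

theorem mollifier_le (z : E3) : mollifier z ≤ mollifierBound :=
  exists_mollifier_bound.choose_spec.2.1 z

theorem norm_fderiv_mollifier_le (z : E3) : ‖fderiv ℝ mollifier z‖ ≤ mollifierBound :=
  exists_mollifier_bound.choose_spec.2.2 z

/-- The mollifier rescaled to the ball of centre `c` and radius `ρ`. -/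
noncomputable def kernelAt (c : E3) (ρ : ℝ) (y : E3) : ℝ := ρ⁻¹ ^ 3 * mollifier (ρ⁻¹ • (y - c))

/-- The average of `u` with respect to the rescaled mollifier. -/
noncomputable def localAvg (D : Set E3) (u : E3 → ℝ) (c : E3) (ρ : ℝ) : ℝ :=
  ∫ y in D, u y * kernelAt c ρ y

theorem kernelAt_nonneg (c : E3) {ρ : ℝ} (hρ : 0 < ρ) (y : E3) : 0 ≤ kernelAt c ρ y :=
  mul_nonneg (by positivity) (mollifier_nonneg _)

theorem kernelAt_le (c : E3) {ρ : ℝ} (hρ : 0 < ρ) (y : E3) :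
    kernelAt c ρ y ≤ mollifierBound * ρ⁻¹ ^ 3 := by
  rw [mul_comm]
  exact mul_le_mul_of_nonneg_left (mollifier_le _) (by positivity)

theorem norm_inv_smul_sub {c y : E3} {ρ : ℝ} (hρ : 0 < ρ) :
    ‖ρ⁻¹ • (y - c)‖ = ρ⁻¹ * ‖y - c‖ := by
  rw [norm_smul, Real.norm_of_nonneg (by positivity)]

theorem kernelAt_eq_zero {c : E3} {ρ : ℝ} (hρ : 0 < ρ) {y : E3}
    (hy : y ∉ Metric.ball c ρ) : kernelAt c ρ y = 0 := by
  rw [kernelAt, mollifier_eq_zero, mul_zero]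
  rw [Metric.mem_ball, dist_eq_norm, not_lt] at hy
  rw [norm_inv_smul_sub hρ, ← div_eq_inv_mul, le_div_iff₀ hρ]
  linarith

theorem contDiff_kernelAt (c : E3) (ρ : ℝ) : ContDiff ℝ ∞ (kernelAt c ρ) := by
  unfold kernelAt
  exact contDiff_const.mul (contDiff_mollifier.comp (by fun_prop))

theorem tsupport_kernelAt {c : E3} {ρ : ℝ} (hρ : 0 < ρ) :
    tsupport (kernelAt c ρ) ⊆ Metric.closedBall c ρ := by
  refine closure_minimal (fun y hy => ?_) Metric.isClosed_closedBall
  by_contra h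
  exact hy (kernelAt_eq_zero hρ fun h' => h (Metric.ball_subset_closedBall h'))

theorem hasCompactSupport_kernelAt {c : E3} {ρ : ℝ} (hρ : 0 < ρ) :
    HasCompactSupport (kernelAt c ρ) :=
  (isCompact_closedBall c ρ).of_isClosed_subset (isClosed_tsupport _) (tsupport_kernelAt hρ)

theorem integral_kernelAt (c : E3) {ρ : ℝ} (hρ : 0 < ρ) : ∫ y, kernelAt c ρ y = 1 := by
  unfold kernelAt
  rw [integral_const_mul, integral_sub_right_eq_self (fun y => mollifier (ρ⁻¹ • y)) c,
    Measure.integral_comp_smul]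
  rw [integral_mollifier, finrank_euclideanSpace_fin, smul_eq_mul, mul_one, inv_pow, inv_inv,
    abs_of_pos (by positivity), ← inv_pow, ← mul_pow, inv_mul_cancel₀ hρ.ne', one_pow]

theorem kernelAt_isTest {D : Set E3} {c : E3} {ρ : ℝ} (hρ : 0 < ρ)
    (hD : Metric.closedBall c ρ ⊆ D) : IsTest D (kernelAt c ρ) :=
  ⟨contDiff_kernelAt c ρ, hasCompactSupport_kernelAt hρ, (tsupport_kernelAt hρ).trans hD⟩

/-- When the centre moves with velocity `a` and the radius with velocity `b`, the kernel is
transported by the velocity field $a+b\,(y-c)/\rho$. The derivative computed here is minus the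
divergence of kernel times field, which `div_kernelAt` computes: the continuity equation. -/
theorem hasDerivAt_kernelAt_path (c a y : E3) (ρ b τ : ℝ) (hτ : 0 < ρ + τ * b) :
    HasDerivAt (fun τ : ℝ => kernelAt (c + τ • a) (ρ + τ * b) y)
      (-(3 * b * (ρ + τ * b)⁻¹ ^ 4 * mollifier ((ρ + τ * b)⁻¹ • (y - (c + τ • a)))
        + (ρ + τ * b)⁻¹ ^ 4 * fderiv ℝ mollifier ((ρ + τ * b)⁻¹ • (y - (c + τ • a)))
          (a + b • ((ρ + τ * b)⁻¹ • (y - (c + τ • a)))))) τ := by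
  have h1 : HasDerivAt (fun τ : ℝ => ρ + τ * b) b τ := by
    simpa using ((hasDerivAt_id τ).mul_const b).const_add ρ
  have h2 : HasDerivAt (fun τ : ℝ => (ρ + τ * b)⁻¹) (-b / (ρ + τ * b) ^ 2) τ := h1.inv hτ.ne'
  have h3 : HasDerivAt (fun τ : ℝ => y - (c + τ • a)) (-a) τ := by
    simpa using (((hasDerivAt_id τ).smul_const a).const_add c).const_sub y
  have h4 := h2.smul h3
  have h5 := ((contDiff_mollifier.differentiable (by simp)
    ((ρ + τ * b)⁻¹ • (y - (c + τ • a)))).hasFDerivAt.comp_hasDerivAt τ h4)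
  have h6 := (h2.pow 3).mul h5
  refine h6.congr_deriv ?_
  simp only [map_add, map_smul, map_neg, smul_eq_mul, Function.comp_apply, Pi.pow_apply,
    Pi.smul_apply']
  set A := fderiv ℝ mollifier ((ρ + τ * b)⁻¹ • (y - (c + τ • a)))
  set M := mollifier ((ρ + τ * b)⁻¹ • (y - (c + τ • a)))
  set R := ρ + τ * b
  push_cast
  rw [div_eq_mul_inv, ← inv_pow]
  ring

/-- The summand with factor `3 * b` is the divergence of the dilation part of the field in three
dimensions. -/
theorem div_kernelAt (c a y : E3) (ρ b : ℝ) :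
    ∑ i, fderiv ℝ (fun y => (a i + b * (ρ⁻¹ • (y - c)) i) * kernelAt c ρ y) y (basisVec i)
      = 3 * b * ρ⁻¹ ^ 4 * mollifier (ρ⁻¹ • (y - c))
        + ρ⁻¹ ^ 4 * fderiv ℝ mollifier (ρ⁻¹ • (y - c)) (a + b • (ρ⁻¹ • (y - c))) := by
  have hlin : HasFDerivAt (fun y : E3 => ρ⁻¹ • (y - c)) (ρ⁻¹ • ContinuousLinearMap.id ℝ E3) y :=
    ((hasFDerivAt_id y).sub_const c).const_smul ρ⁻¹
  have hk : HasFDerivAt (kernelAt c ρ)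
      (ρ⁻¹ ^ 3 • (fderiv ℝ mollifier (ρ⁻¹ • (y - c))).comp (ρ⁻¹ • ContinuousLinearMap.id ℝ E3)) y :=
    ((contDiff_mollifier.differentiable (by simp)
      (ρ⁻¹ • (y - c))).hasFDerivAt.comp y hlin).const_mul _
  have hi : ∀ i, HasFDerivAt (fun y : E3 => a i + b * (ρ⁻¹ • (y - c)) i)
      (b • (EuclideanSpace.proj (𝕜 := ℝ) i).comp (ρ⁻¹ • ContinuousLinearMap.id ℝ E3)) y := by
    intro i
    exact (((EuclideanSpace.proj (𝕜 := ℝ) i).hasFDerivAt.comp y hlin).const_mul b).const_add _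
  have hterm : ∀ i, fderiv ℝ (fun y => (a i + b * (ρ⁻¹ • (y - c)) i) * kernelAt c ρ y) y (basisVec i)
      = b * ρ⁻¹ * kernelAt c ρ y + (a i + b * (ρ⁻¹ • (y - c)) i) * (ρ⁻¹ ^ 4 *
        fderiv ℝ mollifier (ρ⁻¹ • (y - c)) (basisVec i)) := by
    intro i
    rw [((hi i).fun_mul hk).fderiv]
    simp [basisVec]
    ring
  have hsum : a + b • (ρ⁻¹ • (y - c)) = ∑ i, (a i + b * (ρ⁻¹ • (y - c)) i) • basisVec i := by
    ext j
    simp [basisVec, Finset.sum_apply, Pi.single_apply]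
  rw [hsum, map_sum]
  simp_rw [hterm, map_smul, smul_eq_mul]
  rw [Finset.sum_add_distrib, Finset.mul_sum]
  simp only [Finset.sum_const, Finset.card_univ, Fintype.card_fin, nsmul_eq_mul, kernelAt]
  push_cast
  congr 1
  · ring
  · exact Finset.sum_congr rfl fun i _ => by ring

/-- The derivative of local averages along an affine path of balls. -/
theorem hasDerivAt_localAvg_path {D : Set E3} {u : E3 → ℝ} {p : E3 → E3}
    (hu : IntegrableOn u D) (hp : IntegrableOn p D) (hw : HasWeakGradient D u p)
    (c a : E3) (ρ b τ : ℝ) (hτ : 0 < ρ + τ * b)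
    (hball : Metric.closedBall (c + τ • a) (ρ + τ * b) ⊆ D) :
    HasDerivAt (fun τ : ℝ => localAvg D u (c + τ • a) (ρ + τ * b))
      (∫ y in D, inner ℝ (p y) (a + b • ((ρ + τ * b)⁻¹ • (y - (c + τ • a))))
        * kernelAt (c + τ • a) (ρ + τ * b) y) τ := by
  set r : ℝ := ρ + τ * b with hr
  set c' : E3 := c + τ • a with hc'
  set F' : ℝ → E3 → ℝ := fun τ y =>
    -(3 * b * (ρ + τ * b)⁻¹ ^ 4 * mollifier ((ρ + τ * b)⁻¹ • (y - (c + τ • a)))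
        + (ρ + τ * b)⁻¹ ^ 4 * fderiv ℝ mollifier ((ρ + τ * b)⁻¹ • (y - (c + τ • a)))
          (a + b • ((ρ + τ * b)⁻¹ • (y - (c + τ • a))))) with hF'
  -- Keeping the radius above `r / 2` bounds the derivative of the kernel uniformly in `y`, as
  -- differentiation under the integral requires.
  have hnear : ∀ᶠ σ in 𝓝 τ, r / 2 < ρ + σ * b := by
    have hc : Continuous fun σ : ℝ => ρ + σ * b := by fun_prop
    exact (hc.tendsto τ).eventually (lt_mem_nhds (by linarith))
  have hF'b : ∀ σ, r / 2 < ρ + σ * b → ∀ y, |F' σ y|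
      ≤ (r / 2)⁻¹ ^ 4 * (3 * |b| + (‖a‖ + |b|)) * mollifierBound := by
    intro σ hσ y
    set z := (ρ + σ * b)⁻¹ • (y - (c + σ • a)) with hz
    have hpos : 0 < ρ + σ * b := by linarith
    have hle : (ρ + σ * b)⁻¹ ^ 4 ≤ (r / 2)⁻¹ ^ 4 := by gcongr
    have h1 : |mollifier z| ≤ mollifierBound := by
      rw [abs_of_nonneg (mollifier_nonneg _)]; exact mollifier_le _
    have h2 : |fderiv ℝ mollifier z (a + b • z)| ≤ mollifierBound * (‖a‖ + |b|) := by
      by_cases hz1 : ‖z‖ ≤ 1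
      · refine ((fderiv ℝ mollifier z).le_opNorm _).trans ?_
        refine mul_le_mul (norm_fderiv_mollifier_le _) ?_ (norm_nonneg _) mollifierBound_pos.le
        refine (norm_add_le _ _).trans (add_le_add le_rfl ?_)
        rw [norm_smul]
        exact mul_le_of_le_one_right (abs_nonneg _) hz1
      · rw [fderiv_mollifier_eq_zero (not_le.1 hz1)]
        simpa using mul_nonneg mollifierBound_pos.le (add_nonneg (norm_nonneg a) (abs_nonneg b))
    have hq : 0 ≤ (ρ + σ * b)⁻¹ ^ 4 := by positivity
    calc |F' σ y| = |3 * b * (ρ + σ * b)⁻¹ ^ 4 * mollifier z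
          + (ρ + σ * b)⁻¹ ^ 4 * fderiv ℝ mollifier z (a + b • z)| := abs_neg _
      _ ≤ (ρ + σ * b)⁻¹ ^ 4 * (3 * |b| * |mollifier z| + |fderiv ℝ mollifier z (a + b • z)|) := by
          refine (abs_add_le _ _).trans (le_of_eq ?_)
          rw [abs_mul, abs_mul, abs_mul, abs_mul, abs_of_nonneg hq, abs_of_pos (three_pos (α := ℝ))]
          ring
      _ ≤ (r / 2)⁻¹ ^ 4 * (3 * |b| * mollifierBound + mollifierBound * (‖a‖ + |b|)) := by
          gcongr
      _ = _ := by ring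
  have hder := hasDerivAt_integral_of_dominated_loc_of_deriv_le
    (μ := volume.restrict D) (F := fun σ y => u y * kernelAt (c + σ • a) (ρ + σ * b) y)
    (F' := fun σ y => u y * F' σ y) (x₀ := τ)
    (bound := fun y => |u y| * ((r / 2)⁻¹ ^ 4 * (3 * |b| + (‖a‖ + |b|)) * mollifierBound))
    (s := {σ | r / 2 < ρ + σ * b}) hnear
    (Eventually.of_forall fun σ => hu.1.mul
      (contDiff_kernelAt _ _).continuous.aestronglyMeasurable)
    (by
      have : MemLp (kernelAt c' r) ∞ (volume.restrict D) :=
        (contDiff_kernelAt _ _).continuous.memLp_of_hasCompactSupport (hasCompactSupport_kernelAt hτ)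
      exact Integrable.mul_of_top_left hu this)
    (by
      refine hu.1.mul (Continuous.aestronglyMeasurable ?_)
      have hf : Continuous (fderiv ℝ mollifier) := contDiff_mollifier.continuous_fderiv (by simp)
      have hm : Continuous mollifier := contDiff_mollifier.continuous
      have hl : Continuous fun y : E3 => (ρ + τ * b)⁻¹ • (y - (c + τ • a)) := by fun_prop
      exact (((continuous_const.mul (hm.comp hl)).add (continuous_const.mul
        ((hf.comp hl).clm_apply (continuous_const.add (hl.const_smul b)))))).neg)
    (Eventually.of_forall fun y σ hσ => by
      rw [norm_mul]
      exact mul_le_mul_of_nonneg_left (hF'b σ hσ y) (norm_nonneg _))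
    (hu.norm.mul_const _)
    (Eventually.of_forall fun y σ hσ =>
      (hasDerivAt_kernelAt_path c a y ρ b σ (by linarith [show r / 2 < ρ + σ * b from hσ])).const_mul
        (u y))
  refine hder.2.congr_deriv ?_
  -- The components of the transported density times velocity. They are test functions in `D`
  -- because the closed ball lies in `D`, so the weak gradient may be integrated by parts against
  -- their divergence.
  set V : Fin 3 → E3 → ℝ := fun i y => (a i + b * (r⁻¹ • (y - c')) i) * kernelAt c' r y with hV
  have hVtest : ∀ i, IsTest D (V i) := by
    intro i
    have hk := kernelAt_isTest hτ hball
    have hs : ContDiff ℝ ∞ fun y : E3 => a i + b * (r⁻¹ • (y - c')) i := by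
      have : ContDiff ℝ ∞ fun y : E3 => EuclideanSpace.proj (𝕜 := ℝ) i (r⁻¹ • (y - c')) :=
        (EuclideanSpace.proj (𝕜 := ℝ) i).contDiff.comp (by fun_prop)
      exact contDiff_const.add (contDiff_const.mul this)
    exact ⟨hs.mul hk.smooth, hk.compact.mul_left,
      (tsupport_mul_subset_right).trans hk.support⟩
  have hub : ∀ i, Integrable (fun y => u y * fderiv ℝ (V i) y (basisVec i)) (volume.restrict D) := by
    intro i
    have : MemLp (fun y => fderiv ℝ (V i) y (basisVec i)) ∞ (volume.restrict D) :=
      (((hVtest i).smooth.continuous_fderiv (by simp)).clm_apply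
        continuous_const).memLp_of_hasCompactSupport ((hVtest i).compact.fderiv_apply ℝ _)
    exact Integrable.mul_of_top_left hu this
  have hpi : ∀ i, Integrable (fun y => p y i) (volume.restrict D) := fun i =>
    (EuclideanSpace.proj (𝕜 := ℝ) i).integrable_comp hp
  have hpb : ∀ i, Integrable (fun y => p y i * V i y) (volume.restrict D) := by
    intro i
    have : MemLp (V i) ∞ (volume.restrict D) :=
      (hVtest i).smooth.continuous.memLp_of_hasCompactSupport (hVtest i).compact
    exact Integrable.mul_of_top_left (hpi i) this
  calc ∫ y in D, u y * F' τ y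
      = ∫ y in D, - ∑ i, u y * fderiv ℝ (V i) y (basisVec i) := by
        refine integral_congr_ae (Eventually.of_forall fun y => ?_)
        simp only
        rw [← Finset.mul_sum, div_kernelAt c' a y r b]
        simp only [hF', mul_neg, ← hr, ← hc']
    _ = ∑ i, ∫ y in D, p y i * V i y := by
        rw [integral_neg, integral_finsetSum _ fun i _ => hub i, ← Finset.sum_neg_distrib]
        refine Finset.sum_congr rfl fun i _ => ?_
        rw [hw (V i) (hVtest i) i, neg_neg]
    _ = ∫ y in D, inner ℝ (p y) (a + b • (r⁻¹ • (y - c'))) * kernelAt c' r y := by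
        rw [← integral_finsetSum _ fun i _ => hpb i]
        refine integral_congr_ae (Eventually.of_forall fun y => ?_)
        simp only [hV, PiLp.inner_apply, Finset.sum_mul]
        refine Finset.sum_congr rfl fun i _ => ?_
        simp
        ring

/-- The mean value inequality along the affine path of balls. On each ball the velocity field is at
most `‖c' - c‖ + |ρ' - ρ|` and the kernel at most `mollifierBound * r⁻¹ ^ 3`. Only the gradient on a
set `W` containing the path enters, which makes the estimate local. -/
theorem abs_localAvg_sub_le {D W : Set E3} {u : E3 → ℝ} {p : E3 → E3}
    (hu : IntegrableOn u D) (hp : IntegrableOn p D) (hw : HasWeakGradient D u p)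
    (hWD : W ⊆ D) {c c' : E3} {ρ ρ' r : ℝ} (hr : 0 < r) (hρ : r ≤ ρ)
    (hρ' : r ≤ ρ')
    (hball : ∀ τ ∈ Icc (0 : ℝ) 1, Metric.closedBall (c + τ • (c' - c)) (ρ + τ * (ρ' - ρ)) ⊆ W) :
    |localAvg D u c' ρ' - localAvg D u c ρ|
      ≤ mollifierBound * (‖c' - c‖ + |ρ' - ρ|) * r⁻¹ ^ 3 * ∫ y in W, ‖p y‖ := by
  have hrτ : ∀ τ ∈ Icc (0 : ℝ) 1, r ≤ ρ + τ * (ρ' - ρ) := by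
    intro τ hτ
    nlinarith [hτ.1, hτ.2, mul_nonneg hτ.1 (sub_nonneg.2 hρ'),
      mul_nonneg (sub_nonneg.2 hτ.2) (sub_nonneg.2 hρ)]
  have hd : ∀ τ ∈ Icc (0 : ℝ) 1, HasDerivAt
      (fun τ : ℝ => localAvg D u (c + τ • (c' - c)) (ρ + τ * (ρ' - ρ)))
      (∫ y in D, inner ℝ (p y) ((c' - c) + (ρ' - ρ) • ((ρ + τ * (ρ' - ρ))⁻¹ •
        (y - (c + τ • (c' - c))))) * kernelAt (c + τ • (c' - c)) (ρ + τ * (ρ' - ρ)) y) τ :=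
    fun τ hτ => hasDerivAt_localAvg_path hu hp hw c (c' - c) ρ (ρ' - ρ) τ
      (hr.trans_le (hrτ τ hτ)) ((hball τ hτ).trans hWD)
  have hb : ∀ τ ∈ Ico (0 : ℝ) 1, ‖∫ y in D, inner ℝ (p y) ((c' - c) + (ρ' - ρ) •
      ((ρ + τ * (ρ' - ρ))⁻¹ • (y - (c + τ • (c' - c))))) *
        kernelAt (c + τ • (c' - c)) (ρ + τ * (ρ' - ρ)) y‖
      ≤ mollifierBound * (‖c' - c‖ + |ρ' - ρ|) * r⁻¹ ^ 3 * ∫ y in W, ‖p y‖ := by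
    intro τ hτ
    have hτ' := Ico_subset_Icc_self hτ
    set R := ρ + τ * (ρ' - ρ) with hR
    set q := c + τ • (c' - c) with hq
    have hRr : r ≤ R := hrτ τ hτ'
    have hRpos : 0 < R := hr.trans_le hRr
    have hzero : ∀ y, y ∉ W → inner ℝ (p y) ((c' - c) + (ρ' - ρ) • (R⁻¹ • (y - q))) *
        kernelAt q R y = 0 := by
      intro y hy
      rw [kernelAt_eq_zero hRpos (fun h => hy (hball τ hτ' (Metric.ball_subset_closedBall h))),
        mul_zero]
    rw [setIntegral_eq_integral_of_forall_compl_eq_zero fun y hy => hzero y fun h => hy (hWD h),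
      ← setIntegral_eq_integral_of_forall_compl_eq_zero hzero, ← integral_const_mul]
    refine norm_integral_le_of_norm_le ((hp.mono_set hWD).norm.const_mul _)
      (Eventually.of_forall fun y => ?_)
    by_cases hy : y ∈ Metric.ball q R
    · rw [norm_mul, Real.norm_of_nonneg (kernelAt_nonneg _ hRpos _)]
      have h1 : ‖inner ℝ (p y) ((c' - c) + (ρ' - ρ) • (R⁻¹ • (y - q)))‖
          ≤ ‖p y‖ * (‖c' - c‖ + |ρ' - ρ|) := by
        refine (norm_inner_le_norm _ _).trans (mul_le_mul_of_nonneg_left ?_ (norm_nonneg _))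
        refine (norm_add_le _ _).trans (add_le_add le_rfl ?_)
        rw [norm_smul, norm_inv_smul_sub hRpos]
        refine mul_le_of_le_one_right (abs_nonneg _) ?_
        rw [Metric.mem_ball, dist_eq_norm] at hy
        rw [← div_eq_inv_mul, div_le_one hRpos]
        exact hy.le
      have h2 : kernelAt q R y ≤ mollifierBound * r⁻¹ ^ 3 := by
        refine (kernelAt_le q hRpos y).trans (mul_le_mul_of_nonneg_left ?_ mollifierBound_pos.le)
        gcongr
      calc _ ≤ (‖p y‖ * (‖c' - c‖ + |ρ' - ρ|)) * (mollifierBound * r⁻¹ ^ 3) :=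
            mul_le_mul h1 h2 (kernelAt_nonneg _ hRpos _) (by positivity)
        _ = _ := by ring
    · rw [kernelAt_eq_zero hRpos hy, mul_zero, norm_zero]
      have := mollifierBound_pos
      positivity
  have := norm_image_sub_le_of_norm_deriv_le_segment_01'
    (fun τ hτ => (hd τ hτ).hasDerivWithinAt) hb
  simpa using this

end Ferro

namespace Ferro

/-! ### Sobolev inequality under a cone condition -/

theorem eLpNorm_four_pow {α Z : Type*} [MeasurableSpace α] {μ : Measure α} [NormedAddCommGroup Z]
    (f : α → Z) : eLpNorm f 4 μ ^ 4 = ∫⁻ x, ‖f x‖ₑ ^ 4 ∂μ := by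
  have := eLpNorm_nnreal_pow_eq_lintegral (f := f) (μ := μ) (p := 4) (by norm_num)
  have h4 : (((4 : ℝ≥0) : ℝ)) = ((4 : ℕ) : ℝ) := by norm_num
  simp only [h4, ENNReal.rpow_natCast] at this
  exact this

theorem eLpNorm_two_sq {α Z : Type*} [MeasurableSpace α] {μ : Measure α} [NormedAddCommGroup Z]
    (f : α → Z) : eLpNorm f 2 μ ^ 2 = ∫⁻ x, ‖f x‖ₑ ^ 2 ∂μ := by
  have := eLpNorm_nnreal_pow_eq_lintegral (f := f) (μ := μ) (p := 2) (by norm_num)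
  have h2 : (((2 : ℝ≥0) : ℝ)) = ((2 : ℕ) : ℝ) := by norm_num
  simp only [h2, ENNReal.rpow_natCast] at this
  exact this

theorem sq_lintegral_le {α : Type*} [MeasurableSpace α] {μ : Measure α} {g : α → ℝ≥0∞}
    (hg : AEMeasurable g μ) : (∫⁻ x, g x ∂μ) ^ 2 ≤ μ univ * ∫⁻ x, g x ^ 2 ∂μ := by
  have h := ENNReal.lintegral_mul_le_Lp_mul_Lq μ Real.HolderConjugate.two_two
    (aemeasurable_const (b := (1 : ℝ≥0∞))) hg
  simp only [Pi.mul_apply, one_mul, ENNReal.one_rpow, lintegral_const] at h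
  calc (∫⁻ x, g x ∂μ) ^ 2 ≤ (μ univ ^ (1 / 2 : ℝ) * (∫⁻ x, g x ^ (2 : ℝ) ∂μ) ^ (1 / 2 : ℝ)) ^ 2 := by
        gcongr
    _ = _ := by
        rw [mul_pow, ← ENNReal.rpow_natCast, ← ENNReal.rpow_mul, ← ENNReal.rpow_natCast,
          ← ENNReal.rpow_mul]
        norm_num

/-- Integrals over balls of fixed radius define a bounded map from `L²` to `L⁴`. -/
theorem lintegral_ball_pow_four_le {g : E3 → ℝ≥0∞} (hg : Measurable g) (R : ℝ) :
    ∫⁻ x, (∫⁻ y in Metric.closedBall x R, g y) ^ 4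
      ≤ volume (Metric.closedBall (0 : E3) R) ^ 3 * (∫⁻ y, g y ^ 2) ^ 2 := by
  set V := volume (Metric.closedBall (0 : E3) R) with hV
  set Q := ∫⁻ y, g y ^ 2 with hQ
  have hVx : ∀ x : E3, volume (Metric.closedBall x R) = V := fun x =>
    Measure.addHaar_closedBall_center volume x R
  -- Cauchy–Schwarz bounds the fourth power by the square of the local integral of $g^2$. One of the
  -- two factors is replaced by the total `Q`, and the other is integrated in `x` by Fubini.
  have hpt : ∀ x, (∫⁻ y in Metric.closedBall x R, g y) ^ 4
      ≤ V ^ 2 * Q * ∫⁻ y in Metric.closedBall x R, g y ^ 2 := by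
    intro x
    have h1 := sq_lintegral_le (μ := volume.restrict (Metric.closedBall x R)) hg.aemeasurable
    rw [Measure.restrict_apply_univ, hVx] at h1
    have h2 : ∫⁻ y in Metric.closedBall x R, g y ^ 2 ≤ Q := setLIntegral_le_lintegral _ _
    calc (∫⁻ y in Metric.closedBall x R, g y) ^ 4
        = ((∫⁻ y in Metric.closedBall x R, g y) ^ 2) ^ 2 := by rw [← pow_mul]
      _ ≤ (V * ∫⁻ y in Metric.closedBall x R, g y ^ 2) ^ 2 := by gcongr
      _ = V ^ 2 * (∫⁻ y in Metric.closedBall x R, g y ^ 2)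
          * ∫⁻ y in Metric.closedBall x R, g y ^ 2 := by ring
      _ ≤ _ := by gcongr
  have hsw : ∫⁻ x, ∫⁻ y in Metric.closedBall x R, g y ^ 2 = V * Q := by
    have e1 : ∀ x, ∫⁻ y in Metric.closedBall x R, g y ^ 2
        = ∫⁻ y, {z : E3 × E3 | dist z.2 z.1 ≤ R}.indicator (fun z => g z.2 ^ 2) (x, y) := by
      intro x
      rw [← lintegral_indicator Metric.isClosed_closedBall.measurableSet]
      rfl
    have hm : MeasurableSet {z : E3 × E3 | dist z.2 z.1 ≤ R} :=
      measurableSet_le (measurable_snd.dist measurable_fst) measurable_const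
    simp_rw [e1]
    rw [lintegral_lintegral_swap (f := fun x y => {z : E3 × E3 | dist z.2 z.1 ≤ R}.indicator
      (fun z => g z.2 ^ 2) (x, y))
      (((hg.comp measurable_snd).pow_const 2).indicator hm).aemeasurable]
    have e2 : ∀ y, ∫⁻ x, {z : E3 × E3 | dist z.2 z.1 ≤ R}.indicator (fun z => g z.2 ^ 2) (x, y)
        = V * g y ^ 2 := by
      intro y
      have : (fun x => {z : E3 × E3 | dist z.2 z.1 ≤ R}.indicator (fun z => g z.2 ^ 2) (x, y))
          = (Metric.closedBall y R).indicator fun _ => g y ^ 2 := by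
        ext x
        by_cases h : dist y x ≤ R
        · have h' : x ∈ Metric.closedBall y R := by rwa [Metric.mem_closedBall, dist_comm]
          simp [indicator, h, h']
        · have h' : x ∉ Metric.closedBall y R := by rwa [Metric.mem_closedBall, dist_comm]
          simp only [indicator, h', if_false, mem_ofPred_eq, h]
      rw [this, lintegral_indicator Metric.isClosed_closedBall.measurableSet, setLIntegral_const,
        hVx, mul_comm]
    simp_rw [e2]
    rw [lintegral_const_mul _ (hg.pow_const 2)]
  calc ∫⁻ x, (∫⁻ y in Metric.closedBall x R, g y) ^ 4
      ≤ ∫⁻ x, V ^ 2 * Q * ∫⁻ y in Metric.closedBall x R, g y ^ 2 := lintegral_mono hpt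
    _ ≤ V ^ 2 * Q * ∫⁻ x, ∫⁻ y in Metric.closedBall x R, g y ^ 2 := by
        rw [lintegral_const_mul'' _ ?_]
        have hm : MeasurableSet {z : E3 × E3 | dist z.2 z.1 ≤ R} :=
          measurableSet_le (measurable_snd.dist measurable_fst) measurable_const
        have : Measurable fun x => ∫⁻ y, {z : E3 × E3 | dist z.2 z.1 ≤ R}.indicator
            (fun z => g z.2 ^ 2) (x, y) :=
          (((hg.comp measurable_snd).pow_const 2).indicator hm).lintegral_prod_right'
        have hfun : (fun x => ∫⁻ y in Metric.closedBall x R, g y ^ 2) = fun x => ∫⁻ y,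
            {z : E3 × E3 | dist z.2 z.1 ≤ R}.indicator (fun z => g z.2 ^ 2) (x, y) := by
          ext x
          rw [← lintegral_indicator Metric.isClosed_closedBall.measurableSet]
          rfl
        rw [hfun]
        exact this.aemeasurable
    _ = _ := by rw [hsw]; ring

theorem continuous_localAvg {D : Set E3} {u : E3 → ℝ} (hu : IntegrableOn u D) (a : E3) {ρ : ℝ}
    (hρ : 0 < ρ) : Continuous fun x => localAvg D u (x + a) ρ := by
  refine continuous_of_dominated (bound := fun y => |u y| * (mollifierBound * ρ⁻¹ ^ 3))
    (fun x => hu.1.mul (contDiff_kernelAt _ _).continuous.aestronglyMeasurable) (fun x => ?_)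
    (hu.norm.mul_const _) (Eventually.of_forall fun y => ?_)
  · refine Eventually.of_forall fun y => ?_
    rw [norm_mul, Real.norm_of_nonneg (kernelAt_nonneg _ hρ _)]
    exact mul_le_mul_of_nonneg_left (kernelAt_le _ hρ _) (norm_nonneg _)
  · refine continuous_const.mul (continuous_const.mul (contDiff_mollifier.continuous.comp ?_))
    fun_prop

theorem abs_localAvg_le {D : Set E3} {u : E3 → ℝ} (hu : IntegrableOn u D) (c : E3) {ρ : ℝ}
    (hρ : 0 < ρ) : |localAvg D u c ρ| ≤ mollifierBound * ρ⁻¹ ^ 3 * ∫ y in D, |u y| := by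
  rw [← integral_const_mul]
  refine norm_integral_le_of_norm_le (G := ℝ) (hu.norm.const_mul _)
    (Eventually.of_forall fun y => ?_)
  rw [norm_mul, Real.norm_of_nonneg (kernelAt_nonneg _ hρ _), mul_comm]
  exact mul_le_mul_of_nonneg_right (kernelAt_le _ hρ _) (norm_nonneg _)

/-- Local averages over small balls near `x` converge to the value at `x`, for almost every `x`. -/
theorem ae_tendsto_localAvg {D : Set E3} (hD : MeasurableSet D) {u : E3 → ℝ}
    (hu : IntegrableOn u D) (e : E3) (he : ‖e‖ ≤ 1) {c : ℝ} (hc : 0 < c) {s : ℕ → ℝ}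
    (hs : ∀ n, 0 < s n) (hs0 : Tendsto s atTop (𝓝 0)) :
    ∀ᵐ x, x ∈ D → Tendsto (fun n => localAvg D u (x + s n • e) (c * s n)) atTop (𝓝 (u x)) := by
  set ut : E3 → ℝ := D.indicator u with hut
  have huti : Integrable ut := (integrable_indicator_iff hD).2 hu
  -- The balls are not centred at `x`. Their centres are within `c⁻¹` radii of `x`, which the
  -- differentiation theorem for doubling measures permits.
  filter_upwards [IsUnifLocDoublingMeasure.ae_tendsto_average_norm_sub volume
    huti.locallyIntegrable c⁻¹] with x hx hxD
  have h1 := hx (fun n => x + s n • e) (fun n => c * s n)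
    (l := atTop) (tendsto_nhdsWithin_iff.2 ⟨by simpa using hs0.const_mul c,
      Eventually.of_forall fun n => mul_pos hc (hs n)⟩)
    (Eventually.of_forall fun n => by
      rw [Metric.mem_closedBall, dist_eq_norm, inv_mul_cancel_left₀ hc.ne', sub_add_cancel_left,
        norm_neg, norm_smul, Real.norm_of_nonneg (hs n).le]
      exact mul_le_of_le_one_right (hs n).le he)
  set v : ℝ := (volume (Metric.closedBall (0 : E3) 1)).toReal with hv
  rw [tendsto_iff_norm_sub_tendsto_zero]
  refine squeeze_zero (fun _ => norm_nonneg _) (fun n => ?_)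
    (by simpa only [mul_zero] using h1.const_mul (mollifierBound * v))
  have hcs : 0 < c * s n := mul_pos hc (hs n)
  set q := x + s n • e
  set R := c * s n
  have hki : Integrable (kernelAt q R) :=
    (contDiff_kernelAt q R).continuous.integrable_of_hasCompactSupport
      (hasCompactSupport_kernelAt hcs)
  have hb : ∀ y, ‖kernelAt q R y‖ ≤ mollifierBound * R⁻¹ ^ 3 := fun y => by
    rw [Real.norm_of_nonneg (kernelAt_nonneg _ hcs _)]; exact kernelAt_le _ hcs _
  have huk : Integrable fun y => ut y * kernelAt q R y :=
    huti.mul_bdd hki.1 (Eventually.of_forall hb)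
  have e1 : localAvg D u q R = ∫ y, ut y * kernelAt q R y := by
    rw [localAvg, ← integral_indicator hD]
    refine integral_congr_ae (Eventually.of_forall fun y => ?_)
    by_cases hy : y ∈ D <;> simp [hut, hy]
  have e2 : u x = ∫ y, ut x * kernelAt q R y := by
    rw [integral_const_mul, integral_kernelAt q hcs, mul_one, hut, indicator_of_mem hxD]
  have hvol : volume.real (Metric.closedBall q R) = R ^ 3 * v := by
    rw [Measure.real, Measure.addHaar_closedBall volume q hcs.le, finrank_euclideanSpace_fin,
      ENNReal.toReal_mul, ENNReal.toReal_ofReal (by positivity), hv,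
      Measure.addHaar_unitClosedBall_eq_addHaar_unitBall]
  have hdi : IntegrableOn (fun y => ‖ut y - ut x‖) (Metric.closedBall q R) :=
    (huti.integrableOn.sub (integrableOn_const measure_closedBall_lt_top.ne)).norm
  have e3 : mollifierBound * v * ⨍ y in Metric.closedBall q R, ‖ut y - ut x‖
      = mollifierBound * R⁻¹ ^ 3 * ∫ y in Metric.closedBall q R, ‖ut y - ut x‖ := by
    have hvpos : v ≠ 0 := by
      have : 0 < v := ENNReal.toReal_pos (Metric.measure_closedBall_pos _ _ one_pos).ne'
        measure_closedBall_lt_top.ne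
      exact this.ne'
    rw [setAverage_eq, hvol, smul_eq_mul, mul_inv, inv_pow]
    field_simp
  rw [e1, e2, ← integral_sub huk (hki.const_mul _), e3, ← integral_const_mul,
    ← setIntegral_eq_integral_of_forall_compl_eq_zero (s := Metric.closedBall q R)]
  · refine norm_integral_le_of_norm_le (hdi.const_mul _) (Eventually.of_forall fun y => ?_)
    rw [← sub_mul, norm_mul, mul_comm]
    exact mul_le_mul_of_nonneg_right (hb y) (norm_nonneg _)
  · intro y hy
    rw [kernelAt_eq_zero hcs fun h => hy (Metric.ball_subset_closedBall h)]
    simp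

/-- The cone with vertex `x`, axis `e`, opening `c` and height `r` is contained in `D`, for every
vertex `x ∈ N`. -/
def ConesInside (D N : Set E3) (e : E3) (c r : ℝ) : Prop :=
  ∀ x ∈ N, ∀ s ∈ Ioc 0 r, Metric.closedBall (x + s • e) (c * s) ⊆ D

/-- Inside the cone, averages over the balls with centre `x + s • e` and radius `c * s` converge to
`u x` as $s\to0$. Passing from scale $s$ to $s/16$ changes the average by at most a multiple of
$s^{-2}\int_{B(x,2s)}|p|$, whose $L^4$ norm in `x` is at most a multiple of $s^{1/4}\|p\|_{L^2}$.
The changes therefore sum geometrically, and Fatou's lemma passes to the limit. The constant depends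
on the shape of the cone only. -/
theorem exists_cone_sobolev {c r : ℝ} (hc : 0 < c) (hc1 : c ≤ 1) (hr : 0 < r) :
    ∃ C : ℝ≥0, ∀ (D N : Set E3) (e : E3) (u : E3 → ℝ) (p : E3 → E3), MeasurableSet D →
      MeasurableSet N → N ⊆ D → ‖e‖ ≤ 1 → ConesInside D N e c r → IntegrableOn u D →
      IntegrableOn p D → HasWeakGradient D u p →
      eLpNorm (fun x => u x - localAvg D u (x + r • e) (c * r)) 4 (volume.restrict N)
        ≤ C * eLpNorm p 2 (volume.restrict D) := by
  set v : ℝ := (volume (Metric.closedBall (0 : E3) 1)).toReal with hv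
  -- `2` bounds the displacement of centre and radius divided by the scale, and `16 / c` comes from
  -- the smaller of two consecutive radii.
  set M : ℝ := 2 * mollifierBound * (16 / c) ^ 3 with hM
  have hMpos : 0 < M := by have := mollifierBound_pos; positivity
  have hvnn : 0 ≤ v := ENNReal.toReal_nonneg
  -- The fourth power of one increment is at most $M^4s^{-8}\,((2s)^3v)^3=512\,M^4v^3s$ times
  -- $\|p\|_{L^2}^4$. The later `L = K + 1` is at least one, so `K ≤ L ^ 4`.
  set K : ℝ := 512 * M ^ 4 * v ^ 3 * r with hK
  have hKnn : 0 ≤ K := by positivity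
  set L : ℝ≥0 := ⟨K + 1, by positivity⟩ with hL
  refine ⟨2 * L, ?_⟩
  intro D N e u p hD hN hND he hcone hu hp hw
  -- With ratio `1 / 16` the factor $s^{1/4}$ is halved at each step.
  set s : ℕ → ℝ := fun n => r * (1 / 16) ^ n with hs
  have hspos : ∀ n, 0 < s n := fun n => by positivity
  have hs0 : Tendsto s atTop (𝓝 0) := by
    simpa only [mul_zero] using (tendsto_pow_atTop_nhds_zero_of_lt_one
      (by norm_num : (0 : ℝ) ≤ 1 / 16) (by norm_num)).const_mul r
  have hsr : ∀ n, s n ≤ r := fun n =>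
    mul_le_of_le_one_right hr.le (pow_le_one₀ (by norm_num) (by norm_num))
  have hss : ∀ n, s (n + 1) = s n / 16 := fun n => by simp only [hs, pow_succ]; ring
  set A : ℕ → E3 → ℝ := fun n x => localAvg D u (x + s n • e) (c * s n) with hA
  have hAc : ∀ n, Continuous (A n) := fun n =>
    continuous_localAvg hu (s n • e) (mul_pos hc (hspos n))
  -- a measurable representative of the gradient, extended by zero
  set pt : E3 → E3 := D.indicator p with hpt
  have hpti : Integrable pt := (integrable_indicator_iff hD).2 hp
  set p' : E3 → E3 := hpti.1.mk pt with hp'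
  have hp'm : StronglyMeasurable p' := hpti.1.stronglyMeasurable_mk
  have hpp' : pt =ᵐ[volume] p' := hpti.1.ae_eq_mk
  have hP2 : ∫⁻ y, ‖p' y‖ₑ ^ 2 = eLpNorm p 2 (volume.restrict D) ^ 2 := by
    rw [← eLpNorm_two_sq, ← eLpNorm_congr_ae hpp', hpt, eLpNorm_indicator_eq_eLpNorm_restrict hD]
  set P := eLpNorm p 2 (volume.restrict D) with hP
  have hdiff : ∀ n, ∀ x ∈ N, ‖A (n + 1) x - A n x‖ₑ ≤ ENNReal.ofReal (M * (s n)⁻¹ ^ 2)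
      * ∫⁻ y in Metric.closedBall x (2 * s n), ‖p' y‖ₑ := by
    intro n x hx
    have hsn := hspos n
    have h1 := abs_localAvg_sub_le (W := D ∩ Metric.closedBall x (2 * s n)) hu hp hw
      inter_subset_left (c := x + s n • e) (c' := x + s (n + 1) • e) (ρ := c * s n)
      (ρ' := c * s (n + 1)) (r := c * s (n + 1)) (mul_pos hc (hspos _))
      (mul_le_mul_of_nonneg_left (by rw [hss]; linarith) hc.le) le_rfl (by
        intro τ hτ
        set σ : ℝ := s n + τ * (s (n + 1) - s n) with hσ
        have e1 : x + s n • e + τ • (x + s (n + 1) • e - (x + s n • e)) = x + σ • e := by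
          rw [hσ]; module
        have e2 : c * s n + τ * (c * s (n + 1) - c * s n) = c * σ := by rw [hσ]; ring
        have hσ1 : σ ≤ s n := by rw [hσ, hss]; nlinarith [hτ.1]
        have hσ0 : 0 < σ := by rw [hσ, hss]; nlinarith [hτ.1, hτ.2]
        rw [e1, e2]
        refine subset_inter (hcone x hx σ ⟨hσ0, hσ1.trans (hsr n)⟩) ?_
        refine Metric.closedBall_subset_closedBall' ?_
        rw [dist_eq_norm, add_sub_cancel_left, norm_smul, Real.norm_of_nonneg hσ0.le]
        nlinarith [mul_le_of_le_one_right hσ0.le he, mul_le_of_le_one_left hσ0.le hc1])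
    have h2 : mollifierBound * (‖x + s (n + 1) • e - (x + s n • e)‖ + |c * s (n + 1) - c * s n|)
        * (c * s (n + 1))⁻¹ ^ 3 ≤ M * (s n)⁻¹ ^ 2 := by
      have e3 : x + s (n + 1) • e - (x + s n • e) = -((15 / 16 * s n) • e) := by
        rw [hss]; module
      have e4 : c * s (n + 1) - c * s n = -(15 / 16 * (c * s n)) := by rw [hss]; ring
      rw [e3, e4, norm_neg, abs_neg, norm_smul, Real.norm_of_nonneg (by positivity),
        abs_of_nonneg (by positivity), hss]
      have h3 : 15 / 16 * s n * ‖e‖ + 15 / 16 * (c * s n) ≤ 2 * s n := by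
        nlinarith [mul_le_of_le_one_right hsn.le he, mul_le_of_le_one_left hsn.le hc1]
      have hmb := mollifierBound_pos
      calc mollifierBound * (15 / 16 * s n * ‖e‖ + 15 / 16 * (c * s n)) * (c * (s n / 16))⁻¹ ^ 3
          ≤ mollifierBound * (2 * s n) * (c * (s n / 16))⁻¹ ^ 3 := by gcongr
        _ = M * (s n)⁻¹ ^ 2 := by rw [hM]; field_simp
    have h4 : ∫ y in D ∩ Metric.closedBall x (2 * s n), ‖p y‖
        = ∫ y in Metric.closedBall x (2 * s n), ‖p' y‖ := by
      rw [inter_comm, ← setIntegral_indicator hD]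
      refine integral_congr_ae (ae_restrict_of_ae ?_)
      filter_upwards [hpp'] with y hy
      rw [← hy, hpt]
      exact (norm_indicator_eq_indicator_norm _ _).symm
    have h5 : Integrable p' (volume.restrict (Metric.closedBall x (2 * s n))) :=
      (hpti.congr hpp').integrableOn
    rw [h4] at h1
    have h6 : |A (n + 1) x - A n x|
        ≤ M * (s n)⁻¹ ^ 2 * ∫ y in Metric.closedBall x (2 * s n), ‖p' y‖ :=
      h1.trans (mul_le_mul_of_nonneg_right h2 (integral_nonneg fun _ => norm_nonneg _))
    rw [Real.enorm_eq_ofReal_abs, ← ofReal_integral_norm_eq_lintegral_enorm h5,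
      ← ENNReal.ofReal_mul (by positivity)]
    exact ENNReal.ofReal_le_ofReal h6
  have hstep : ∀ n, eLpNorm (fun x => A (n + 1) x - A n x) 4 (volume.restrict N)
      ≤ L * (2 : ℝ≥0∞)⁻¹ ^ n * P := by
    intro n
    have hsn := hspos n
    refine (ENNReal.pow_right_strictMono (n := 4) (by norm_num)).le_iff_le.1 ?_
    rw [eLpNorm_four_pow]
    calc ∫⁻ x in N, ‖A (n + 1) x - A n x‖ₑ ^ 4
        ≤ ∫⁻ x in N, (ENNReal.ofReal (M * (s n)⁻¹ ^ 2)
          * ∫⁻ y in Metric.closedBall x (2 * s n), ‖p' y‖ₑ) ^ 4 :=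
          setLIntegral_mono' hN fun x hx => by gcongr; exact hdiff n x hx
      _ ≤ ∫⁻ x, (ENNReal.ofReal (M * (s n)⁻¹ ^ 2)
          * ∫⁻ y in Metric.closedBall x (2 * s n), ‖p' y‖ₑ) ^ 4 := setLIntegral_le_lintegral _ _
      _ = ENNReal.ofReal (M * (s n)⁻¹ ^ 2) ^ 4
          * ∫⁻ x, (∫⁻ y in Metric.closedBall x (2 * s n), ‖p' y‖ₑ) ^ 4 := by
          simp_rw [mul_pow]
          rw [lintegral_const_mul' _ _ (by finiteness)]
      _ ≤ ENNReal.ofReal (M * (s n)⁻¹ ^ 2) ^ 4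
          * (volume (Metric.closedBall (0 : E3) (2 * s n)) ^ 3 * (P ^ 2) ^ 2) := by
          gcongr
          rw [← hP2]
          exact lintegral_ball_pow_four_le hp'm.measurable.enorm _
      _ = ENNReal.ofReal (K * (1 / 16) ^ n) * P ^ 4 := by
          have hvol : volume (Metric.closedBall (0 : E3) (2 * s n))
              = ENNReal.ofReal ((2 * s n) ^ 3 * v) := by
            rw [Measure.addHaar_closedBall volume _ (by positivity), finrank_euclideanSpace_fin,
              ENNReal.ofReal_mul (by positivity), hv,
              Measure.addHaar_unitClosedBall_eq_addHaar_unitBall, ENNReal.ofReal_toReal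
              (by finiteness)]
          rw [hvol, ← mul_assoc, ← ENNReal.ofReal_pow (by positivity),
            ← ENNReal.ofReal_pow (by positivity), ← ENNReal.ofReal_mul (by positivity), ← pow_mul]
          congr 2
          have : s n = r * (1 / 16) ^ n := rfl
          have h7 : K * (1 / 16) ^ n = 512 * M ^ 4 * v ^ 3 * s n := by rw [hK, this]; ring
          rw [h7]
          field_simp
          ring
      _ ≤ (L * (2 : ℝ≥0∞)⁻¹ ^ n) ^ 4 * P ^ 4 := by
          gcongr
          have h8 : ((L : ℝ≥0∞) * (2 : ℝ≥0∞)⁻¹ ^ n) = ENNReal.ofReal ((K + 1) * (1 / 2) ^ n) := by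
            rw [ENNReal.ofReal_mul (by positivity), ENNReal.ofReal_pow (by norm_num)]
            congr 1
            · rw [hL, ENNReal.ofReal, Real.toNNReal_of_nonneg (by positivity)]
              rfl
            · congr 1
              rw [one_div, ENNReal.ofReal_inv_of_pos two_pos]
              simp
          rw [h8, ← ENNReal.ofReal_pow (by positivity)]
          refine ENNReal.ofReal_le_ofReal ?_
          have h9 : ((1 / 2 : ℝ) ^ n) ^ 4 = (1 / 16) ^ n := by
            rw [← pow_mul, mul_comm, pow_mul]; norm_num
          rw [mul_pow, h9]
          refine mul_le_mul_of_nonneg_right ?_ (by positivity)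
          nlinarith [pow_le_pow_left₀ zero_le_one (by linarith : (1 : ℝ) ≤ K + 1) 3,
            pow_succ (K + 1) 3]
      _ = _ := by rw [mul_pow _ P]
  have hsum : ∀ n, eLpNorm (fun x => A n x - A 0 x) 4 (volume.restrict N) ≤ 2 * L * P := by
    intro n
    have e1 : (fun x => A n x - A 0 x) = ∑ k ∈ Finset.range n, fun x => A (k + 1) x - A k x := by
      ext x
      rw [Finset.sum_apply, Finset.sum_range_sub (fun k => A k x)]
    rw [e1]
    calc _ ≤ ∑ k ∈ Finset.range n, eLpNorm (fun x => A (k + 1) x - A k x) 4 (volume.restrict N) :=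
          eLpNorm_sum_le (fun k _ => ((hAc _).sub (hAc _)).aestronglyMeasurable) (by norm_num)
      _ ≤ ∑ k ∈ Finset.range n, L * (2 : ℝ≥0∞)⁻¹ ^ k * P := Finset.sum_le_sum fun k _ => hstep k
      _ = (∑ k ∈ Finset.range n, (2 : ℝ≥0∞)⁻¹ ^ k) * (L * P) := by
          rw [Finset.sum_mul]
          exact Finset.sum_congr rfl fun k _ => by ring
      _ ≤ 2 * (L * P) := by
          gcongr
          exact (ENNReal.sum_le_tsum _).trans ENNReal.tsum_geometric_two.le
      _ = _ := by ring
  have hlim : ∀ᵐ x ∂(volume.restrict N),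
      Tendsto (fun n => A n x - A 0 x) atTop (𝓝 (u x - A 0 x)) := by
    refine (ae_restrict_iff' hN).2 ?_
    filter_upwards [ae_tendsto_localAvg hD hu e he hc hspos hs0] with x hx hxN
    exact (hx (hND hxN)).sub_const _
  have hfat := Lp.eLpNorm_lim_le_liminf_eLpNorm (p := 4)
    (f := fun n x => A n x - A 0 x)
    (fun n => ((hAc n).sub (hAc 0)).aestronglyMeasurable (μ := volume.restrict N)) _ hlim
  have hA0 : ∀ x, A 0 x = localAvg D u (x + r • e) (c * r) := fun x => by simp [hA, hs]
  simp_rw [hA0] at hfat hsum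
  refine hfat.trans ?_
  have : ((2 * L : ℝ≥0) : ℝ≥0∞) * P = 2 * L * P := by push_cast; ring
  rw [this]
  refine liminf_le_of_le (by isBoundedDefault) fun b hb => ?_
  obtain ⟨n, hn⟩ := hb.exists
  exact hn.trans (hsum n)

end Ferro

namespace Ferro

/-! ### Sobolev and Poincaré inequalities on domains with local cones -/

/-- `u ∈ L²(D)` has the weak gradient `p ∈ L²(D)³`. -/
structure IsSobolev (D : Set E3) (u : E3 → ℝ) (p : E3 → E3) : Prop where
  memLp : MemLp u 2 (volume.restrict D)
  memLp_grad : MemLp p 2 (volume.restrict D)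
  grad : HasWeakGradient D u p

/-- Near `x₀`, the points of `D` are vertices of cones in `D` of uniform shape. -/
def LocalCones (D : Set E3) (x₀ : E3) : Prop :=
  ∃ (e : E3) (c r : ℝ), ‖e‖ ≤ 1 ∧ 0 < c ∧ c ≤ 1 ∧ 0 < r ∧
    ConesInside D (Metric.ball x₀ r ∩ D) e c r

/-- At interior points the axis may be zero: the cones degenerate to balls centred at their
vertices. -/
theorem localCones_of_mem {D : Set E3} (hD : IsOpen D) {x₀ : E3} (hx : x₀ ∈ D) :
    LocalCones D x₀ := by
  obtain ⟨r, hr, hb⟩ := Metric.isOpen_iff.1 hD x₀ hx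
  refine ⟨0, 1, r / 4, by simp, one_pos, le_rfl, by positivity, ?_⟩
  intro x hx s hs
  refine Subset.trans ?_ hb
  intro y hy
  rw [smul_zero, add_zero, one_mul, Metric.mem_closedBall] at hy
  have h1 : dist x x₀ < r / 4 := hx.1
  have h2 := dist_triangle y x x₀
  rw [Metric.mem_ball]
  linarith [hs.2]

theorem localCones_of_notMem_closure {D : Set E3} {x₀ : E3} (hx : x₀ ∉ closure D) :
    LocalCones D x₀ := by
  obtain ⟨r, hr, hb⟩ := Metric.isOpen_iff.1 isClosed_closure.isOpen_compl x₀ hx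
  refine ⟨0, 1, r, by simp, one_pos, le_rfl, hr, ?_⟩
  intro x hx
  exact absurd (subset_closure hx.2) (hb hx.1)

/-- Strict differentiability compares `ρ y - ρ x` with `l (y - x)` uniformly for `x`, `y` near `x₀`.
Along an axis with `l e = δ > 0` and a small opening, the increment is at least
$s\delta-\tfrac{\delta}{4}s-\tfrac{\delta}{4}2s>0$. The same axis serves every vertex near `x₀`. -/
theorem exists_cone_increasing {ρ : E3 → ℝ} (hρ : ContDiff ℝ ∞ ρ) {x₀ : E3}
    (hne : fderiv ℝ ρ x₀ ≠ 0) {O : Set E3} (hO : O ∈ 𝓝 x₀) :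
    ∃ (e : E3) (c r : ℝ), ‖e‖ ≤ 1 ∧ 0 < c ∧ c ≤ 1 ∧ 0 < r ∧ Metric.ball x₀ r ⊆ O ∧
      ∀ x ∈ Metric.ball x₀ r, ∀ s ∈ Ioc 0 r, ∀ y ∈ Metric.closedBall (x + s • e) (c * s),
        y ∈ O ∧ ρ x < ρ y := by
  set l := fderiv ℝ ρ x₀ with hl
  obtain ⟨e₀, he₀⟩ : ∃ e₀, l e₀ ≠ 0 := by
    by_contra h
    push Not at h
    exact hne (ContinuousLinearMap.ext h)
  have he₀n : e₀ ≠ 0 := fun h => he₀ (by rw [h, map_zero])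
  set e : E3 := (SignType.sign (l e₀) : ℝ) • (‖e₀‖⁻¹ • e₀) with he
  have hle : 0 < l e := by
    rw [he, map_smul, map_smul, smul_eq_mul, smul_eq_mul, mul_left_comm, sign_mul_self]
    have : 0 < |l e₀| := abs_pos.2 he₀
    positivity
  have hen : ‖e‖ ≤ 1 := by
    rw [he, norm_smul, norm_smul, norm_inv, norm_norm, inv_mul_cancel₀ (norm_ne_zero_iff.2 he₀n),
      mul_one]
    rcases lt_or_gt_of_ne he₀ with h | h <;> simp [sign_neg, sign_pos, h]
  set δ := l e with hδ
  set c : ℝ := min 1 (δ / (4 * (‖l‖ + 1))) with hc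
  have hcpos : 0 < c := lt_min one_pos (by positivity)
  have hcl : c * ‖l‖ ≤ δ / 4 := by
    have h1 : c ≤ δ / (4 * (‖l‖ + 1)) := min_le_right _ _
    have h2 : c * ‖l‖ ≤ δ / (4 * (‖l‖ + 1)) * (‖l‖ + 1) := by
      refine mul_le_mul h1 (by linarith) (norm_nonneg _) (by positivity)
    refine h2.trans (le_of_eq ?_)
    field_simp
  have hstrict : HasStrictFDerivAt ρ l x₀ :=
    hρ.contDiffAt.hasStrictFDerivAt (by simp)
  have hev := hstrict.isLittleO.def (show 0 < δ / 4 by positivity)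
  rw [nhds_prod_eq, eventually_prod_self_iff'] at hev
  obtain ⟨S, hS, hev⟩ := hev
  obtain ⟨R, hR, hball⟩ := Metric.mem_nhds_iff.1 (inter_mem hS hO)
  refine ⟨e, c, R / 4, hen, hcpos, min_le_left _ _, by positivity, ?_, ?_⟩
  · exact (Metric.ball_subset_ball (by linarith)).trans (hball.trans inter_subset_right)
  intro x hx s hs y hy
  have hxR : x ∈ Metric.ball x₀ R := Metric.ball_subset_ball (by linarith) hx
  have hyx : ‖y - x - s • e‖ ≤ c * s := by
    rw [Metric.mem_closedBall, dist_eq_norm] at hy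
    rwa [sub_sub]
  have hc1 : c ≤ 1 := min_le_left _ _
  have hse : ‖s • e‖ ≤ s := by
    rw [norm_smul, Real.norm_of_nonneg hs.1.le]; exact mul_le_of_le_one_right hs.1.le hen
  have hyxn : ‖y - x‖ ≤ 2 * s := by
    have : y - x = (y - x - s • e) + s • e := by abel
    rw [this]
    refine (norm_add_le _ _).trans ?_
    nlinarith [mul_le_of_le_one_left hs.1.le hc1]
  have hyR : y ∈ Metric.ball x₀ R := by
    rw [Metric.mem_ball, dist_eq_norm] at hx ⊢
    have : y - x₀ = (y - x) + (x - x₀) := by abel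
    rw [this]
    refine (norm_add_le _ _).trans_lt ?_
    linarith [hs.2]
  refine ⟨(hball hyR).2, ?_⟩
  have h1 : ‖ρ y - ρ x - l (y - x)‖ ≤ δ / 4 * ‖y - x‖ :=
    hev y (hball hyR).1 x (hball hxR).1
  have h2 : l (y - x) = s * δ + l (y - x - s • e) := by
    rw [map_sub l (y - x), map_smul, smul_eq_mul]; ring
  have h3 : |l (y - x - s • e)| ≤ δ / 4 * s := by
    refine (l.le_opNorm _).trans ?_
    calc ‖l‖ * ‖y - x - s • e‖ ≤ ‖l‖ * (c * s) := by gcongr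
      _ = c * ‖l‖ * s := by ring
      _ ≤ _ := mul_le_mul_of_nonneg_right hcl hs.1.le
  rw [Real.norm_eq_abs] at h1
  have h4 := (abs_le.1 h1).1
  have h5 := (abs_le.1 h3).1
  have h6 : δ / 4 * ‖y - x‖ ≤ δ / 4 * (2 * s) := by gcongr
  have h7 : 0 < s * δ := mul_pos hs.1 hle
  nlinarith

/-- Cones along which `-ρ` increases stay in the sublevel set of `ρ`. -/
theorem localCones_of_smoothBoundary {D : Set E3} (hD : HasSmoothBoundary D) {x₀ : E3}
    (hx : x₀ ∈ frontier D) : LocalCones D x₀ := by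
  obtain ⟨ρ, hρ, hne, hev⟩ := hD x₀ hx
  have hne' : fderiv ℝ (fun x => -ρ x) x₀ ≠ 0 := by
    rw [fderiv_fun_neg]
    exact neg_ne_zero.2 hne
  obtain ⟨e, c, r, h1, h2, h3, h4, h5, h6⟩ := exists_cone_increasing hρ.neg hne' hev
  refine ⟨e, c, r, h1, h2, h3, h4, fun x hx s hs y hy => ?_⟩
  obtain ⟨h7, h8⟩ := h6 x hx.1 s hs y hy
  have h9 : ρ x < 0 := (h5 hx.1).1 hx.2
  refine h7.2 ?_
  have : -ρ x < -ρ y := h8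
  linarith

/-- Vertices outside the hole have `ρ ≥ 0`, and `ρ` increases strictly along the cone. Hence `ρ > 0`
near every point of the cone, which excludes the closure of the hole and not just the hole; for this
the local description of `H` is needed in a neighbourhood of each such point. -/
theorem localCones_compl_of_smoothBoundary {H Y : Set E3} (hH : HasSmoothBoundary H)
    (hY : IsOpen Y) {x₀ : E3} (hx : x₀ ∈ frontier H) (hxY : x₀ ∈ Y) :
    LocalCones (Y \ closure H) x₀ := by
  obtain ⟨ρ, hρ, hne, hev⟩ := hH x₀ hx
  obtain ⟨e, c, r, h1, h2, h3, h4, h5, h6⟩ := exists_cone_increasing hρ hne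
    (inter_mem (eventually_eventually_nhds.2 hev) (hY.mem_nhds hxY))
  refine ⟨e, c, r, h1, h2, h3, h4, fun x hx s hs y hy => ?_⟩
  obtain ⟨h7, h8⟩ := h6 x hx.1 s hs y hy
  have hx0 : 0 ≤ ρ x := by
    by_contra h
    exact hx.2.2 (subset_closure ((h5 hx.1).1.self_of_nhds.2 (not_le.1 h)))
  refine ⟨h7.2, fun hcl => ?_⟩
  have hy0 : ∀ᶠ z in 𝓝 y, 0 < ρ z :=
    hρ.continuous.continuousAt.eventually (lt_mem_nhds (hx0.trans_lt h8))
  have : ∀ᶠ z in 𝓝 y, z ∉ H := by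
    have h7' : ∀ᶠ z in 𝓝 y, (z ∈ H ↔ ρ z < 0) := h7.1
    filter_upwards [hy0, h7'] with z hz1 hz2 hz
    exact absurd (hz2.1 hz) (not_lt.2 hz1.le)
  rw [mem_closure_iff_frequently] at hcl
  exact hcl this

theorem IsSobolev.integrableOn {D : Set E3} {u : E3 → ℝ} {p : E3 → E3} (h : IsSobolev D u p)
    (hD : volume D ≠ ⊤) : IntegrableOn u D :=
  have : IsFiniteMeasure (volume.restrict D) := ⟨by simpa using hD.lt_top⟩
  h.memLp.integrable (by norm_num)

theorem IsSobolev.integrableOn_grad {D : Set E3} {u : E3 → ℝ} {p : E3 → E3}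
    (h : IsSobolev D u p) (hD : volume D ≠ ⊤) : IntegrableOn p D :=
  have : IsFiniteMeasure (volume.restrict D) := ⟨by simpa using hD.lt_top⟩
  h.memLp_grad.integrable (by norm_num)

theorem ofReal_integral_norm_le {Z : Type*} [NormedAddCommGroup Z] {D : Set E3} {f : E3 → Z}
    (hf : MemLp f 2 (volume.restrict D)) (hD : volume D ≠ ⊤) :
    ENNReal.ofReal (∫ y in D, ‖f y‖)
      ≤ eLpNorm f 2 (volume.restrict D) * volume D ^ (1 / 2 : ℝ) := by
  have : IsFiniteMeasure (volume.restrict D) := ⟨by simpa using hD.lt_top⟩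
  rw [ofReal_integral_norm_eq_lintegral_enorm (hf.integrable (by norm_num)),
    ← eLpNorm_one_eq_lintegral_enorm]
  refine (eLpNorm_le_eLpNorm_mul_rpow_measure_univ (q := 2) (by norm_num) hf.1).trans (le_of_eq ?_)
  rw [Measure.restrict_apply_univ]
  norm_num

theorem eLpNorm_cone_piece_le {c r : ℝ} {C : ℝ≥0} {D N : Set E3} {e : E3} {u : E3 → ℝ}
    {p : E3 → E3} (hu : IntegrableOn u D) (hN : MeasurableSet N) (hND : N ⊆ D) (hcr : 0 < c * r)
    (hC : eLpNorm (fun x => u x - localAvg D u (x + r • e) (c * r)) 4 (volume.restrict N)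
        ≤ C * eLpNorm p 2 (volume.restrict D)) {a B : ℝ}
    (hB : ∀ x ∈ N, |localAvg D u (x + r • e) (c * r) - a| ≤ B) :
    eLpNorm (fun x => u x - a) 4 (volume.restrict N)
      ≤ C * eLpNorm p 2 (volume.restrict D) + volume D ^ (1 / 4 : ℝ) * ENNReal.ofReal B := by
  have hAc := continuous_localAvg hu (r • e) hcr
  have e1 : (fun x => u x - a) = (fun x => u x - localAvg D u (x + r • e) (c * r))
      + fun x => localAvg D u (x + r • e) (c * r) - a := by
    ext x; simp
  rw [e1]
  have hum : AEStronglyMeasurable u (volume.restrict N) := (hu.mono_set hND).1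
  refine (eLpNorm_add_le (hum.sub hAc.aestronglyMeasurable)
    (hAc.sub continuous_const).aestronglyMeasurable (by norm_num)).trans (add_le_add hC ?_)
  refine (eLpNorm_le_of_ae_bound ((ae_restrict_iff' hN).2 (Eventually.of_forall hB))).trans ?_
  gcongr
  rw [Measure.restrict_apply_univ]
  refine (ENNReal.rpow_le_rpow (measure_mono hND) (by positivity)).trans (le_of_eq ?_)
  norm_num

/-- The uniform integral bound of order four on `S ∩ D` for functionals `u - a u` that are
controlled by `b u p`. -/
def FourBound (D S : Set E3) (a : (E3 → ℝ) → ℝ) (b : (E3 → ℝ) → (E3 → E3) → ℝ≥0∞) : Prop :=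
  ∃ C : ℝ≥0, ∀ u p, IsSobolev D u p →
    ∫⁻ x in S ∩ D, ‖u x - a u‖ₑ ^ 4 ≤ (C * b u p) ^ 4

/-- By compactness it is enough to work near one point of `Q`. There `u` minus its average over the
ball at the base of the cone is bounded by `exists_cone_sobolev`, and the distance of that average
from `a u` by `hB`. Taking `a = 0` yields the Sobolev inequality, and taking `a` to be a fixed local
average yields the Poincaré inequality. -/
theorem fourBound_of_localCones {D Q : Set E3} (hDo : IsOpen D) (hDv : volume D ≠ ⊤)
    (hQ : IsCompact Q) (hcone : ∀ x ∈ Q, LocalCones D x) {a : (E3 → ℝ) → ℝ}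
    {b : (E3 → ℝ) → (E3 → E3) → ℝ≥0∞}
    (hb : ∀ u p, eLpNorm p 2 (volume.restrict D) ≤ b u p)
    (hbt : ∀ u p, IsSobolev D u p → b u p ≠ ⊤)
    (hB : ∀ σ : ℝ, 0 < σ → ∃ C : ℝ≥0, ∀ q : E3, Metric.closedBall q σ ⊆ D →
      ∀ u p, IsSobolev D u p → ENNReal.ofReal |localAvg D u q σ - a u| ≤ C * b u p) :
    FourBound D Q a b := by
  refine hQ.induction_on (p := fun S => FourBound D S a b) ?_ ?_ ?_ ?_
  · exact ⟨0, fun u p _ => by simp⟩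
  · rintro S S' hSS' ⟨C, hC⟩
    exact ⟨C, fun u p h => (lintegral_mono_set (inter_subset_inter_left _ hSS')).trans (hC u p h)⟩
  · rintro S S' ⟨C, hC⟩ ⟨C', hC'⟩
    refine ⟨C + C', fun u p h => ?_⟩
    rw [union_inter_distrib_right]
    refine (lintegral_union_le _ _ _).trans ((add_le_add (hC u p h) (hC' u p h)).trans ?_)
    push_cast
    rw [add_mul]
    exact pow_add_pow_le zero_le zero_le (by norm_num)
  · intro x₀ hx₀
    obtain ⟨e, c, r, he, hc, hc1, hr, hcones⟩ := hcone x₀ hx₀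
    obtain ⟨C₁, hC₁⟩ := exists_cone_sobolev hc hc1 hr
    obtain ⟨C₂, hC₂⟩ := hB (c * r) (mul_pos hc hr)
    set V : ℝ≥0 := (volume D ^ (1 / 4 : ℝ)).toNNReal with hV
    have hVe : (V : ℝ≥0∞) = volume D ^ (1 / 4 : ℝ) := ENNReal.coe_toNNReal
      (ENNReal.rpow_ne_top_of_nonneg (by norm_num) hDv)
    refine ⟨Metric.ball x₀ r, mem_nhdsWithin_of_mem_nhds (Metric.ball_mem_nhds _ hr),
      C₁ + V * C₂, fun u p h => ?_⟩
    have hNm : MeasurableSet (Metric.ball x₀ r ∩ D) :=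
      Metric.isOpen_ball.measurableSet.inter hDo.measurableSet
    have hbt := hbt u p h
    have h1 := hC₁ D _ e u p hDo.measurableSet hNm inter_subset_right he hcones
      (h.integrableOn hDv) (h.integrableOn_grad hDv) h.grad
    have h2 := eLpNorm_cone_piece_le (a := a u) (B := (C₂ * b u p).toReal) (h.integrableOn hDv)
      hNm inter_subset_right (mul_pos hc hr) h1 (fun x hx => by
        rw [← ENNReal.ofReal_le_iff_le_toReal (ENNReal.mul_ne_top ENNReal.coe_ne_top hbt)]
        exact hC₂ _ (hcones x hx r ⟨hr, le_rfl⟩) u p h)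
    rw [← eLpNorm_four_pow]
    gcongr
    refine h2.trans ?_
    rw [ENNReal.ofReal_toReal (ENNReal.mul_ne_top ENNReal.coe_ne_top hbt)]
    push_cast
    rw [add_mul, mul_assoc (V : ℝ≥0∞), hVe]
    gcongr
    exact hb u p

/-- The Sobolev embedding `H¹(D) ⊆ L⁴(D)` for a bounded open set with smooth boundary. -/
theorem exists_sobolev_of_smoothBoundary {D : Set E3} (hDo : IsOpen D)
    (hDb : Bornology.IsBounded D) (hD : HasSmoothBoundary D) :
    ∃ C : ℝ≥0, ∀ u p, IsSobolev D u p → eLpNorm u 4 (volume.restrict D)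
      ≤ C * (eLpNorm u 2 (volume.restrict D) + eLpNorm p 2 (volume.restrict D)) := by
  have hDv : volume D ≠ ⊤ := hDb.measure_lt_top.ne
  obtain ⟨C, hC⟩ := fourBound_of_localCones (Q := closure D) hDo hDv hDb.isCompact_closure
    (fun x hx => by
      by_cases hxD : x ∈ D
      · exact localCones_of_mem hDo hxD
      · exact localCones_of_smoothBoundary hD ⟨hx, by rwa [hDo.interior_eq]⟩)
    (a := fun _ => 0) (b := fun u p => eLpNorm u 2 (volume.restrict D)
      + eLpNorm p 2 (volume.restrict D)) (fun u p => le_add_self)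
    (fun u p h => ENNReal.add_ne_top.2 ⟨h.memLp.eLpNorm_ne_top, h.memLp_grad.eLpNorm_ne_top⟩)
    (fun σ hσ => by
      have hM : 0 ≤ mollifierBound * σ⁻¹ ^ 3 := by have := mollifierBound_pos; positivity
      refine ⟨(mollifierBound * σ⁻¹ ^ 3).toNNReal * (volume D ^ (1 / 2 : ℝ)).toNNReal,
        fun q _ u p h => ?_⟩
      have h1 := abs_localAvg_le (h.integrableOn hDv) q hσ
      rw [sub_zero]
      refine (ENNReal.ofReal_le_ofReal h1).trans ?_
      rw [ENNReal.ofReal_mul hM]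
      push_cast
      rw [ENNReal.coe_toNNReal (ENNReal.rpow_ne_top_of_nonneg (by norm_num) hDv), mul_assoc]
      refine mul_le_mul' le_rfl ((ofReal_integral_norm_le h.memLp hDv).trans ?_)
      rw [mul_comm]
      exact mul_le_mul' le_rfl le_self_add)
  refine ⟨C, fun u p h => ?_⟩
  have h1 := hC u p h
  rw [inter_eq_right.2 subset_closure] at h1
  simp only [sub_zero] at h1
  rw [← eLpNorm_four_pow] at h1
  exact (ENNReal.pow_right_strictMono (n := 4) (by norm_num)).le_iff_le.1 h1

/-- Two balls inside a common ball are joined by their convex combinations, which remain in that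
ball, so `abs_localAvg_sub_le` applies. -/
theorem exists_localAvg_link {D : Set E3} (hDv : volume D ≠ ⊤) {R : ℝ} {r : ℝ}
    (hr : 0 < r) : ∃ C : ℝ, 0 ≤ C ∧ ∀ (x q q' : E3) (ρ ρ' : ℝ), Metric.closedBall x R ⊆ D →
      r ≤ ρ → r ≤ ρ' → dist q x + ρ ≤ R → dist q' x + ρ' ≤ R → ∀ u p, IsSobolev D u p →
      |localAvg D u q' ρ' - localAvg D u q ρ| ≤ C * ∫ y in D, ‖p y‖ := by
  have hmb := mollifierBound_pos
  refine ⟨mollifierBound * (3 * |R|) * r⁻¹ ^ 3, by positivity, ?_⟩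
  intro x q q' ρ ρ' hD hρ hρ' hq hq' u p h
  have hx0 := dist_nonneg (x := q) (y := x)
  have hx0' := dist_nonneg (x := q') (y := x)
  have h1 := abs_localAvg_sub_le (W := Metric.closedBall x R) (h.integrableOn hDv)
    (h.integrableOn_grad hDv) h.grad hD (c := q) (c' := q') (ρ := ρ) (ρ' := ρ') hr hρ hρ' (by
      intro τ hτ
      refine Metric.closedBall_subset_closedBall' ?_
      have e1 : q + τ • (q' - q) - x = (1 - τ) • (q - x) + τ • (q' - x) := by module
      rw [dist_eq_norm, e1]
      rw [dist_eq_norm] at hq hq'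
      have h2 := norm_add_le ((1 - τ) • (q - x)) (τ • (q' - x))
      rw [norm_smul, norm_smul, Real.norm_of_nonneg (sub_nonneg.2 hτ.2),
        Real.norm_of_nonneg hτ.1] at h2
      have h3 := mul_le_mul_of_nonneg_left hq (sub_nonneg.2 hτ.2)
      have h4 := mul_le_mul_of_nonneg_left hq' hτ.1
      linarith)
  have hR : 0 < R := by linarith
  have h5 : ‖q' - q‖ + |ρ' - ρ| ≤ 3 * |R| := by
    rw [abs_of_pos hR]
    have h6 : ‖q' - q‖ ≤ dist q' x + dist q x := by
      rw [← dist_eq_norm]; exact dist_triangle_right _ _ _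
    have h7 : |ρ' - ρ| ≤ R := abs_le.2 ⟨by linarith, by linarith⟩
    linarith
  have h8 : ∫ y in Metric.closedBall x R, ‖p y‖ ≤ ∫ y in D, ‖p y‖ :=
    setIntegral_mono_set (h.integrableOn_grad hDv).norm
      (Eventually.of_forall fun _ => norm_nonneg _) hD.eventuallyLE
  have h9 : 0 ≤ ∫ y in Metric.closedBall x R, ‖p y‖ := integral_nonneg fun _ => norm_nonneg _
  refine h1.trans (mul_le_mul ?_ h8 h9 (by positivity))
  exact mul_le_mul_of_nonneg_right (mul_le_mul_of_nonneg_left h5 hmb.le) (by positivity)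

/-- In a connected open set, all local averages are comparable. -/
theorem exists_localAvg_chain {D : Set E3} (hDo : IsOpen D) (hDv : volume D ≠ ⊤)
    (hDc : IsPreconnected D) {c₀ : E3} {ρ₀ : ℝ} (hρ₀ : 0 < ρ₀)
    (h₀ : Metric.closedBall c₀ ρ₀ ⊆ D) {q : E3} (hq : q ∈ D) :
    ∃ ρ C : ℝ, 0 < ρ ∧ 0 ≤ C ∧ Metric.closedBall q ρ ⊆ D ∧ ∀ u p, IsSobolev D u p →
      |localAvg D u q ρ - localAvg D u c₀ ρ₀| ≤ C * ∫ y in D, ‖p y‖ := by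
  -- The centres from which `c₀` can be reached form an open set that is relatively closed in `D`,
  -- hence all of `D` by connectedness. Radius and constant may depend on the centre.
  set S : Set E3 := {q | ∃ ρ C : ℝ, 0 < ρ ∧ 0 ≤ C ∧ Metric.closedBall q ρ ⊆ D ∧
    ∀ u p, IsSobolev D u p →
      |localAvg D u q ρ - localAvg D u c₀ ρ₀| ≤ C * ∫ y in D, ‖p y‖} with hS
  have htri : ∀ {a b c A B I : ℝ}, |a - b| ≤ A * I → |b - c| ≤ B * I → |a - c| ≤ (A + B) * I := by
    intro a b c A B I h1 h2
    have := abs_sub_le a b c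
    linarith [add_mul A B I]
  have hSo : IsOpen S := by
    rw [Metric.isOpen_iff]
    rintro q ⟨ρ, C, hρ, hC, hb, hq⟩
    obtain ⟨C', hC', hl⟩ := exists_localAvg_link hDv (R := ρ) (half_pos hρ)
    refine ⟨ρ / 2, half_pos hρ, fun q' hq' => ⟨ρ / 2, C' + C, half_pos hρ, by positivity, ?_, ?_⟩⟩
    · refine (Metric.closedBall_subset_closedBall' ?_).trans hb
      linarith [Metric.mem_ball.1 hq']
    · intro u p h
      refine htri (hl q q q' ρ (ρ / 2) hb (by linarith) le_rfl (by simp) ?_ u p h) (hq u p h)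
      linarith [Metric.mem_ball.1 hq']
  have hcl : closure S ∩ D ⊆ S := by
    rintro q ⟨hqS, hqD⟩
    obtain ⟨R', hR', hb'⟩ := Metric.isOpen_iff.1 hDo q hqD
    set R := R' / 2 with hR
    have hRpos : 0 < R := half_pos hR'
    have hb : Metric.closedBall q R ⊆ D :=
      (Metric.closedBall_subset_ball (by linarith)).trans hb'
    obtain ⟨q', hq'S, hq'⟩ := Metric.mem_closure_iff.1 hqS (R / 4) (by positivity)
    obtain ⟨ρ, C, hρ, hC, hρb, hq'a⟩ := hq'S
    set ρ' := min ρ (R / 2) with hρ'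
    have hρ'pos : 0 < ρ' := lt_min hρ (by positivity)
    obtain ⟨C₁, hC₁, hl₁⟩ := exists_localAvg_link hDv (R := ρ) hρ'pos
    obtain ⟨C₂, hC₂, hl₂⟩ := exists_localAvg_link hDv (R := R) hρ'pos
    refine ⟨R / 2, C₂ + (C₁ + C), by positivity, by positivity,
      (Metric.closedBall_subset_closedBall (by linarith)).trans hb, fun u p h => ?_⟩
    refine htri (hl₂ q q' q ρ' (R / 2) hb le_rfl (min_le_right _ _) ?_ (by simp; linarith) u p h)
      (htri (hl₁ q' q' q' ρ ρ' hρb (min_le_left _ _) le_rfl (by simp)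
        (by rw [dist_self, zero_add]; exact min_le_left ρ _) u p h) (hq'a u p h))
    rw [dist_comm]
    linarith [min_le_right ρ (R / 2)]
  exact hDc.subset_of_closure_inter_subset hSo
    ⟨c₀, h₀ (Metric.mem_closedBall_self hρ₀.le), ρ₀, 0, hρ₀, le_rfl, h₀, fun u p _ => by simp⟩ hcl hq

/-- The chain of `exists_localAvg_chain` has a constant that depends on `q`, but nearby centres can
share it, and compactness makes it uniform. The compact set is defined with open balls, because this
makes it closed; closed balls in `D` return as a separate condition. -/
theorem exists_localAvg_uniform {D : Set E3} (hDo : IsOpen D) (hDb : Bornology.IsBounded D)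
    (hDc : IsPreconnected D) {c₀ : E3} {ρ₀ : ℝ} (hρ₀ : 0 < ρ₀)
    (h₀ : Metric.closedBall c₀ ρ₀ ⊆ D) {σ : ℝ} (hσ : 0 < σ) :
    ∃ C : ℝ, 0 ≤ C ∧ ∀ q, Metric.closedBall q σ ⊆ D → ∀ u p, IsSobolev D u p →
      |localAvg D u q σ - localAvg D u c₀ ρ₀| ≤ C * ∫ y in D, ‖p y‖ := by
  have hDv : volume D ≠ ⊤ := hDb.measure_lt_top.ne
  set K : Set E3 := {q | Metric.ball q σ ⊆ D} with hK
  have hKD : K ⊆ D := fun q hq => hq (Metric.mem_ball_self hσ)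
  have hKcl : IsClosed K := by
    rw [← isSeqClosed_iff_isClosed]
    intro s q hs hlim y hy
    have h1 : Tendsto (fun n => dist y (s n)) atTop (𝓝 (dist y q)) :=
      tendsto_const_nhds.dist hlim
    obtain ⟨n, hn⟩ := (h1.eventually (gt_mem_nhds (Metric.mem_ball.1 hy))).exists
    exact hs n hn
  have hKc : IsCompact K := Metric.isCompact_of_isClosed_isBounded hKcl (hDb.subset hKD)
  have hInt : ∀ p : E3 → E3, 0 ≤ ∫ y in D, ‖p y‖ := fun p => integral_nonneg fun _ => norm_nonneg _
  have key : ∃ C : ℝ, 0 ≤ C ∧ ∀ q ∈ K, Metric.closedBall q σ ⊆ D → ∀ u p, IsSobolev D u p →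
      |localAvg D u q σ - localAvg D u c₀ ρ₀| ≤ C * ∫ y in D, ‖p y‖ := by
    refine hKc.induction_on (p := fun S => ∃ C : ℝ, 0 ≤ C ∧ ∀ q ∈ S, Metric.closedBall q σ ⊆ D →
      ∀ u p, IsSobolev D u p →
      |localAvg D u q σ - localAvg D u c₀ ρ₀| ≤ C * ∫ y in D, ‖p y‖) ?_ ?_ ?_ ?_
    · exact ⟨0, le_rfl, fun q hq => absurd hq (notMem_empty q)⟩
    · rintro S S' hSS' ⟨C, hC0, hC⟩
      exact ⟨C, hC0, fun q hq => hC q (hSS' hq)⟩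
    · rintro S S' ⟨C, hC0, hC⟩ ⟨C', hC0', hC'⟩
      refine ⟨C + C', by positivity, ?_⟩
      rintro q (hq | hq) hb u p h
      · refine (hC q hq hb u p h).trans (mul_le_mul_of_nonneg_right (by linarith) (hInt p))
      · refine (hC' q hq hb u p h).trans (mul_le_mul_of_nonneg_right (by linarith) (hInt p))
    · intro q₀ hq₀
      obtain ⟨ρ, C, hρ, hC, hρb, hq₀a⟩ := exists_localAvg_chain hDo hDv hDc hρ₀ h₀ (hKD hq₀)
      set ρ' := min ρ (σ / 2) with hρ'
      have hρ'pos : 0 < ρ' := lt_min hρ (by positivity)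
      obtain ⟨C₁, hC₁, hl₁⟩ := exists_localAvg_link hDv (R := ρ) hρ'pos
      obtain ⟨C₂, hC₂, hl₂⟩ := exists_localAvg_link hDv (R := σ) hρ'pos
      refine ⟨Metric.ball q₀ (σ / 4), mem_nhdsWithin_of_mem_nhds
        (Metric.ball_mem_nhds _ (by positivity)), C₂ + (C₁ + C), by positivity, ?_⟩
      intro q hq hb u p h
      have h1 := hl₂ q q₀ q ρ' σ hb le_rfl ((min_le_right _ _).trans (by linarith)) (by
        rw [dist_comm]
        linarith [min_le_right ρ (σ / 2), Metric.mem_ball.1 hq]) (by simp) u p h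
      have h2 := hl₁ q₀ q₀ q₀ ρ ρ' hρb (min_le_left _ _) le_rfl (by simp)
        (by rw [dist_self, zero_add]; exact min_le_left ρ _) u p h
      have h3 := hq₀a u p h
      have h4 := abs_sub_le (localAvg D u q σ) (localAvg D u q₀ ρ') (localAvg D u c₀ ρ₀)
      have h5 := abs_sub_le (localAvg D u q₀ ρ') (localAvg D u q₀ ρ) (localAvg D u c₀ ρ₀)
      linarith [add_mul C₂ (C₁ + C) (∫ y in D, ‖p y‖), add_mul C₁ C (∫ y in D, ‖p y‖)]
  obtain ⟨C, hC0, hC⟩ := key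
  exact ⟨C, hC0, fun q hb => hC q (Metric.ball_subset_closedBall.trans hb) hb⟩

/-- A Poincaré-Sobolev inequality on a bounded connected open set, on the part of the domain that
lies in a compact set with local cones. -/
theorem exists_poincare_of_localCones {D Q : Set E3} (hDo : IsOpen D)
    (hDb : Bornology.IsBounded D) (hDc : IsConnected D) (hQ : IsCompact Q)
    (hcone : ∀ x ∈ Q, LocalCones D x) :
    ∃ (c₀ : E3) (ρ₀ : ℝ), 0 < ρ₀ ∧ ∃ C : ℝ≥0, ∀ u p, IsSobolev D u p →
      ∫⁻ x in Q ∩ D, ‖u x - localAvg D u c₀ ρ₀‖ₑ ^ 4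
        ≤ (C * eLpNorm p 2 (volume.restrict D)) ^ 4 := by
  have hDv : volume D ≠ ⊤ := hDb.measure_lt_top.ne
  obtain ⟨c₀, hc₀⟩ := hDc.nonempty
  obtain ⟨r, hr, hball⟩ := Metric.isOpen_iff.1 hDo c₀ hc₀
  have h₀ : Metric.closedBall c₀ (r / 2) ⊆ D :=
    (Metric.closedBall_subset_ball (by linarith)).trans hball
  refine ⟨c₀, r / 2, half_pos hr, ?_⟩
  refine fourBound_of_localCones hDo hDv hQ hcone (a := fun u => localAvg D u c₀ (r / 2))
    (b := fun u p => eLpNorm p 2 (volume.restrict D)) (fun u p => le_rfl)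
    (fun u p h => h.memLp_grad.eLpNorm_ne_top) (fun σ hσ => ?_)
  obtain ⟨C, hC0, hC⟩ := exists_localAvg_uniform hDo hDb hDc.isPreconnected (half_pos hr) h₀ hσ
  refine ⟨C.toNNReal * (volume D ^ (1 / 2 : ℝ)).toNNReal, fun q hq u p h => ?_⟩
  refine (ENNReal.ofReal_le_ofReal (hC q hq u p h)).trans ?_
  rw [ENNReal.ofReal_mul hC0]
  push_cast
  rw [ENNReal.coe_toNNReal (ENNReal.rpow_ne_top_of_nonneg (by norm_num) hDv), mul_assoc]
  refine mul_le_mul' le_rfl ((ofReal_integral_norm_le h.memLp_grad hDv).trans ?_)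
  rw [mul_comm]

end Ferro

namespace Ferro

/-! ### Operations on Sobolev functions -/

/-- The gradient of a differentiable function. -/
noncomputable def gradVec (χ : E3 → ℝ) (x : E3) : E3 :=
  WithLp.toLp 2 fun i => fderiv ℝ χ x (basisVec i)

theorem gradVec_apply (χ : E3 → ℝ) (x : E3) (i : Fin 3) :
    gradVec χ x i = fderiv ℝ χ x (basisVec i) := rfl

theorem continuous_gradVec {χ : E3 → ℝ} (hχ : ContDiff ℝ ∞ χ) : Continuous (gradVec χ) := by
  refine (PiLp.continuous_toLp 2 _).comp (continuous_pi fun i => ?_)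
  exact (hχ.continuous_fderiv (by simp)).clm_apply continuous_const

theorem gradVec_eq_zero_of_notMem_tsupport {χ : E3 → ℝ} {x : E3} (hx : x ∉ tsupport χ) :
    gradVec χ x = 0 := by
  have : fderiv ℝ χ x = 0 :=
    Function.notMem_support.1 fun h => hx (support_fderiv_subset ℝ h)
  ext i
  simp [gradVec_apply, this]

theorem hasCompactSupport_gradVec {χ : E3 → ℝ} (hχ : HasCompactSupport χ) :
    HasCompactSupport (gradVec χ) :=
  hχ.mono' fun _ hx => by_contra fun h => hx (gradVec_eq_zero_of_notMem_tsupport h)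

theorem IsSobolev.add {D : Set E3} {u v : E3 → ℝ} {p q : E3 → E3} (hu : IsSobolev D u p)
    (hv : IsSobolev D v q) : IsSobolev D (fun x => u x + v x) (fun x => p x + q x) := by
  refine ⟨hu.memLp.add hv.memLp, hu.memLp_grad.add hv.memLp_grad, fun ψ hψ i => ?_⟩
  have hc : ∀ r : E3 → E3, MemLp r 2 (volume.restrict D) →
      MemLp (fun x => r x i) 2 (volume.restrict D) := fun r hr =>
    hr.continuousLinearMap_comp (EuclideanSpace.proj (𝕜 := ℝ) i)
  have e1 : ∫ x in D, (u x + v x) * fderiv ℝ ψ x (basisVec i)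
      = (∫ x in D, u x * fderiv ℝ ψ x (basisVec i))
        + ∫ x in D, v x * fderiv ℝ ψ x (basisVec i) := by
    have h1 : Integrable (fun x => u x * fderiv ℝ ψ x (basisVec i)) (volume.restrict D) :=
      hu.memLp.integrable_mul (hψ.memLp_fderiv i)
    have h2 : Integrable (fun x => v x * fderiv ℝ ψ x (basisVec i)) (volume.restrict D) :=
      hv.memLp.integrable_mul (hψ.memLp_fderiv i)
    simp_rw [← integral_add h1 h2, add_mul]
  have e2 : ∫ x in D, (p x + q x) i * ψ x = (∫ x in D, p x i * ψ x) + ∫ x in D, q x i * ψ x := by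
    have h1 : Integrable (fun x => p x i * ψ x) (volume.restrict D) :=
      (hc p hu.memLp_grad).integrable_mul hψ.memLp
    have h2 : Integrable (fun x => q x i * ψ x) (volume.restrict D) :=
      (hc q hv.memLp_grad).integrable_mul hψ.memLp
    simp_rw [← integral_add h1 h2, PiLp.add_apply, add_mul]
  rw [e1, e2, hu.grad ψ hψ i, hv.grad ψ hψ i]
  ring

theorem isSobolev_of_contDiff {D : Set E3} {χ : E3 → ℝ} (hχ : ContDiff ℝ ∞ χ)
    (hc : HasCompactSupport χ) : IsSobolev D χ (gradVec χ) := by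
  refine ⟨hχ.continuous.memLp_of_hasCompactSupport hc,
    (continuous_gradVec hχ).memLp_of_hasCompactSupport (hasCompactSupport_gradVec hc),
    fun ψ hψ i => ?_⟩
  have hψ0 : ∀ x, x ∉ D → ψ x = 0 := fun x hx =>
    image_eq_zero_of_notMem_tsupport fun h => hx (hψ.support h)
  have hψ1 : ∀ x, x ∉ D → fderiv ℝ ψ x = 0 := fun x hx =>
    Function.notMem_support.1 fun h => hx (hψ.support (support_fderiv_subset ℝ h))
  rw [setIntegral_eq_integral_of_forall_compl_eq_zero fun x hx => by simp [hψ1 x hx],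
    setIntegral_eq_integral_of_forall_compl_eq_zero fun x hx => by simp [hψ0 x hx]]
  have hd : Continuous fun x => fderiv ℝ ψ x (basisVec i) :=
    (hψ.smooth.continuous_fderiv (by simp)).clm_apply continuous_const
  have hd' : Continuous fun x => fderiv ℝ χ x (basisVec i) :=
    (hχ.continuous_fderiv (by simp)).clm_apply continuous_const
  exact integral_mul_fderiv_eq_neg_fderiv_mul_of_integrable
    ((hd'.mul hψ.smooth.continuous).integrable_of_hasCompactSupport hψ.compact.mul_left)
    ((hχ.continuous.mul hd).integrable_of_hasCompactSupport hc.mul_right)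
    ((hχ.continuous.mul hψ.smooth.continuous).integrable_of_hasCompactSupport hc.mul_right)
    (fun x _ => hχ.differentiable (by simp) x) (fun x _ => hψ.smooth.differentiable (by simp) x)

theorem memLp_restrict_of_eq_zero {Z : Type*} [NormedAddCommGroup Z] {U D : Set E3}
    (hU : MeasurableSet U) (hUD : U ⊆ D) {f : E3 → Z} (hf : MemLp f 2 (volume.restrict U))
    (h0 : ∀ x ∈ D, x ∉ U → f x = 0) (hD : MeasurableSet D) : MemLp f 2 (volume.restrict D) := by
  have h1 : MemLp (U.indicator f) 2 (volume.restrict D) := by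
    rw [memLp_indicator_iff_restrict hU, Measure.restrict_restrict hU, inter_eq_left.2 hUD]
    exact hf
  refine h1.ae_eq ?_
  filter_upwards [ae_restrict_mem hD] with x hx
  by_cases hxU : x ∈ U
  · simp [hxU]
  · simp [hxU, h0 x hx hxU]

theorem memLp_bdd_mul {D : Set E3} {χ u : E3 → ℝ} (hu : MemLp u 2 (volume.restrict D))
    (hχ : Continuous χ) {B : ℝ} (hB : ∀ x, |χ x| ≤ B) :
    MemLp (fun x => χ x * u x) 2 (volume.restrict D) :=
  hu.of_le_mul (c := B) (hχ.aestronglyMeasurable.mul hu.1) (Eventually.of_forall fun x => by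
    rw [norm_mul]; exact mul_le_mul_of_nonneg_right (hB x) (norm_nonneg _))

/-- Multiplication by a smooth function that vanishes near `D \ U` maps `H¹(U)` to `H¹(D)`. -/
theorem IsSobolev.cutoff {U D : Set E3} (hU : MeasurableSet U) (hD : MeasurableSet D)
    (hUD : U ⊆ D) {u : E3 → ℝ} {p : E3 → E3} (h : IsSobolev U u p) {χ : E3 → ℝ}
    (hχ : ContDiff ℝ ∞ χ) {B : ℝ} (hχ1 : ∀ x, |χ x| ≤ B) (hχB : ∀ x, ‖gradVec χ x‖ ≤ B)
    (hχ0 : ∀ x ∈ D, x ∉ U → x ∉ tsupport χ) :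
    IsSobolev D (fun x => χ x * u x) (fun x => χ x • p x + u x • gradVec χ x) := by
  have hz : ∀ x ∈ D, x ∉ U → χ x = 0 := fun x hx hx' =>
    image_eq_zero_of_notMem_tsupport (hχ0 x hx hx')
  have hz' : ∀ x ∈ D, x ∉ U → gradVec χ x = 0 := fun x hx hx' =>
    gradVec_eq_zero_of_notMem_tsupport (hχ0 x hx hx')
  have hm1 : MemLp (fun x => χ x • p x) 2 (volume.restrict U) :=
    h.memLp_grad.of_le_mul (c := B) (hχ.continuous.aestronglyMeasurable.smul h.memLp_grad.1)
      (Eventually.of_forall fun x => by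
        rw [norm_smul]; exact mul_le_mul_of_nonneg_right (hχ1 x) (norm_nonneg _))
  have hm2 : MemLp (fun x => u x • gradVec χ x) 2 (volume.restrict U) :=
    h.memLp.of_le_mul (c := B) (h.memLp.1.smul (continuous_gradVec hχ).aestronglyMeasurable)
      (Eventually.of_forall fun x => by
        rw [norm_smul, mul_comm]; exact mul_le_mul_of_nonneg_right (hχB x) (norm_nonneg _))
  refine ⟨memLp_restrict_of_eq_zero hU hUD (memLp_bdd_mul h.memLp hχ.continuous hχ1)
    (fun x hx hx' => by simp [hz x hx hx']) hD,
    memLp_restrict_of_eq_zero hU hUD (hm1.add hm2)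
    (fun x hx hx' => by simp [hz x hx hx', hz' x hx hx']) hD, fun ψ hψ i => ?_⟩
  -- A point in both supports lies in `D` and in the support of `χ`, hence in `U`. Multiplication by
  -- `χ` thus turns tests in `D` into tests in `U`.
  have htest : IsTest U fun x => χ x * ψ x := by
    refine ⟨hχ.mul hψ.smooth, hψ.compact.mul_left, fun x hx => ?_⟩
    have h1 : x ∈ tsupport χ := tsupport_mul_subset_left hx
    have h2 : x ∈ tsupport ψ := tsupport_mul_subset_right hx
    by_contra hxU
    exact hχ0 x (hψ.support h2) hxU h1
  have hψ' := hψ.memLp_fderiv i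
  have hUle : volume.restrict U ≤ volume.restrict D := Measure.restrict_mono hUD le_rfl
  have hi1 : Integrable (fun x => χ x * u x * fderiv ℝ ψ x (basisVec i)) (volume.restrict U) :=
    (memLp_bdd_mul h.memLp hχ.continuous hχ1).integrable_mul (hψ'.mono_measure hUle)
  have hg : MemLp (fun x => gradVec χ x i * u x) 2 (volume.restrict U) :=
    memLp_bdd_mul h.memLp ((EuclideanSpace.proj (𝕜 := ℝ) i).continuous.comp
      (continuous_gradVec hχ)) (fun x => (PiLp.norm_apply_le _ i).trans (hχB x))
  have hi2 : Integrable (fun x => gradVec χ x i * u x * ψ x) (volume.restrict U) :=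
    hg.integrable_mul (hψ.memLp.mono_measure hUle)
  have hi3 : Integrable (fun x => p x i * (χ x * ψ x)) (volume.restrict U) :=
    (h.memLp_grad.continuousLinearMap_comp (EuclideanSpace.proj (𝕜 := ℝ) i)).integrable_mul
      htest.memLp
  have key := h.grad _ htest i
  have e1 : ∀ x, u x * fderiv ℝ (fun x => χ x * ψ x) x (basisVec i)
      = χ x * u x * fderiv ℝ ψ x (basisVec i) + gradVec χ x i * u x * ψ x := by
    intro x
    rw [fderiv_fun_mul (hχ.differentiable (by simp) x) (hψ.smooth.differentiable (by simp) x)]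
    simp only [add_apply, smul_apply, smul_eq_mul,
      gradVec_apply]
    ring
  simp_rw [e1] at key
  rw [integral_add hi1 hi2] at key
  have e2 : ∫ x in D, χ x * u x * fderiv ℝ ψ x (basisVec i)
      = ∫ x in U, χ x * u x * fderiv ℝ ψ x (basisVec i) :=
    setIntegral_eq_of_subset_of_forall_sdiff_eq_zero hD hUD fun x hx => by
      simp [hz x hx.1 hx.2]
  have e3 : ∫ x in D, (χ x • p x + u x • gradVec χ x) i * ψ x
      = ∫ x in U, (χ x • p x + u x • gradVec χ x) i * ψ x :=
    setIntegral_eq_of_subset_of_forall_sdiff_eq_zero hD hUD fun x hx => by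
      simp [hz x hx.1 hx.2, hz' x hx.1 hx.2]
  have e4 : ∫ x in U, (χ x • p x + u x • gradVec χ x) i * ψ x
      = (∫ x in U, p x i * (χ x * ψ x)) + ∫ x in U, gradVec χ x i * u x * ψ x := by
    rw [← integral_add hi3 hi2]
    refine integral_congr_ae (Eventually.of_forall fun x => ?_)
    simp only [PiLp.add_apply, PiLp.smul_apply, smul_eq_mul]
    ring
  rw [e2, e3, e4]
  linarith

/-! ### Change of scale -/

/-- The affine map `y ↦ ε (b + y)`. -/
noncomputable def affMap (ε : ℝ) (b y : E3) : E3 := ε • (b + y)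

theorem affMap_inv {ε : ℝ} (hε : 0 < ε) (b x : E3) : affMap ε b (ε⁻¹ • x - b) = x := by
  rw [affMap, add_sub_cancel, smul_inv_smul₀ hε.ne']

theorem inv_affMap {ε : ℝ} (hε : 0 < ε) (b y : E3) : ε⁻¹ • affMap ε b y - b = y := by
  rw [affMap, inv_smul_smul₀ hε.ne', add_sub_cancel_left]

theorem affMap_image {ε : ℝ} (hε : 0 < ε) (b : E3) (S : Set E3) :
    affMap ε b '' S = {x | ε⁻¹ • x - b ∈ S} := by
  ext x
  constructor
  · rintro ⟨y, hy, rfl⟩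
    simpa [inv_affMap hε] using hy
  · intro hx
    exact ⟨_, hx, affMap_inv hε b x⟩

theorem continuous_affMap (ε : ℝ) (b : E3) : Continuous (affMap ε b) := by
  unfold affMap; fun_prop

theorem measurableEmbedding_affMap {ε : ℝ} (hε : 0 < ε) (b : E3) :
    MeasurableEmbedding (affMap ε b) :=
  (Homeomorph.mk (Equiv.mk (affMap ε b) (fun x => ε⁻¹ • x - b) (inv_affMap hε b) (affMap_inv hε b))
    (continuous_affMap ε b) (by fun_prop)).measurableEmbedding

theorem map_affMap {ε : ℝ} (hε : 0 < ε) (b : E3) :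
    Measure.map (affMap ε b) volume = ENNReal.ofReal (ε ^ 3)⁻¹ • (volume : Measure E3) := by
  have h1 : affMap ε b = (fun y => ε • y) ∘ fun y => b + y := rfl
  rw [h1, ← Measure.map_map (by fun_prop) (by fun_prop),
    (measurePreserving_add_left (volume : Measure E3) b).map_eq, Measure.map_addHaar_smul _ hε.ne',
    finrank_euclideanSpace_fin, abs_of_pos (by positivity)]

theorem lintegral_comp_affMap {ε : ℝ} (hε : 0 < ε) (b : E3) (f : E3 → ℝ≥0∞) (S : Set E3) :
    ∫⁻ y in S, f (affMap ε b y)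
      = ENNReal.ofReal (ε ^ 3)⁻¹ * ∫⁻ x in affMap ε b '' S, f x := by
  have he := measurableEmbedding_affMap hε b
  have h1 : volume.restrict S = (volume : Measure E3).restrict (affMap ε b ⁻¹' (affMap ε b '' S)) := by
    rw [preimage_image_eq _ he.injective]
  rw [h1, ← he.lintegral_map, ← he.restrict_map, map_affMap hε, Measure.restrict_smul,
    lintegral_smul_measure, smul_eq_mul]

theorem lintegral_affMap_image {ε : ℝ} (hε : 0 < ε) (b : E3) (f : E3 → ℝ≥0∞) (S : Set E3) :
    ∫⁻ x in affMap ε b '' S, f x = ENNReal.ofReal (ε ^ 3) * ∫⁻ y in S, f (affMap ε b y) := by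
  rw [lintegral_comp_affMap hε, ← mul_assoc, ← ENNReal.ofReal_mul (by positivity),
    mul_inv_cancel₀ (by positivity), ENNReal.ofReal_one, one_mul]

theorem integral_comp_affMap {ε : ℝ} (hε : 0 < ε) (b : E3) (f : E3 → ℝ) :
    ∫ y, f (affMap ε b y) = (ε ^ 3)⁻¹ * ∫ x, f x := by
  rw [← (measurableEmbedding_affMap hε b).integral_map, map_affMap hε, integral_smul_measure,
    ENNReal.toReal_ofReal (by positivity), smul_eq_mul]

theorem memLp_comp_affMap {Z : Type*} [NormedAddCommGroup Z] {ε : ℝ} (hε : 0 < ε) (b : E3)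
    {D U : Set E3} (hDU : ∀ y ∈ D, affMap ε b y ∈ U) {f : E3 → Z}
    (hf : MemLp f 2 (volume.restrict U)) :
    MemLp (fun y => f (affMap ε b y)) 2 (volume.restrict D) := by
  have he := measurableEmbedding_affMap hε b
  have h1 : volume.restrict D = (volume : Measure E3).restrict (affMap ε b ⁻¹' (affMap ε b '' D)) := by
    rw [preimage_image_eq _ he.injective]
  have h2 : MemLp f 2 ((Measure.map (affMap ε b) volume).restrict (affMap ε b '' D)) := by
    rw [map_affMap hε, Measure.restrict_smul]
    exact (hf.mono_measure (Measure.restrict_mono (by rintro _ ⟨y, hy, rfl⟩; exact hDU y hy)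
      le_rfl)).smul_measure ENNReal.ofReal_ne_top
  rw [he.restrict_map] at h2
  rw [h1]
  exact (he.memLp_map_measure_iff).1 h2

/-- Sobolev functions under a change of scale. -/
theorem IsSobolev.comp_affMap {ε : ℝ} (hε : 0 < ε) (b : E3) {D U : Set E3}
    (hDU : ∀ y ∈ D, affMap ε b y ∈ U) {u : E3 → ℝ} {p : E3 → E3} (h : IsSobolev U u p) :
    IsSobolev D (fun y => u (affMap ε b y)) (fun y => ε • p (affMap ε b y)) := by
  refine ⟨memLp_comp_affMap hε b hDU h.memLp, (memLp_comp_affMap hε b hDU h.memLp_grad).const_smul ε,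
    fun ψ hψ i => ?_⟩
  set φ : E3 → ℝ := fun x => ψ (ε⁻¹ • x - b) with hφ
  have hφψ : ∀ y, φ (affMap ε b y) = ψ y := fun y => by simp only [hφ, inv_affMap hε]
  have hφs : ContDiff ℝ ∞ φ := hψ.smooth.comp (by fun_prop)
  have hφt : tsupport φ ⊆ affMap ε b '' tsupport ψ := by
    refine closure_minimal (fun x hx => ?_) ?_
    · exact ⟨_, subset_tsupport ψ hx, affMap_inv hε b x⟩
    · exact (hψ.compact.isCompact.image (continuous_affMap ε b)).isClosed
  have hφ' : IsTest U φ := by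
    refine ⟨hφs, (hψ.compact.isCompact.image (continuous_affMap ε b)).of_isClosed_subset
      (isClosed_tsupport _) hφt, fun x hx => ?_⟩
    obtain ⟨y, hy, rfl⟩ := hφt hx
    exact hDU y (hψ.support hy)
  have hder : ∀ y, fderiv ℝ φ (affMap ε b y) (basisVec i) = ε⁻¹ * fderiv ℝ ψ y (basisVec i) := by
    intro y
    have hl : HasFDerivAt (fun x : E3 => ε⁻¹ • x - b) (ε⁻¹ • ContinuousLinearMap.id ℝ E3)
        (affMap ε b y) := ((hasFDerivAt_id _).const_smul ε⁻¹).sub_const b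
    have h2 := (hψ.smooth.differentiable (by simp) (ε⁻¹ • affMap ε b y - b)).hasFDerivAt.comp
      (affMap ε b y) hl
    rw [show φ = ψ ∘ fun x : E3 => ε⁻¹ • x - b from rfl, h2.fderiv, inv_affMap hε]
    simp
  have key := h.grad φ hφ' i
  have hz : ∀ {S : Set E3} {ψ : E3 → ℝ}, IsTest S ψ → ∀ x, x ∉ S →
      ψ x = 0 ∧ fderiv ℝ ψ x (basisVec i) = 0 := by
    intro S ψ hψ x hx
    refine ⟨image_eq_zero_of_notMem_tsupport fun h => hx (hψ.support h), ?_⟩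
    have : fderiv ℝ ψ x = 0 :=
      Function.notMem_support.1 fun h => hx (hψ.support (support_fderiv_subset ℝ h))
    simp [this]
  rw [setIntegral_eq_integral_of_forall_compl_eq_zero fun x hx => by simp [(hz hφ' x hx).2],
    setIntegral_eq_integral_of_forall_compl_eq_zero fun x hx => by simp [(hz hφ' x hx).1]] at key
  rw [setIntegral_eq_integral_of_forall_compl_eq_zero fun x hx => by simp [(hz hψ x hx).2],
    setIntegral_eq_integral_of_forall_compl_eq_zero fun x hx => by simp [(hz hψ x hx).1]]
  have e1 := integral_comp_affMap hε b fun x => u x * fderiv ℝ φ x (basisVec i)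
  have e2 := integral_comp_affMap hε b fun x => p x i * φ x
  simp only [hder, hφψ] at e1 e2
  have e3 : ∫ y, u (affMap ε b y) * fderiv ℝ ψ y (basisVec i)
      = ε * ∫ y, u (affMap ε b y) * (ε⁻¹ * fderiv ℝ ψ y (basisVec i)) := by
    rw [← integral_const_mul]
    refine integral_congr_ae (Eventually.of_forall fun y => ?_)
    simp only
    field_simp
  have e4 : ∫ y, (ε • p (affMap ε b y)) i * ψ y = ε * ∫ y, p (affMap ε b y) i * ψ y := by
    rw [← integral_const_mul]
    refine integral_congr_ae (Eventually.of_forall fun y => ?_)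
    simp only [PiLp.smul_apply, smul_eq_mul]
    ring
  rw [e3, e4, e1, e2, key]
  ring

/-! ### Geometry of the perforated domain -/

theorem scaledCopy_eq (ε : ℝ) (k : Fin 3 → ℤ) (S : Set E3) :
    scaledCopy ε k S = affMap ε (latticePt k) '' S := rfl

theorem isOpen_unitCell : IsOpen unitCell := by
  have : unitCell = ⋂ i, (fun y : E3 => y i) ⁻¹' Ioo (0 : ℝ) 1 := by
    ext y; simp [unitCell]
  rw [this]
  exact isOpen_iInter_of_finite fun i =>
    isOpen_Ioo.preimage (EuclideanSpace.proj (𝕜 := ℝ) i).continuous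

theorem isBounded_unitCell : Bornology.IsBounded unitCell := by
  refine (Metric.isBounded_iff_subset_closedBall 0).2 ⟨Real.sqrt 3, fun y hy => ?_⟩
  rw [mem_closedBall_zero_iff, EuclideanSpace.norm_eq]
  refine Real.sqrt_le_sqrt ?_
  calc ∑ i, ‖y i‖ ^ 2 ≤ ∑ _i : Fin 3, (1 : ℝ) := Finset.sum_le_sum fun i _ => by
        rw [Real.norm_of_nonneg (hy i).1.le]
        exact pow_le_one₀ (hy i).1.le (hy i).2.le
    _ = 3 := by simp

theorem center_mem_unitCell : (WithLp.toLp 2 fun _ => (1 / 2 : ℝ)) ∈ unitCell := by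
  intro i
  norm_num

theorem latticePt_eq_of_mem {ε : ℝ} (hε : 0 < ε) {k j : Fin 3 → ℤ} {x : E3}
    (hk : x ∈ scaledCopy ε k unitCell) (hj : x ∈ scaledCopy ε j unitCell) : k = j := by
  rw [scaledCopy_eq, affMap_image hε] at hk hj
  funext i
  have h1 := hk i
  have h2 := hj i
  simp only [PiLp.sub_apply, latticePt] at h1 h2
  have h3 : (k i : ℝ) < j i + 1 := by linarith [h1.1, h2.2]
  have h4 : (j i : ℝ) < k i + 1 := by linarith [h1.2, h2.1]
  have h5 : k i < j i + 1 := by exact_mod_cast h3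
  have h6 : j i < k i + 1 := by exact_mod_cast h4
  omega

namespace Model

variable {P : Model}

theorem finite_cells (hP : P.Admissible) {ε : ℝ} (hε : 0 < ε) :
    {k : Fin 3 → ℤ | scaledCopy ε k unitCell ⊆ P.Ω}.Finite := by
  obtain ⟨M, hM⟩ := (Metric.isBounded_iff_subset_closedBall 0).1 hP.Ω_bounded
  obtain ⟨N, hN⟩ := exists_nat_gt (ε⁻¹ * M + 1)
  refine (Set.finite_Icc (fun _ : Fin 3 => -(N : ℤ)) fun _ => (N : ℤ)).subset fun k hk => ?_
  have h1 := hM (hk ⟨_, center_mem_unitCell, rfl⟩)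
  rw [mem_closedBall_zero_iff, norm_smul, Real.norm_of_nonneg hε.le] at h1
  have h2 : ∀ i, |(k i : ℝ) + 1 / 2| ≤ ε⁻¹ * M := by
    intro i
    have h3 := PiLp.norm_apply_le (latticePt k + WithLp.toLp 2 fun _ => (1 / 2 : ℝ)) i
    have h4 : ‖latticePt k + WithLp.toLp 2 fun _ => (1 / 2 : ℝ)‖ ≤ ε⁻¹ * M := by
      rw [← div_eq_inv_mul, le_div_iff₀ hε]; linarith
    exact (show |(k i : ℝ) + 1 / 2| = _ from rfl).le.trans (h3.trans h4)
  have h5 : ∀ i, -(N : ℝ) ≤ k i ∧ (k i : ℝ) ≤ N := fun i => by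
    have := abs_le.1 (h2 i)
    exact ⟨by linarith, by linarith⟩
  exact ⟨fun i => by exact_mod_cast (h5 i).1, fun i => by exact_mod_cast (h5 i).2⟩

theorem isCompact_closure_hole (hP : P.Admissible) : IsCompact (closure P.hole) :=
  Metric.isCompact_of_isClosed_isBounded isClosed_closure
    (isBounded_unitCell.subset hP.hole_isolated)

theorem isClosed_holes (hP : P.Admissible) {ε : ℝ} (hε : 0 < ε) : IsClosed (P.holes ε) :=
  (finite_cells hP hε).isClosed_biUnion fun k _ =>
    ((isCompact_closure_hole hP).image (continuous_affMap ε (latticePt k))).isClosed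

theorem isOpen_perforated (hP : P.Admissible) {ε : ℝ} (hε : 0 < ε) : IsOpen (P.perforated ε) :=
  hP.Ω_open.sdiff (isClosed_holes hP hε)

theorem perforated_subset (P : Model) (ε : ℝ) : P.perforated ε ⊆ P.Ω := sdiff_subset

theorem perforated_subset_exterior (P : Model) (ε : ℝ) : P.perforated ε ⊆ P.exterior ε :=
  fun _ hx => hx.2

theorem volume_perforated_ne_top (hP : P.Admissible) (ε : ℝ) : volume (P.perforated ε) ≠ ⊤ :=
  (hP.Ω_bounded.subset (P.perforated_subset ε)).measure_lt_top.ne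

/-- The part of a cell outside the hole lies in the perforated domain. -/
theorem scaledCopy_subset_perforated (hP : P.Admissible) {ε : ℝ} (hε : 0 < ε) {k : Fin 3 → ℤ}
    (hk : scaledCopy ε k unitCell ⊆ P.Ω) :
    scaledCopy ε k (unitCell \ closure P.hole) ⊆ P.perforated ε := by
  rintro _ ⟨y, hy, rfl⟩
  refine ⟨hk ⟨y, hy.1, rfl⟩, fun hx => ?_⟩
  simp only [holes, mem_iUnion] at hx
  obtain ⟨j, hj, hx⟩ := hx
  have h1 : j = k := latticePt_eq_of_mem hε (image_mono hP.hole_isolated hx) ⟨y, hy.1, rfl⟩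
  subst h1
  obtain ⟨z, hz, hzy⟩ := hx
  have := (measurableEmbedding_affMap hε (latticePt j)).injective hzy
  exact hy.2 (this ▸ hz)

/-- The reference cell without the hole has local cones away from the boundary of the cell. -/
theorem localCones_cell (hP : P.Admissible) {x : E3} (hx : x ∈ unitCell) :
    LocalCones (unitCell \ closure P.hole) x := by
  by_cases h1 : x ∈ closure P.hole
  · by_cases h2 : x ∈ P.hole
    · refine localCones_of_notMem_closure fun h3 => ?_
      obtain ⟨y, hy, hy'⟩ := mem_closure_iff.1 h3 _ hP.hole_open h2
      exact hy'.2 (subset_closure hy)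
    · exact localCones_compl_of_smoothBoundary hP.hole_smooth isOpen_unitCell
        ⟨h1, by rwa [hP.hole_open.interior_eq]⟩ hx
  · exact localCones_of_mem (isOpen_unitCell.sdiff isClosed_closure) ⟨hx, h1⟩

/-- A smooth cutoff in the unit cell that equals one near the hole. -/
theorem exists_cutoff (hP : P.Admissible) : ∃ ζ : E3 → ℝ, ContDiff ℝ ∞ ζ ∧ HasCompactSupport ζ ∧
    tsupport ζ ⊆ unitCell ∧ (∀ x ∈ closure P.hole, ∀ᶠ y in 𝓝 x, ζ y = 1) ∧
    ∀ x, ζ x ∈ Icc (0 : ℝ) 1 := by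
  obtain ⟨L, hLc, hKL, hLY⟩ := exists_compact_between (isCompact_closure_hole hP) isOpen_unitCell
    hP.hole_isolated
  obtain ⟨f, hf1, hf0, hf⟩ := exists_contMDiffMap_one_nhds_of_subset_interior (n := (⊤ : ℕ∞))
    (modelWithCornersSelf ℝ E3) isClosed_closure hKL
  have ht : tsupport f ⊆ L := closure_minimal
    (fun x hx => by_contra fun h => hx (hf0 x h)) hLc.isClosed
  refine ⟨f, f.contMDiff.contDiff, hLc.of_isClosed_subset (isClosed_tsupport _) ht, ht.trans hLY,
    fun x hx => ?_, hf⟩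
  exact hf1.filter_mono (nhds_le_nhdsSet hx)

end Model

end Ferro

namespace Ferro

/-! ### The embedding `H¹ ⊂ L⁴` of perforated domains, uniformly in the period -/

theorem IsSobolev.mono {U D : Set E3} {u : E3 → ℝ} {p : E3 → E3} (h : IsSobolev U u p)
    (hU : MeasurableSet U) (hDU : D ⊆ U) : IsSobolev D u p := by
  refine ⟨h.memLp.mono_measure (Measure.restrict_mono hDU le_rfl),
    h.memLp_grad.mono_measure (Measure.restrict_mono hDU le_rfl), fun ψ hψ i => ?_⟩
  have key := h.grad ψ ⟨hψ.smooth, hψ.compact, hψ.support.trans hDU⟩ i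
  have hz : ∀ x, x ∉ D → ψ x = 0 ∧ fderiv ℝ ψ x = 0 := fun x hx =>
    ⟨image_eq_zero_of_notMem_tsupport fun h => hx (hψ.support h),
      Function.notMem_support.1 fun h => hx (hψ.support (support_fderiv_subset ℝ h))⟩
  rw [← setIntegral_eq_of_subset_of_forall_sdiff_eq_zero hU hDU fun x hx => by
      simp [(hz x hx.2).2],
    ← setIntegral_eq_of_subset_of_forall_sdiff_eq_zero hU hDU fun x hx => by
      simp [(hz x hx.2).1]]
  exact key

theorem ennreal_add_pow_le (a b : ℝ≥0∞) {n : ℕ} (hn : 1 ≤ n) :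
    (a + b) ^ n ≤ 2 ^ (n - 1) * (a ^ n + b ^ n) := by
  have h := ENNReal.rpow_add_le_mul_rpow_add_rpow a b (p := n) (by exact_mod_cast hn)
  rw [show ((n : ℝ) - 1) = ((n - 1 : ℕ) : ℝ) by push_cast [hn]; ring] at h
  simpa only [ENNReal.rpow_natCast] using h

theorem enorm_add_sq_le {Z : Type*} [NormedAddCommGroup Z] (a b : Z) :
    ‖a + b‖ₑ ^ 2 ≤ 2 * (‖a‖ₑ ^ 2 + ‖b‖ₑ ^ 2) :=
  (pow_le_pow_left' (enorm_add_le a b) 2).trans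
    (by simpa using ennreal_add_pow_le ‖a‖ₑ ‖b‖ₑ one_le_two)

/-- The powers of $\epsilon$ come from scaling: volumes carry $\epsilon^3$ and gradients $\epsilon$.
In the $L^4$ bound $\epsilon^3\cdot\epsilon^4=\epsilon\cdot(\epsilon^3)^2$ leaves one factor
$\epsilon$, and in the $L^2$ bound $\epsilon^2$ remains. The first estimate controls the constant
`a` itself, so that filling a hole with `a` costs no more than the $L^2$ norm of `u` on the cell. -/
theorem exists_scaled_poincare {D Q : Set E3} (hDo : IsOpen D) (hDb : Bornology.IsBounded D)
    (hDc : IsConnected D) (hQ : IsCompact Q) (hcone : ∀ x ∈ Q, LocalCones D x) :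
    ∃ C : ℝ≥0, ∀ ε : ℝ, 0 < ε → ∀ (b : E3) (u : E3 → ℝ) (p : E3 → E3),
      IsSobolev (affMap ε b '' D) u p → ∃ a : ℝ,
        (∫⁻ _ in affMap ε b '' Q, ‖a‖ₑ ^ 2 ≤ C * ∫⁻ x in affMap ε b '' D, ‖u x‖ₑ ^ 2) ∧
        (∫⁻ x in affMap ε b '' (Q ∩ D), ‖u x - a‖ₑ ^ 2
          ≤ C * ENNReal.ofReal ε ^ 2 * ∫⁻ x in affMap ε b '' D, ‖p x‖ₑ ^ 2) ∧
        ∫⁻ x in affMap ε b '' (Q ∩ D), ‖u x - a‖ₑ ^ 4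
          ≤ C * ENNReal.ofReal ε * (∫⁻ x in affMap ε b '' D, ‖p x‖ₑ ^ 2) ^ 2 := by
  obtain ⟨c₀, ρ₀, hρ₀, C, hC⟩ := exists_poincare_of_localCones hDo hDb hDc hQ hcone
  have hDv : volume D ≠ ⊤ := hDb.measure_lt_top.ne
  have hQv : volume Q ≠ ⊤ := hQ.measure_lt_top.ne
  obtain ⟨V, hV⟩ : ∃ V : ℝ≥0, volume D = V := ⟨_, (ENNReal.coe_toNNReal hDv).symm⟩
  obtain ⟨W, hW⟩ : ∃ W : ℝ≥0, volume Q = W := ⟨_, (ENNReal.coe_toNNReal hQv).symm⟩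
  set M : ℝ≥0 := (mollifierBound * ρ₀⁻¹ ^ 3).toNNReal with hM
  -- One summand for each of the three estimates. The second follows from the $L^4$ bound by
  -- Cauchy–Schwarz, and `1 + W` is used so that its square dominates `W`.
  refine ⟨M ^ 2 * V * W + (1 + W) * C ^ 2 + C ^ 4, fun ε hε b u p h => ?_⟩
  have hS := h.comp_affMap hε b (D := D) fun y hy => mem_image_of_mem _ hy
  set w : E3 → ℝ := fun y => u (affMap ε b y) with hw
  set q : E3 → E3 := fun y => ε • p (affMap ε b y) with hq
  set a := localAvg D w c₀ ρ₀ with ha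
  have h4 := hC w q hS
  rw [mul_pow, show eLpNorm q 2 (volume.restrict D) ^ 4
    = (eLpNorm q 2 (volume.restrict D) ^ 2) ^ 2 by ring, eLpNorm_two_sq] at h4
  have hq2 : ∫⁻ y in D, ‖q y‖ₑ ^ 2
      = ENNReal.ofReal ε ^ 2 * ∫⁻ y in D, ‖p (affMap ε b y)‖ₑ ^ 2 := by
    rw [← lintegral_const_mul' _ _ (by finiteness)]
    refine lintegral_congr fun y => ?_
    rw [hq, enorm_smul, mul_pow, Real.enorm_eq_ofReal hε.le]
  rw [hq2] at h4
  set G := ∫⁻ y in D, ‖p (affMap ε b y)‖ₑ ^ 2 with hG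
  refine ⟨a, ?_, ?_, ?_⟩
  · rw [lintegral_affMap_image hε, lintegral_affMap_image hε, mul_left_comm]
    gcongr
    rw [setLIntegral_const, hW]
    have h1 : ‖a‖ₑ ≤ M * (eLpNorm w 2 (volume.restrict D) * volume D ^ (1 / 2 : ℝ)) := by
      rw [Real.enorm_eq_ofReal_abs]
      refine (ENNReal.ofReal_le_ofReal (abs_localAvg_le (hS.integrableOn hDv) c₀ hρ₀)).trans ?_
      rw [ENNReal.ofReal_mul (mul_nonneg mollifierBound_pos.le (by positivity))]
      exact mul_le_mul_right (ofReal_integral_norm_le hS.memLp hDv) _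
    have h2 : ‖a‖ₑ ^ 2 ≤ M ^ 2 * V * ∫⁻ y in D, ‖w y‖ₑ ^ 2 := by
      refine (pow_le_pow_left' h1 2).trans (le_of_eq ?_)
      rw [mul_pow, mul_pow, eLpNorm_two_sq, ← ENNReal.rpow_natCast (volume D ^ (1 / 2 : ℝ)),
        ← ENNReal.rpow_mul, hV]
      norm_num
      ring
    calc ‖a‖ₑ ^ 2 * W ≤ (M ^ 2 * V * ∫⁻ y in D, ‖w y‖ₑ ^ 2) * W := by gcongr
      _ = (M ^ 2 * V * W : ℝ≥0) * ∫⁻ y in D, ‖w y‖ₑ ^ 2 := by push_cast; ring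
      _ ≤ _ := by
        gcongr
        exact le_add_right (le_add_right le_rfl)
  · rw [lintegral_affMap_image hε, lintegral_affMap_image hε, mul_left_comm]
    gcongr
    have h1 : (∫⁻ y in Q ∩ D, ‖w y - a‖ₑ ^ 2) ^ 2
        ≤ W * ∫⁻ y in Q ∩ D, ‖w y - a‖ₑ ^ 4 := by
      refine (sq_lintegral_le ?_).trans ?_
      · exact (((hS.memLp.1.mono_measure (Measure.restrict_mono inter_subset_right le_rfl)).sub
          aestronglyMeasurable_const).enorm.pow_const 2)
      · rw [Measure.restrict_apply_univ, ← hW]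
        simp_rw [← pow_mul]
        gcongr
        exact inter_subset_left
    have h2 : ∫⁻ y in Q ∩ D, ‖w y - a‖ₑ ^ 2 ≤ ((1 + W) * C ^ 2 : ℝ≥0) * (ENNReal.ofReal ε ^ 2 * G) := by
      rw [← ENNReal.pow_le_pow_left_iff two_ne_zero]
      calc _ ≤ W * (C ^ 4 * (ENNReal.ofReal ε ^ 2 * G) ^ 2) := h1.trans (by gcongr)
        _ ≤ (1 + W) ^ 2 * (C ^ 4 * (ENNReal.ofReal ε ^ 2 * G) ^ 2) := by
          gcongr
          rw [sq]
          exact le_mul_of_one_le_of_le (le_add_right le_rfl) (le_add_left le_rfl)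
        _ = _ := by push_cast; ring
    calc _ ≤ _ := h2
      _ = ((1 + W) * C ^ 2 : ℝ≥0) * ENNReal.ofReal ε ^ 2 * G := by ring
      _ ≤ _ := by
        gcongr
        exact le_add_right (le_add_left le_rfl)
  · rw [lintegral_affMap_image hε, lintegral_affMap_image hε, ENNReal.ofReal_pow hε.le]
    calc ENNReal.ofReal ε ^ 3 * ∫⁻ y in Q ∩ D, ‖w y - a‖ₑ ^ 4
        ≤ ENNReal.ofReal ε ^ 3 * (C ^ 4 * (ENNReal.ofReal ε ^ 2 * G) ^ 2) := by gcongr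
      _ = (C ^ 4 : ℝ≥0) * ENNReal.ofReal ε * (ENNReal.ofReal ε ^ 3 * G) ^ 2 := by push_cast; ring
      _ ≤ _ := by
        gcongr
        exact le_add_left le_rfl

theorem gradVec_congr {f g : E3 → ℝ} {x : E3} (h : f =ᶠ[𝓝 x] g) : gradVec f x = gradVec g x := by
  ext i
  rw [gradVec_apply, gradVec_apply, h.fderiv_eq]

theorem gradVec_const_mul (c : ℝ) {f : E3 → ℝ} {x : E3} (hf : DifferentiableAt ℝ f x) :
    gradVec (fun y => c * f y) x = c • gradVec f x := by
  ext i
  simp [gradVec_apply, fderiv_const_mul hf]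

theorem gradVec_one_sub (f : E3 → ℝ) (x : E3) : gradVec (fun y => 1 - f y) x = -gradVec f x := by
  ext i
  simp [gradVec_apply, fderiv_const_sub]

theorem gradVec_rescale {ζ : E3 → ℝ} (hζ : ContDiff ℝ ∞ ζ) (ε : ℝ) (b x : E3) :
    gradVec (fun x => ζ (ε⁻¹ • x - b)) x = ε⁻¹ • gradVec ζ (ε⁻¹ • x - b) := by
  have hl : HasFDerivAt (fun x : E3 => ε⁻¹ • x - b) (ε⁻¹ • ContinuousLinearMap.id ℝ E3) x :=
    ((hasFDerivAt_id _).const_smul ε⁻¹).sub_const b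
  have h2 := (hζ.differentiable (by simp) (ε⁻¹ • x - b)).hasFDerivAt.comp x hl
  ext i
  rw [gradVec_apply, show (fun x => ζ (ε⁻¹ • x - b)) = ζ ∘ fun x : E3 => ε⁻¹ • x - b from rfl,
    h2.fderiv]
  simp [gradVec_apply]

theorem tsupport_rescale {ζ : E3 → ℝ} (hζ : HasCompactSupport ζ) {ε : ℝ} (hε : 0 < ε) (b : E3) :
    tsupport (fun x => ζ (ε⁻¹ • x - b)) ⊆ affMap ε b '' tsupport ζ := by
  refine closure_minimal (fun x hx => ?_) ?_
  · exact ⟨_, subset_tsupport ζ hx, affMap_inv hε b x⟩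
  · exact (hζ.isCompact.image (continuous_affMap ε b)).isClosed

namespace Model

variable {P : Model}

/-- A function on the perforated domain is extended to the holes of the cells `k ∈ I` by the
constants `a k`, by means of a cutoff. -/
theorem exists_extension (hP : P.Admissible) {ζ : E3 → ℝ} (hζ : ContDiff ℝ ∞ ζ)
    (hζc : HasCompactSupport ζ) (hζY : tsupport ζ ⊆ unitCell)
    (hζ1 : ∀ x ∈ closure P.hole, ∀ᶠ y in 𝓝 x, ζ y = 1) (hζI : ∀ x, ζ x ∈ Icc (0 : ℝ) 1)
    {B : ℝ} (hB : ∀ x, ‖gradVec ζ x‖ ≤ B) {ε : ℝ} (hε : 0 < ε) {I : Finset (Fin 3 → ℤ)}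
    (hI : ∀ k, k ∈ I ↔ scaledCopy ε k unitCell ⊆ P.Ω) (a : (Fin 3 → ℤ) → ℝ)
    {u : E3 → ℝ} {p : E3 → E3} (h : IsSobolev (P.perforated ε) u p) :
    ∃ (v : E3 → ℝ) (q : E3 → E3), IsSobolev P.Ω v q ∧
      (∀ x ∈ P.Ω, (∀ k ∈ I, x ∉ scaledCopy ε k (tsupport ζ)) →
        x ∈ P.perforated ε ∧ v x = u x ∧ q x = p x) ∧
      ∀ k ∈ I, ∀ x ∈ scaledCopy ε k (tsupport ζ), ∃ z ∈ Icc (0 : ℝ) 1, ∃ ξ : E3,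
        ‖ξ‖ ≤ ε⁻¹ * B ∧ (x ∉ P.perforated ε → z = 1 ∧ ξ = 0) ∧
        v x = (1 - z) * u x + z * a k ∧ q x = (1 - z) • p x + (a k - u x) • ξ := by
  set ζs : (Fin 3 → ℤ) → E3 → ℝ := fun k x => ζ (ε⁻¹ • x - latticePt k) with hζs
  have hsm : ∀ k, ContDiff ℝ ∞ (ζs k) := fun k => hζ.comp (by fun_prop)
  have hts : ∀ k, tsupport (ζs k) ⊆ scaledCopy ε k (tsupport ζ) := fun k =>
    tsupport_rescale hζc hε _
  have hcs : ∀ k, HasCompactSupport (ζs k) := fun k =>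
    (hζc.isCompact.image (continuous_affMap ε _)).of_isClosed_subset (isClosed_tsupport _) (hts k)
  -- The extension is `(1 - G 1) * u + G a`. The supports of the rescaled cutoffs lie in disjoint
  -- cells, so near a point of a cell only one summand is present.
  set G : ((Fin 3 → ℤ) → ℝ) → E3 → ℝ := fun a x => ∑ k ∈ I, a k * ζs k x with hG
  have hGs : ∀ a, ContDiff ℝ ∞ (G a) := fun a =>
    ContDiff.sum fun k _ => contDiff_const.mul (hsm k)
  have hGc : ∀ a, HasCompactSupport (G a) := fun a => by
    refine HasCompactSupport.intro (K := ⋃ k ∈ I, tsupport (ζs k))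
      (I.finite_toSet.isCompact_biUnion fun k _ => (hcs k).isCompact) fun x hx => ?_
    refine Finset.sum_eq_zero fun k hk => ?_
    have : x ∉ tsupport (ζs k) := fun hx' => hx (mem_biUnion hk hx')
    rw [image_eq_zero_of_notMem_tsupport this, mul_zero]
  have hin : ∀ k ∈ I, ∀ x ∈ scaledCopy ε k unitCell, ∀ a, G a =ᶠ[𝓝 x] fun y => a k * ζs k y := by
    intro k hk x hx a
    have ho : IsOpen (scaledCopy ε k unitCell) := by
      rw [scaledCopy_eq, affMap_image hε]
      exact isOpen_unitCell.preimage (by fun_prop)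
    filter_upwards [ho.mem_nhds hx] with y hy
    refine Finset.sum_eq_single k (fun j _ hjk => ?_) fun h => absurd hk h
    have : y ∉ tsupport (ζs j) := fun h =>
      hjk (latticePt_eq_of_mem hε (image_mono hζY (hts j h)) hy)
    rw [image_eq_zero_of_notMem_tsupport this, mul_zero]
  have hout : ∀ x, (∀ k ∈ I, x ∉ scaledCopy ε k (tsupport ζ)) → ∀ a, G a =ᶠ[𝓝 x] fun _ => 0 := by
    intro x hx a
    have : ∀ᶠ y in 𝓝 x, ∀ k ∈ I, ζs k y = 0 := by
      rw [Filter.eventually_all_finset]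
      intro k hk
      exact notMem_tsupport_iff_eventuallyEq.1 fun h => hx k hk (hts k h)
    filter_upwards [this] with y hy
    exact Finset.sum_eq_zero fun k hk => by rw [hy k hk, mul_zero]
  have hhole : ∀ k, ∀ x ∈ scaledCopy ε k (closure P.hole), ζs k =ᶠ[𝓝 x] fun _ => 1 := by
    rintro k _ ⟨y, hy, rfl⟩
    have hc : ContinuousAt (fun x : E3 => ε⁻¹ • x - latticePt k) (affMap ε (latticePt k) y) := by
      fun_prop
    have := hζ1 y hy
    rw [← inv_affMap hε (latticePt k) y] at this
    exact hc.eventually this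
  have hsub : closure P.hole ⊆ tsupport ζ := fun x hx => subset_tsupport _ (by
    rw [Function.mem_support, (hζ1 x hx).self_of_nhds]; exact one_ne_zero)
  have hex : ∀ x ∈ P.Ω, x ∉ P.perforated ε → ∃ k ∈ I, x ∈ scaledCopy ε k (closure P.hole) := by
    intro x hx hx'
    have : x ∈ P.holes ε := by_contra fun h => hx' ⟨hx, h⟩
    simp only [holes, mem_iUnion] at this
    obtain ⟨k, hk, hxk⟩ := this
    exact ⟨k, (hI k).2 hk, hxk⟩
  -- `χ` vanishes near every hole, so that `χ * u` is a Sobolev function on the whole of `Ω`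
  -- whatever the values of `u` in the holes.
  set χ : E3 → ℝ := fun x => 1 - G (fun _ => 1) x with hχ
  have hχs : ContDiff ℝ ∞ χ := contDiff_const.sub (hGs _)
  obtain ⟨B₁, hB₁⟩ := (hGc fun _ => 1).exists_bound_of_continuous (hGs _).continuous
  obtain ⟨B₂, hB₂⟩ := (hasCompactSupport_gradVec (hGc fun _ => 1)).exists_bound_of_continuous
    (continuous_gradVec (hGs _))
  have h1 := h.cutoff (isOpen_perforated hP hε).measurableSet hP.Ω_open.measurableSet
    (P.perforated_subset ε) hχs (B := max (1 + B₁) B₂)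
    (fun x => by
      refine le_max_of_le_left ((abs_sub _ _).trans ?_)
      rw [abs_one]
      exact add_le_add le_rfl (hB₁ x))
    (fun x => by
      rw [hχ, gradVec_one_sub, norm_neg]
      exact le_max_of_le_right (hB₂ x))
    (fun x hx hx' => by
      obtain ⟨k, hk, hxk⟩ := hex x hx hx'
      rw [notMem_tsupport_iff_eventuallyEq]
      filter_upwards [hin k hk x (image_mono hP.hole_isolated hxk) fun _ => 1, hhole k x hxk]
        with y h1 h2
      simp [hχ, h1, h2])
  refine ⟨_, _, h1.add (isSobolev_of_contDiff (D := P.Ω) (hGs a) (hGc a)), fun x hx hxk => ?_,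
    fun k hk x hxk => ?_⟩
  · have e1 := hout x hxk
    refine ⟨by_contra fun h => ?_, ?_, ?_⟩
    · obtain ⟨k, hk, hxk'⟩ := hex x hx h
      exact hxk k hk (image_mono hsub hxk')
    · simp only [hχ]
      rw [(e1 _).self_of_nhds, (e1 _).self_of_nhds]
      ring
    · have e2 : ∀ a, gradVec (G a) x = 0 := fun a => by
        rw [gradVec_congr (e1 a)]
        ext i
        simp [gradVec_apply]
      simp only [hχ]
      rw [gradVec_one_sub, e2, e2, (e1 _).self_of_nhds]
      simp
  · have e1 := hin k hk x (image_mono hζY hxk)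
    have e2 : ∀ a, gradVec (G a) x = a k • gradVec (ζs k) x := fun a => by
      rw [gradVec_congr (e1 a), gradVec_const_mul _ ((hsm k).differentiable (by simp) x)]
    refine ⟨ζs k x, hζI _, gradVec (ζs k) x, ?_, fun hx => ?_, ?_, ?_⟩
    · rw [hζs, gradVec_rescale hζ, norm_smul, Real.norm_of_nonneg (by positivity)]
      exact mul_le_mul_of_nonneg_left (hB _) (by positivity)
    · have hxΩ : x ∈ P.Ω := (hI k).1 hk (image_mono hζY hxk)
      obtain ⟨j, hj, hxj⟩ := hex x hxΩ hx
      have : j = k := latticePt_eq_of_mem hε (image_mono hP.hole_isolated hxj) (image_mono hζY hxk)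
      subst this
      have e3 := hhole j x hxj
      refine ⟨e3.self_of_nhds, ?_⟩
      rw [gradVec_congr e3]
      ext i
      simp [gradVec_apply]
    · simp only [hχ]
      rw [(e1 _).self_of_nhds, (e1 _).self_of_nhds]
      ring
    · simp only [hχ]
      rw [gradVec_one_sub, e2, e2, (e1 _).self_of_nhds]
      simp only [one_mul]
      module

end Model

end Ferro

/-! ### Comparison of the perforated domain with `Ω`, cell by cell -/

namespace Ferro

theorem setLIntegral_le_sdiff_add_sum {ι : Type*} (I : Finset ι) (D : Set E3) (T : ι → Set E3)
    (f : E3 → ℝ≥0∞) :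
    ∫⁻ x in D, f x ≤ (∫⁻ x in D \ ⋃ k ∈ I, T k, f x) + ∑ k ∈ I, ∫⁻ x in D ∩ T k, f x := by
  have h1 : D ⊆ (D \ ⋃ k ∈ I, T k) ∪ ⋃ k : I, (D ∩ T k) := by
    intro x hx
    by_cases h : x ∈ ⋃ k ∈ I, T k
    · simp only [mem_iUnion] at h
      obtain ⟨k, hk, hxk⟩ := h
      exact Or.inr (mem_iUnion.2 ⟨⟨k, hk⟩, hx, hxk⟩)
    · exact Or.inl ⟨hx, h⟩
  refine (lintegral_mono_set h1).trans ((lintegral_union_le _ _ _).trans ?_)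
  gcongr
  refine (lintegral_iUnion_le _ _).trans (le_of_eq ?_)
  rw [tsum_fintype, Finset.sum_coe_sort I fun k => ∫⁻ x in D ∩ T k, f x]

theorem sum_setLIntegral_le {ι : Type*} {I : Finset ι} {U : Set E3} {S : ι → Set E3}
    (hS : ∀ k ∈ I, MeasurableSet (S k)) (hd : (I : Set ι).PairwiseDisjoint S)
    (hSU : ∀ k ∈ I, S k ⊆ U) (f : E3 → ℝ≥0∞) :
    ∑ k ∈ I, ∫⁻ x in S k, f x ≤ ∫⁻ x in U, f x := by
  rw [← lintegral_biUnion_finset hd hS]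
  exact lintegral_mono_set (iUnion₂_subset hSU)

theorem enorm_convex_sub_le {z : ℝ} (hz : z ∈ Icc (0 : ℝ) 1) (a b : ℝ) :
    ‖a - ((1 - z) * a + z * b)‖ₑ ≤ ‖a - b‖ₑ := by
  rw [show a - ((1 - z) * a + z * b) = z * (a - b) by ring, enorm_mul]
  refine mul_le_of_le_one_left zero_le ?_
  rw [Real.enorm_eq_ofReal hz.1]
  exact ENNReal.ofReal_le_one.2 hz.2

theorem enorm_smul_le_of_mem_Icc {Z : Type*} [NormedAddCommGroup Z] [NormedSpace ℝ Z] {z : ℝ}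
    (hz : z ∈ Icc (0 : ℝ) 1) (a : Z) : ‖z • a‖ₑ ≤ ‖a‖ₑ := by
  rw [enorm_smul]
  refine mul_le_of_le_one_left zero_le ?_
  rw [Real.enorm_eq_ofReal hz.1]
  exact ENNReal.ofReal_le_one.2 hz.2

namespace Model

variable {P : Model}

/-- The period is bounded if some cell fits into the domain. -/
theorem exists_period_bound (hP : P.Admissible) : ∃ E : ℝ≥0, ∀ ε : ℝ, 0 < ε →
    ∀ k, scaledCopy ε k unitCell ⊆ P.Ω → ENNReal.ofReal ε ≤ E := by
  have hY : volume unitCell ≠ 0 := (isOpen_unitCell.measure_pos volume ⟨_, center_mem_unitCell⟩).ne'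
  have hY' : volume unitCell ≠ ⊤ := isBounded_unitCell.measure_lt_top.ne
  have hΩ : volume P.Ω ≠ ⊤ := hP.Ω_bounded.measure_lt_top.ne
  refine ⟨(1 + volume P.Ω / volume unitCell).toNNReal, fun ε hε k hk => ?_⟩
  rw [ENNReal.coe_toNNReal (by finiteness)]
  have h1 := measure_mono (μ := volume) hk
  rw [scaledCopy_eq, ← setLIntegral_one, lintegral_affMap_image hε, setLIntegral_one] at h1
  have h2 : ENNReal.ofReal (ε ^ 3) ≤ volume P.Ω / volume unitCell :=
    (ENNReal.le_div_iff_mul_le (Or.inl hY) (Or.inl hY')).2 h1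
  -- Comparing volumes bounds only `ε ^ 3`; this passes to `ε` without a cube root.
  have h3 : ε ≤ 1 + ε ^ 3 := by
    rcases le_total ε 1 with h | h
    · have : 0 < ε ^ 3 := by positivity
      linarith
    · nlinarith [mul_self_nonneg ε]
  calc ENNReal.ofReal ε ≤ ENNReal.ofReal (1 + ε ^ 3) := ENNReal.ofReal_le_ofReal h3
    _ = 1 + ENNReal.ofReal (ε ^ 3) := by
      rw [ENNReal.ofReal_add one_pos.le (by positivity), ENNReal.ofReal_one]
    _ ≤ _ := by gcongr

/-- In the cell `k` the function `v` is $(1-\zeta)u+\zeta a_k$, where `a k` is the average given by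
`exists_scaled_poincare`. It need not agree with `u` where the cutoff is nonzero. The gradient of
the cutoff is of size $\epsilon^{-1}$ but multiplies $u-a_k$, which is of size $\epsilon|\nabla u|$
in $L^2$. Since $|u-v|\le|u-a_k|$, the $L^4$ norm of `u` is recovered from that of `v` and the
scaled Poincaré–Sobolev inequality. -/
theorem exists_sq_four_bound (hP : P.Admissible) : ∃ M : ℝ≥0, 1 ≤ M ∧ ∀ ε : ℝ, 0 < ε →
    ∀ (u : E3 → ℝ) (p : E3 → E3), IsSobolev (P.perforated ε) u p → ∃ v q, IsSobolev P.Ω v q ∧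
      (∫⁻ x in P.Ω, ‖v x‖ₑ ^ 2 ≤ M * ∫⁻ x in P.perforated ε, ‖u x‖ₑ ^ 2) ∧
      (∫⁻ x in P.Ω, ‖q x‖ₑ ^ 2 ≤ M * ∫⁻ x in P.perforated ε, ‖p x‖ₑ ^ 2) ∧
      ∫⁻ x in P.perforated ε, ‖u x‖ₑ ^ 4
        ≤ M * ((∫⁻ x in P.Ω, ‖v x‖ₑ ^ 4) + (∫⁻ x in P.perforated ε, ‖p x‖ₑ ^ 2) ^ 2) := by
  obtain ⟨ζ, hζ, hζc, hζY, hζ1, hζI⟩ := exists_cutoff hP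
  obtain ⟨B₀, hB₀⟩ := (hasCompactSupport_gradVec hζc).exists_bound_of_continuous
    (continuous_gradVec hζ)
  set B : ℝ≥0 := B₀.toNNReal
  have hB : ∀ x, ‖gradVec ζ x‖ ≤ B := fun x => (hB₀ x).trans (Real.le_coe_toNNReal _)
  set D : Set E3 := unitCell \ closure P.hole with hD
  have hDo : IsOpen D := isOpen_unitCell.sdiff isClosed_closure
  obtain ⟨C, hC⟩ := exists_scaled_poincare (D := D) (Q := tsupport ζ) hDo
    (isBounded_unitCell.subset sdiff_subset) hP.cell_connected hζc.isCompact
    fun x hx => localCones_cell hP (hζY hx)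
  obtain ⟨E, hE⟩ := exists_period_bound hP
  refine ⟨9 + 2 * C + 2 * B ^ 2 * C + 8 * C * E, ?_, fun ε hε u p h => ?_⟩
  · exact le_add_right (le_add_right (le_add_right (by norm_num)))
  set U := P.perforated ε with hU
  have hUm : MeasurableSet U := (isOpen_perforated hP hε).measurableSet
  set I : Finset (Fin 3 → ℤ) := (finite_cells hP hε).toFinset with hIdef
  have hI : ∀ k, k ∈ I ↔ scaledCopy ε k unitCell ⊆ P.Ω := fun k => by simp [hIdef]
  have hDU : ∀ k ∈ I, scaledCopy ε k D ⊆ U := fun k hk =>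
    scaledCopy_subset_perforated hP hε ((hI k).1 hk)
  -- For cells that are not contained in `Ω` the constant is set to zero and plays no role.
  have hex : ∀ k : Fin 3 → ℤ, ∃ a : ℝ, k ∈ I →
      (∫⁻ _ in scaledCopy ε k (tsupport ζ), ‖a‖ₑ ^ 2
        ≤ C * ∫⁻ x in scaledCopy ε k D, ‖u x‖ₑ ^ 2) ∧
      (∫⁻ x in scaledCopy ε k (tsupport ζ ∩ D), ‖u x - a‖ₑ ^ 2
        ≤ C * ENNReal.ofReal ε ^ 2 * ∫⁻ x in scaledCopy ε k D, ‖p x‖ₑ ^ 2) ∧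
      ∫⁻ x in scaledCopy ε k (tsupport ζ ∩ D), ‖u x - a‖ₑ ^ 4
        ≤ C * ENNReal.ofReal ε * (∫⁻ x in scaledCopy ε k D, ‖p x‖ₑ ^ 2) ^ 2 := by
    intro k
    by_cases hk : k ∈ I
    · obtain ⟨a, ha⟩ := hC ε hε (latticePt k) u p (h.mono hUm (hDU k hk))
      exact ⟨a, fun _ => ha⟩
    · exact ⟨0, fun h => absurd h hk⟩
  choose a ha using hex
  obtain ⟨v, q, hvq, hout, hin⟩ := exists_extension hP hζ hζc hζY hζ1 hζI hB hε hI a h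
  set T : (Fin 3 → ℤ) → Set E3 := fun k => scaledCopy ε k (tsupport ζ) with hT
  set S : (Fin 3 → ℤ) → Set E3 := fun k => scaledCopy ε k (tsupport ζ ∩ D) with hS
  have hmeas : ∀ {R : Set E3} k, MeasurableSet R → MeasurableSet (scaledCopy ε k R) := fun k hR =>
    (measurableEmbedding_affMap hε (latticePt k)).measurableSet_image.2 hR
  have hTm : ∀ k, MeasurableSet (T k) := fun k => hmeas k (isClosed_tsupport ζ).measurableSet
  have hSm : ∀ k, MeasurableSet (S k) := fun k =>
    hmeas k ((isClosed_tsupport ζ).measurableSet.inter hDo.measurableSet)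
  have hdisj : ∀ {R : Set E3}, R ⊆ unitCell →
      (I : Set (Fin 3 → ℤ)).PairwiseDisjoint fun k => scaledCopy ε k R := by
    intro R hR k _ j _ hkj
    exact disjoint_left.2 fun x hx hx' =>
      hkj (latticePt_eq_of_mem hε (image_mono hR hx) (image_mono hR hx'))
  have hST : ∀ k, S k ⊆ T k := fun k => image_mono inter_subset_left
  have hSD : ∀ k, S k ⊆ scaledCopy ε k D := fun k => image_mono inter_subset_right
  -- Within the support of the cutoff, points of the perforated domain are those outside the hole of
  -- the same cell.
  have hTS : ∀ k ∈ I, ∀ x ∈ T k, x ∈ U → x ∈ S k := by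
    rintro k hk _ ⟨y, hy, rfl⟩ hx
    refine ⟨y, ⟨hy, hζY hy, fun hy' => hx.2 ?_⟩, rfl⟩
    exact mem_biUnion (x := k) ((hI k).1 hk) ⟨y, hy', rfl⟩
  have hsumD : ∀ f : E3 → ℝ≥0∞, ∑ k ∈ I, ∫⁻ x in scaledCopy ε k D, f x ≤ ∫⁻ x in U, f x :=
    sum_setLIntegral_le (fun k _ => hmeas k hDo.measurableSet) (hdisj sdiff_subset) hDU
  have hsumS : ∀ f : E3 → ℝ≥0∞, ∑ k ∈ I, ∫⁻ x in S k, f x ≤ ∫⁻ x in U, f x := fun f =>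
    (Finset.sum_le_sum fun k _ => lintegral_mono_set (hSD k)).trans (hsumD f)
  have hoff : ∀ x ∈ P.Ω \ ⋃ k ∈ I, T k, x ∈ U ∧ v x = u x ∧ q x = p x := fun x hx =>
    hout x hx.1 fun k hk hxk => hx.2 (mem_biUnion hk hxk)
  have hoffm : MeasurableSet (P.Ω \ ⋃ k ∈ I, T k) :=
    hP.Ω_open.measurableSet.diff (I.measurableSet_biUnion fun k _ => hTm k)
  have hindS : ∀ (k) (f : E3 → ℝ≥0∞), ∫⁻ x in T k, (S k).indicator f x = ∫⁻ x in S k, f x := by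
    intro k f
    rw [setLIntegral_indicator (hSm k), inter_eq_left.2 (hST k)]
  refine ⟨v, q, hvq, ?_, ?_, ?_⟩
  · refine (setLIntegral_le_sdiff_add_sum I P.Ω T _).trans ?_
    have h1 : ∫⁻ x in P.Ω \ ⋃ k ∈ I, T k, ‖v x‖ₑ ^ 2 ≤ ∫⁻ x in U, ‖u x‖ₑ ^ 2 := by
      rw [setLIntegral_congr_fun (g := fun x => ‖u x‖ₑ ^ 2) hoffm fun x hx => by
        simp only [(hoff x hx).2.1]]
      exact lintegral_mono_set fun x hx => (hoff x hx).1
    have h2 : ∀ k ∈ I, ∫⁻ x in P.Ω ∩ T k, ‖v x‖ₑ ^ 2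
        ≤ 2 * (∫⁻ x in S k, ‖u x‖ₑ ^ 2) + 2 * C * ∫⁻ x in scaledCopy ε k D, ‖u x‖ₑ ^ 2 := by
      intro k hk
      refine (lintegral_mono_set inter_subset_right).trans ?_
      calc ∫⁻ x in T k, ‖v x‖ₑ ^ 2
          ≤ ∫⁻ x in T k, (2 * (S k).indicator (fun x => ‖u x‖ₑ ^ 2) x + 2 * ‖a k‖ₑ ^ 2) := by
            refine setLIntegral_mono' (hTm k) fun x hx => ?_
            obtain ⟨z, hz, ξ, hξ, hxU, hv, -⟩ := hin k hk x hx
            rw [hv, ← mul_add]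
            refine (enorm_add_sq_le _ _).trans ?_
            gcongr
            · by_cases hxU' : x ∈ U
              · rw [indicator_of_mem (hTS k hk x hx hxU')]
                gcongr
                exact enorm_smul_le_of_mem_Icc ⟨sub_nonneg.2 hz.2, by linarith [hz.1]⟩ (u x)
              · simp [(hxU hxU').1]
            · exact enorm_smul_le_of_mem_Icc hz (a k)
        _ = 2 * (∫⁻ x in S k, ‖u x‖ₑ ^ 2) + 2 * ∫⁻ _ in T k, ‖a k‖ₑ ^ 2 := by
            rw [lintegral_add_right _ measurable_const, lintegral_const_mul' _ _ (by finiteness),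
              hindS, lintegral_const_mul' _ _ (by finiteness)]
        _ ≤ _ := by
            rw [mul_assoc 2]
            gcongr
            exact (ha k hk).1
    calc _ ≤ (∫⁻ x in U, ‖u x‖ₑ ^ 2) + ∑ k ∈ I, (2 * (∫⁻ x in S k, ‖u x‖ₑ ^ 2)
          + 2 * C * ∫⁻ x in scaledCopy ε k D, ‖u x‖ₑ ^ 2) := by
          gcongr with k hk
          exact h2 k hk
      _ ≤ (∫⁻ x in U, ‖u x‖ₑ ^ 2) + (2 * (∫⁻ x in U, ‖u x‖ₑ ^ 2)
          + 2 * C * ∫⁻ x in U, ‖u x‖ₑ ^ 2) := by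
          rw [Finset.sum_add_distrib, ← Finset.mul_sum, ← Finset.mul_sum]
          gcongr
          · exact hsumS _
          · exact hsumD _
      _ = (3 + 2 * C : ℝ≥0) * ∫⁻ x in U, ‖u x‖ₑ ^ 2 := by push_cast; ring
      _ ≤ _ := by
          refine mul_le_mul' (ENNReal.coe_le_coe.2 (le_add_right (le_add_right ?_))) le_rfl
          exact add_le_add (by norm_num) le_rfl
  · refine (setLIntegral_le_sdiff_add_sum I P.Ω T _).trans ?_
    have h1 : ∫⁻ x in P.Ω \ ⋃ k ∈ I, T k, ‖q x‖ₑ ^ 2 ≤ ∫⁻ x in U, ‖p x‖ₑ ^ 2 := by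
      rw [setLIntegral_congr_fun (g := fun x => ‖p x‖ₑ ^ 2) hoffm fun x hx => by
        simp only [(hoff x hx).2.2]]
      exact lintegral_mono_set fun x hx => (hoff x hx).1
    have h2 : ∀ k ∈ I, ∫⁻ x in P.Ω ∩ T k, ‖q x‖ₑ ^ 2
        ≤ 2 * (∫⁻ x in S k, ‖p x‖ₑ ^ 2)
          + 2 * B ^ 2 * C * ∫⁻ x in scaledCopy ε k D, ‖p x‖ₑ ^ 2 := by
      intro k hk
      refine (lintegral_mono_set inter_subset_right).trans ?_
      set b : ℝ≥0∞ := ENNReal.ofReal (ε⁻¹ * B) with hb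
      -- Here the factor $\epsilon^{-1}$ of the cutoff cancels the factor $\epsilon$ of the Poincaré
      -- inequality.
      have hbε : b ^ 2 * ENNReal.ofReal ε ^ 2 = B ^ 2 := by
        rw [← mul_pow, hb, ← ENNReal.ofReal_mul (by positivity)]
        congr 1
        rw [show ε⁻¹ * (B : ℝ) * ε = B by field_simp, ENNReal.ofReal_coe_nnreal]
      have hum : AEMeasurable (fun x => ‖p x‖ₑ ^ 2) (volume.restrict (S k)) :=
        (h.memLp_grad.1.mono_measure (Measure.restrict_mono ((hSD k).trans (hDU k hk)) le_rfl)
          ).enorm.pow_const 2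
      calc ∫⁻ x in T k, ‖q x‖ₑ ^ 2
          ≤ ∫⁻ x in T k, (S k).indicator
              (fun x => 2 * ‖p x‖ₑ ^ 2 + 2 * b ^ 2 * ‖u x - a k‖ₑ ^ 2) x := by
            refine setLIntegral_mono' (hTm k) fun x hx => ?_
            obtain ⟨z, hz, ξ, hξ, hxU, -, hq⟩ := hin k hk x hx
            rw [hq]
            by_cases hxU' : x ∈ U
            · rw [indicator_of_mem (hTS k hk x hx hxU'), mul_assoc, ← mul_add]
              refine (enorm_add_sq_le _ _).trans ?_
              gcongr
              · exact enorm_smul_le_of_mem_Icc ⟨sub_nonneg.2 hz.2, by linarith [hz.1]⟩ (p x)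
              · rw [enorm_smul, ← mul_pow, mul_comm, ← enorm_neg (a k - u x), neg_sub]
                gcongr
                rw [← ofReal_norm]
                exact ENNReal.ofReal_le_ofReal hξ
            · simp [(hxU hxU').1, (hxU hxU').2]
        _ = 2 * (∫⁻ x in S k, ‖p x‖ₑ ^ 2) + 2 * b ^ 2 * ∫⁻ x in S k, ‖u x - a k‖ₑ ^ 2 := by
            rw [hindS, lintegral_add_left' (hum.const_mul 2),
              lintegral_const_mul' _ _ (by finiteness), lintegral_const_mul' _ _ (by finiteness)]
        _ ≤ 2 * (∫⁻ x in S k, ‖p x‖ₑ ^ 2) + 2 * b ^ 2 *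
              (C * ENNReal.ofReal ε ^ 2 * ∫⁻ x in scaledCopy ε k D, ‖p x‖ₑ ^ 2) := by
            gcongr
            exact (ha k hk).2.1
        _ = _ := by rw [← hbε]; ring
    calc _ ≤ (∫⁻ x in U, ‖p x‖ₑ ^ 2) + ∑ k ∈ I, (2 * (∫⁻ x in S k, ‖p x‖ₑ ^ 2)
          + 2 * B ^ 2 * C * ∫⁻ x in scaledCopy ε k D, ‖p x‖ₑ ^ 2) := by
          gcongr with k hk
          exact h2 k hk
      _ ≤ (∫⁻ x in U, ‖p x‖ₑ ^ 2) + (2 * (∫⁻ x in U, ‖p x‖ₑ ^ 2)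
          + 2 * B ^ 2 * C * ∫⁻ x in U, ‖p x‖ₑ ^ 2) := by
          rw [Finset.sum_add_distrib, ← Finset.mul_sum, ← Finset.mul_sum]
          gcongr
          · exact hsumS _
          · exact hsumD _
      _ = (3 + 2 * B ^ 2 * C : ℝ≥0) * ∫⁻ x in U, ‖p x‖ₑ ^ 2 := by push_cast; ring
      _ ≤ _ := by
          refine mul_le_mul' (ENNReal.coe_le_coe.2 (le_add_right ?_)) le_rfl
          exact add_le_add (le_add_right (by norm_num)) le_rfl
  · refine (setLIntegral_le_sdiff_add_sum I U T _).trans ?_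
    have hUm' : MeasurableSet (U \ ⋃ k ∈ I, T k) :=
      hUm.diff (I.measurableSet_biUnion fun k _ => hTm k)
    have h1 : ∫⁻ x in U \ ⋃ k ∈ I, T k, ‖u x‖ₑ ^ 4 ≤ ∫⁻ x in P.Ω, ‖v x‖ₑ ^ 4 := by
      rw [setLIntegral_congr_fun (g := fun x => ‖v x‖ₑ ^ 4) hUm' fun x hx => by
        simp only [(hoff x ⟨P.perforated_subset ε hx.1, hx.2⟩).2.1]]
      exact lintegral_mono_set (sdiff_subset.trans (P.perforated_subset ε))
    have h2 : ∀ k ∈ I, ∫⁻ x in U ∩ T k, ‖u x‖ₑ ^ 4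
        ≤ 8 * (∫⁻ x in S k, ‖v x‖ₑ ^ 4)
          + 8 * C * E * (∫⁻ x in scaledCopy ε k D, ‖p x‖ₑ ^ 2) ^ 2 := by
      intro k hk
      have hvm : AEMeasurable (fun x => ‖v x‖ₑ ^ 4) (volume.restrict (S k)) :=
        (hvq.memLp.1.mono_measure (Measure.restrict_mono (((hSD k).trans (hDU k hk)).trans
          (P.perforated_subset ε)) le_rfl)).enorm.pow_const 4
      calc ∫⁻ x in U ∩ T k, ‖u x‖ₑ ^ 4 ≤ ∫⁻ x in S k, ‖u x‖ₑ ^ 4 :=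
            lintegral_mono_set fun x hx => hTS k hk x hx.2 hx.1
        _ ≤ ∫⁻ x in S k, (8 * ‖v x‖ₑ ^ 4 + 8 * ‖u x - a k‖ₑ ^ 4) := by
            refine setLIntegral_mono' (hSm k) fun x hx => ?_
            obtain ⟨z, hz, ξ, hξ, hxU, hv, -⟩ := hin k hk x (hST k hx)
            have h3 : ‖u x‖ₑ ≤ ‖v x‖ₑ + ‖u x - a k‖ₑ := by
              calc ‖u x‖ₑ = ‖v x + (u x - v x)‖ₑ := by rw [add_sub_cancel]
                _ ≤ ‖v x‖ₑ + ‖u x - v x‖ₑ := enorm_add_le _ _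
                _ ≤ _ := by
                  gcongr
                  rw [hv]
                  exact enorm_convex_sub_le hz _ _
            refine (pow_le_pow_left' h3 4).trans ((ennreal_add_pow_le _ _ (by norm_num)).trans ?_)
            rw [← mul_add]
            norm_num
        _ = 8 * (∫⁻ x in S k, ‖v x‖ₑ ^ 4) + 8 * ∫⁻ x in S k, ‖u x - a k‖ₑ ^ 4 := by
            rw [lintegral_add_left' (hvm.const_mul 8),
              lintegral_const_mul' _ _ (by finiteness), lintegral_const_mul' _ _ (by finiteness)]
        _ ≤ 8 * (∫⁻ x in S k, ‖v x‖ₑ ^ 4)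
            + 8 * (C * E * (∫⁻ x in scaledCopy ε k D, ‖p x‖ₑ ^ 2) ^ 2) := by
            gcongr
            refine (ha k hk).2.2.trans ?_
            gcongr
            exact hE ε hε k ((hI k).1 hk)
        _ = _ := by ring
    calc _ ≤ (∫⁻ x in P.Ω, ‖v x‖ₑ ^ 4) + ∑ k ∈ I, (8 * (∫⁻ x in S k, ‖v x‖ₑ ^ 4)
          + 8 * C * E * (∫⁻ x in scaledCopy ε k D, ‖p x‖ₑ ^ 2) ^ 2) := by
          gcongr with k hk
          exact h2 k hk
      _ ≤ (∫⁻ x in P.Ω, ‖v x‖ₑ ^ 4) + (8 * (∫⁻ x in P.Ω, ‖v x‖ₑ ^ 4)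
          + 8 * C * E * (∫⁻ x in U, ‖p x‖ₑ ^ 2) ^ 2) := by
          rw [Finset.sum_add_distrib, ← Finset.mul_sum, ← Finset.mul_sum]
          gcongr
          · exact (hsumS _).trans (lintegral_mono_set (P.perforated_subset ε))
          -- A sum of squares of nonnegative numbers is at most the square of their sum: one factor
          -- is bounded by the total Dirichlet integral and the rest summed over the disjoint cells.
          · calc ∑ k ∈ I, (∫⁻ x in scaledCopy ε k D, ‖p x‖ₑ ^ 2) ^ 2
                ≤ ∑ k ∈ I, (∫⁻ x in scaledCopy ε k D, ‖p x‖ₑ ^ 2) * ∫⁻ x in U, ‖p x‖ₑ ^ 2 := by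
                  gcongr with k hk
                  rw [sq]
                  gcongr
                  exact hDU k hk
              _ ≤ _ := by
                  rw [← Finset.sum_mul, sq]
                  gcongr
                  exact hsumD _
      _ = (9 : ℝ≥0) * (∫⁻ x in P.Ω, ‖v x‖ₑ ^ 4)
          + (8 * C * E : ℝ≥0) * (∫⁻ x in U, ‖p x‖ₑ ^ 2) ^ 2 := by push_cast; ring
      _ ≤ _ := by
          rw [mul_add]
          gcongr
          · exact le_add_right (le_add_right (le_add_right le_rfl))
          · exact le_add_left le_rfl

/-- The embedding of `H¹` of the perforated domain into `L⁴`, uniformly in the period. -/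
theorem exists_uniform_sobolev (hP : P.Admissible) : ∃ C : ℝ≥0, ∀ ε : ℝ, 0 < ε →
    ∀ (u : E3 → ℝ) (p : E3 → E3), IsSobolev (P.perforated ε) u p →
      eLpNorm u 4 (volume.restrict (P.perforated ε))
        ≤ C * (eLpNorm u 2 (volume.restrict (P.perforated ε))
          + eLpNorm p 2 (volume.restrict (P.perforated ε))) := by
  obtain ⟨M, hM1, hM⟩ := exists_sq_four_bound hP
  obtain ⟨C, hC⟩ := exists_sobolev_of_smoothBoundary hP.Ω_open hP.Ω_bounded hP.Ω_smooth
  refine ⟨M * ((2 * C * M) ^ 4 + 1), fun ε hε u p h => ?_⟩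
  obtain ⟨v, q, hvq, h1, h2, h3⟩ := hM ε hε u p h
  have h4 := hC v q hvq
  set U := P.perforated ε
  set N := eLpNorm u 2 (volume.restrict U) + eLpNorm p 2 (volume.restrict U) with hN
  -- `1 ≤ M` gives `M ≤ M ^ 2`, so roots are taken without introducing the root of `M`.
  have hsq : ∀ {X Y : ℝ≥0∞}, X ^ 2 ≤ M * Y ^ 2 → X ≤ M * Y := by
    intro X Y hXY
    rw [← ENNReal.pow_le_pow_left_iff two_ne_zero, mul_pow]
    refine hXY.trans ?_
    gcongr
    exact_mod_cast le_self_pow₀ hM1 two_ne_zero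
  simp only [← eLpNorm_two_sq, ← eLpNorm_four_pow] at h1 h2 h3
  have h5 : eLpNorm v 4 (volume.restrict P.Ω) ≤ 2 * C * M * N := by
    refine h4.trans ?_
    calc C * (eLpNorm v 2 (volume.restrict P.Ω) + eLpNorm q 2 (volume.restrict P.Ω))
        ≤ C * (M * N + M * N) := by
          gcongr
          · exact (hsq h1).trans (by gcongr; exact le_add_right le_rfl)
          · exact (hsq h2).trans (by gcongr; exact le_add_left le_rfl)
      _ = _ := by ring
  have hK : 1 ≤ M * ((2 * C * M) ^ 4 + 1) := le_mul_of_one_le_of_le hM1 (le_add_left le_rfl)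
  rw [← ENNReal.pow_le_pow_left_iff (n := 4) (by norm_num)]
  refine h3.trans ?_
  calc M * (eLpNorm v 4 (volume.restrict P.Ω) ^ 4 + (eLpNorm p 2 (volume.restrict U) ^ 2) ^ 2)
      ≤ M * ((2 * C * M * N : ℝ≥0∞) ^ 4 + N ^ 4) := by
        rw [← pow_mul]
        refine mul_le_mul' le_rfl (add_le_add (pow_le_pow_left' h5 4) ?_)
        exact pow_le_pow_left' (le_add_left le_rfl) 4
    _ = (M * ((2 * C * M) ^ 4 + 1) : ℝ≥0) * N ^ 4 := by push_cast; ring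
    _ ≤ _ := by
        rw [mul_pow _ N]
        refine mul_le_mul' ?_ le_rfl
        exact_mod_cast le_self_pow₀ hK (by norm_num)

end Model

end Ferro

namespace Ferro

/-! ### Mollification and the chain rule -/

theorem exists_translate_sub_le {q : E3 → ℝ} (hq : Integrable q) {η : ℝ≥0∞} (hη : η ≠ 0) :
    ∃ δ > 0, ∀ z : E3, ‖z‖ < δ → ∫⁻ x, ‖q (x + z) - q x‖ₑ ≤ η := by
  have hq1 : MemLp q 1 := memLp_one_iff_integrable.2 hq
  let σ : E3 → C(E3, E3) := fun z => ⟨fun x => x + z, by fun_prop⟩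
  have hσ : Continuous σ := by
    apply ContinuousMap.continuous_of_continuous_uncurry
    exact continuous_snd.add continuous_fst
  have hmp : ∀ z, MeasurePreserving (σ z) (volume : Measure E3) volume := fun z =>
    measurePreserving_add_right volume z
  have hc : Continuous fun z => Lp.compMeasurePreserving (σ z) (hmp z) (hq1.toLp q) :=
    Continuous.compMeasurePreservingLp continuous_const hσ hmp (by simp)
  have he : ∀ z, edist (Lp.compMeasurePreserving (σ z) (hmp z) (hq1.toLp q)) (hq1.toLp q)
      = ∫⁻ x, ‖q (x + z) - q x‖ₑ := by
    intro z
    rw [Lp.edist_def, eLpNorm_one_eq_lintegral_enorm]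
    refine lintegral_congr_ae ?_
    filter_upwards [Lp.coeFn_compMeasurePreserving (hq1.toLp q) (hmp z), hq1.coeFn_toLp,
      (hmp z).quasiMeasurePreserving.ae_eq_comp hq1.coeFn_toLp] with x h1 h2 h3
    rw [Pi.sub_apply, h1, h2, h3]
    rfl
  have h0 : Lp.compMeasurePreserving (σ 0) (hmp 0) (hq1.toLp q) = hq1.toLp q := by
    rw [← edist_eq_zero, he]
    simp
  have ht := hc.tendsto 0
  rw [h0, EMetric.tendsto_nhds] at ht
  obtain ⟨δ, hδ, h⟩ := Metric.eventually_nhds_iff.1 (ht η (pos_iff_ne_zero.2 hη))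
  refine ⟨δ, hδ, fun z hz => ?_⟩
  rw [← he]
  exact (h (by simpa using hz)).le

theorem kernelAt_add (x z : E3) (ρ : ℝ) : kernelAt x ρ (x + z) = kernelAt 0 ρ z := by
  simp [kernelAt]

theorem localAvg_eq_indicator {U : Set E3} (hU : MeasurableSet U) (q : E3 → ℝ) (c : E3) (ρ : ℝ) :
    localAvg U q c ρ = localAvg univ (U.indicator q) c ρ := by
  rw [localAvg, localAvg, Measure.restrict_univ, ← integral_indicator hU]
  refine integral_congr_ae (Eventually.of_forall fun y => ?_)
  by_cases hy : y ∈ U <;> simp [hy]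

/-- The kernel has mass one and small support, so by Fubini the $L^1$ error is at most the largest
$L^1$ distance between `q` and a small translate of it. -/
theorem tendsto_lintegral_localAvg_sub {q : E3 → ℝ} (hq : Integrable q) {s : ℕ → ℝ}
    (hs : ∀ n, 0 < s n) (hs0 : Tendsto s atTop (𝓝 0)) :
    Tendsto (fun n => ∫⁻ x, ‖localAvg univ q x (s n) - q x‖ₑ) atTop (𝓝 0) := by
  rw [ENNReal.tendsto_nhds_zero]
  intro η hη
  obtain ⟨δ, hδ, h⟩ := exists_translate_sub_le hq hη.ne'
  filter_upwards [hs0.eventually (gt_mem_nhds hδ)] with n hn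
  have hk := (contDiff_kernelAt 0 (s n)).continuous
  have hki : Integrable (kernelAt 0 (s n)) :=
    hk.integrable_of_hasCompactSupport (hasCompactSupport_kernelAt (hs n))
  have hint : ∀ x, Integrable fun z => q (x + z) * kernelAt 0 (s n) z := fun x =>
    (hq.comp_add_left x).mul_bdd (c := mollifierBound * (s n)⁻¹ ^ 3) hk.aestronglyMeasurable
      (Eventually.of_forall fun z => by
        rw [Real.norm_of_nonneg (kernelAt_nonneg _ (hs n) _)]
        exact kernelAt_le _ (hs n) _)
  have h1 : ∀ x, ‖localAvg univ q x (s n) - q x‖ₑ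
      ≤ ∫⁻ z, ENNReal.ofReal (kernelAt 0 (s n) z) * ‖q (x + z) - q x‖ₑ := by
    intro x
    have e1 : localAvg univ q x (s n) = ∫ z, q (x + z) * kernelAt 0 (s n) z := by
      rw [localAvg, Measure.restrict_univ, ← integral_add_left_eq_self _ x]
      simp_rw [kernelAt_add]
    have e2 : localAvg univ q x (s n) - q x
        = ∫ z, (q (x + z) * kernelAt 0 (s n) z - q x * kernelAt 0 (s n) z) := by
      rw [integral_sub (hint x) (hki.const_mul _), e1, integral_const_mul,
        integral_kernelAt _ (hs n), mul_one]
    rw [e2]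
    refine (enorm_integral_le_lintegral_enorm _).trans (lintegral_mono fun z => ?_)
    rw [← sub_mul, enorm_mul, Real.enorm_eq_ofReal (kernelAt_nonneg _ (hs n) _), mul_comm]
  have hmeas : AEMeasurable (Function.uncurry fun x z : E3 =>
      ENNReal.ofReal (kernelAt 0 (s n) z) * ‖q (x + z) - q x‖ₑ) (volume.prod volume) := by
    refine AEMeasurable.mul (by fun_prop) (AEStronglyMeasurable.enorm ?_)
    refine AEStronglyMeasurable.sub ?_ hq.1.comp_fst
    exact hq.1.comp_quasiMeasurePreserving (quasiMeasurePreserving_add volume volume)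
  calc ∫⁻ x, ‖localAvg univ q x (s n) - q x‖ₑ
      ≤ ∫⁻ x, ∫⁻ z, ENNReal.ofReal (kernelAt 0 (s n) z) * ‖q (x + z) - q x‖ₑ := lintegral_mono h1
    _ = ∫⁻ z, ∫⁻ x, ENNReal.ofReal (kernelAt 0 (s n) z) * ‖q (x + z) - q x‖ₑ :=
        lintegral_lintegral_swap hmeas
    _ ≤ ∫⁻ z, ENNReal.ofReal (kernelAt 0 (s n) z) * η := by
        refine lintegral_mono fun z => ?_
        rw [lintegral_const_mul' _ _ ENNReal.ofReal_ne_top]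
        by_cases hz : z ∈ Metric.ball (0 : E3) (s n)
        · rw [mem_ball_zero_iff] at hz
          exact mul_le_mul' le_rfl (h z (hz.trans hn))
        · simp [kernelAt_eq_zero (hs n) hz]
    _ = η := by
        rw [lintegral_mul_const _ (by fun_prop), ← ofReal_integral_eq_lintegral_ofReal hki
          (Eventually.of_forall fun z => kernelAt_nonneg _ (hs n) z),
          integral_kernelAt _ (hs n), ENNReal.ofReal_one, one_mul]

/-- The path formula `hasDerivAt_localAvg_path` with constant radius: the derivative of the
mollification is the mollification of the weak derivative. -/
theorem hasLineDerivAt_localAvg {D : Set E3} {u : E3 → ℝ} {p : E3 → E3}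
    (hu : IntegrableOn u D) (hp : IntegrableOn p D) (hw : HasWeakGradient D u p)
    {x : E3} {ρ : ℝ} (hρ : 0 < ρ) (hball : Metric.closedBall x ρ ⊆ D) (i : Fin 3) :
    HasLineDerivAt ℝ (fun x => localAvg D u x ρ) (localAvg D (fun y => p y i) x ρ) x
      (basisVec i) := by
  have h := hasDerivAt_localAvg_path hu hp hw x (basisVec i) ρ 0 0 (by simpa using hρ)
    (by simpa using hball)
  simp only [mul_zero, add_zero, zero_smul] at h
  have e : ∀ y, inner ℝ (p y) (basisVec i) = p y i := fun y => by
    simp [basisVec, EuclideanSpace.inner_single_right]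
  simp only [e] at h
  exact h

/-- The chain rule for the composition with a bounded function with bounded derivative. -/
theorem HasWeakGradient.comp {U : Set E3} (hU : IsOpen U) {u : E3 → ℝ} {p : E3 → E3}
    (hu : IntegrableOn u U) (hp : IntegrableOn p U) (h : HasWeakGradient U u p)
    {β β' : ℝ → ℝ} (hβ : ∀ r, HasDerivAt β (β' r) r) (hβ' : Continuous β') {M : ℝ}
    (hM : ∀ r, |β r| ≤ M) (hM' : ∀ r, |β' r| ≤ M) :
    HasWeakGradient U (fun x => β (u x)) (fun x => β' (u x) • p x) := by
  intro ψ hψ i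
  have hUm := hU.measurableSet
  have hβc : Continuous β := continuous_iff_continuousAt.2 fun r => (hβ r).continuousAt
  have hz : ∀ x, x ∉ U → ψ x = 0 ∧ fderiv ℝ ψ x = 0 := fun x hx =>
    ⟨image_eq_zero_of_notMem_tsupport fun h => hx (hψ.support h),
      Function.notMem_support.1 fun h => hx (hψ.support (support_fderiv_subset ℝ h))⟩
  -- Around points of the support of `ψ` balls of radius at most `δ` stay in `U`, so the mollified
  -- gradients are genuine derivatives where `ψ` can see them.
  obtain ⟨δ, hδ, hball⟩ := hψ.compact.isCompact.exists_cthickening_subset_open hU hψ.support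
  set s : ℕ → ℝ := fun n => δ / (n + 1) with hs
  have hspos : ∀ n, 0 < s n := fun n => by positivity
  have hs0 : Tendsto s atTop (𝓝 0) := by
    simpa [hs, div_eq_mul_inv] using (tendsto_one_div_add_atTop_nhds_zero_nat (𝕜 := ℝ)).const_mul δ
  have hsδ : ∀ n, s n ≤ δ := fun n => div_le_self hδ.le (by simp)
  set pi : E3 → ℝ := fun y => p y i with hpi
  have hpii : IntegrableOn pi U := (EuclideanSpace.proj (𝕜 := ℝ) i).integrable_comp hp
  set un : ℕ → E3 → ℝ := fun n x => localAvg U u x (s n) with hun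
  set pn : ℕ → E3 → ℝ := fun n x => localAvg U pi x (s n) with hpn
  have hunc : ∀ n, Continuous (un n) := fun n => by
    simpa using continuous_localAvg hu 0 (hspos n)
  have hpnc : ∀ n, Continuous (pn n) := fun n => by
    simpa using continuous_localAvg hpii 0 (hspos n)
  have hψd : Continuous fun x => fderiv ℝ ψ x (basisVec i) :=
    (hψ.smooth.continuous_fderiv (by simp)).clm_apply continuous_const
  have hψdc : HasCompactSupport fun x => fderiv ℝ ψ x (basisVec i) :=
    hψ.compact.fderiv_apply ℝ _
  have hparts : ∀ n, ∫ x, β (un n x) * fderiv ℝ ψ x (basisVec i)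
      = - ∫ x, (β' (un n x) * pn n x) * ψ x := by
    intro n
    refine integral_bilinear_hasLineDerivAt_right_eq_neg_left_of_integrable
      (B := ContinuousLinearMap.mul ℝ ℝ) (v := basisVec i) ?_ ?_ ?_ ?_ ?_
    · exact (((hβ'.comp (hunc n)).mul (hpnc n)).mul
        hψ.smooth.continuous).integrable_of_hasCompactSupport hψ.compact.mul_left
    · exact ((hβc.comp (hunc n)).mul hψd).integrable_of_hasCompactSupport hψdc.mul_left
    · exact ((hβc.comp (hunc n)).mul
        hψ.smooth.continuous).integrable_of_hasCompactSupport hψ.compact.mul_left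
    · intro x hx
      have h1 := hasLineDerivAt_localAvg hu hp h (hspos n) (x := x)
        ((Metric.closedBall_subset_closedBall (hsδ n)).trans
          ((Metric.closedBall_subset_cthickening hx δ).trans hball)) i
      have h2 : HasDerivAt β (β' (un n x)) (un n (x + (0 : ℝ) • basisVec i)) := by
        simpa using hβ (un n x)
      exact h2.comp (0 : ℝ) h1
    · intro x _
      exact (hψ.smooth.differentiable (by simp) x).hasFDerivAt.hasLineDerivAt _
  have hae : ∀ᵐ x, x ∈ U → Tendsto (fun n => un n x) atTop (𝓝 (u x)) := by
    have := ae_tendsto_localAvg hUm hu 0 (by simp) one_pos hspos hs0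
    simpa [hun] using this
  obtain ⟨Bψ, hBψ⟩ := hψ.compact.exists_bound_of_continuous hψ.smooth.continuous
  have hlim1 : Tendsto (fun n => ∫ x, β (un n x) * fderiv ℝ ψ x (basisVec i)) atTop
      (𝓝 (∫ x, β (u x) * fderiv ℝ ψ x (basisVec i))) := by
    refine tendsto_integral_of_dominated_convergence
      (fun x => M * |fderiv ℝ ψ x (basisVec i)|)
      (fun n => ((hβc.comp (hunc n)).mul hψd).aestronglyMeasurable)
      ((hψd.integrable_of_hasCompactSupport hψdc).norm.const_mul M)
      (fun n => Eventually.of_forall fun x => ?_) ?_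
    · rw [norm_mul]
      exact mul_le_mul_of_nonneg_right (hM _) (norm_nonneg _)
    · filter_upwards [hae] with x hx
      by_cases hxU : x ∈ U
      · exact ((hβc.tendsto _).comp (hx hxU)).mul_const _
      · simp [(hz x hxU).2]
  have hum : AEStronglyMeasurable u (volume.restrict U) := hu.1
  set pz : E3 → ℝ := U.indicator pi with hpz
  have hpzi : Integrable pz := (integrable_indicator_iff hUm).2 hpii
  have hpneq : ∀ n x, pn n x = localAvg univ pz x (s n) := fun n x =>
    localAvg_eq_indicator hUm pi x (s n)
  set bz : E3 → ℝ := U.indicator fun x => β' (u x) * ψ x with hbz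
  have hbzm : AEStronglyMeasurable bz :=
    (aestronglyMeasurable_indicator_iff hUm).2 ((hβ'.comp_aestronglyMeasurable hum).mul
      hψ.smooth.continuous.aestronglyMeasurable)
  have hM0 : 0 ≤ M := (abs_nonneg _).trans (hM 0)
  have hB0 : 0 ≤ Bψ := (norm_nonneg _).trans (hBψ 0)
  -- The mollified gradient converges in $L^1$ and its factor is bounded, so it may be replaced by
  -- its limit. The factor converges almost everywhere, and dominated convergence then applies.
  have hlim2 : Tendsto (fun n => ∫ x, (β' (un n x) * pn n x) * ψ x) atTop
      (𝓝 (∫ x, bz x * pz x)) := by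
    have ha : Tendsto (fun n => ∫ x, (β' (un n x) * ψ x) * pz x) atTop
        (𝓝 (∫ x, bz x * pz x)) := by
      refine tendsto_integral_of_dominated_convergence (fun x => M * Bψ * |pz x|)
        (fun n => ((hβ'.comp (hunc n)).mul hψ.smooth.continuous).aestronglyMeasurable.mul hpzi.1)
        (hpzi.norm.const_mul _) (fun n => Eventually.of_forall fun x => ?_) ?_
      · rw [norm_mul, norm_mul]
        exact mul_le_mul_of_nonneg_right (mul_le_mul (hM' _) (hBψ _) (norm_nonneg _) hM0)
          (norm_nonneg _)
      · filter_upwards [hae] with x hx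
        by_cases hxU : x ∈ U
        · simp only [hbz, indicator_of_mem hxU]
          exact (((hβ'.tendsto _).comp (hx hxU)).mul_const _).mul_const _
        · simp [hpz, hxU]
    have hint1 : ∀ n, Integrable fun x => (β' (un n x) * ψ x) * pz x := fun n =>
      hpzi.bdd_mul (c := M * Bψ)
        ((hβ'.comp (hunc n)).mul hψ.smooth.continuous).aestronglyMeasurable
        (Eventually.of_forall fun x => by
          rw [norm_mul]; exact mul_le_mul (hM' _) (hBψ _) (norm_nonneg _) hM0)
    have hint2 : ∀ n, Integrable fun x => (β' (un n x) * pn n x) * ψ x := fun n =>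
      (((hβ'.comp (hunc n)).mul (hpnc n)).mul
        hψ.smooth.continuous).integrable_of_hasCompactSupport hψ.compact.mul_left
    have hb : Tendsto (fun n => (∫ x, (β' (un n x) * pn n x) * ψ x)
        - ∫ x, (β' (un n x) * ψ x) * pz x) atTop (𝓝 0) := by
      have h1 := (ENNReal.Tendsto.const_mul (a := ENNReal.ofReal (M * Bψ))
        (tendsto_lintegral_localAvg_sub hpzi hspos hs0) (Or.inr ENNReal.ofReal_ne_top))
      rw [mul_zero] at h1
      rw [tendsto_iff_enorm_sub_tendsto_zero]
      refine tendsto_of_tendsto_of_tendsto_of_le_of_le tendsto_const_nhds h1 (fun n => zero_le)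
        fun n => ?_
      rw [sub_zero, ← integral_sub (hint2 n) (hint1 n),
        ← lintegral_const_mul' _ _ ENNReal.ofReal_ne_top]
      refine (enorm_integral_le_lintegral_enorm _).trans (lintegral_mono fun x => ?_)
      rw [← hpneq, show β' (un n x) * pn n x * ψ x - β' (un n x) * ψ x * pz x
        = (β' (un n x) * ψ x) * (pn n x - pz x) by ring, enorm_mul]
      refine mul_le_mul' ?_ le_rfl
      rw [← ofReal_norm, norm_mul]
      exact ENNReal.ofReal_le_ofReal (mul_le_mul (hM' _) (hBψ _) (norm_nonneg _) hM0)
    simpa using hb.add ha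
  have heq := tendsto_nhds_unique hlim1 ((hlim2.neg).congr fun n => (hparts n).symm)
  rw [setIntegral_eq_integral_of_forall_compl_eq_zero fun x hx => by simp [(hz x hx).2], heq,
    setIntegral_eq_integral_of_forall_compl_eq_zero fun x hx => by simp [(hz x hx).1]]
  congr 1
  refine integral_congr_ae (Eventually.of_forall fun x => ?_)
  by_cases hxU : x ∈ U
  · simp only [hbz, hpz, hpi, indicator_of_mem hxU, PiLp.smul_apply, smul_eq_mul]
    ring
  · simp [hbz, hpz, hxU, (hz x hxU).1]

theorem HasWeakGradient.congr {U : Set E3} {u v : E3 → ℝ} {p : E3 → E3}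
    (h : HasWeakGradient U u p) (huv : u =ᵐ[volume.restrict U] v) : HasWeakGradient U v p := by
  intro ψ hψ i
  rw [← h ψ hψ i]
  refine integral_congr_ae (huv.mono fun x hx => ?_)
  simp only [hx]

theorem HasWeakGradient.unique {U : Set E3} (hU : IsOpen U) {u : E3 → ℝ} {p q : E3 → E3}
    (hp : IntegrableOn p U) (hq : IntegrableOn q U) (h : HasWeakGradient U u p)
    (h' : HasWeakGradient U u q) : p =ᵐ[volume.restrict U] q := by
  have key : ∀ i : Fin 3, ∀ᵐ x, x ∈ U → p x i - q x i = 0 := by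
    intro i
    have hpi : IntegrableOn (fun x => p x i) U :=
      (EuclideanSpace.proj (𝕜 := ℝ) i).integrable_comp hp
    have hqi : IntegrableOn (fun x => q x i) U :=
      (EuclideanSpace.proj (𝕜 := ℝ) i).integrable_comp hq
    refine hU.ae_eq_zero_of_integral_contDiff_smul_eq_zero
      (hpi.sub hqi).locallyIntegrableOn fun g hg hgc hgU => ?_
    have e1 := h g ⟨hg, hgc, hgU⟩ i
    have e2 := h' g ⟨hg, hgc, hgU⟩ i
    have hz : ∀ x, x ∉ U → g x = 0 := fun x hx =>
      image_eq_zero_of_notMem_tsupport fun h => hx (hgU h)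
    obtain ⟨B, hB⟩ := hgc.exists_bound_of_continuous hg.continuous
    have i1 : IntegrableOn (fun x => p x i * g x) U :=
      hpi.mul_bdd hg.continuous.aestronglyMeasurable (Eventually.of_forall hB)
    have i2 : IntegrableOn (fun x => q x i * g x) U :=
      hqi.mul_bdd hg.continuous.aestronglyMeasurable (Eventually.of_forall hB)
    rw [← setIntegral_eq_integral_of_forall_compl_eq_zero (s := U) fun x hx => by simp [hz x hx]]
    have e3 : ∫ x in U, g x • (p x i - q x i)
        = (∫ x in U, p x i * g x) - ∫ x in U, q x i * g x := by
      rw [← integral_sub i1 i2]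
      refine integral_congr_ae (Eventually.of_forall fun x => ?_)
      simp only [smul_eq_mul]
      ring
    rw [e3]
    linarith
  rw [Filter.EventuallyEq, ae_restrict_iff' hU.measurableSet]
  filter_upwards [key 0, key 1, key 2] with x h0 h1 h2 hx
  ext i
  fin_cases i
  exacts [sub_eq_zero.1 (h0 hx), sub_eq_zero.1 (h1 hx), sub_eq_zero.1 (h2 hx)]

/-- If both `u > 0` and `w = log u` have weak gradients, then `∇u = u ∇w`. -/
theorem weakGradient_log {U : Set E3} (hU : IsOpen U) {u w : E3 → ℝ} {p q : E3 → E3}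
    (hu : IntegrableOn u U) (hp : IntegrableOn p U) (hup : HasWeakGradient U u p)
    (hw : IntegrableOn w U) (hq : IntegrableOn q U) (hwq : HasWeakGradient U w q)
    (hpos : ∀ᵐ x ∂(volume.restrict U), 0 < u x)
    (hlog : w =ᵐ[volume.restrict U] fun x => Real.log (u x)) :
    ∀ᵐ x ∂(volume.restrict U), p x = u x • q x := by
  have hπ : ∀ r : ℝ, |Real.arctan r| ≤ 2 := fun r => by
    have h1 := Real.arctan_lt_pi_div_two r
    have h2 := Real.neg_pi_div_two_lt_arctan r
    have h3 := Real.pi_le_four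
    exact abs_le.2 ⟨by linarith, by linarith⟩
  have hb1 : ∀ r : ℝ, |1 / (1 + r ^ 2)| ≤ 2 := fun r => by
    rw [abs_of_nonneg (by positivity), div_le_iff₀ (by positivity)]
    nlinarith [sq_nonneg r]
  have hb2 : ∀ r : ℝ, |1 / (1 + Real.exp r ^ 2) * Real.exp r| ≤ 2 := fun r => by
    rw [abs_of_nonneg (by positivity), one_div_mul_eq_div, div_le_iff₀ (by positivity)]
    nlinarith [sq_nonneg (Real.exp r - 1)]
  have hc1 : Continuous fun r : ℝ => 1 / (1 + r ^ 2) :=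
    continuous_const.div (by fun_prop) fun r => by positivity
  have hc2 : Continuous fun r : ℝ => 1 / (1 + Real.exp r ^ 2) * Real.exp r :=
    (hc1.comp Real.continuous_exp).mul Real.continuous_exp
  -- Neither logarithm nor exponential is bounded with bounded derivative. The common function
  -- $\arctan u=\arctan e^{w}$ is so in both variables; its two gradients agree by uniqueness, and
  -- the positive factor $1/(1+u^2)$ cancels.
  have g1 := hup.comp hU hu hp Real.hasDerivAt_arctan hc1 hπ hb1
  have g2 := hwq.comp hU hw hq (β := fun r => Real.arctan (Real.exp r))
    (fun r => (Real.hasDerivAt_arctan _).comp r (Real.hasDerivAt_exp r)) hc2 (fun r => hπ _) hb2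
  have hexp : ∀ᵐ x ∂(volume.restrict U), Real.exp (w x) = u x := by
    filter_upwards [hpos, hlog] with x h1 h2
    rw [h2, Real.exp_log h1]
  have i1 : IntegrableOn (fun x => (1 / (1 + u x ^ 2)) • p x) U :=
    hp.bdd_smul 2 (hc1.comp_aestronglyMeasurable hu.1) (Eventually.of_forall fun x => hb1 _)
  have i2 : IntegrableOn (fun x => (1 / (1 + Real.exp (w x) ^ 2) * Real.exp (w x)) • q x) U :=
    hq.bdd_smul 2 (hc2.comp_aestronglyMeasurable hw.1) (Eventually.of_forall fun x => hb2 _)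
  have key := HasWeakGradient.unique hU i1 i2 g1 (g2.congr (hexp.mono fun x hx => by
    simp only [hx]))
  filter_upwards [key, hexp] with x h1 h2
  simp only [h2, mul_smul] at h1
  exact smul_right_injective _ (by positivity : (1 / (1 + u x ^ 2)) ≠ 0) h1

end Ferro

namespace Ferro

/-! ### Bilinear maps on the function spaces -/

theorem inner_eq_integral {U : Set E3} (f g : L2 U) : inner ℝ f g = ∫ x in U, f x * g x := by
  rw [L2.inner_def]
  refine integral_congr_ae (Eventually.of_forall fun x => ?_)
  simp [mul_comm]

theorem integrable_mul_L2 {U : Set E3} (f g : L2 U) :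
    Integrable (fun x => f x * g x) (volume.restrict U) :=
  (Lp.memLp f).integrable_mul (Lp.memLp g)

theorem inner_nonneg_of_ae_nonneg {U : Set E3} {f g : L2 U}
    (hf : ∀ᵐ x ∂(volume.restrict U), 0 ≤ f x) (hg : ∀ᵐ x ∂(volume.restrict U), 0 ≤ g x) :
    0 ≤ inner ℝ f g := by
  rw [inner_eq_integral]
  refine integral_nonneg_of_ae ?_
  filter_upwards [hf, hg] with x h1 h2
  exact mul_nonneg h1 h2

/-- The function underlying an element of `H¹(U)`, as a linear map. -/
noncomputable def fnL (U : Set E3) : H1 U →L[ℝ] L2 U :=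
  (WithLp.fstL 2 ℝ (L2 U) (L2Vec U)).comp (H1 U).subtypeL

/-- The weak gradient as a linear map. -/
noncomputable def wgradL (U : Set E3) : H1 U →L[ℝ] L2Vec U :=
  (WithLp.sndL 2 ℝ (L2 U) (L2Vec U)).comp (H1 U).subtypeL

theorem fnL_apply {U : Set E3} (w : H1 U) : fnL U w = fn w := rfl

theorem wgradL_apply {U : Set E3} (w : H1 U) : wgradL U w = wgrad w := rfl

theorem toH1Dual_apply {U : Set E3} (u : L2 U) (w : H1 U) : toH1Dual u w = inner ℝ u (fn w) := rfl

theorem norm_sq_eq {U : Set E3} (w : H1 U) : ‖w‖ ^ 2 = ‖fn w‖ ^ 2 + ‖wgrad w‖ ^ 2 :=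
  WithLp.prod_norm_sq_eq_of_L2 (w : WithLp 2 (L2 U × L2Vec U))

theorem norm_fn_le {U : Set E3} (w : H1 U) : ‖fn w‖ ≤ ‖w‖ := by
  refine abs_le_of_sq_le_sq' ?_ (norm_nonneg _) |>.2
  rw [norm_sq_eq w]
  exact le_add_of_nonneg_right (sq_nonneg _)

theorem norm_wgrad_le {U : Set E3} (w : H1 U) : ‖wgrad w‖ ≤ ‖w‖ := by
  refine abs_le_of_sq_le_sq' ?_ (norm_nonneg _) |>.2
  rw [norm_sq_eq w]
  exact le_add_of_nonneg_left (sq_nonneg _)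

theorem isSobolev_coe {U : Set E3} (w : H1 U) : IsSobolev U (fn w) (wgrad w) :=
  ⟨Lp.memLp _, Lp.memLp _, w.2⟩

/-- The embedding of `H¹(U)` into `L⁴(U)` holds with the constant `C`. -/
def FourEmbedding (U : Set E3) (C : ℝ≥0) : Prop :=
  ∀ w : H1 U, eLpNorm (fn w) 4 (volume.restrict U) ≤ C * ‖w‖ₑ

theorem Model.exists_fourEmbedding {P : Model} (hP : P.Admissible) :
    ∃ C : ℝ≥0, ∀ ε : ℝ, 0 < ε → FourEmbedding (P.perforated ε) C := by
  obtain ⟨C, hC⟩ := Model.exists_uniform_sobolev hP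
  refine ⟨2 * C, fun ε hε w => (hC ε hε _ _ (isSobolev_coe w)).trans ?_⟩
  rw [← Lp.enorm_def, ← Lp.enorm_def]
  have h1 : ‖fn w‖ₑ ≤ ‖w‖ₑ := by
    rw [← ofReal_norm, ← ofReal_norm]; exact ENNReal.ofReal_le_ofReal (norm_fn_le w)
  have h2 : ‖wgrad w‖ₑ ≤ ‖w‖ₑ := by
    rw [← ofReal_norm, ← ofReal_norm]; exact ENNReal.ofReal_le_ofReal (norm_wgrad_le w)
  calc (C : ℝ≥0∞) * (‖fn w‖ₑ + ‖wgrad w‖ₑ) ≤ C * (‖w‖ₑ + ‖w‖ₑ) := by gcongr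
    _ = _ := by push_cast; ring

section Product

variable {U : Set E3} {C : ℝ≥0}

theorem FourEmbedding.memLp (hS : FourEmbedding U C) (w : H1 U) : MemLp (fn w) 4 (volume.restrict U) :=
  ⟨(Lp.memLp (fn w)).1, (hS w).trans_lt (by finiteness)⟩

theorem eLpNorm_mul_le {f g : E3 → ℝ} (hf : AEStronglyMeasurable f (volume.restrict U))
    (hg : AEStronglyMeasurable g (volume.restrict U)) :
    eLpNorm (fun x => f x * g x) 2 (volume.restrict U)
      ≤ eLpNorm f 4 (volume.restrict U) * eLpNorm g 4 (volume.restrict U) := by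
  have : ENNReal.HolderTriple 4 4 2 := ⟨by
    refine ENNReal.eq_inv_of_mul_eq_one_left ?_
    rw [← two_mul, mul_right_comm, show (2 : ℝ≥0∞) * 2 = 4 by norm_num]
    exact ENNReal.mul_inv_cancel (by norm_num) (by norm_num)⟩
  have h := eLpNorm_le_eLpNorm_mul_eLpNorm'_of_norm (p := 4) (q := 4) (r := 2) hf hg
    (fun a b => a * b) 1 (Eventually.of_forall fun x => by simp)
  simpa using h

theorem FourEmbedding.memLp_mul (hS : FourEmbedding U C) (u w : H1 U) :
    MemLp (fun x => fn u x * fn w x) 2 (volume.restrict U) :=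
  ⟨(Lp.memLp (fn u)).1.mul (Lp.memLp (fn w)).1,
    (eLpNorm_mul_le (Lp.memLp (fn u)).1 (Lp.memLp (fn w)).1).trans_lt
      (ENNReal.mul_lt_top (hS.memLp u).2 (hS.memLp w).2)⟩

variable (hS : FourEmbedding U C)

/-- The product of two elements of `H¹(U)`, as an element of `L²(U)`. -/
noncomputable def mulL : H1 U →L[ℝ] H1 U →L[ℝ] L2 U :=
  (LinearMap.mk₂ ℝ (fun u w => (hS.memLp_mul u w).toLp _)
    (fun u u' w => by
      rw [← MemLp.toLp_add]
      refine MemLp.toLp_congr _ _ ((Lp.coeFn_add (fn u) (fn u')).mono fun x hx => ?_)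
      simp only [Pi.add_apply] at hx ⊢
      rw [← add_mul, ← hx]
      rfl)
    (fun c u w => by
      rw [← MemLp.toLp_const_smul]
      refine MemLp.toLp_congr _ _ ((Lp.coeFn_smul c (fn u)).mono fun x hx => ?_)
      simp only [Pi.smul_apply, smul_eq_mul] at hx ⊢
      rw [← mul_assoc, ← hx]
      rfl)
    (fun u w w' => by
      rw [← MemLp.toLp_add]
      refine MemLp.toLp_congr _ _ ((Lp.coeFn_add (fn w) (fn w')).mono fun x hx => ?_)
      simp only [Pi.add_apply] at hx ⊢
      rw [← mul_add, ← hx]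
      rfl)
    (fun c u w => by
      rw [← MemLp.toLp_const_smul]
      refine MemLp.toLp_congr _ _ ((Lp.coeFn_smul c (fn w)).mono fun x hx => ?_)
      simp only [Pi.smul_apply, smul_eq_mul] at hx ⊢
      rw [mul_left_comm, ← hx]
      rfl)).mkContinuous₂ (C ^ 2) fun u w => by
    rw [LinearMap.mk₂_apply, Lp.norm_toLp]
    refine ENNReal.toReal_le_of_le_ofReal (by positivity) ?_
    refine (eLpNorm_mul_le (Lp.memLp (fn u)).1 (Lp.memLp (fn w)).1).trans
      ((mul_le_mul' (hS u) (hS w)).trans (le_of_eq ?_))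
    rw [ENNReal.ofReal_mul (by positivity), ENNReal.ofReal_mul (by positivity), ofReal_norm,
      ofReal_norm, ← NNReal.coe_pow, ENNReal.ofReal_coe_nnreal]
    push_cast
    ring

theorem coeFn_mulL (u w : H1 U) :
    mulL hS u w =ᵐ[volume.restrict U] fun x => fn u x * fn w x :=
  (hS.memLp_mul u w).coeFn_toLp

theorem norm_mulL_le (u w : H1 U) : ‖mulL hS u w‖ ≤ C ^ 2 * ‖u‖ * ‖w‖ :=
  (ContinuousLinearMap.le_opNorm₂ _ u w).trans (by
    gcongr
    exact LinearMap.mkContinuous₂_norm_le _ (by positivity) _)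

theorem mulL_comm (u w : H1 U) : mulL hS u w = mulL hS w u := by
  refine Lp.ext ?_
  filter_upwards [coeFn_mulL hS u w, coeFn_mulL hS w u] with x h1 h2
  rw [h1, h2, mul_comm]

theorem mulL_self_nonneg (u : H1 U) : ∀ᵐ x ∂(volume.restrict U), 0 ≤ mulL hS u u x := by
  filter_upwards [coeFn_mulL hS u u] with x h1
  rw [h1]
  exact mul_self_nonneg _

theorem norm_mulL_le_eLpNorm (u w : H1 U) : ‖mulL hS u w‖ₑ
    ≤ eLpNorm (fn u) 4 (volume.restrict U) * eLpNorm (fn w) 4 (volume.restrict U) := by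
  rw [Lp.enorm_def, eLpNorm_congr_ae (coeFn_mulL hS u w)]
  exact eLpNorm_mul_le (Lp.memLp (fn u)).1 (Lp.memLp (fn w)).1

theorem inner_mulL_mulL (u v w z : H1 U) :
    inner ℝ (mulL hS u v) (mulL hS w z) = inner ℝ (mulL hS u w) (mulL hS v z) := by
  rw [inner_eq_integral, inner_eq_integral]
  refine integral_congr_ae ?_
  filter_upwards [coeFn_mulL hS u v, coeFn_mulL hS w z, coeFn_mulL hS u w, coeFn_mulL hS v z]
    with x h1 h2 h3 h4
  rw [h1, h2, h3, h4]
  ring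

/-- $\int u^2w^2$ is the inner product of $u^2$ and $w^2$. The factor `u` enters through its $L^4$
norm alone, which is the norm of $\mathbf m$ that is bounded uniformly in time. -/
theorem norm_mulL_sq_le (u w : H1 U) :
    ‖mulL hS u w‖ ^ 2 ≤ ‖mulL hS u u‖ * (C ^ 2 * ‖w‖ ^ 2) := by
  rw [← real_inner_self_eq_norm_sq, inner_mulL_mulL]
  refine (real_inner_le_norm _ _).trans ?_
  gcongr
  exact (norm_mulL_le hS w w).trans (le_of_eq (by ring))

end Product

/-! ### The bilinear forms of the coefficients -/

theorem integral_norm_mul_norm_le {D : Set E3} (p q : L2Vec D) :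
    ∫ x in D, ‖p x‖ * ‖q x‖ ≤ ‖p‖ * ‖q‖ := by
  have h := real_inner_le_norm ((Lp.memLp p).norm.toLp _ : L2 D) ((Lp.memLp q).norm.toLp _)
  rw [inner_eq_integral, Lp.norm_toLp, Lp.norm_toLp, eLpNorm_norm, eLpNorm_norm] at h
  refine le_trans (le_of_eq (integral_congr_ae ?_)) h
  filter_upwards [(Lp.memLp p).norm.coeFn_toLp, (Lp.memLp q).norm.coeFn_toLp] with x h1 h2
  rw [h1, h2]

theorem integral_norm_sq_eq {D : Set E3} (p : L2Vec D) : ∫ x in D, ‖p x‖ ^ 2 = ‖p‖ ^ 2 := by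
  rw [← real_inner_self_eq_norm_sq, L2.inner_def]
  simp

/-- The bound of a coefficient field. -/
noncomputable def coefBound (D : Set E3) (a : Fin 3 → Fin 3 → E3 → (E3 →ᵇ ℝ)) : ℝ :=
  ∑ i, ∑ j, (eLpNorm (a i j) ⊤ (volume.restrict D)).toReal

theorem coefBound_nonneg (D : Set E3) (a : Fin 3 → Fin 3 → E3 → (E3 →ᵇ ℝ)) : 0 ≤ coefBound D a :=
  Finset.sum_nonneg fun _ _ => Finset.sum_nonneg fun _ _ => ENNReal.toReal_nonneg

section Forms

variable {D D' : Set E3} {a : Fin 3 → Fin 3 → E3 → (E3 →ᵇ ℝ)}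

theorem IsCoefficient.abs_oscForm_le (ha : IsCoefficient D a) (ε : ℝ) :
    ∀ᵐ x ∂(volume.restrict D), ∀ p q : E3, |oscForm a ε x p q| ≤ coefBound D a * (‖p‖ * ‖q‖) := by
  have h : ∀ᵐ x ∂(volume.restrict D), ∀ i j,
      ‖a i j x‖ ≤ (eLpNorm (a i j) ⊤ (volume.restrict D)).toReal := by
    rw [ae_all_iff]; intro i
    rw [ae_all_iff]; intro j
    have h1 := ae_le_eLpNormEssSup (f := a i j) (μ := volume.restrict D)
    rw [eLpNorm_exponent_top]
    filter_upwards [h1] with x hx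
    have h2 := (ha.memLp i j).2
    rw [eLpNorm_exponent_top] at h2
    rw [← toReal_enorm]
    exact ENNReal.toReal_mono h2.ne hx
  filter_upwards [h] with x hx p q
  rw [oscForm, coefBound, Finset.sum_mul]
  refine (Finset.abs_sum_le_sum_abs _ _).trans (Finset.sum_le_sum fun i _ => ?_)
  rw [Finset.sum_mul]
  refine (Finset.abs_sum_le_sum_abs _ _).trans (Finset.sum_le_sum fun j _ => ?_)
  rw [mul_assoc, abs_mul, abs_mul]
  have h1 : |a i j x (ε⁻¹ • x)| ≤ _ := ((a i j x).norm_coe_le_norm _).trans (hx i j)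
  have h2 : |p j| ≤ ‖p‖ := PiLp.norm_apply_le p j
  have h3 : |q i| ≤ ‖q‖ := PiLp.norm_apply_le q i
  gcongr

theorem IsCoefficient.integrable_oscForm (ha : IsCoefficient D' a) (hD : D ⊆ D') (ε : ℝ)
    (p q : L2Vec D) : Integrable (fun x => oscForm a ε x (p x) (q x)) (volume.restrict D) := by
  have hle : volume.restrict D ≤ volume.restrict D' := Measure.restrict_mono hD le_rfl
  have hi : Integrable (fun x => ‖p x‖ * ‖q x‖) (volume.restrict D) :=
    (Lp.memLp p).norm.integrable_mul (Lp.memLp q).norm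
  refine (hi.const_mul (coefBound D' a)).mono' ?_ ?_
  · have hs : ∀ i j, AEStronglyMeasurable (fun x => a i j x (ε⁻¹ • x) * p x j * q x i)
        (volume.restrict D) := by
      intro i j
      have h1 : AEStronglyMeasurable (fun x => (a i j x, ε⁻¹ • x)) (volume.restrict D) :=
        ((ha.memLp i j).1.mono_measure hle).prodMk (by fun_prop)
      -- Joint continuity of evaluation makes the oscillating coefficient $a(x,x/\epsilon)$
      -- measurable.
      have h2 : Continuous fun z : (E3 →ᵇ ℝ) × E3 => z.1 z.2 := continuous_eval
      exact ((h2.comp_aestronglyMeasurable h1).mul (memLp_coord j p).1).mul (memLp_coord i q).1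
    have := Finset.aestronglyMeasurable_fun_sum (μ := volume.restrict D) Finset.univ
      fun i _ => Finset.aestronglyMeasurable_fun_sum Finset.univ fun j _ => hs i j
    exact this
  · filter_upwards [ae_restrict_of_ae_restrict_of_subset hD (ha.abs_oscForm_le ε)] with x hx
    exact hx _ _

theorem oscForm_add_left (ε : ℝ) (x p p' q : E3) :
    oscForm a ε x (p + p') q = oscForm a ε x p q + oscForm a ε x p' q := by
  simp only [oscForm, PiLp.add_apply, ← Finset.sum_add_distrib]
  exact Finset.sum_congr rfl fun i _ => Finset.sum_congr rfl fun j _ => by ring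

theorem oscForm_smul_left (ε c : ℝ) (x p q : E3) :
    oscForm a ε x (c • p) q = c * oscForm a ε x p q := by
  simp only [oscForm, PiLp.smul_apply, smul_eq_mul, Finset.mul_sum]
  exact Finset.sum_congr rfl fun i _ => Finset.sum_congr rfl fun j _ => by ring

theorem oscForm_add_right (ε : ℝ) (x p q q' : E3) :
    oscForm a ε x p (q + q') = oscForm a ε x p q + oscForm a ε x p q' := by
  simp only [oscForm, PiLp.add_apply, ← Finset.sum_add_distrib]
  exact Finset.sum_congr rfl fun i _ => Finset.sum_congr rfl fun j _ => by ring

theorem oscForm_smul_right (ε c : ℝ) (x p q : E3) :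
    oscForm a ε x p (c • q) = c * oscForm a ε x p q := by
  simp only [oscForm, PiLp.smul_apply, smul_eq_mul, Finset.mul_sum]
  exact Finset.sum_congr rfl fun i _ => Finset.sum_congr rfl fun j _ => by ring

/-- The bilinear form `∫_D a(x, x/ε) p · q`. -/
noncomputable def coefForm (ha : IsCoefficient D' a) (hD : D ⊆ D') (ε : ℝ) :
    L2Vec D →L[ℝ] L2Vec D →L[ℝ] ℝ :=
  (LinearMap.mk₂ ℝ (fun p q => ∫ x in D, oscForm a ε x (p x) (q x))
    (fun p p' q => by
      rw [← integral_add (ha.integrable_oscForm hD ε p q) (ha.integrable_oscForm hD ε p' q)]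
      refine integral_congr_ae ((Lp.coeFn_add p p').mono fun x hx => ?_)
      simp only [hx, Pi.add_apply, oscForm_add_left])
    (fun c p q => by
      rw [smul_eq_mul, ← integral_const_mul]
      refine integral_congr_ae ((Lp.coeFn_smul c p).mono fun x hx => ?_)
      simp only [hx, Pi.smul_apply, oscForm_smul_left])
    (fun p q q' => by
      rw [← integral_add (ha.integrable_oscForm hD ε p q) (ha.integrable_oscForm hD ε p q')]
      refine integral_congr_ae ((Lp.coeFn_add q q').mono fun x hx => ?_)
      simp only [hx, Pi.add_apply, oscForm_add_right])
    (fun c p q => by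
      rw [smul_eq_mul, ← integral_const_mul]
      refine integral_congr_ae ((Lp.coeFn_smul c q).mono fun x hx => ?_)
      simp only [hx, Pi.smul_apply, oscForm_smul_right])).mkContinuous₂ (coefBound D' a)
    fun p q => by
      have hi : Integrable (fun x => ‖p x‖ * ‖q x‖) (volume.restrict D) :=
        (Lp.memLp p).norm.integrable_mul (Lp.memLp q).norm
      rw [LinearMap.mk₂_apply, mul_assoc]
      refine (norm_integral_le_of_norm_le (hi.const_mul (coefBound D' a))
        ((ae_restrict_of_ae_restrict_of_subset hD (ha.abs_oscForm_le ε)).mono fun x hx => hx _ _)).trans ?_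
      rw [integral_const_mul]
      exact mul_le_mul_of_nonneg_left (integral_norm_mul_norm_le p q) (coefBound_nonneg _ _)

variable (ha : IsCoefficient D' a) (hD : D ⊆ D') (ε : ℝ)

theorem coefForm_apply (p q : L2Vec D) :
    coefForm ha hD ε p q = ∫ x in D, oscForm a ε x (p x) (q x) := rfl

theorem abs_coefForm_le (p q : L2Vec D) :
    |coefForm ha hD ε p q| ≤ coefBound D' a * (‖p‖ * ‖q‖) := by
  have h : ‖coefForm ha hD ε‖ ≤ coefBound D' a :=
    LinearMap.mkContinuous₂_norm_le _ (coefBound_nonneg _ _) _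
  rw [← mul_assoc]
  refine ((coefForm ha hD ε).le_opNorm₂ p q).trans ?_
  gcongr

theorem coefForm_comm (p q : L2Vec D) : coefForm ha hD ε p q = coefForm ha hD ε q p := by
  rw [coefForm_apply, coefForm_apply]
  have h : ∀ᵐ x ∂(volume.restrict D'), ∀ i j, ∀ y, a i j x y = a j i x y := by
    rw [ae_all_iff]; intro i
    rw [ae_all_iff]; intro j
    exact ha.symm i j
  refine integral_congr_ae ((ae_restrict_of_ae_restrict_of_subset hD h).mono fun x hx => ?_)
  simp only [oscForm]
  rw [Finset.sum_comm]
  refine Finset.sum_congr rfl fun i _ => Finset.sum_congr rfl fun j _ => ?_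
  rw [hx j i]
  ring

theorem le_coefForm_self {α : ℝ} (hα : ∀ᵐ x ∂(volume.restrict D'), ∀ y ξ : E3,
    α * ‖ξ‖ ^ 2 ≤ ∑ i, ∑ j, a i j x y * ξ j * ξ i) (p : L2Vec D) :
    α * ‖p‖ ^ 2 ≤ coefForm ha hD ε p p := by
  rw [coefForm_apply, ← integral_norm_sq_eq, ← integral_const_mul]
  refine integral_mono_ae (((Lp.memLp p).norm.integrable_sq).const_mul α)
    (ha.integrable_oscForm hD ε p p) ?_
  exact (ae_restrict_of_ae_restrict_of_subset hD hα).mono fun x hx => hx _ _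

theorem coefForm_self_nonneg (p : L2Vec D) : 0 ≤ coefForm ha hD ε p p := by
  obtain ⟨α, hα, h⟩ := ha.coercive
  exact (by positivity : 0 ≤ α * ‖p‖ ^ 2).trans (le_coefForm_self ha hD ε h p)

/-- If `q = u p` with `u ≥ 0`, then the form is nonnegative at `(p, q)`. -/
theorem coefForm_nonneg_of_smul {p q : L2Vec D} {u : E3 → ℝ}
    (hu : ∀ᵐ x ∂(volume.restrict D), 0 ≤ u x) (hq : ∀ᵐ x ∂(volume.restrict D), q x = u x • p x) :
    0 ≤ coefForm ha hD ε p q := by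
  obtain ⟨α, hα, h⟩ := ha.coercive
  rw [coefForm_apply]
  refine integral_nonneg_of_ae ?_
  filter_upwards [hu, hq, ae_restrict_of_ae_restrict_of_subset hD h] with x h1 h2 h3
  rw [h2, oscForm_smul_right]
  exact mul_nonneg h1 ((by positivity : 0 ≤ α * ‖p x‖ ^ 2).trans (h3 _ _))

/-- By symmetry the two sides differ by half the form at `p - q`. This is the subgradient inequality
for the exchange energy. -/
theorem coefForm_convex (p q : L2Vec D) :
    coefForm ha hD ε p p / 2 - coefForm ha hD ε q q / 2 ≤ coefForm ha hD ε p (p - q) := by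
  have h := coefForm_self_nonneg ha hD ε (p - q)
  have h2 := coefForm_comm ha hD ε p q
  simp only [map_sub, sub_apply] at h ⊢
  linarith

end Forms

/-! ### Restriction of the components of a vector field -/

theorem norm_toLp_coord_le {U O : Set E3} (hUO : U ⊆ O) (i : Fin 3) (p : L2Vec O) :
    ‖((memLp_coord i p).mono_measure (Measure.restrict_mono hUO le_rfl)).toLp _‖ ≤ ‖p‖ := by
  rw [Lp.norm_toLp]
  refine ENNReal.toReal_le_of_le_ofReal (norm_nonneg _) ?_
  rw [ofReal_norm, Lp.enorm_def]
  refine (eLpNorm_mono_measure _ (Measure.restrict_mono hUO le_rfl)).trans ?_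
  exact eLpNorm_mono fun x => PiLp.norm_apply_le (p x) i

/-- The `i`-th component of a vector field on `O`, restricted to `U`. -/
noncomputable def coordL {U O : Set E3} (hUO : U ⊆ O) (i : Fin 3) : L2Vec O →L[ℝ] L2 U :=
  LinearMap.mkContinuous
    { toFun := fun p => ((memLp_coord i p).mono_measure (Measure.restrict_mono hUO le_rfl)).toLp _
      map_add' := fun p q => by
        rw [← MemLp.toLp_add]
        refine MemLp.toLp_congr _ _ ((ae_restrict_of_ae_restrict_of_subset hUO
          (Lp.coeFn_add p q)).mono fun x hx => ?_)
        beta_reduce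
        rw [hx]
        rfl
      map_smul' := fun c p => by
        rw [RingHom.id_apply, ← MemLp.toLp_const_smul]
        refine MemLp.toLp_congr _ _ ((ae_restrict_of_ae_restrict_of_subset hUO
          (Lp.coeFn_smul c p)).mono fun x hx => ?_)
        beta_reduce
        rw [hx]
        rfl } 1 fun p => by
    rw [one_mul]
    exact norm_toLp_coord_le hUO i p

theorem coeFn_coordL {U O : Set E3} (hUO : U ⊆ O) (i : Fin 3) (p : L2Vec O) :
    coordL hUO i p =ᵐ[volume.restrict U] fun x => p x i :=
  ((memLp_coord i p).mono_measure (Measure.restrict_mono hUO le_rfl)).coeFn_toLp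

theorem norm_coordL_le {U O : Set E3} (hUO : U ⊆ O) (i : Fin 3) (p : L2Vec O) :
    ‖coordL hUO i p‖ ≤ ‖p‖ :=
  norm_toLp_coord_le hUO i p

end Ferro

namespace Ferro

/-! ### Integrals over initial intervals of $(0,T)$ -/

theorem intervalIntegrable_of_timeMeasure {T : ℝ} {f : ℝ → ℝ} (hf : Integrable f (timeMeasure T))
    {τ : ℝ} (hτ : τ ∈ Icc 0 T) : IntervalIntegrable f volume 0 τ := by
  rw [intervalIntegrable_iff_integrableOn_Ioc_of_le hτ.1]
  have h : IntegrableOn f (Ioc 0 T) := by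
    rw [integrableOn_Ioc_iff_integrableOn_Ioo]; exact hf
  exact h.mono_set (Ioc_subset_Ioc_right hτ.2)

theorem integral_timeMeasure_eq {T : ℝ} (hT : 0 < T) (f : ℝ → ℝ) :
    ∫ t, f t ∂(timeMeasure T) = ∫ t in (0 : ℝ)..T, f t := by
  rw [intervalIntegral.integral_of_le hT.le, integral_Ioc_eq_integral_Ioo]

/-- A bound of the integral over almost every `(0, τ)` is a bound of the integral over `(0, T)`. -/
theorem integral_timeMeasure_le_of_ae_le {T : ℝ} (hT : 0 < T) {f : ℝ → ℝ}
    (hf : Integrable f (timeMeasure T)) {C : ℝ}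
    (h : ∀ᵐ τ ∂(timeMeasure T), ∫ t in (0 : ℝ)..τ, f t ≤ C) :
    ∫ t, f t ∂(timeMeasure T) ≤ C := by
  rw [integral_timeMeasure_eq hT]
  set S : Set ℝ := {τ | τ ∈ Ioo 0 T ∧ ∫ t in (0 : ℝ)..τ, f t ≤ C} with hSdef
  -- The times at which the bound holds accumulate at `T`, and the primitive is continuous there.
  have hcl : T ∈ closure S := by
    rw [Metric.mem_closure_iff]
    intro δ hδ
    have hpos : 0 < timeMeasure T (Ioo (T - δ) T) := by
      rw [Measure.restrict_apply measurableSet_Ioo, Ioo_inter_Ioo, min_self, Real.volume_Ioo]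
      refine ENNReal.ofReal_pos.2 (sub_pos.2 (max_lt (by linarith) hT))
    have h2 : ∀ᵐ τ ∂(timeMeasure T), τ ∈ S := by
      filter_upwards [h, ae_restrict_mem measurableSet_Ioo] with τ h1 h2 using ⟨h2, h1⟩
    obtain ⟨τ, hτ, hτS⟩ := ((frequently_ae_mem_iff.2 hpos.ne').and_eventually h2).exists
    refine ⟨τ, hτS, ?_⟩
    rw [Real.dist_eq, abs_lt]
    exact ⟨by linarith [hτ.2], by linarith [hτ.1]⟩
  have hcont : ContinuousOn (fun τ => ∫ t in (0 : ℝ)..τ, f t) (uIcc 0 T) := by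
    refine intervalIntegral.continuousOn_primitive_interval ?_
    rw [uIcc_of_le hT.le, integrableOn_Icc_iff_integrableOn_Ioo]
    exact hf
  have hne : (𝓝[S] T).NeBot := mem_closure_iff_nhdsWithin_neBot.1 hcl
  have hsub : S ⊆ uIcc 0 T := by
    rw [uIcc_of_le hT.le]
    exact fun τ hτ => Ioo_subset_Icc_self hτ.1
  exact le_of_tendsto ((hcont T right_mem_uIcc).mono hsub)
    (eventually_nhdsWithin_of_forall fun τ hτ => hτ.2)

theorem intervalIntegral_mono_timeMeasure {T : ℝ} {f g : ℝ → ℝ}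
    (hf : Integrable f (timeMeasure T)) (hg : Integrable g (timeMeasure T))
    (h : ∀ᵐ t ∂(timeMeasure T), f t ≤ g t) {τ : ℝ} (hτ : τ ∈ Icc 0 T) :
    ∫ t in (0 : ℝ)..τ, f t ≤ ∫ t in (0 : ℝ)..τ, g t := by
  refine intervalIntegral.integral_mono_ae_restrict hτ.1 (intervalIntegrable_of_timeMeasure hf hτ)
    (intervalIntegrable_of_timeMeasure hg hτ) ?_
  rw [← restrict_Ioo_eq_restrict_Icc]
  exact ae_restrict_of_ae_restrict_of_subset (Ioo_subset_Ioo_right hτ.2) h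

/-! ### The modulus of a vector field -/

section ModSq

variable {U : Set E3} {C : ℝ≥0} (hS : FourEmbedding U C)

/-- The function `|m|²` in `L²(U)`. -/
noncomputable def modSq (m : Fin 3 → H1 U) : L2 U := ∑ j, mulL hS (m j) (m j)

theorem coeFn_modSq (m : Fin 3 → H1 U) :
    modSq hS m =ᵐ[volume.restrict U] fun x => ∑ j, fn (m j) x ^ 2 := by
  have h : ∀ᵐ x ∂(volume.restrict U), ∀ j, mulL hS (m j) (m j) x = fn (m j) x * fn (m j) x :=
    ae_all_iff.2 fun j => coeFn_mulL hS (m j) (m j)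
  rw [modSq]
  filter_upwards [h, Lp.coeFn_finsetSum Finset.univ fun j => mulL hS (m j) (m j)] with x h1 h2
  rw [h2, Finset.sum_apply]
  exact Finset.sum_congr rfl fun j _ => by rw [h1 j, sq]

theorem modSq_nonneg (m : Fin 3 → H1 U) : ∀ᵐ x ∂(volume.restrict U), 0 ≤ modSq hS m x := by
  filter_upwards [coeFn_modSq hS m] with x hx
  rw [hx]
  exact Finset.sum_nonneg fun j _ => sq_nonneg _

theorem sum_inner_modSq (m : Fin 3 → H1 U) :
    ∑ i, inner ℝ (modSq hS m) (mulL hS (m i) (m i)) = ‖modSq hS m‖ ^ 2 := by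
  rw [← inner_sum, ← real_inner_self_eq_norm_sq]
  rfl

theorem norm_mulL_self_le (m : Fin 3 → H1 U) (j : Fin 3) :
    ‖mulL hS (m j) (m j)‖ ≤ ‖modSq hS m‖ := by
  refine Lp.norm_le_norm_of_ae_le ?_
  filter_upwards [coeFn_modSq hS m, coeFn_mulL hS (m j) (m j)] with x h1 h2
  rw [h1, h2, ← sq, Real.norm_of_nonneg (sq_nonneg _),
    Real.norm_of_nonneg (Finset.sum_nonneg fun j _ => sq_nonneg _)]
  exact Finset.single_le_sum (f := fun j => fn (m j) x ^ 2) (fun j _ => sq_nonneg _)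
    (Finset.mem_univ j)

theorem norm_modSq_le (m : Fin 3 → H1 U) {R : ℝ} (hm : ∀ i, ‖m i‖ ≤ R) :
    ‖modSq hS m‖ ≤ 3 * (C ^ 2 * R ^ 2) := by
  refine (norm_sum_le _ _).trans ?_
  calc ∑ j, ‖mulL hS (m j) (m j)‖ ≤ ∑ _j : Fin 3, (C ^ 2 * R ^ 2 : ℝ) := by
        refine Finset.sum_le_sum fun j _ => (norm_mulL_le hS _ _).trans ?_
        rw [mul_assoc, ← sq]
        gcongr
        exact hm j
    _ = _ := by simp

/-- The subgradient inequality for $\frac14\int|m|^4$. The identity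
$2m\cdot(m-m')=|m|^2-|m'|^2+|m-m'|^2$ is multiplied by $|m|^2\ge0$, the last term is dropped, and
$|m|^2|m'|^2$ is split by Young's inequality. -/
theorem modSq_convex (m m' : Fin 3 → H1 U) :
    ‖modSq hS m‖ ^ 2 / 4 - ‖modSq hS m'‖ ^ 2 / 4
      ≤ ∑ i, inner ℝ (modSq hS m) (mulL hS (m i) (m i - m' i)) := by
  have h1 : ∀ i, 0 ≤ inner ℝ (modSq hS m) (mulL hS (m i - m' i) (m i - m' i)) := fun i =>
    inner_nonneg_of_ae_nonneg (modSq_nonneg hS m) (mulL_self_nonneg hS _)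
  have h2 : ∀ i, mulL hS (m i) (m i - m' i) = (1 / 2 : ℝ) • (mulL hS (m i) (m i)
      - mulL hS (m' i) (m' i) + mulL hS (m i - m' i) (m i - m' i)) := by
    intro i
    simp only [map_sub, sub_apply, mulL_comm hS (m' i) (m i)]
    module
  have h3 : ∑ i, inner ℝ (modSq hS m) (mulL hS (m i) (m i - m' i))
      = 1 / 2 * (‖modSq hS m‖ ^ 2 - inner ℝ (modSq hS m) (modSq hS m')
        + ∑ i, inner ℝ (modSq hS m) (mulL hS (m i - m' i) (m i - m' i))) := by
    simp_rw [h2, inner_smul_right, inner_add_right, inner_sub_right]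
    rw [← Finset.mul_sum, Finset.sum_add_distrib, Finset.sum_sub_distrib, sum_inner_modSq,
      ← inner_sum Finset.univ (fun i => mulL hS (m' i) (m' i))]
    rfl
  have h4 := Finset.sum_nonneg fun i (_ : i ∈ Finset.univ) => h1 i
  have h5 : inner ℝ (modSq hS m) (modSq hS m') ≤ ‖modSq hS m‖ ^ 2 / 2 + ‖modSq hS m'‖ ^ 2 / 2 := by
    refine (real_inner_le_norm _ _).trans ?_
    nlinarith [sq_nonneg (‖modSq hS m‖ - ‖modSq hS m'‖)]
  rw [h3]
  linarith

/-- Cauchy–Schwarz against the constant function one. It lets the quartic term absorb quadratic ones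
in the first estimate of `m`. -/
theorem sum_norm_sq_le {V : ℝ} (hV : volume U ≤ ENNReal.ofReal (V ^ 2)) (hV0 : 0 ≤ V)
    (m : Fin 3 → H1 U) : ∑ i, ‖fn (m i)‖ ^ 2 ≤ V * ‖modSq hS m‖ := by
  have : IsFiniteMeasure (volume.restrict U) := ⟨by
    rw [Measure.restrict_apply_univ]; exact hV.trans_lt ENNReal.ofReal_lt_top⟩
  have hone : MemLp (fun _ : E3 => (1 : ℝ)) 2 (volume.restrict U) := memLp_const 1
  have h1 : ∑ i, ‖fn (m i)‖ ^ 2 = inner ℝ (hone.toLp _) (modSq hS m) := by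
    rw [modSq, inner_sum]
    refine Finset.sum_congr rfl fun i _ => ?_
    rw [← real_inner_self_eq_norm_sq, inner_eq_integral, inner_eq_integral]
    refine integral_congr_ae ?_
    filter_upwards [hone.coeFn_toLp, coeFn_mulL hS (m i) (m i)] with x h1 h2
    rw [h1, h2, one_mul]
  rw [h1]
  refine (real_inner_le_norm _ _).trans (mul_le_mul_of_nonneg_right ?_ (norm_nonneg _))
  rw [← abs_of_nonneg (norm_nonneg _), ← abs_of_nonneg hV0, ← sq_le_sq,
    ← real_inner_self_eq_norm_sq, inner_eq_integral]
  have h2 : ∫ x in U, (hone.toLp _ : L2 U) x * (hone.toLp _ : L2 U) x = ∫ _ in U, (1 : ℝ) := by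
    refine integral_congr_ae ?_
    filter_upwards [hone.coeFn_toLp] with x h1
    rw [h1, one_mul]
  rw [h2, setIntegral_const, smul_eq_mul, mul_one, Measure.real]
  exact ENNReal.toReal_le_of_le_ofReal (by positivity) hV

end ModSq

/-! ### The equations in terms of the bilinear maps -/

namespace Model

variable {P : Model} {ε T : ℝ} {m₀ : Fin 3 → H1 (P.perforated ε)} {v₀ : L2 (P.perforated ε)}
  {s : P.Unknowns ε}

namespace IsWeakSolution

theorem weak_m (h : P.IsWeakSolution ε T m₀ v₀ s) (hP : P.Admissible) {C : ℝ≥0}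
    (hS : FourEmbedding (P.perforated ε) C) :
    ∀ᵐ t ∂(timeMeasure T), ∀ (w : H1 (P.perforated ε)) (i : Fin 3),
      P.γ * inner ℝ (s.dm i t) (fn w)
        = - coefForm hP.A_coef (P.perforated_subset ε) ε (wgrad (s.m i t)) (wgrad w)
          - P.θc * (inner ℝ (modSq hS fun j => s.m j t) (mulL hS (s.m i t) w)
            - inner ℝ (fn (s.m i t)) (fn w))
          - inner ℝ (mulL hS (s.θ t) (s.m i t)) (fn w)
          + inner ℝ (coordL (P.perforated_subset_exterior ε) i (s.gradφ t)) (fn w) := by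
  filter_upwards [h.eq_m] with t ht w i
  have h1 := ht w i
  have e1 : ∫ x in P.perforated ε, ((∑ j, fn (s.m j t) x ^ 2) - 1) * fn (s.m i t) x * fn w x
      = inner ℝ (modSq hS fun j => s.m j t) (mulL hS (s.m i t) w)
        - inner ℝ (fn (s.m i t)) (fn w) := by
    rw [inner_eq_integral, inner_eq_integral, ← integral_sub (integrable_mul_L2 _ _)
      (integrable_mul_L2 _ _)]
    refine integral_congr_ae ?_
    filter_upwards [coeFn_modSq hS fun j => s.m j t, coeFn_mulL hS (s.m i t) w] with x h2 h3
    rw [h2, h3]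
    ring
  have e2 : ∫ x in P.perforated ε, fn (s.θ t) x * fn (s.m i t) x * fn w x
      = inner ℝ (mulL hS (s.θ t) (s.m i t)) (fn w) := by
    rw [inner_eq_integral]
    refine integral_congr_ae ?_
    filter_upwards [coeFn_mulL hS (s.θ t) (s.m i t)] with x h2
    rw [h2]
  have e3 : ∫ x in P.perforated ε, s.gradφ t x i * fn w x
      = inner ℝ (coordL (P.perforated_subset_exterior ε) i (s.gradφ t)) (fn w) := by
    rw [inner_eq_integral]
    refine integral_congr_ae ?_
    filter_upwards [coeFn_coordL (P.perforated_subset_exterior ε) i (s.gradφ t)] with x h2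
    rw [h2]
  rw [inner_eq_integral, coefForm_apply, ← e1, ← e2, ← e3]
  exact h1

theorem weak_θ (h : P.IsWeakSolution ε T m₀ v₀ s) (hP : P.Admissible) {C : ℝ≥0}
    (hS : FourEmbedding (P.perforated ε) C) :
    ∀ᵐ t ∂(timeMeasure T), ∀ w : H1 (P.perforated ε),
      s.dv t w = ∑ j, inner ℝ (s.dm j t) (mulL hS (s.m j t) w)
        - coefForm hP.K_coef (P.perforated_subset ε) ε
          (P.k₀ • wgrad (s.logθ t) + P.k₁ • wgrad (s.θ t)) (wgrad w) := by
  filter_upwards [h.eq_θ] with t ht w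
  have h1 := ht w
  have e1 : ∫ x in P.perforated ε, (∑ j, fn (s.m j t) x * s.dm j t x) * fn w x
      = ∑ j, inner ℝ (s.dm j t) (mulL hS (s.m j t) w) := by
    simp_rw [inner_eq_integral]
    rw [← integral_finsetSum _ fun j _ => integrable_mul_L2 _ _]
    refine integral_congr_ae ?_
    have h2 : ∀ᵐ x ∂(volume.restrict (P.perforated ε)), ∀ j,
      mulL hS (s.m j t) w x = fn (s.m j t) x * fn w x := ae_all_iff.2 fun j => coeFn_mulL hS _ _
    filter_upwards [h2] with x hx
    rw [Finset.sum_mul]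
    refine Finset.sum_congr rfl fun j _ => ?_
    rw [hx j]
    ring
  have e2 : ∫ x in P.perforated ε, oscForm P.K ε x
      (P.k₀ • wgrad (s.logθ t) x + P.k₁ • wgrad (s.θ t) x) (wgrad w x)
      = coefForm hP.K_coef (P.perforated_subset ε) ε
          (P.k₀ • wgrad (s.logθ t) + P.k₁ • wgrad (s.θ t)) (wgrad w) := by
    rw [coefForm_apply]
    refine integral_congr_ae ?_
    filter_upwards [Lp.coeFn_add (P.k₀ • wgrad (s.logθ t)) (P.k₁ • wgrad (s.θ t)),
      Lp.coeFn_smul P.k₀ (wgrad (s.logθ t)), Lp.coeFn_smul P.k₁ (wgrad (s.θ t))] with x h2 h3 h4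
    rw [h2, Pi.add_apply, h3, h4]
    rfl
  rw [e1, e2] at h1
  linarith

/-- The potential is itself an admissible test function, and `μ` is coercive. -/
theorem norm_gradφ_le (h : P.IsWeakSolution ε T m₀ v₀ s) (hP : P.Admissible) {α : ℝ} (hα : 0 < α)
    (hμ : ∀ᵐ x ∂(volume.restrict univ), ∀ y ξ : E3,
      α * ‖ξ‖ ^ 2 ≤ ∑ i, ∑ j, P.μ i j x y * ξ j * ξ i) :
    ∀ᵐ t ∂(timeMeasure T), ‖s.gradφ t‖ ≤ α⁻¹ * ∑ j, ‖fn (s.m j t)‖ := by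
  filter_upwards [h.eq_φ, h.φ_beppoLevi] with t ht hb
  have h1 := ht _ _ hb
  have h2 := le_coefForm_self hP.μ_coef (subset_univ (P.exterior ε)) ε hμ (s.gradφ t)
  rw [coefForm_apply] at h2
  have e1 : ∫ x in P.perforated ε, ∑ j, fn (s.m j t) x * s.gradφ t x j
      = ∑ j, inner ℝ (fn (s.m j t))
          (coordL (P.perforated_subset_exterior ε) j (s.gradφ t)) := by
    simp_rw [inner_eq_integral]
    rw [← integral_finsetSum _ fun j _ => integrable_mul_L2 _ _]
    refine integral_congr_ae ?_
    have h2 : ∀ᵐ x ∂(volume.restrict (P.perforated ε)), ∀ j,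
      coordL (P.perforated_subset_exterior ε) j (s.gradφ t) x = s.gradφ t x j :=
      ae_all_iff.2 fun j => coeFn_coordL _ _ _
    filter_upwards [h2] with x hx
    exact Finset.sum_congr rfl fun j _ => by rw [hx j]
  have h3 : -∑ j, inner ℝ (fn (s.m j t))
      (coordL (P.perforated_subset_exterior ε) j (s.gradφ t))
      ≤ (∑ j, ‖fn (s.m j t)‖) * ‖s.gradφ t‖ := by
    rw [← Finset.sum_neg_distrib, Finset.sum_mul]
    refine Finset.sum_le_sum fun j _ => ?_
    refine (neg_le_abs _).trans ((abs_real_inner_le_norm _ _).trans ?_)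
    gcongr
    exact norm_coordL_le _ _ _
  have h4 : α * ‖s.gradφ t‖ ^ 2 ≤ (∑ j, ‖fn (s.m j t)‖) * ‖s.gradφ t‖ := by
    rw [e1] at h1
    linarith
  rw [← div_eq_inv_mul, le_div_iff₀ hα]
  rcases (norm_nonneg (s.gradφ t)).eq_or_lt with h0 | h0
  · rw [← h0, zero_mul]
    exact Finset.sum_nonneg fun j _ => norm_nonneg _
  · nlinarith

theorem m_eq_primitive (h : P.IsWeakSolution ε T m₀ v₀ s) (hT : 0 < T) (i : Fin 3) :
    ∀ᵐ t ∂(timeMeasure T), fn (s.m i t) = fn (m₀ i) + ∫ r in (0 : ℝ)..t, s.dm i r :=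
  eq_primitive_of_hasWeakTimeDeriv hT (h.dm_memLp i) (h.dm_deriv i) (h.m_init i)

theorem v_eq_primitive (h : P.IsWeakSolution ε T m₀ v₀ s) (hT : 0 < T) :
    ∀ᵐ t ∂(timeMeasure T), toH1Dual (P.c₁ • fn (s.logθ t) + P.c₂ • fn (s.θ t))
      = toH1Dual v₀ + ∫ r in (0 : ℝ)..t, s.dv r :=
  eq_primitive_of_hasWeakTimeDeriv hT h.dv_memLp h.dv_deriv h.v_init

/-- `∇θ = θ ∇ ln θ`. -/
theorem wgrad_θ (h : P.IsWeakSolution ε T m₀ v₀ s) (hP : P.Admissible) (hε : 0 < ε) :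
    ∀ᵐ t ∂(timeMeasure T), ∀ᵐ x ∂(volume.restrict (P.perforated ε)),
      wgrad (s.θ t) x = fn (s.θ t) x • wgrad (s.logθ t) x := by
  have hv := volume_perforated_ne_top hP ε
  filter_upwards [h.θ_pos, h.logθ_eq] with t h1 h2
  exact weakGradient_log (isOpen_perforated hP hε) ((isSobolev_coe (s.θ t)).integrableOn hv)
    ((isSobolev_coe (s.θ t)).integrableOn_grad hv) (s.θ t).2
    ((isSobolev_coe (s.logθ t)).integrableOn hv)
    ((isSobolev_coe (s.logθ t)).integrableOn_grad hv) (s.logθ t).2 h1 h2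

end IsWeakSolution

end Model

end Ferro

namespace Ferro

/-! ### Energy estimates -/

theorem integrable_pairing {X Y : Type*} [NormedAddCommGroup X] [NormedSpace ℝ X]
    [NormedAddCommGroup Y] [NormedSpace ℝ Y] {T : ℝ} (B : X →L[ℝ] Y →L[ℝ] ℝ) {D : ℝ → X}
    {w : ℝ → Y} (hD : MemLp D 2 (timeMeasure T)) (hw : MemLp w 2 (timeMeasure T)) :
    Integrable (fun t => B (D t) (w t)) (timeMeasure T) := by
  have hn : Integrable (fun t => ‖B‖ * (‖D t‖ * ‖w t‖)) (timeMeasure T) :=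
    (hD.norm.integrable_mul hw.norm).const_mul _
  refine hn.mono' (B.aestronglyMeasurable_comp₂ hD.1 hw.1) (Eventually.of_forall fun t => ?_)
  exact (B.le_opNorm₂ _ _).trans (le_of_eq (by ring))

theorem integrable_norm_sq {X : Type*} [NormedAddCommGroup X] {T : ℝ} {D : ℝ → X}
    (hD : MemLp D 2 (timeMeasure T)) : Integrable (fun t => ‖D t‖ ^ 2) (timeMeasure T) :=
  hD.norm.integrable_sq

theorem integral_eq_primitive_sub {X : Type*} [NormedAddCommGroup X] [NormedSpace ℝ X]
    [CompleteSpace X] {T : ℝ} {D : ℝ → X} (hD : MemLp D 2 (timeMeasure T)) {s t : ℝ}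
    (hs : s ∈ Ioo 0 T) (ht : t ∈ Ioo 0 T) :
    ∫ r in s..t, D r = (∫ r in (0 : ℝ)..t, D r) - ∫ r in (0 : ℝ)..s, D r := by
  have hi : ∀ r ∈ Ioo 0 T, IntervalIntegrable D volume 0 r := by
    intro r hr
    rw [intervalIntegrable_iff_integrableOn_Ioc_of_le hr.1.le]
    have h : IntegrableOn D (Ioo 0 T) := hD.integrable one_le_two
    exact h.mono_set fun x hx => ⟨hx.1, hx.2.trans_lt hr.2⟩
  rw [intervalIntegral.integral_interval_sub_left (hi t ht) (hi s hs)]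

/-- The inner product of `L²(U)` as a bilinear map. -/
noncomputable def innerL (U : Set E3) : L2 U →L[ℝ] L2 U →L[ℝ] ℝ :=
  (innerₗ (L2 U)).mkContinuous₂ 1 fun f g => by
    rw [one_mul]
    exact abs_real_inner_le_norm f g

theorem innerL_apply {U : Set E3} (f g : L2 U) : innerL U f g = inner ℝ f g := rfl

theorem inner_mulL_nonneg {U : Set E3} {C : ℝ≥0} (hS : FourEmbedding U C) {θ : H1 U}
    (hθ : ∀ᵐ x ∂(volume.restrict U), 0 < fn θ x) (u : H1 U) :
    0 ≤ inner ℝ (mulL hS θ u) (fn u) := by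
  rw [inner_eq_integral]
  refine integral_nonneg_of_ae ?_
  filter_upwards [hθ, coeFn_mulL hS θ u] with x h1 h2
  rw [h2, mul_assoc]
  exact mul_nonneg h1.le (mul_self_nonneg _)

theorem sq_sum_fin_three_le (a : Fin 3 → ℝ) : (∑ i, a i) ^ 2 ≤ 3 * ∑ i, a i ^ 2 := by
  simpa using sq_sum_le_card_mul_sum_sq (s := Finset.univ) (f := a)

/-- The subgradient inequality of the half square norm, in the form that `energy_inequality`
consumes. -/
theorem half_norm_sq_sub_le {X : Type*} [NormedAddCommGroup X] [InnerProductSpace ℝ X] (a b : X) :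
    ‖a‖ ^ 2 / 2 ≤ ‖b‖ ^ 2 / 2 + inner ℝ (a - b) a := by
  rw [inner_sub_left, real_inner_self_eq_norm_sq]
  have := real_inner_le_norm b a
  nlinarith [sq_nonneg (‖a‖ - ‖b‖)]

namespace Model

variable {P : Model}

theorem volume_perforated_le (hP : P.Admissible) (ε : ℝ) :
    volume (P.perforated ε) ≤ ENNReal.ofReal ((1 + (volume P.Ω).toReal) ^ 2) := by
  refine (measure_mono (P.perforated_subset ε)).trans ?_
  rw [← ENNReal.ofReal_toReal hP.Ω_bounded.measure_lt_top.ne]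
  refine ENNReal.ofReal_le_ofReal ?_
  rw [ENNReal.toReal_ofReal ENNReal.toReal_nonneg]
  nlinarith [ENNReal.toReal_nonneg (a := volume P.Ω)]

/-- The bound of `m` in `L^∞(0,T;L²)`. -/
theorem exists_bound_norm_m (hP : P.Admissible) {T : ℝ} (hT : 0 < T) (C₀ : ℝ) :
    ∃ M : ℝ, 0 ≤ M ∧ ∀ ε : ℝ, 0 < ε → ∀ (m₀ : Fin 3 → H1 (P.perforated ε))
      (v₀ : L2 (P.perforated ε)), (∀ i, ‖m₀ i‖ ≤ C₀) → ∀ s : P.Unknowns ε,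
      P.IsWeakSolution ε T m₀ v₀ s → ∀ᵐ t ∂(timeMeasure T),
        (∀ i, ‖fn (s.m i t)‖ ≤ M) ∧ ‖s.gradφ t‖ ≤ M := by
  obtain ⟨α, hα, hμ⟩ := hP.μ_coef.coercive
  obtain ⟨C, hC⟩ := exists_fourEmbedding hP
  set V : ℝ := 1 + (volume P.Ω).toReal with hV
  have hV0 : 0 ≤ V := by positivity
  have hγ := hP.γ_pos
  have hθc := hP.θc_pos
  -- With $n$ the $L^2$ norm of $|\mathbf m|^2$, the rate of change of the energy times `γ` is at
  -- most $-\theta_cn^2+Ln\le L^2/(4\theta_c)$. `K` is this maximum divided by `γ`, and `N` results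
  -- from integrating over $(0,T)$.
  set L : ℝ := (P.θc + 3 * α⁻¹) * V with hL
  set K : ℝ := L ^ 2 / (4 * P.θc * P.γ) with hK
  have hK0 : 0 ≤ K := by positivity
  set N : ℝ := Real.sqrt (3 * C₀ ^ 2 + 2 * (K * T)) with hN
  refine ⟨N + α⁻¹ * (3 * N), by positivity, fun ε hε m₀ v₀ hm₀ s h => ?_⟩
  have hS := hC ε hε
  have hmL : ∀ i, MemLp (fun t => fn (s.m i t)) 2 (timeMeasure T) := fun i =>
    (fnL _).comp_memLp' (h.m_memLp i)
  have hφ := h.norm_gradφ_le hP hα hμ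
  set Φ : ℝ → ℝ := fun t => ∑ i, ‖fn (s.m i t)‖ ^ 2 / 2 with hΦ
  set G : Set ℝ := {t | t ∈ Ioo 0 T ∧
    ∀ i, fn (s.m i t) = fn (m₀ i) + ∫ r in (0 : ℝ)..t, s.dm i r} with hG
  have hGae : ∀ᵐ t ∂(timeMeasure T), t ∈ G := by
    filter_upwards [ae_restrict_mem measurableSet_Ioo, ae_all_iff.2 fun i => h.m_eq_primitive hT i]
      with t h1 h2 using ⟨h1, h2⟩
  have hen := energy_inequality (innerL _) h.dm_memLp hmL (Φ := Φ)
    (Φ₀ := ∑ i, ‖fn (m₀ i)‖ ^ 2 / 2) (fun t => Finset.sum_nonneg fun i _ => by positivity) hGae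
    (fun t ht => by
      rw [← Finset.sum_add_distrib]
      refine Finset.sum_le_sum fun i _ => ?_
      have h1 := half_norm_sq_sub_le (fn (s.m i t)) (fn (m₀ i))
      rwa [ht.2 i, add_sub_cancel_left, ← ht.2 i] at h1)
    (fun r hr t ht => by
      rw [← Finset.sum_add_distrib]
      refine Finset.sum_le_sum fun i _ => ?_
      have h1 := half_norm_sq_sub_le (fn (s.m i t)) (fn (s.m i r))
      rwa [show fn (s.m i t) - fn (s.m i r) = ∫ z in r..t, s.dm i z by
        rw [integral_eq_primitive_sub (h.dm_memLp i) hr.1 ht.1, ht.2 i, hr.2 i]; abel] at h1)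
  -- The equation is tested with `m`. Diffusion and temperature terms have a favourable sign, the
  -- latter because `θ > 0`, and the quartic term dominates the remaining ones, so no Gronwall
  -- argument is needed.
  have hpt : ∀ᵐ t ∂(timeMeasure T), ∑ i, innerL _ (s.dm i t) (fn (s.m i t)) ≤ K := by
    filter_upwards [h.weak_m hP hS, h.θ_pos, hφ] with t h1 h2 h3
    have e1 : P.γ * ∑ i, innerL _ (s.dm i t) (fn (s.m i t))
        ≤ - P.θc * ‖modSq hS fun j => s.m j t‖ ^ 2
          + (P.θc + 3 * α⁻¹) * ∑ i, ‖fn (s.m i t)‖ ^ 2 := by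
      have e2 : ∀ i, P.γ * innerL _ (s.dm i t) (fn (s.m i t))
          ≤ - P.θc * inner ℝ (modSq hS fun j => s.m j t) (mulL hS (s.m i t) (s.m i t))
            + P.θc * ‖fn (s.m i t)‖ ^ 2 + ‖s.gradφ t‖ * ‖fn (s.m i t)‖ := by
        intro i
        have a1 := h1 (s.m i t) i
        have a2 := coefForm_self_nonneg hP.A_coef (P.perforated_subset ε) ε (wgrad (s.m i t))
        have a3 := inner_mulL_nonneg hS h2 (s.m i t)
        have a4 : inner ℝ (coordL (P.perforated_subset_exterior ε) i (s.gradφ t)) (fn (s.m i t))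
            ≤ ‖s.gradφ t‖ * ‖fn (s.m i t)‖ := by
          refine (real_inner_le_norm _ _).trans ?_
          gcongr
          exact norm_coordL_le _ _ _
        rw [innerL_apply, a1, real_inner_self_eq_norm_sq]
        linarith
      have e3 := Finset.sum_le_sum fun i (_ : i ∈ Finset.univ) => e2 i
      rw [← Finset.mul_sum, Finset.sum_add_distrib, Finset.sum_add_distrib, ← Finset.mul_sum,
        ← Finset.mul_sum, ← Finset.mul_sum, sum_inner_modSq hS fun j => s.m j t] at e3
      have e4 : ‖s.gradφ t‖ * ∑ i, ‖fn (s.m i t)‖ ≤ α⁻¹ * (3 * ∑ i, ‖fn (s.m i t)‖ ^ 2) := by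
        refine (mul_le_mul_of_nonneg_right h3 (Finset.sum_nonneg fun i _ => norm_nonneg _)).trans ?_
        rw [mul_assoc, ← sq]
        gcongr
        exact sq_sum_fin_three_le _
      linarith
    have e5 := sum_norm_sq_le hS (volume_perforated_le hP ε) hV0 fun j => s.m j t
    set n := ‖modSq hS fun j => s.m j t‖
    have e6 : P.γ * ∑ i, innerL _ (s.dm i t) (fn (s.m i t)) ≤ - P.θc * n ^ 2 + L * n := by
      refine e1.trans ?_
      have := mul_le_mul_of_nonneg_left e5 (by positivity : 0 ≤ P.θc + 3 * α⁻¹)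
      rw [hL, mul_assoc]
      linarith
    have e7 : - P.θc * n ^ 2 + L * n ≤ P.γ * K := by
      rw [hK, show P.γ * (L ^ 2 / (4 * P.θc * P.γ)) = L ^ 2 / (4 * P.θc) by field_simp,
        le_div_iff₀ (by positivity)]
      nlinarith [sq_nonneg (2 * P.θc * n - L)]
    exact le_of_mul_le_mul_left (e6.trans e7) hγ
  have hint : Integrable (fun t => ∑ i, innerL _ (s.dm i t) (fn (s.m i t))) (timeMeasure T) :=
    integrable_finsetSum _ fun i _ => integrable_pairing _ (h.dm_memLp i) (hmL i)
  filter_upwards [hen, hφ, ae_restrict_mem measurableSet_Ioo] with τ h1 h2 hτ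
  have h3 := intervalIntegral_mono_timeMeasure hint (integrable_const K) hpt
    (Ioo_subset_Icc_self hτ)
  rw [intervalIntegral.integral_const, smul_eq_mul, sub_zero] at h3
  have h4 : ∑ i, ‖fn (m₀ i)‖ ^ 2 / 2 ≤ 3 * C₀ ^ 2 / 2 := by
    calc ∑ i, ‖fn (m₀ i)‖ ^ 2 / 2 ≤ ∑ _i : Fin 3, C₀ ^ 2 / 2 := by
          refine Finset.sum_le_sum fun i _ => ?_
          gcongr
          exact (norm_fn_le _).trans (hm₀ i)
      _ = _ := by simp; ring
  have h5 : ∀ i, ‖fn (s.m i τ)‖ ≤ N := by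
    intro i
    refine Real.le_sqrt_of_sq_le ?_
    have h6 : ‖fn (s.m i τ)‖ ^ 2 / 2 ≤ Φ τ :=
      Finset.single_le_sum (f := fun i => ‖fn (s.m i τ)‖ ^ 2 / 2) (fun j _ => by positivity)
        (Finset.mem_univ i)
    have h7 : τ * K ≤ K * T := by
      rw [mul_comm]
      exact mul_le_mul_of_nonneg_left hτ.2.le hK0
    linarith
  have h8 : α⁻¹ * ∑ j, ‖fn (s.m j τ)‖ ≤ α⁻¹ * (3 * N) := by
    gcongr
    calc ∑ j, ‖fn (s.m j τ)‖ ≤ ∑ _j : Fin 3, N := Finset.sum_le_sum fun j _ => h5 j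
      _ = _ := by simp
  have h9 : 0 ≤ N := Real.sqrt_nonneg _
  have h10 : 0 ≤ α⁻¹ * (3 * N) := by positivity
  exact ⟨fun i => by linarith [h5 i], by linarith⟩

end Model

end Ferro

/-! ### Magnetic and thermal energy -/

namespace Ferro

/-- `energy_inequality` with one index and the duality pairing as bilinear map. -/
theorem energy_inequality_dual {X : Type*} [NormedAddCommGroup X] [NormedSpace ℝ X] {T : ℝ}
    {D : ℝ → StrongDual ℝ X} (hD : MemLp D 2 (timeMeasure T)) {w : ℝ → X}
    (hw : MemLp w 2 (timeMeasure T)) {Φ : ℝ → ℝ} {Φ₀ : ℝ} (hΦ : ∀ t, 0 ≤ Φ t) {G : Set ℝ}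
    (hG : ∀ᵐ t ∂(timeMeasure T), t ∈ G)
    (h0 : ∀ t ∈ G, Φ t ≤ Φ₀ + (∫ r in (0 : ℝ)..t, D r) (w t))
    (h1 : ∀ r ∈ G, ∀ t ∈ G, Φ t ≤ Φ r + (∫ z in r..t, D z) (w t)) :
    ∀ᵐ τ ∂(timeMeasure T), Φ τ ≤ Φ₀ + ∫ t in (0 : ℝ)..τ, D t (w t) := by
  have h := energy_inequality (ι := Unit) (ContinuousLinearMap.id ℝ (StrongDual ℝ X))
    (D := fun _ => D) (fun _ => hD) (w := fun _ => w) (fun _ => hw) hΦ hG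
    (fun t ht => by simpa using h0 t ht) (fun r hr t ht => by simpa using h1 r hr t ht)
  simpa using h

theorem integrable_dual_pairing {X : Type*} [NormedAddCommGroup X] [NormedSpace ℝ X] {T : ℝ}
    {D : ℝ → StrongDual ℝ X} {w : ℝ → X} (hD : MemLp D 2 (timeMeasure T))
    (hw : MemLp w 2 (timeMeasure T)) : Integrable (fun t => D t (w t)) (timeMeasure T) :=
  integrable_pairing (ContinuousLinearMap.id ℝ (StrongDual ℝ X)) hD hw

/-- The energy `∫_U c₁ θ + c₂ θ² / 2`. -/
noncomputable def heatEnergy {U : Set E3} (c₁ c₂ : ℝ) (θ : L2 U) : ℝ :=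
  ∫ x in U, (c₁ * θ x + c₂ / 2 * θ x ^ 2)

section HeatEnergy

variable {U : Set E3} {c₁ c₂ : ℝ}

theorem integrable_heatEnergy (hU : volume U ≠ ⊤) (c₁ c₂ : ℝ) (θ : L2 U) :
    Integrable (fun x => c₁ * θ x + c₂ / 2 * θ x ^ 2) (volume.restrict U) := by
  have : IsFiniteMeasure (volume.restrict U) := ⟨by simpa using hU.lt_top⟩
  exact (((Lp.memLp θ).integrable one_le_two).const_mul _).add
    ((Lp.memLp θ).integrable_sq.const_mul _)

theorem heatEnergy_nonneg (hc₁ : 0 ≤ c₁) (hc₂ : 0 ≤ c₂) {θ : L2 U}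
    (hθ : ∀ᵐ x ∂(volume.restrict U), 0 < θ x) : 0 ≤ heatEnergy c₁ c₂ θ := by
  refine integral_nonneg_of_ae ?_
  filter_upwards [hθ] with x hx
  have := hx.le
  simp only [Pi.zero_apply]
  positivity

theorem heatEnergy_le (hU : volume U ≠ ⊤) (hc₁ : 0 ≤ c₁) (hc₂ : 0 ≤ c₂) (θ : L2 U) :
    heatEnergy c₁ c₂ θ ≤ c₁ * (volume U).toReal + (c₁ + c₂) * ‖θ‖ ^ 2 := by
  have : IsFiniteMeasure (volume.restrict U) := ⟨by simpa using hU.lt_top⟩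
  have hsq : ∫ x in U, θ x ^ 2 = ‖θ‖ ^ 2 := by
    rw [← real_inner_self_eq_norm_sq, inner_eq_integral]
    simp_rw [sq]
  calc heatEnergy c₁ c₂ θ ≤ ∫ x in U, (c₁ + (c₁ + c₂) * θ x ^ 2) := by
        refine integral_mono (integrable_heatEnergy hU c₁ c₂ θ)
          ((integrable_const _).add ((Lp.memLp θ).integrable_sq.const_mul _)) fun x => ?_
        have h1 : θ x ≤ 1 + θ x ^ 2 := by nlinarith [sq_nonneg (θ x - 1)]
        have h2 : c₁ * θ x ≤ c₁ * (1 + θ x ^ 2) := mul_le_mul_of_nonneg_left h1 hc₁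
        have h3 : 0 ≤ c₂ * θ x ^ 2 := by positivity
        simp only
        linarith
    _ = _ := by
        rw [integral_add (integrable_const _) ((Lp.memLp θ).integrable_sq.const_mul _),
          integral_const_mul, hsq, setIntegral_const, smul_eq_mul, Measure.real]
        ring

/-- Convexity of the heat energy as a function of `c₁ ln θ + c₂ θ`. -/
theorem heatEnergy_convex (hU : volume U ≠ ⊤) (hc₁ : 0 ≤ c₁) (hc₂ : 0 ≤ c₂) {θ ϑ v w : L2 U}
    (hθ : ∀ᵐ x ∂(volume.restrict U), 0 < θ x) (hϑ : ∀ᵐ x ∂(volume.restrict U), 0 < ϑ x)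
    (hv : ∀ᵐ x ∂(volume.restrict U), v x = c₁ * Real.log (θ x) + c₂ * θ x)
    (hw : ∀ᵐ x ∂(volume.restrict U), w x = c₁ * Real.log (ϑ x) + c₂ * ϑ x) :
    heatEnergy c₁ c₂ θ ≤ heatEnergy c₁ c₂ ϑ + inner ℝ (v - w) θ := by
  rw [inner_eq_integral, heatEnergy, heatEnergy,
    ← integral_add (integrable_heatEnergy hU c₁ c₂ ϑ) (integrable_mul_L2 _ _)]
  refine integral_mono_ae (integrable_heatEnergy hU c₁ c₂ θ)
    ((integrable_heatEnergy hU c₁ c₂ ϑ).add (integrable_mul_L2 _ _)) ?_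
  filter_upwards [hθ, hϑ, hv, hw, Lp.coeFn_sub v w] with x h1 h2 h3 h4 h5
  simp only [h5, Pi.sub_apply, h3, h4]
  set b := θ x
  set a := ϑ x
  -- The derivative of $c_1\theta+c_2\theta^2/2$ with respect to $c_1\ln\theta+c_2\theta$ is
  -- $\theta$. The `c₁` part of the inequality is $\ln x\le x-1$ at `a / b`, and the `c₂` part is
  -- half the square of `b - a`.
  have h6 : Real.log a - Real.log b ≤ a / b - 1 := by
    rw [← Real.log_div h2.ne' h1.ne']
    exact Real.log_le_sub_one_of_pos (div_pos h2 h1)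
  have h7 : b * (Real.log a - Real.log b) ≤ a - b := by
    have := mul_le_mul_of_nonneg_left h6 h1.le
    rwa [mul_sub_one, mul_div_cancel₀ _ h1.ne'] at this
  have h8 := mul_le_mul_of_nonneg_left h7 hc₁
  have h9 : 0 ≤ c₂ * (b - a) ^ 2 := by positivity
  nlinarith

end HeatEnergy

namespace Model

variable {P : Model}

/-- The magnetic energy `½ ∫ A^ε ∇m · ∇m + θc/4 ∫ |m|⁴`. -/
noncomputable def magEnergy (hP : P.Admissible) {ε : ℝ} {C : ℝ≥0}
    (hS : FourEmbedding (P.perforated ε) C) (m : Fin 3 → H1 (P.perforated ε)) : ℝ :=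
  ∑ i, coefForm hP.A_coef (P.perforated_subset ε) ε (wgrad (m i)) (wgrad (m i)) / 2
    + P.θc * (‖modSq hS m‖ ^ 2 / 4)

theorem magEnergy_nonneg (hP : P.Admissible) {ε : ℝ} {C : ℝ≥0}
    (hS : FourEmbedding (P.perforated ε) C) (m : Fin 3 → H1 (P.perforated ε)) :
    P.θc * (‖modSq hS m‖ ^ 2 / 4) ≤ magEnergy hP hS m := by
  refine le_add_of_nonneg_left (Finset.sum_nonneg fun i _ => ?_)
  have := coefForm_self_nonneg hP.A_coef (P.perforated_subset ε) ε (wgrad (m i))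
  positivity

theorem magEnergy_le (hP : P.Admissible) {ε : ℝ} {C : ℝ≥0}
    (hS : FourEmbedding (P.perforated ε) C) {m : Fin 3 → H1 (P.perforated ε)} {R : ℝ}
    (hm : ∀ i, ‖m i‖ ≤ R) : magEnergy hP hS m
      ≤ 3 * (coefBound P.Ω P.A * R ^ 2 / 2) + P.θc * ((3 * (C ^ 2 * R ^ 2)) ^ 2 / 4) := by
  have hθc := hP.θc_pos.le
  refine add_le_add ?_ ?_
  · calc _ ≤ ∑ _i : Fin 3, coefBound P.Ω P.A * R ^ 2 / 2 := by
          refine Finset.sum_le_sum fun i _ => ?_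
          have h1 := (le_abs_self _).trans (abs_coefForm_le hP.A_coef (P.perforated_subset ε) ε
            (wgrad (m i)) (wgrad (m i)))
          have h2 : ‖wgrad (m i)‖ * ‖wgrad (m i)‖ ≤ R ^ 2 := by
            rw [← sq]
            gcongr
            exact (norm_wgrad_le _).trans (hm i)
          have h3 := mul_le_mul_of_nonneg_left h2 (coefBound_nonneg P.Ω P.A)
          linarith
      _ = _ := by simp
  · gcongr
    exact norm_modSq_le hS m hm

/-- The right-hand side of the magnetization equation without the terms from the energy. -/
noncomputable def effForce {ε : ℝ} {C : ℝ≥0} (hS : FourEmbedding (P.perforated ε) C)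
    (s : P.Unknowns ε) (i : Fin 3) (t : ℝ) : L2 (P.perforated ε) :=
  (-P.γ) • s.dm i t + P.θc • fn (s.m i t) - mulL hS (s.θ t) (s.m i t)
    + coordL (P.perforated_subset_exterior ε) i (s.gradφ t)

namespace IsWeakSolution

variable {ε T : ℝ} {m₀ : Fin 3 → H1 (P.perforated ε)} {v₀ : L2 (P.perforated ε)}
  {s : P.Unknowns ε}

/-- The critical product is $\theta\mathbf m$, with $\theta\in L^2(0,T;L^4)$ by the embedding and
$\mathbf m\in L^\infty(0,T;L^4)$. -/
theorem memLp_effForce (h : P.IsWeakSolution ε T m₀ v₀ s) {C : ℝ≥0}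
    (hS : FourEmbedding (P.perforated ε) C) (i : Fin 3) :
    MemLp (effForce hS s i) 2 (timeMeasure T) := by
  obtain ⟨R, hR⟩ := h.m_L4
  have h1 : MemLp (fun t => mulL hS (s.θ t) (s.m i t)) 2 (timeMeasure T) := by
    refine h.θ_memLp.of_le_mul (c := C * R)
      ((mulL hS).aestronglyMeasurable_comp₂ h.θ_memLp.1 (h.m_memLp i).1) ?_
    filter_upwards [hR i] with t ht
    have h2 := (norm_mulL_le_eLpNorm hS (s.θ t) (s.m i t)).trans (mul_le_mul' (hS _) ht)
    have h3 := ENNReal.toReal_mono (by finiteness) h2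
    simpa [mul_comm, mul_left_comm, mul_assoc] using h3
  have h2 : MemLp (fun t => coordL (P.perforated_subset_exterior ε) i (s.gradφ t)) 2
      (timeMeasure T) :=
    (coordL (P.perforated_subset_exterior ε) i).comp_memLp' (h.gradφ_memLp.mono_exponent le_top)
  have h3 : MemLp (fun t => fn (s.m i t)) 2 (timeMeasure T) := (fnL _).comp_memLp' (h.m_memLp i)
  exact ((((h.dm_memLp i).const_smul (-P.γ)).add (h3.const_smul P.θc)).sub h1).add h2

/-- By the weak equation tested with `m - b`, `effForce` is the differential of the magnetic energy
at `m`. The convexity inequalities `coefForm_convex` and `modSq_convex` make it a subgradient. Its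
pairing involves the function `m - b` and not its gradient. -/
theorem magEnergy_convex (h : P.IsWeakSolution ε T m₀ v₀ s) (hP : P.Admissible) {C : ℝ≥0}
    (hS : FourEmbedding (P.perforated ε) C) :
    ∀ᵐ t ∂(timeMeasure T), ∀ b : Fin 3 → H1 (P.perforated ε),
      magEnergy hP hS (fun i => s.m i t) ≤ magEnergy hP hS b
        + ∑ i, inner ℝ (fn (s.m i t) - fn (b i)) (effForce hS s i t) := by
  filter_upwards [h.weak_m hP hS] with t ht b
  have h1 : ∀ i, inner ℝ (fn (s.m i t) - fn (b i)) (effForce hS s i t)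
      = coefForm hP.A_coef (P.perforated_subset ε) ε (wgrad (s.m i t))
          (wgrad (s.m i t) - wgrad (b i))
        + P.θc * inner ℝ (modSq hS fun j => s.m j t) (mulL hS (s.m i t) (s.m i t - b i)) := by
    intro i
    have a1 := ht (s.m i t - b i) i
    rw [show fn (s.m i t - b i) = fn (s.m i t) - fn (b i) from rfl,
      show wgrad (s.m i t - b i) = wgrad (s.m i t) - wgrad (b i) from rfl] at a1
    rw [real_inner_comm, effForce, inner_add_left, inner_sub_left, inner_add_left,
      real_inner_smul_left, real_inner_smul_left]
    linarith
  have h2 := modSq_convex hS (fun i => s.m i t) b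
  have h3 := Finset.sum_le_sum fun i (_ : i ∈ Finset.univ) =>
    coefForm_convex hP.A_coef (P.perforated_subset ε) ε (wgrad (s.m i t)) (wgrad (b i))
  rw [Finset.sum_sub_distrib] at h3
  have h4 := mul_le_mul_of_nonneg_left h2 hP.θc_pos.le
  simp_rw [h1]
  rw [Finset.sum_add_distrib, ← Finset.mul_sum, magEnergy, magEnergy]
  linarith

theorem coeFn_v (h : P.IsWeakSolution ε T m₀ v₀ s) :
    ∀ᵐ t ∂(timeMeasure T), ∀ᵐ x ∂(volume.restrict (P.perforated ε)),
      (P.c₁ • fn (s.logθ t) + P.c₂ • fn (s.θ t)) x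
        = P.c₁ * Real.log (fn (s.θ t) x) + P.c₂ * fn (s.θ t) x := by
  filter_upwards [h.logθ_eq] with t ht
  filter_upwards [ht, Lp.coeFn_add (P.c₁ • fn (s.logθ t)) (P.c₂ • fn (s.θ t)),
    Lp.coeFn_smul P.c₁ (fn (s.logθ t)), Lp.coeFn_smul P.c₂ (fn (s.θ t))] with x h1 h2 h3 h4
  rw [h2, Pi.add_apply, h3, h4, Pi.smul_apply, Pi.smul_apply, h1]
  rfl

/-- This replaces the test of the magnetization equation with `∂_t m`, which is only square
integrable and so not an admissible test function. -/
theorem magEnergy_inequality (h : P.IsWeakSolution ε T m₀ v₀ s) (hP : P.Admissible) (hT : 0 < T)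
    {C : ℝ≥0} (hS : FourEmbedding (P.perforated ε) C) :
    ∀ᵐ τ ∂(timeMeasure T), magEnergy hP hS (fun i => s.m i τ) ≤ magEnergy hP hS m₀
      + ∫ t in (0 : ℝ)..τ, ∑ i, innerL _ (s.dm i t) (effForce hS s i t) := by
  have hθc := hP.θc_pos
  set G : Set ℝ := {t | t ∈ Ioo 0 T ∧
    (∀ i, fn (s.m i t) = fn (m₀ i) + ∫ r in (0 : ℝ)..t, s.dm i r) ∧
    ∀ b : Fin 3 → H1 (P.perforated ε), magEnergy hP hS (fun i => s.m i t)
      ≤ magEnergy hP hS b + ∑ i, inner ℝ (fn (s.m i t) - fn (b i)) (effForce hS s i t)} with hG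
  have hGae : ∀ᵐ t ∂(timeMeasure T), t ∈ G := by
    filter_upwards [ae_restrict_mem measurableSet_Ioo,
      ae_all_iff.2 fun i => h.m_eq_primitive hT i, h.magEnergy_convex hP hS]
      with t h1 h2 h3 using ⟨h1, h2, h3⟩
  refine energy_inequality (innerL (P.perforated ε)) h.dm_memLp (h.memLp_effForce hS)
    (fun t => ?_) hGae ?_ ?_
  · exact (by positivity : 0 ≤ P.θc * (‖modSq hS fun i => s.m i t‖ ^ 2 / 4)).trans
      (magEnergy_nonneg hP hS _)
  · rintro t ⟨-, h2, h3⟩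
    refine (h3 m₀).trans (le_of_eq ?_)
    congr 1
    refine Finset.sum_congr rfl fun i _ => ?_
    rw [h2 i, add_sub_cancel_left, innerL_apply]
  · rintro r ⟨hr1, hr2, -⟩ t ⟨h1, h2, h3⟩
    refine (h3 fun i => s.m i r).trans (le_of_eq ?_)
    congr 1
    refine Finset.sum_congr rfl fun i _ => ?_
    rw [h2 i, hr2 i, add_sub_add_left_eq_sub, ← integral_eq_primitive_sub (h.dm_memLp i) hr1 h1,
      innerL_apply]

/-- The heat equation tested with `θ`. The maximum with zero provides nonnegativity at every time,
although `θ` is positive only at almost every time. -/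
theorem heatEnergy_inequality (h : P.IsWeakSolution ε T m₀ v₀ s) (hP : P.Admissible)
    (hT : 0 < T) {θ₀ : L2 (P.perforated ε)}
    (hθ₀ : ∀ᵐ x ∂(volume.restrict (P.perforated ε)), 0 < θ₀ x)
    (hv₀ : ∀ᵐ x ∂(volume.restrict (P.perforated ε)),
      v₀ x = P.c₁ * Real.log (θ₀ x) + P.c₂ * θ₀ x) :
    ∀ᵐ τ ∂(timeMeasure T), max 0 (heatEnergy P.c₁ P.c₂ (fn (s.θ τ)))
      ≤ heatEnergy P.c₁ P.c₂ θ₀ + ∫ t in (0 : ℝ)..τ, s.dv t (s.θ t) := by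
  have hvU := volume_perforated_ne_top hP ε
  have hpos : ∀ {t}, (∀ᵐ x ∂(volume.restrict (P.perforated ε)), 0 < fn (s.θ t) x) →
      max 0 (heatEnergy P.c₁ P.c₂ (fn (s.θ t))) = heatEnergy P.c₁ P.c₂ (fn (s.θ t)) :=
    fun ht => max_eq_right (heatEnergy_nonneg hP.c₁_pos.le hP.c₂_pos.le ht)
  set v : ℝ → L2 (P.perforated ε) := fun t => P.c₁ • fn (s.logθ t) + P.c₂ • fn (s.θ t) with hv
  set G : Set ℝ := {t | t ∈ Ioo 0 T ∧
    (∀ᵐ x ∂(volume.restrict (P.perforated ε)), 0 < fn (s.θ t) x) ∧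
    (∀ᵐ x ∂(volume.restrict (P.perforated ε)),
      v t x = P.c₁ * Real.log (fn (s.θ t) x) + P.c₂ * fn (s.θ t) x) ∧
    toH1Dual (v t) = toH1Dual v₀ + ∫ r in (0 : ℝ)..t, s.dv r} with hG
  have hGae : ∀ᵐ t ∂(timeMeasure T), t ∈ G := by
    filter_upwards [ae_restrict_mem measurableSet_Ioo, h.θ_pos, h.coeFn_v, h.v_eq_primitive hT]
      with t h1 h2 h3 h4 using ⟨h1, h2, h3, h4⟩
  refine energy_inequality_dual h.dv_memLp h.θ_memLp (fun t => le_max_left _ _) hGae ?_ ?_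
  · rintro t ⟨-, h2, h3, h4⟩
    rw [hpos h2]
    refine (heatEnergy_convex hvU hP.c₁_pos.le hP.c₂_pos.le h2 hθ₀ h3 hv₀).trans (le_of_eq ?_)
    rw [inner_sub_left, ← toH1Dual_apply, ← toH1Dual_apply, h4, add_apply, add_sub_cancel_left]
  · rintro r ⟨hr1, hr2, hr3, hr4⟩ t ⟨h1, h2, h3, h4⟩
    rw [hpos h2, hpos hr2]
    refine (heatEnergy_convex hvU hP.c₁_pos.le hP.c₂_pos.le h2 hr2 h3 hr3).trans (le_of_eq ?_)
    rw [inner_sub_left, ← toH1Dual_apply, ← toH1Dual_apply, h4, hr4, add_apply, add_apply,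
      add_sub_add_left_eq_sub, integral_eq_primitive_sub h.dv_memLp hr1 h1, sub_apply]

end IsWeakSolution

/-- The bounds of `m` in `L^∞(0,T;L⁴)`, of `∂_t m` in `L²(0,T;L²)` and of `∇θ` in
`L²(0,T;L²)`. -/
theorem exists_bound_energy (hP : P.Admissible) {T : ℝ} (hT : 0 < T) (C₀ : ℝ) {C : ℝ≥0}
    (hC : ∀ ε : ℝ, 0 < ε → FourEmbedding (P.perforated ε) C) :
    ∃ M : ℝ, 0 ≤ M ∧ ∀ (ε : ℝ) (hε : 0 < ε) (m₀ : Fin 3 → H1 (P.perforated ε))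
      (θ₀ v₀ : L2 (P.perforated ε)), (∀ i, ‖m₀ i‖ ≤ C₀) → ‖θ₀‖ ≤ C₀ →
      (∀ᵐ x ∂(volume.restrict (P.perforated ε)), 0 < θ₀ x ∧ v₀ x = P.F (θ₀ x)) →
      ∀ s : P.Unknowns ε, P.IsWeakSolution ε T m₀ v₀ s →
        (∀ᵐ t ∂(timeMeasure T), ‖modSq (hC ε hε) fun i => s.m i t‖ ≤ M) ∧
        (∫ t, ∑ i, ‖s.dm i t‖ ^ 2 ∂(timeMeasure T) ≤ M) ∧
        ∫ t, ‖wgrad (s.θ t)‖ ^ 2 ∂(timeMeasure T) ≤ M := by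
  obtain ⟨M₁, hM₁, hbd⟩ := exists_bound_norm_m hP hT C₀
  obtain ⟨α, hα, hK⟩ := hP.K_coef.coercive
  have hγ := hP.γ_pos
  have hθc := hP.θc_pos
  have hk₁ := hP.k₁_pos
  have hk₀ := hP.k₀_pos
  -- `K` is the remainder when the terms linear in `∂_t m` are absorbed into half of the damping
  -- `γ‖∂_t m‖²`. `E` adds the initial magnetic energy, the initial heat energy and the contribution
  -- of `K` over $(0,T)$.
  set K : ℝ := 3 * ((P.θc * M₁ + M₁) ^ 2 / (2 * P.γ)) with hKdef
  set E : ℝ := (3 * (coefBound P.Ω P.A * C₀ ^ 2 / 2) + P.θc * ((3 * (C ^ 2 * C₀ ^ 2)) ^ 2 / 4))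
    + (P.c₁ * (volume P.Ω).toReal + (P.c₁ + P.c₂) * C₀ ^ 2) + K * T with hE
  have hK0 : 0 ≤ K := by positivity
  have hE0 : 0 ≤ E := by
    have := coefBound_nonneg P.Ω P.A
    have := hP.c₁_pos
    have := hP.c₂_pos
    positivity
  refine ⟨Real.sqrt (4 * E / P.θc) + 2 * E / P.γ + E / (P.k₁ * α), by positivity,
    fun ε hε m₀ θ₀ v₀ hm₀ hθ₀ hv₀ s h => ?_⟩
  have hS := hC ε hε
  have hvU := volume_perforated_ne_top hP ε
  have hforce := h.memLp_effForce hS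
  have hθL : MemLp (fun t => wgrad (s.θ t)) 2 (timeMeasure T) := (wgradL _).comp_memLp' h.θ_memLp
  have hen1 := h.magEnergy_inequality hP hT hS
  have hen2 := h.heatEnergy_inequality hP hT (hv₀.mono fun x hx => hx.1)
    (hv₀.mono fun x hx => hx.2)
  have hint1 : Integrable (fun t => ∑ i, innerL _ (s.dm i t) (effForce hS s i t))
      (timeMeasure T) :=
    integrable_finsetSum _ fun i _ => integrable_pairing _ (h.dm_memLp i) (hforce i)
  have hint2 : Integrable (fun t => s.dv t (s.θ t)) (timeMeasure T) :=
    integrable_dual_pairing h.dv_memLp h.θ_memLp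
  have hint3 : Integrable (fun t => ∑ i, ‖s.dm i t‖ ^ 2) (timeMeasure T) :=
    integrable_finsetSum _ fun i _ => integrable_norm_sq (h.dm_memLp i)
  have hint4 := integrable_norm_sq hθL
  have hint5 : Integrable (fun t => P.γ / 2 * ∑ i, ‖s.dm i t‖ ^ 2
      + P.k₁ * α * ‖wgrad (s.θ t)‖ ^ 2) (timeMeasure T) :=
    (hint3.const_mul _).add (hint4.const_mul _)
  -- The term $-\int\theta\,\mathbf m\cdot\partial_t\mathbf m$ of the magnetic balance cancels
  -- against the source of the heat equation tested with `θ`. The `k₀` part of the diffusion is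
  -- nonnegative because $\nabla\theta=\theta\nabla\ln\theta$, and the `k₁` part is coercive in
  -- `∇θ`.
  have hpt : ∀ᵐ t ∂(timeMeasure T), (∑ i, innerL _ (s.dm i t) (effForce hS s i t))
      + s.dv t (s.θ t)
      ≤ K - (P.γ / 2 * ∑ i, ‖s.dm i t‖ ^ 2 + P.k₁ * α * ‖wgrad (s.θ t)‖ ^ 2) := by
    filter_upwards [h.weak_θ hP hS, hbd ε hε m₀ v₀ hm₀ s h, h.θ_pos, h.wgrad_θ hP hε]
      with t h1 h2 h3 h4
    have e1 : ∀ i, innerL _ (s.dm i t) (effForce hS s i t)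
        ≤ - (P.γ / 2) * ‖s.dm i t‖ ^ 2 + (P.θc * M₁ + M₁) ^ 2 / (2 * P.γ)
          - inner ℝ (s.dm i t) (mulL hS (s.θ t) (s.m i t)) := by
      intro i
      rw [innerL_apply, effForce, inner_add_right, inner_sub_right, inner_add_right,
        real_inner_smul_right, real_inner_smul_right, real_inner_self_eq_norm_sq]
      have a1 : inner ℝ (s.dm i t) (fn (s.m i t)) ≤ ‖s.dm i t‖ * M₁ :=
        (real_inner_le_norm _ _).trans (mul_le_mul_of_nonneg_left (h2.1 i) (norm_nonneg _))
      have a2 : inner ℝ (s.dm i t) (coordL (P.perforated_subset_exterior ε) i (s.gradφ t))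
          ≤ ‖s.dm i t‖ * M₁ := by
        refine (real_inner_le_norm _ _).trans (mul_le_mul_of_nonneg_left ?_ (norm_nonneg _))
        exact (norm_coordL_le _ _ _).trans h2.2
      have a3 := mul_le_mul_of_nonneg_left a1 hθc.le
      have a4 : ‖s.dm i t‖ * (P.θc * M₁ + M₁)
          ≤ P.γ / 2 * ‖s.dm i t‖ ^ 2 + (P.θc * M₁ + M₁) ^ 2 / (2 * P.γ) := by
        rw [← sub_nonneg]
        have : P.γ / 2 * ‖s.dm i t‖ ^ 2 + (P.θc * M₁ + M₁) ^ 2 / (2 * P.γ)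
            - ‖s.dm i t‖ * (P.θc * M₁ + M₁)
            = (P.γ * ‖s.dm i t‖ - (P.θc * M₁ + M₁)) ^ 2 / (2 * P.γ) := by
          field_simp
          ring
        rw [this]
        positivity
      linarith
    have e2 := Finset.sum_le_sum fun i (_ : i ∈ Finset.univ) => e1 i
    rw [Finset.sum_sub_distrib, Finset.sum_add_distrib, ← Finset.mul_sum] at e2
    have e3 : ∑ _i : Fin 3, (P.θc * M₁ + M₁) ^ 2 / (2 * P.γ) = K := by simp [hKdef]
    have e4 := h1 (s.θ t)
    have e5 := coefForm_nonneg_of_smul hP.K_coef (P.perforated_subset ε) ε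
      (h3.mono fun x hx => hx.le) h4
    have e6 := le_coefForm_self hP.K_coef (P.perforated_subset ε) ε hK (wgrad (s.θ t))
    rw [map_add, map_smul, map_smul, add_apply, smul_apply, smul_apply, smul_eq_mul,
      smul_eq_mul] at e4
    have e7 : ∑ i, inner ℝ (s.dm i t) (mulL hS (s.θ t) (s.m i t))
        = ∑ i, inner ℝ (s.dm i t) (mulL hS (s.m i t) (s.θ t)) :=
      Finset.sum_congr rfl fun i _ => by rw [mulL_comm]
    have e8 := mul_le_mul_of_nonneg_left e6 hk₁.le
    have e9 := mul_nonneg hk₀.le e5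
    linarith
  have hmain : ∀ᵐ τ ∂(timeMeasure T), P.θc * (‖modSq hS fun i => s.m i τ‖ ^ 2 / 4)
      + ∫ t in (0 : ℝ)..τ, (P.γ / 2 * ∑ i, ‖s.dm i t‖ ^ 2 + P.k₁ * α * ‖wgrad (s.θ t)‖ ^ 2)
      ≤ E := by
    filter_upwards [hen1, hen2, ae_restrict_mem measurableSet_Ioo] with τ h1 h2 hτ
    have hτ' : τ ∈ Icc 0 T := Ioo_subset_Icc_self hτ
    have h3 := intervalIntegral_mono_timeMeasure (hint1.add hint2)
      ((integrable_const K).sub hint5) hpt hτ'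
    simp only [Pi.add_apply, Pi.sub_apply] at h3
    rw [intervalIntegral.integral_add (intervalIntegrable_of_timeMeasure hint1 hτ')
      (intervalIntegrable_of_timeMeasure hint2 hτ'), intervalIntegral.integral_sub
      (intervalIntegrable_of_timeMeasure (integrable_const K) hτ')
      (intervalIntegrable_of_timeMeasure hint5 hτ'), intervalIntegral.integral_const, smul_eq_mul,
      sub_zero] at h3
    have h4 := magEnergy_nonneg hP hS fun i => s.m i τ
    have h5 : 0 ≤ max 0 (heatEnergy P.c₁ P.c₂ (fn (s.θ τ))) := le_max_left _ _
    have h6 := magEnergy_le hP hS hm₀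
    have h7 := heatEnergy_le hvU hP.c₁_pos.le hP.c₂_pos.le θ₀
    have h8 : P.c₁ * (volume (P.perforated ε)).toReal ≤ P.c₁ * (volume P.Ω).toReal :=
      mul_le_mul_of_nonneg_left (ENNReal.toReal_mono hP.Ω_bounded.measure_lt_top.ne
        (measure_mono (P.perforated_subset ε))) hP.c₁_pos.le
    have h9 : (P.c₁ + P.c₂) * ‖θ₀‖ ^ 2 ≤ (P.c₁ + P.c₂) * C₀ ^ 2 :=
      mul_le_mul_of_nonneg_left (pow_le_pow_left₀ (norm_nonneg _) hθ₀ 2)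
        (add_pos hP.c₁_pos hP.c₂_pos).le
    have h10 : τ * K ≤ K * T := by
      rw [mul_comm]
      exact mul_le_mul_of_nonneg_left hτ.2.le hK0
    linarith
  have hnonneg : ∀ {τ}, τ ∈ Ioo 0 T → 0 ≤ ∫ t in (0 : ℝ)..τ,
      (P.γ / 2 * ∑ i, ‖s.dm i t‖ ^ 2 + P.k₁ * α * ‖wgrad (s.θ t)‖ ^ 2) := fun hτ =>
    intervalIntegral.integral_nonneg hτ.1.le fun t _ => by positivity
  have htot : ∫ t, (P.γ / 2 * ∑ i, ‖s.dm i t‖ ^ 2 + P.k₁ * α * ‖wgrad (s.θ t)‖ ^ 2)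
      ∂(timeMeasure T) ≤ E := by
    refine integral_timeMeasure_le_of_ae_le hT hint5 (hmain.mono fun τ hτ => ?_)
    have : 0 ≤ P.θc * (‖modSq hS fun i => s.m i τ‖ ^ 2 / 4) := by positivity
    linarith
  rw [integral_add (hint3.const_mul _) (hint4.const_mul _), integral_const_mul,
    integral_const_mul] at htot
  have hn3 : 0 ≤ ∫ t, ∑ i, ‖s.dm i t‖ ^ 2 ∂(timeMeasure T) :=
    integral_nonneg fun t => Finset.sum_nonneg fun i _ => by positivity
  have hn4 : 0 ≤ ∫ t, ‖wgrad (s.θ t)‖ ^ 2 ∂(timeMeasure T) := integral_nonneg fun t => by positivity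
  have hs1 : 0 ≤ Real.sqrt (4 * E / P.θc) := Real.sqrt_nonneg _
  have hs2 : 0 ≤ 2 * E / P.γ := by positivity
  have hs3 : 0 ≤ E / (P.k₁ * α) := by positivity
  refine ⟨?_, ?_, ?_⟩
  · filter_upwards [hmain, ae_restrict_mem measurableSet_Ioo] with τ h1 hτ
    have h2 := hnonneg hτ
    have h3 : ‖modSq hS fun i => s.m i τ‖ ≤ Real.sqrt (4 * E / P.θc) := by
      refine Real.le_sqrt_of_sq_le ?_
      rw [le_div_iff₀ hθc]
      linarith
    linarith
  · have h1 : ∫ t, ∑ i, ‖s.dm i t‖ ^ 2 ∂(timeMeasure T) ≤ 2 * E / P.γ := by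
      rw [le_div_iff₀ hγ]
      have : 0 ≤ P.k₁ * α * ∫ t, ‖wgrad (s.θ t)‖ ^ 2 ∂(timeMeasure T) := by positivity
      linarith
    linarith
  · have h1 : ∫ t, ‖wgrad (s.θ t)‖ ^ 2 ∂(timeMeasure T) ≤ E / (P.k₁ * α) := by
      rw [le_div_iff₀ (by positivity)]
      have : 0 ≤ P.γ / 2 * ∫ t, ∑ i, ‖s.dm i t‖ ^ 2 ∂(timeMeasure T) := by positivity
      linarith
    linarith

end Model

end Ferro

/-! ### Estimates of $F(\theta)$ and of its time derivative -/

namespace Ferro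

theorem eLpNorm_le_ofReal_of_integral_le {X : Type*} [NormedAddCommGroup X] {T : ℝ} {f : ℝ → X}
    (hf : MemLp f 2 (timeMeasure T)) {C : ℝ} (hC : 0 ≤ C)
    (h : ∫ t, ‖f t‖ ^ 2 ∂(timeMeasure T) ≤ C ^ 2) :
    eLpNorm f 2 (timeMeasure T) ≤ ENNReal.ofReal C := by
  rw [← ENNReal.pow_le_pow_left_iff two_ne_zero, eLpNorm_two_sq, ← ENNReal.ofReal_pow hC]
  refine le_trans (le_of_eq ?_) (ENNReal.ofReal_le_ofReal h)
  rw [ofReal_integral_eq_lintegral_ofReal (integrable_norm_sq hf)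
    (Eventually.of_forall fun t => by positivity)]
  refine lintegral_congr fun t => ?_
  rw [ENNReal.ofReal_pow (norm_nonneg _), ofReal_norm]

theorem intervalIntegral_le_integral_timeMeasure {T : ℝ} (hT : 0 < T) {f : ℝ → ℝ}
    (hf : Integrable f (timeMeasure T)) (h0 : ∀ t, 0 ≤ f t) {τ : ℝ} (hτ : τ ∈ Icc 0 T) :
    ∫ t in (0 : ℝ)..τ, f t ≤ ∫ t, f t ∂(timeMeasure T) := by
  rw [integral_timeMeasure_eq hT]
  exact intervalIntegral.integral_mono_interval le_rfl hτ.1 hτ.2 (Eventually.of_forall h0)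
    (intervalIntegrable_of_timeMeasure hf (right_mem_Icc.2 hT.le))

theorem integrable_innerSL_comp {X V : Type*} [NormedAddCommGroup X] [InnerProductSpace ℝ X]
    [NormedAddCommGroup V] [NormedSpace ℝ V] (L : V →L[ℝ] X) {T : ℝ} {u : ℝ → X}
    (hu : Integrable u (timeMeasure T)) :
    Integrable (fun t => (innerSL ℝ (u t)).comp L) (timeMeasure T) := by
  let R : StrongDual ℝ X →L[ℝ] StrongDual ℝ V := ContinuousLinearMap.precomp ℝ L
  exact R.integrable_comp ((innerSL ℝ).integrable_comp hu)

/-- Weak derivatives are preserved by bounded linear maps. -/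
theorem HasWeakTimeDeriv.clm_comp {X Y : Type*} [NormedAddCommGroup X] [NormedSpace ℝ X]
    [CompleteSpace X] [NormedAddCommGroup Y] [NormedSpace ℝ Y] [CompleteSpace Y] {T : ℝ}
    {f f' : ℝ → X} (h : HasWeakTimeDeriv T f f') (hf : Integrable f (timeMeasure T))
    (hf' : Integrable f' (timeMeasure T)) (L : X →L[ℝ] Y) :
    HasWeakTimeDeriv T (fun t => L (f t)) (fun t => L (f' t)) := by
  intro ψ hψ hc hs
  have hint : ∀ {g : ℝ → X} {η : ℝ → ℝ}, Integrable g (timeMeasure T) → Continuous η →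
      HasCompactSupport η → Integrable (fun t => η t • g t) (timeMeasure T) := by
    intro g η hg hη hηc
    obtain ⟨B, hB⟩ := hηc.exists_bound_of_continuous hη
    exact hg.bdd_smul B hη.aestronglyMeasurable (Eventually.of_forall hB)
  have h1 := congrArg L (h ψ hψ hc hs)
  rw [map_neg, ← L.integral_comp_comm (hint hf (hψ.continuous_deriv (by simp)) hc.deriv),
    ← L.integral_comp_comm (hint hf' hψ.continuous hc)] at h1
  simpa only [map_smul] using h1

theorem integral_dual_norm_sq_le {V : Type*} [NormedAddCommGroup V] [NormedSpace ℝ V] {T : ℝ}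
    {f : ℝ → StrongDual ℝ V} (hf : MemLp f 2 (timeMeasure T)) {g : ℝ → ℝ}
    (hg : Integrable g (timeMeasure T)) (h : ∀ᵐ t ∂(timeMeasure T), ‖f t‖ ^ 2 ≤ g t) :
    ∫ t, ‖f t‖ ^ 2 ∂(timeMeasure T) ≤ ∫ t, g t ∂(timeMeasure T) :=
  integral_mono_ae (integrable_norm_sq hf) hg h

/-- Precomposition of a square integrable family of functionals with a contraction. -/
theorem precomp_dual_bound {V W : Type*} [NormedAddCommGroup V] [NormedSpace ℝ V]
    [NormedAddCommGroup W] [NormedSpace ℝ W] (L : W →L[ℝ] V) (hL : ‖L‖ ≤ 1)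
    {T : ℝ} {f f' : ℝ → StrongDual ℝ V} (h : HasWeakTimeDeriv T f f')
    (hf : Integrable f (timeMeasure T)) (hf' : MemLp f' 2 (timeMeasure T)) {C : ℝ} (hC : 0 ≤ C)
    (hb : ∫ t, ‖f' t‖ ^ 2 ∂(timeMeasure T) ≤ C ^ 2) :
    HasWeakTimeDeriv T (fun t => (f t).comp L) (fun t => (f' t).comp L) ∧
      AEStronglyMeasurable (fun t => (f' t).comp L) (timeMeasure T) ∧
      eLpNorm (fun t => (f' t).comp L) 2 (timeMeasure T) ≤ ENNReal.ofReal C := by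
  let R : StrongDual ℝ V →L[ℝ] StrongDual ℝ W := ContinuousLinearMap.precomp ℝ L
  have hR : ∀ g : StrongDual ℝ V, ‖g.comp L‖ ≤ ‖g‖ := fun g =>
    (g.opNorm_comp_le L).trans (mul_le_of_le_one_right (norm_nonneg _) hL)
  have hm : MemLp (fun t => (f' t).comp L) 2 (timeMeasure T) := R.comp_memLp' hf'
  refine ⟨h.clm_comp hf (hf'.integrable one_le_two) R, hm.1,
    eLpNorm_le_ofReal_of_integral_le hm hC (le_trans ?_ hb)⟩
  exact integral_mono (integrable_norm_sq hm) (integrable_norm_sq hf')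
    fun t => pow_le_pow_left₀ (norm_nonneg _) (hR _) 2

theorem restrict_dual_bound {V : Type*} [NormedAddCommGroup V] [NormedSpace ℝ V]
    (p : Submodule ℝ V) {T : ℝ} {f f' : ℝ → StrongDual ℝ V} (h : HasWeakTimeDeriv T f f')
    (hf : Integrable f (timeMeasure T)) (hf' : MemLp f' 2 (timeMeasure T)) {C : ℝ} (hC : 0 ≤ C)
    (hb : ∫ t, ‖f' t‖ ^ 2 ∂(timeMeasure T) ≤ C ^ 2) :
    HasWeakTimeDeriv T (fun t => (f t).comp p.subtypeL) (fun t => (f' t).comp p.subtypeL) ∧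
      AEStronglyMeasurable (fun t => (f' t).comp p.subtypeL) (timeMeasure T) ∧
      eLpNorm (fun t => (f' t).comp p.subtypeL) 2 (timeMeasure T) ≤ ENNReal.ofReal C :=
  precomp_dual_bound p.subtypeL p.norm_subtypeL_le h hf hf' hC hb

namespace Model

variable {P : Model}

/-- The function `c₁ ln θ + c₂ θ` in `H¹`. -/
noncomputable def entropy {ε : ℝ} (s : P.Unknowns ε) (t : ℝ) : H1 (P.perforated ε) :=
  P.c₁ • s.logθ t + P.c₂ • s.θ t

theorem wgrad_entropy {ε : ℝ} (s : P.Unknowns ε) (t : ℝ) :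
    wgrad (entropy s t) = P.c₁ • wgrad (s.logθ t) + P.c₂ • wgrad (s.θ t) := rfl

namespace IsWeakSolution

variable {ε T : ℝ} {m₀ : Fin 3 → H1 (P.perforated ε)} {v₀ : L2 (P.perforated ε)}
  {s : P.Unknowns ε}

theorem memLp_entropy (h : P.IsWeakSolution ε T m₀ v₀ s) :
    MemLp (entropy s) 2 (timeMeasure T) :=
  (h.logθ_memLp.const_smul P.c₁).add (h.θ_memLp.const_smul P.c₂)

/-- The equation for `v` tested with `v`. The derivative lives in the dual of $H^1$, and `toH1Dual`
turns differences of `v` into integrals of that derivative. -/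
theorem entropy_inequality (h : P.IsWeakSolution ε T m₀ v₀ s) (hT : 0 < T) :
    ∀ᵐ τ ∂(timeMeasure T), ‖fn (entropy s τ)‖ ^ 2 / 2
      ≤ ‖v₀‖ ^ 2 / 2 + ∫ t in (0 : ℝ)..τ, s.dv t (entropy s t) := by
  have hGae : ∀ᵐ t ∂(timeMeasure T), t ∈ {t | t ∈ Ioo 0 T ∧
      toH1Dual (fn (entropy s t)) = toH1Dual v₀ + ∫ r in (0 : ℝ)..t, s.dv r} := by
    filter_upwards [ae_restrict_mem measurableSet_Ioo, h.v_eq_primitive hT]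
      with t h1 h2 using ⟨h1, h2⟩
  refine energy_inequality_dual h.dv_memLp h.memLp_entropy (fun t => by positivity) hGae ?_ ?_
  · rintro t ⟨-, h2⟩
    refine (half_norm_sq_sub_le (fn (entropy s t)) v₀).trans (le_of_eq ?_)
    rw [inner_sub_left, ← toH1Dual_apply, ← toH1Dual_apply, h2, add_apply, add_sub_cancel_left]
  · rintro r ⟨hr1, hr2⟩ t ⟨h1, h2⟩
    refine (half_norm_sq_sub_le (fn (entropy s t)) (fn (entropy s r))).trans (le_of_eq ?_)
    rw [inner_sub_left, ← toH1Dual_apply, ← toH1Dual_apply, h2, hr2, add_apply, add_apply,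
      add_sub_add_left_eq_sub, integral_eq_primitive_sub h.dv_memLp hr1 h1, sub_apply]

/-- The diffusion term tested with the entropy. -/
theorem le_coefForm_entropy (h : P.IsWeakSolution ε T m₀ v₀ s) (hP : P.Admissible) (hε : 0 < ε)
    {α : ℝ} (hK : ∀ᵐ x ∂(volume.restrict P.Ω), ∀ y ξ : E3,
      α * ‖ξ‖ ^ 2 ≤ ∑ i, ∑ j, P.K i j x y * ξ j * ξ i) :
    ∀ᵐ t ∂(timeMeasure T), P.k₀ * P.c₁ * (α * ‖wgrad (s.logθ t)‖ ^ 2)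
        + P.k₁ * P.c₂ * (α * ‖wgrad (s.θ t)‖ ^ 2)
      ≤ coefForm hP.K_coef (P.perforated_subset ε) ε
        (P.k₀ • wgrad (s.logθ t) + P.k₁ • wgrad (s.θ t)) (wgrad (entropy s t)) := by
  have hk₀ := hP.k₀_pos
  have hk₁ := hP.k₁_pos
  have hc₁ := hP.c₁_pos
  have hc₂ := hP.c₂_pos
  filter_upwards [h.θ_pos, h.wgrad_θ hP hε] with t h1 h2
  -- Both mixed terms are positive multiples of the form at the gradients of `ln θ` and `θ`, which
  -- is nonnegative since the second gradient is `θ` times the first.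
  have e1 := coefForm_nonneg_of_smul hP.K_coef (P.perforated_subset ε) ε
    (h1.mono fun x hx => hx.le) h2
  have e2 := le_coefForm_self hP.K_coef (P.perforated_subset ε) ε hK (wgrad (s.θ t))
  have e3 := le_coefForm_self hP.K_coef (P.perforated_subset ε) ε hK (wgrad (s.logθ t))
  have e4 := coefForm_comm hP.K_coef (P.perforated_subset ε) ε (wgrad (s.θ t)) (wgrad (s.logθ t))
  rw [wgrad_entropy]
  simp only [map_add, map_smul, add_apply, smul_apply, smul_eq_mul, e4]
  have e5 := mul_le_mul_of_nonneg_left e3 (mul_pos hk₀ hc₁).le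
  have e6 := mul_le_mul_of_nonneg_left e2 (mul_pos hk₁ hc₂).le
  have e7 := mul_nonneg (mul_pos hk₀ hc₂).le e1
  have e8 := mul_nonneg (mul_pos hk₁ hc₁).le e1
  linarith

end IsWeakSolution

theorem norm_mulL_le_of_modSq_le {U : Set E3} {C : ℝ≥0} (hS : FourEmbedding U C)
    {m : Fin 3 → H1 U} {M : ℝ} (hM : ‖modSq hS m‖ ≤ M) (j : Fin 3) (w : H1 U) :
    ‖mulL hS (m j) w‖ ≤ Real.sqrt M * C * ‖w‖ := by
  have hM0 : 0 ≤ M := (norm_nonneg _).trans hM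
  refine abs_le_of_sq_le_sq' ?_ (by positivity) |>.2
  refine (norm_mulL_sq_le hS (m j) w).trans ?_
  rw [mul_pow, mul_pow, Real.sq_sqrt hM0, mul_assoc]
  gcongr
  exact (norm_mulL_self_le hS m j).trans hM

/-- With `d` the time derivative of `m` this bounds the source of the heat equation as a functional
on $H^1$, by the $L^4$ bound of `m` and the $L^2$ norm of its time derivative. -/
theorem sum_inner_mulL_le {U : Set E3} {C : ℝ≥0} (hS : FourEmbedding U C)
    {m : Fin 3 → H1 U} {M : ℝ} (hM : ‖modSq hS m‖ ≤ M) (d : Fin 3 → L2 U) (w : H1 U) :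
    |∑ j, inner ℝ (d j) (mulL hS (m j) w)| ≤ Real.sqrt M * C * (∑ j, ‖d j‖) * ‖w‖ := by
  refine (Finset.abs_sum_le_sum_abs _ _).trans ?_
  rw [Finset.mul_sum, Finset.sum_mul]
  refine Finset.sum_le_sum fun j _ => (abs_real_inner_le_norm _ _).trans ?_
  refine (mul_le_mul_of_nonneg_left (norm_mulL_le_of_modSq_le hS hM j w) (norm_nonneg _)).trans
    (le_of_eq (by ring))

/-- The gradient of the entropy is controlled by the dissipation. -/
theorem norm_wgrad_entropy_sq_le (hP : P.Admissible) {α : ℝ} (hα : 0 < α) {ε : ℝ}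
    (s : P.Unknowns ε) (t : ℝ) :
    ‖wgrad (entropy s t)‖ ^ 2 ≤ 2 * (P.c₁ / (P.k₀ * α) + P.c₂ / (P.k₁ * α)) *
      (P.k₀ * P.c₁ * (α * ‖wgrad (s.logθ t)‖ ^ 2)
        + P.k₁ * P.c₂ * (α * ‖wgrad (s.θ t)‖ ^ 2)) := by
  have hk₀ := hP.k₀_pos
  have hk₁ := hP.k₁_pos
  have hc₁ := hP.c₁_pos
  have hc₂ := hP.c₂_pos
  have h1 : ‖wgrad (entropy s t)‖
      ≤ P.c₁ * ‖wgrad (s.logθ t)‖ + P.c₂ * ‖wgrad (s.θ t)‖ := by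
    rw [wgrad_entropy]
    refine (norm_add_le _ _).trans ?_
    rw [norm_smul, norm_smul, Real.norm_of_nonneg hc₁.le, Real.norm_of_nonneg hc₂.le]
  generalize ‖wgrad (s.logθ t)‖ = x at h1 ⊢
  generalize ‖wgrad (s.θ t)‖ = y at h1 ⊢
  have h2 : ‖wgrad (entropy s t)‖ ^ 2 ≤ 2 * (P.c₁ ^ 2 * x ^ 2 + P.c₂ ^ 2 * y ^ 2) := by
    refine (pow_le_pow_left₀ (norm_nonneg _) h1 2).trans ?_
    nlinarith [sq_nonneg (P.c₁ * x - P.c₂ * y)]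
  -- The product contains the desired squares plus nonnegative cross terms, which are dropped.
  have h3 : 2 * (P.c₁ / (P.k₀ * α) + P.c₂ / (P.k₁ * α)) *
      (P.k₀ * P.c₁ * (α * x ^ 2) + P.k₁ * P.c₂ * (α * y ^ 2))
      = 2 * (P.c₁ ^ 2 * x ^ 2 + P.c₂ ^ 2 * y ^ 2)
        + 2 * (P.c₁ / (P.k₀ * α) * (P.k₁ * P.c₂ * (α * y ^ 2))
          + P.c₂ / (P.k₁ * α) * (P.k₀ * P.c₁ * (α * x ^ 2))) := by
    field_simp
    ring
  rw [h3]
  exact h2.trans (le_add_of_nonneg_right (by positivity))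

theorem add_mul_sq_le_of_sq_le {Q S R L a b x y : ℝ} (hS : S ^ 2 ≤ 3 * R) :
    (Q * S + L * (a * x + b * y)) ^ 2
      ≤ 6 * Q ^ 2 * R + 4 * L ^ 2 * (a ^ 2 * x ^ 2 + b ^ 2 * y ^ 2) := by
  have h1 : (a * x + b * y) ^ 2 ≤ 2 * (a ^ 2 * x ^ 2 + b ^ 2 * y ^ 2) := by
    nlinarith [sq_nonneg (a * x - b * y)]
  have h2 := mul_le_mul_of_nonneg_left h1 (sq_nonneg L)
  have h3 := mul_le_mul_of_nonneg_left hS (sq_nonneg Q)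
  nlinarith [sq_nonneg (Q * S - L * (a * x + b * y))]

/-- The time derivative of the entropy is controlled by the energy bounds. -/
theorem IsWeakSolution.norm_dv_sq_le {ε T : ℝ} {m₀ : Fin 3 → H1 (P.perforated ε)}
    {v₀ : L2 (P.perforated ε)} {s : P.Unknowns ε} (h : P.IsWeakSolution ε T m₀ v₀ s)
    (hP : P.Admissible) {C : ℝ≥0} (hS : FourEmbedding (P.perforated ε) C) {M : ℝ}
    (hmod : ∀ᵐ t ∂(timeMeasure T), ‖modSq hS (fun j => s.m j t)‖ ≤ M) :
    ∀ᵐ t ∂(timeMeasure T), ‖s.dv t‖ ^ 2 ≤ 6 * (Real.sqrt M * C) ^ 2 * (∑ i, ‖s.dm i t‖ ^ 2)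
      + 4 * coefBound P.Ω P.K ^ 2
        * (P.k₀ ^ 2 * ‖wgrad (s.logθ t)‖ ^ 2 + P.k₁ ^ 2 * ‖wgrad (s.θ t)‖ ^ 2) := by
  have hk₀ := hP.k₀_pos
  have hk₁ := hP.k₁_pos
  have hΛ0 := coefBound_nonneg P.Ω P.K
  set Q : ℝ := Real.sqrt M * C with hQ
  set Λ : ℝ := coefBound P.Ω P.K with hΛ
  have hQ0 : 0 ≤ Q := by positivity
  filter_upwards [h.weak_θ hP hS, hmod] with t h1 h2
  have e1 : ‖s.dv t‖ ≤ Q * (∑ j, ‖s.dm j t‖)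
      + Λ * (P.k₀ * ‖wgrad (s.logθ t)‖ + P.k₁ * ‖wgrad (s.θ t)‖) := by
    refine ContinuousLinearMap.opNorm_le_bound _ (by positivity) fun w => ?_
    rw [h1 w, Real.norm_eq_abs, add_mul]
    refine (abs_sub _ _).trans (add_le_add
      (sum_inner_mulL_le hS h2 (fun j => s.dm j t) w) ?_)
    refine (abs_coefForm_le _ _ _ _ _).trans ?_
    rw [← mul_assoc]
    have e2 : ‖P.k₀ • wgrad (s.logθ t) + P.k₁ • wgrad (s.θ t)‖
        ≤ P.k₀ * ‖wgrad (s.logθ t)‖ + P.k₁ * ‖wgrad (s.θ t)‖ := by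
      refine (norm_add_le _ _).trans ?_
      rw [norm_smul, norm_smul, Real.norm_of_nonneg hk₀.le, Real.norm_of_nonneg hk₁.le]
    exact mul_le_mul (mul_le_mul_of_nonneg_left e2 hΛ0) (norm_wgrad_le w) (norm_nonneg _)
      (by positivity)
  refine (pow_le_pow_left₀ (ContinuousLinearMap.opNorm_nonneg (s.dv t)) e1 2).trans ?_
  exact add_mul_sq_le_of_sq_le (sq_sum_fin_three_le fun j => ‖s.dm j t‖)

set_option maxHeartbeats 800000 in
/-- The bounds of `c₁ ln θ + c₂ θ` and of its time derivative. -/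
theorem exists_bound_entropy (hP : P.Admissible) {T : ℝ} (hT : 0 < T) (C₀ : ℝ) :
    ∃ M : ℝ, 0 ≤ M ∧ ∀ (ε : ℝ), 0 < ε → ∀ (m₀ : Fin 3 → H1 (P.perforated ε))
      (θ₀ v₀ : L2 (P.perforated ε)), (∀ i, ‖m₀ i‖ ≤ C₀) → ‖θ₀‖ ≤ C₀ → ‖v₀‖ ≤ C₀ →
      (∀ᵐ x ∂(volume.restrict (P.perforated ε)), 0 < θ₀ x ∧ v₀ x = P.F (θ₀ x)) →
      ∀ s : P.Unknowns ε, P.IsWeakSolution ε T m₀ v₀ s →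
        (∫ t, ‖entropy s t‖ ^ 2 ∂(timeMeasure T) ≤ M) ∧
        ∫ t, ‖s.dv t‖ ^ 2 ∂(timeMeasure T) ≤ M := by
  obtain ⟨C, hC⟩ := exists_fourEmbedding hP
  obtain ⟨M, hM0, hM⟩ := exists_bound_energy hP hT C₀ hC
  obtain ⟨α, hα, hK⟩ := hP.K_coef.coercive
  have hk₀ := hP.k₀_pos
  have hk₁ := hP.k₁_pos
  have hc₁ := hP.c₁_pos
  have hc₂ := hP.c₂_pos
  set Q : ℝ := Real.sqrt M * C with hQ
  have hQ0 : 0 ≤ Q := by positivity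
  set κ : ℝ := 2 * (P.c₁ / (P.k₀ * α) + P.c₂ / (P.k₁ * α)) with hκ
  have hκ0 : 0 < κ := by positivity
  -- The Young parameter is small enough for two absorptions: `δ * κ ≤ 1 / 2` for the gradient of
  -- `v` into the diffusion, and `δ * T ≤ 1 / 8` for its $L^2$ norm integrated in time, which takes
  -- the place of Gronwall's lemma.
  set δ : ℝ := 1 / (2 * κ + 8 * T) with hδ
  have hδ0 : 0 < δ := by positivity
  have hδκ : δ * κ ≤ 1 / 2 := by
    rw [hδ, one_div_mul_eq_div, div_le_iff₀ (by positivity)]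
    linarith
  have hδT : δ * T ≤ 1 / 8 := by
    rw [hδ, one_div_mul_eq_div, div_le_iff₀ (by positivity)]
    linarith
  set E : ℝ := C₀ ^ 2 / 2 + 3 * Q ^ 2 / (4 * δ) * M with hE
  have hE0 : 0 ≤ E := by positivity
  set Λ : ℝ := coefBound P.Ω P.K with hΛ
  have hΛ0 : 0 ≤ Λ := coefBound_nonneg _ _
  -- The first bracket bounds `v` and the second its time derivative. In the latter the gradient of
  -- `ln θ` is bounded by the new dissipation estimate, and that of `θ` by the earlier energy bound.
  refine ⟨(4 * E * T + κ * (3 * E))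
    + (6 * Q ^ 2 * M + 4 * Λ ^ 2 * (P.k₀ ^ 2 * (3 * E / (P.k₀ * P.c₁ * α)) + P.k₁ ^ 2 * M)),
    by positivity, fun ε hε m₀ θ₀ v₀ hm₀ hθ₀ hv₀ hF s h => ?_⟩
  have hS := hC ε hε
  obtain ⟨hmod, hdm, hθ⟩ := hM ε hε m₀ θ₀ v₀ hm₀ hθ₀ hF s h
  have hvL := h.memLp_entropy
  have hiθ := integrable_norm_sq ((wgradL _).comp_memLp' h.θ_memLp)
  have hil := integrable_norm_sq ((wgradL _).comp_memLp' h.logθ_memLp)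
  have hiv := integrable_norm_sq ((fnL _).comp_memLp' hvL)
  simp only [Function.comp_apply, wgradL_apply, fnL_apply] at hiθ hil hiv
  have hid : Integrable (fun t => ∑ i, ‖s.dm i t‖ ^ 2) (timeMeasure T) :=
    integrable_finsetSum _ fun i _ => integrable_norm_sq (h.dm_memLp i)
  set g : ℝ → ℝ := fun t => P.k₀ * P.c₁ * (α * ‖wgrad (s.logθ t)‖ ^ 2)
    + P.k₁ * P.c₂ * (α * ‖wgrad (s.θ t)‖ ^ 2) with hg
  have hg0 : ∀ t, 0 ≤ g t := fun t => by positivity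
  have hig : Integrable g (timeMeasure T) :=
    ((hil.const_mul α).const_mul _).add ((hiθ.const_mul α).const_mul _)
  have hgrad : ∀ t, ‖wgrad (entropy s t)‖ ^ 2 ≤ κ * g t := fun t =>
    norm_wgrad_entropy_sq_le hP hα s t
  have hpt : ∀ᵐ t ∂(timeMeasure T), s.dv t (entropy s t)
      ≤ δ * ‖fn (entropy s t)‖ ^ 2 + 3 * Q ^ 2 / (4 * δ) * ∑ i, ‖s.dm i t‖ ^ 2 - g t / 2 := by
    filter_upwards [h.weak_θ hP hS, h.le_coefForm_entropy hP hε hK, hmod] with t h1 h2 h3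
    have e1 := (le_abs_self _).trans (sum_inner_mulL_le hS h3 (fun j => s.dm j t) (entropy s t))
    have e2 := sq_sum_fin_three_le fun j => ‖s.dm j t‖
    have e3 := norm_sq_eq (entropy s t)
    have e4 := hgrad t
    set S := ∑ j, ‖s.dm j t‖
    set W := ‖entropy s t‖
    have e5 : Q * S * W ≤ δ * W ^ 2 + Q ^ 2 / (4 * δ) * S ^ 2 := by
      rw [← sub_nonneg]
      have : δ * W ^ 2 + Q ^ 2 / (4 * δ) * S ^ 2 - Q * S * W = (2 * δ * W - Q * S) ^ 2 / (4 * δ) := by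
        field_simp
        ring
      rw [this]
      positivity
    have e6 : Q ^ 2 / (4 * δ) * S ^ 2 ≤ 3 * Q ^ 2 / (4 * δ) * ∑ i, ‖s.dm i t‖ ^ 2 := by
      refine (mul_le_mul_of_nonneg_left e2 (by positivity)).trans (le_of_eq (by ring))
    have e7 : δ * ‖wgrad (entropy s t)‖ ^ 2 ≤ g t / 2 := by
      refine (mul_le_mul_of_nonneg_left e4 hδ0.le).trans ?_
      rw [← mul_assoc]
      have := mul_le_mul_of_nonneg_right hδκ (hg0 t)
      linarith
    rw [h1 (entropy s t)]
    have e8 : δ * W ^ 2 = δ * ‖fn (entropy s t)‖ ^ 2 + δ * ‖wgrad (entropy s t)‖ ^ 2 := by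
      rw [e3]; ring
    linarith
  set N : ℝ := ∫ t, ‖fn (entropy s t)‖ ^ 2 ∂(timeMeasure T) with hN
  have hmain : ∀ᵐ τ ∂(timeMeasure T), ‖fn (entropy s τ)‖ ^ 2 / 2 + ∫ t in (0 : ℝ)..τ, g t / 2
      ≤ E + δ * N := by
    filter_upwards [h.entropy_inequality hT, ae_restrict_mem measurableSet_Ioo] with τ h1 hτ
    have hτ' : τ ∈ Icc 0 T := Ioo_subset_Icc_self hτ
    have i1 : Integrable (fun t => δ * ‖fn (entropy s t)‖ ^ 2) (timeMeasure T) := hiv.const_mul δ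
    have i2 : Integrable (fun t => 3 * Q ^ 2 / (4 * δ) * ∑ i, ‖s.dm i t‖ ^ 2) (timeMeasure T) :=
      hid.const_mul _
    have i3 : Integrable (fun t => g t / 2) (timeMeasure T) := hig.div_const 2
    have h3 := intervalIntegral_mono_timeMeasure (integrable_dual_pairing h.dv_memLp hvL)
      ((i1.add i2).sub i3) hpt hτ'
    simp only [Pi.add_apply, Pi.sub_apply] at h3
    rw [intervalIntegral.integral_sub
      ((intervalIntegrable_of_timeMeasure i1 hτ').add (intervalIntegrable_of_timeMeasure i2 hτ'))
      (intervalIntegrable_of_timeMeasure i3 hτ'), intervalIntegral.integral_add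
      (intervalIntegrable_of_timeMeasure i1 hτ') (intervalIntegrable_of_timeMeasure i2 hτ'),
      intervalIntegral.integral_const_mul, intervalIntegral.integral_const_mul] at h3
    have h4 := intervalIntegral_le_integral_timeMeasure hT hiv (fun t => by positivity) hτ'
    have h5 := (intervalIntegral_le_integral_timeMeasure hT hid
      (fun t => Finset.sum_nonneg fun i _ => by positivity) hτ').trans hdm
    have h6 := mul_le_mul_of_nonneg_left h4 hδ0.le
    have h7 := mul_le_mul_of_nonneg_left h5 (by positivity : 0 ≤ 3 * Q ^ 2 / (4 * δ))
    have h8 : ‖v₀‖ ^ 2 ≤ C₀ ^ 2 := pow_le_pow_left₀ (norm_nonneg _) hv₀ 2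
    linarith
  -- Integrating the energy inequality once more in time gives $N\le2ET+2\delta TN$ with $2\delta
  -- T\le\frac14$, so the last term is absorbed.
  have hNle : N ≤ 4 * E * T := by
    have h1 : N ≤ ∫ _, 2 * (E + δ * N) ∂(timeMeasure T) := by
      refine integral_mono_ae hiv (integrable_const _) ?_
      filter_upwards [hmain, ae_restrict_mem measurableSet_Ioo] with τ h1 hτ
      have : 0 ≤ ∫ t in (0 : ℝ)..τ, g t / 2 :=
        intervalIntegral.integral_nonneg hτ.1.le fun t _ => by have := hg0 t; positivity
      linarith
    rw [integral_timeMeasure_eq hT, intervalIntegral.integral_const, smul_eq_mul, sub_zero] at h1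
    have hN0 : 0 ≤ N := integral_nonneg fun t => by positivity
    have h2 := mul_le_mul_of_nonneg_right hδT hN0
    have h3 : T * (2 * (E + δ * N)) = 2 * (E * T) + 2 * (δ * T * N) := by ring
    have h4 : 0 ≤ E * T := by positivity
    linarith
  have hgle : ∫ t, g t ∂(timeMeasure T) ≤ 3 * E := by
    have h1 : ∫ t, g t / 2 ∂(timeMeasure T) ≤ E + δ * N := by
      refine integral_timeMeasure_le_of_ae_le hT (hig.div_const 2) (hmain.mono fun τ hτ => ?_)
      have : 0 ≤ ‖fn (entropy s τ)‖ ^ 2 / 2 := by positivity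
      linarith
    rw [integral_div] at h1
    have h2 := mul_le_mul_of_nonneg_left hNle hδ0.le
    have h3 := mul_le_mul_of_nonneg_right hδT (by positivity : 0 ≤ 4 * E)
    linarith
  have hlog : ∫ t, ‖wgrad (s.logθ t)‖ ^ 2 ∂(timeMeasure T) ≤ 3 * E / (P.k₀ * P.c₁ * α) := by
    rw [le_div_iff₀ (by positivity), mul_comm, ← integral_const_mul]
    refine (integral_mono (hil.const_mul _) hig fun t => ?_).trans hgle
    have : 0 ≤ P.k₁ * P.c₂ * (α * ‖wgrad (s.θ t)‖ ^ 2) := by positivity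
    simp only [hg]
    linarith
  have hpos1 : 0 ≤ 6 * Q ^ 2 * M
      + 4 * Λ ^ 2 * (P.k₀ ^ 2 * (3 * E / (P.k₀ * P.c₁ * α)) + P.k₁ ^ 2 * M) := by positivity
  have hpos2 : 0 ≤ 4 * E * T + κ * (3 * E) := by positivity
  constructor
  · have h1 : ∫ t, ‖entropy s t‖ ^ 2 ∂(timeMeasure T)
        ≤ ∫ t, (‖fn (entropy s t)‖ ^ 2 + κ * g t) ∂(timeMeasure T) := by
      refine integral_mono (integrable_norm_sq hvL) (hiv.add (hig.const_mul κ)) fun t => ?_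
      rw [norm_sq_eq]
      exact add_le_add le_rfl (hgrad t)
    rw [integral_add hiv (hig.const_mul κ), integral_const_mul] at h1
    have h2 := mul_le_mul_of_nonneg_left hgle hκ0.le
    linarith
  · have hdv := h.norm_dv_sq_le hP hS hmod
    have i1 : Integrable (fun t => 6 * Q ^ 2 * ∑ i, ‖s.dm i t‖ ^ 2) (timeMeasure T) :=
      hid.const_mul _
    have i2 : Integrable (fun t => P.k₀ ^ 2 * ‖wgrad (s.logθ t)‖ ^ 2) (timeMeasure T) :=
      hil.const_mul _
    have i3 : Integrable (fun t => P.k₁ ^ 2 * ‖wgrad (s.θ t)‖ ^ 2) (timeMeasure T) :=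
      hiθ.const_mul _
    have i4 : Integrable (fun t => 4 * Λ ^ 2 * (P.k₀ ^ 2 * ‖wgrad (s.logθ t)‖ ^ 2
        + P.k₁ ^ 2 * ‖wgrad (s.θ t)‖ ^ 2)) (timeMeasure T) := (i2.add i3).const_mul _
    have h1 := integral_dual_norm_sq_le h.dv_memLp (i1.add i4) hdv
    simp only [Pi.add_apply] at h1
    rw [integral_add i1 i4, integral_const_mul, integral_const_mul (4 * Λ ^ 2),
      integral_add i2 i3, integral_const_mul, integral_const_mul] at h1
    have h2 : 6 * Q ^ 2 * ∫ t, ∑ i, ‖s.dm i t‖ ^ 2 ∂(timeMeasure T) ≤ 6 * Q ^ 2 * M := by gcongr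
    have h3 : 4 * Λ ^ 2 * (P.k₀ ^ 2 * ∫ t, ‖wgrad (s.logθ t)‖ ^ 2 ∂(timeMeasure T)
        + P.k₁ ^ 2 * ∫ t, ‖wgrad (s.θ t)‖ ^ 2 ∂(timeMeasure T))
        ≤ 4 * Λ ^ 2 * (P.k₀ ^ 2 * (3 * E / (P.k₀ * P.c₁ * α)) + P.k₁ ^ 2 * M) := by gcongr
    linarith

end Model

end Ferro

theorem lemma4p2 (P : Ferro.Model) (hP : P.Admissible) (T : ℝ) (hT : 0 < T) (C₀ : ℝ) :
    ∃ C : ℝ, 0 < C ∧ ∀ ε : ℝ, 0 < ε →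
      ∀ (m₀ : Fin 3 → Ferro.H1 (P.perforated ε)) (θ₀ v₀ : Ferro.L2 (P.perforated ε)),
        (∀ i, ‖m₀ i‖ ≤ C₀) → ‖θ₀‖ ≤ C₀ → ‖v₀‖ ≤ C₀ →
        (∀ᵐ x ∂(volume.restrict (P.perforated ε)), 0 < θ₀ x ∧ v₀ x = P.F (θ₀ x)) →
        ∀ s : P.Unknowns ε, P.IsWeakSolution ε T m₀ v₀ s →
          ∃ (v : ℝ → Ferro.H1 (P.perforated ε)) (dv : ℝ → Ferro.Hm1 (P.perforated ε)),
            (∀ᵐ t ∂(Ferro.timeMeasure T), Ferro.fn (v t) =ᵐ[volume.restrict (P.perforated ε)]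
              fun x => P.F (Ferro.fn (s.θ t) x)) ∧
            AEStronglyMeasurable v (Ferro.timeMeasure T) ∧
            eLpNorm v 2 (Ferro.timeMeasure T) ≤ ENNReal.ofReal C ∧
            Ferro.HasWeakTimeDeriv T (fun t => Ferro.toHm1 (Ferro.fn (v t))) dv ∧
            AEStronglyMeasurable dv (Ferro.timeMeasure T) ∧
            eLpNorm dv 2 (Ferro.timeMeasure T) ≤ ENNReal.ofReal C := by
  obtain ⟨M, hM0, hM⟩ := Ferro.Model.exists_bound_entropy hP hT C₀
  -- The summand one makes the constant strictly positive even when `M` vanishes.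
  refine ⟨Real.sqrt M + 1, by positivity, fun ε hε m₀ θ₀ v₀ hm₀ hθ₀ hv₀ hF s h => ?_⟩
  obtain ⟨h1, h2⟩ := hM ε hε m₀ θ₀ v₀ hm₀ hθ₀ hv₀ hF s h
  have hMC : M ≤ (Real.sqrt M + 1) ^ 2 := by
    nlinarith [Real.sq_sqrt hM0, Real.sqrt_nonneg M]
  have hvL := h.memLp_entropy
  have hfn : MemLp (fun t => Ferro.fn (Ferro.Model.entropy s t)) 2 (Ferro.timeMeasure T) :=
    (Ferro.fnL _).comp_memLp' hvL
  have hC : 0 ≤ Real.sqrt M + 1 := by positivity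
  -- The derivative in the dual of $H^1$ is restricted to $H^1_0$. Restriction is linear and
  -- contracting, so it preserves both the weak derivative and the bound.
  exact ⟨Ferro.Model.entropy s, fun t => (s.dv t).comp (Ferro.H10 _).subtypeL, h.coeFn_v, hvL.1,
    Ferro.eLpNorm_le_ofReal_of_integral_le hvL hC (h1.trans hMC),
    Ferro.restrict_dual_bound (Ferro.H10 _) h.dv_deriv
      (Ferro.integrable_innerSL_comp ((WithLp.fstL 2 ℝ (Ferro.L2 _) (Ferro.L2Vec _)).comp
        (Ferro.H1 _).subtypeL) (hfn.integrable one_le_two)) h.dv_memLp hC (h2.trans hMC)⟩
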